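/- **Model.** The word RAM has words of $w$ bits ($w\ge 1$), addressed memory cells of one word, finitely many registers, and unit-cost addition and subtraction modulo $2^w$, bitwise operations, shifts, comparisons, loads and stores (no multiplication or division). Inputs are read word by word from a read-only input and results are written word by word. Programs are fixed finite texts that do not depend on the input parameters or on $w$; every executed instruction or test costs one step. The randomness of a data structure is a string of independent uniformly random words, read during initialization only. "Space $s$" means that no cell with address $\ge \lfloor s\rfloor$ is ever accessed (by initialization or evaluation, workspace included). It is assumed throughout that $2^w$ is at least the stated space bound. Bounds hold for every outcome of the randomness. Evaluation is deterministic, and arbitrarily many evaluations may be made. $[u]=\{0,\dots,u-1\}$, $\log=\log_2$. **Definitions.** For $\Gamma:\{0,1\}^{nc}\to(\{0,1\}^{m})^{d}$, whose inputs are strings of $c$ characters of $n$ bits, let $\Gamma(S)=\{(i,\Gamma(x)_i): x\in S,\ 1\le i\le d\}$. $\Gamma$ is *$k$-majority-unique* if every nonempty set $S$ of at most $k$ inputs contains an $x$ with $|\Gamma(\{x\})\setminus\Gamma(S\setminus\{x\})|>d/2$. A family of functions $[u]\to[r]$ is *$k$-independent* if, for a uniformly random member $f$ of the family, the values of $f$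 on any set of at most $k$ keys are independent and uniform in $[r]$. **Part 1.** For every constant $a$ there are a constant $C>0$ and programs forming a randomized data structure which, for all positive integers $\lambda,n,\kappa$ with $\kappa\le a n$ and all $w$ (large enough to address the space), initializes a function $\Gamma:(\{0,1\}^{n})^{2^\lambda}\to(\{0,1\}^{n+\kappa+4})^{2^{\lambda+3}}$ such that * the space is at most $C\,(1+2^{n+\kappa+2\lambda}\,n/w)$ words, and the initialization time is at most $C\,(w+2^{n+\kappa+\lambda}(1+2^\lambda n/w))$; * the evaluation time of $\Gamma$ is at most $C\,2^\lambda(\lambda+2^\lambda n/w)$; * $\Gamma$ is $2^\kappa$-majority-unique with probability at least $1-2^{-n+1}$. (Characters are read and written one per word.) **Part 2.** For all constants $a,b$ there are a constant $C>0$ and programs forming a randomized data structure which, for all positive integers $u,r,t,k$ with $k\le u^{a/t}$ and $r\le u^{b}$ and all $w$ (large enough to address the space), selects a family $\mathcal F$ of functions from $[u]$ to $[r]$, indexed by $[r]^L$ for some $L$ that depends only on $u,r,t,k,w$, such that * the space used to represent $\mathcal F$, as well as the space used to represent the function $f\in\mathcal F$ with a given index (constructed from the representation of $\mathcal F$ and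 the index), is at most $C\,(1+k\,u^{1/t}\,t\,(\log u)/w)$ words, and each of these two initializations takes at most $C\,(w+k\,u^{1/t}\,t\,(1+(\log u)/w))$ steps; * the evaluation time of every $f\in\mathcal F$ is at most $C\,(1+t\log t+t(\log u)/w)$; * $\mathcal F$ (with uniformly random index) is $k$-independent with probability at least $1-u^{-1/t}$. (Numbers that exceed a word are given by their base-$2^w$ digits.) -/

import Mathlib

/-! ### The word RAM

Words are `w`-bit strings.  A program is a fixed finite text, the same for all inputs and all word
lengths.  It works with registers and a random access memory whose cells and addresses are words.
There is no multiplication or division: only addition, subtraction, bitwise operations and shifts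
are available.  Inputs are natural numbers, which a program reads word by word from a read-only
input; outputs are words written to a write-only output. -/

namespace WordRAM

/-- Binary arithmetic instructions. -/
inductive Op
  | add | sub | and | or | xor | shl | shr

/-- The effect of an arithmetic instruction on two words (addition and subtraction are modulo
`2 ^ w`, shifts are logical). -/
def Op.eval {w : ℕ} : Op → BitVec w → BitVec w → BitVec w
  | .add, a, b => a + b
  | .sub, a, b => a - b
  | .and, a, b => a &&& b
  | .or, a, b => a ||| b
  | .xor, a, b => a ^^^ b
  | .shl, a, b => a <<< b
  | .shr, a, b => a >>> b

/-- Tests that compare two registers, as unsigned integers. -/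
inductive Test
  | eq (a b : ℕ)
  | lt (a b : ℕ)

/-- Programs.  Registers are named by natural numbers. -/
inductive Prog
  /-- do nothing -/
  | skip
  /-- register `d` := the constant `n` -/
  | const (d n : ℕ)
  /-- register `d` := (register `a`) `o` (register `b`) -/
  | op (o : Op) (d a b : ℕ)
  /-- register `d` := memory cell whose address is in register `a` -/
  | load (d a : ℕ)
  /-- memory cell whose address is in register `a` := register `s` -/
  | store (a s : ℕ)
  /-- register `d` := word number (register `j`) of input number (register `i`) -/
  | input (d i j : ℕ)
  /-- register `d` := the length, in words, of input number (register `i`) -/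
  | inputLen (d i : ℕ)
  /-- append register `s` to the output -/
  | output (s : ℕ)
  /-- first `p`, then `q` -/
  | seq (p q : Prog)
  /-- `p` if the test succeeds, `q` otherwise -/
  | ite (c : Test) (p q : Prog)
  /-- repeat `p` as long as the test succeeds -/
  | loop (c : Test) (p : Prog)

/-- Memory contents. -/
abbrev Mem (w : ℕ) := BitVec w → BitVec w

structure State (w : ℕ) where
  reg : ℕ → BitVec w
  mem : Mem w
  out : List (BitVec w)

/-- The outcome of a test in a state. -/
def Test.Holds {w : ℕ} (σ : State w) : Test → Prop
  | .eq a b => σ.reg a = σ.reg b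
  | .lt a b => (σ.reg a).toNat < (σ.reg b).toNat

/-- Assign the word `v` to register `d`. -/
def State.setReg {w : ℕ} (σ : State w) (d : ℕ) (v : BitVec w) : State w :=
  { σ with reg := Function.update σ.reg d v }

/-- `Exec S inp p σ τ σ'`: with input numbers `inp` and a memory of `S` words, the program `p`,
started in state `σ`, halts after `τ` steps in state `σ'`.  Every instruction and every evaluation
of a test is one step.  Only the cells with addresses `0, …, S - 1` may be accessed: a program that
attempts any other access has no execution. -/
inductive Exec {w : ℕ} (S : ℕ) (inp : List ℕ) : Prog → State w → ℕ → State w → Prop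
  | skip (σ) : Exec S inp .skip σ 1 σ
  | const (σ d n) : Exec S inp (.const d n) σ 1 (σ.setReg d (BitVec.ofNat w n))
  | op (σ o d a b) : Exec S inp (.op o d a b) σ 1 (σ.setReg d (o.eval (σ.reg a) (σ.reg b)))
  | load (σ d a) (h : (σ.reg a).toNat < S) :
      Exec S inp (.load d a) σ 1 (σ.setReg d (σ.mem (σ.reg a)))
  | store (σ a s) (h : (σ.reg a).toNat < S) :
      Exec S inp (.store a s) σ 1
        { σ with mem := Function.update σ.mem (σ.reg a) (σ.reg s) }
  | input (σ d i j) :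
      Exec S inp (.input d i j) σ 1
        (σ.setReg d
          (BitVec.ofNat w (inp.getD (σ.reg i).toNat 0 / 2 ^ (w * (σ.reg j).toNat))))
  | inputLen (σ d i) :
      Exec S inp (.inputLen d i) σ 1
        (σ.setReg d
          (BitVec.ofNat w (Nat.digits (2 ^ w) (inp.getD (σ.reg i).toNat 0)).length))
  | output (σ s) : Exec S inp (.output s) σ 1 { σ with out := σ.out ++ [σ.reg s] }
  | seq {p q σ₁ σ₂ σ₃ τ₁ τ₂} (h₁ : Exec S inp p σ₁ τ₁ σ₂) (h₂ : Exec S inp q σ₂ τ₂ σ₃) :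
      Exec S inp (.seq p q) σ₁ (τ₁ + τ₂) σ₃
  | iteTrue {c p q σ₁ σ₂ τ} (hc : c.Holds σ₁) (h : Exec S inp p σ₁ τ σ₂) :
      Exec S inp (.ite c p q) σ₁ (τ + 1) σ₂
  | iteFalse {c p q σ₁ σ₂ τ} (hc : ¬ c.Holds σ₁) (h : Exec S inp q σ₁ τ σ₂) :
      Exec S inp (.ite c p q) σ₁ (τ + 1) σ₂
  | loopDone {c p σ} (hc : ¬ c.Holds σ) : Exec S inp (.loop c p) σ 1 σ
  | loopStep {c p σ₁ σ₂ σ₃ τ₁ τ₂} (hc : c.Holds σ₁) (h₁ : Exec S inp p σ₁ τ₁ σ₂)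
      (h₂ : Exec S inp (.loop c p) σ₂ τ₂ σ₃) :
      Exec S inp (.loop c p) σ₁ (τ₁ + τ₂ + 1) σ₃

/-- Started on memory `M` (with all registers zero and empty output) and input numbers `inp`, the
program `p` halts within `T` steps, never leaves the first `S` memory cells, and ends with memory
`M'` and output `out`. -/
def Runs {w : ℕ} (S : ℕ) (T : ℝ) (p : Prog) (inp : List ℕ) (M M' : Mem w)
    (out : List (BitVec w)) : Prop :=
  ∃ (τ : ℕ) (σ' : State w), (τ : ℝ) ≤ T ∧ Exec S inp p ⟨fun _ => 0, M, []⟩ τ σ' ∧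
    σ'.mem = M' ∧ σ'.out = out

/-- The memory contents `M` represent a function on `α` under the evaluation program `p`: any
sequence of evaluations, each using at most `S` words of memory (workspace included) and `T` steps,
is answered correctly.  `enc x` is the input of an evaluation at `x`, and `Correct x out` says that
`out` is a correct output for it.  An evaluation may write to the memory, but has to leave it in a
condition in which all further evaluations are answered correctly too. -/
def Represents {w : ℕ} {α : Type} (S : ℕ) (T : ℝ) (p : Prog) (enc : α → List ℕ)
    (Correct : α → List (BitVec w) → Prop) (M : Mem w) : Prop :=
  ∃ R : Set (Mem w), M ∈ R ∧ ∀ N ∈ R, ∀ x : α, ∃ N' ∈ R, ∃ out : List (BitVec w),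
    Runs S T p (enc x) N N' out ∧ Correct x out

/-- The number with base `2 ^ w` digits `l`, least significant first. -/
def wordsToNat {w : ℕ} (l : List (BitVec w)) : ℕ :=
  Nat.ofDigits (2 ^ w) (l.map BitVec.toNat)

end WordRAM

/-! ### Unique neighbours and `k`-independence -/

namespace Hashing

/-- The probability of the event `E` under the uniform distribution on a finite type. -/
noncomputable def uniformProb {Ω : Type} [Fintype Ω] (E : Set Ω) : ℝ :=
  (E.ncard : ℝ) / Fintype.card Ω

open Classical in
/-- The set of outputs `Γ(S) = {(i, Γ(x)ᵢ) : x ∈ S}`. -/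
noncomputable def nbrs {α β : Type} {d : ℕ} (Γ : α → Fin d → β) (S : Finset α) :
    Finset (Fin d × β) :=
  S.biUnion fun x => Finset.univ.image fun i => (i, Γ x i)

open Classical in
/-- `Γ` is `k`-majority-unique: every nonempty set of at most `k` inputs contains an input `x` with
more than `d / 2` neighbours that are not neighbours of any other input of the set. -/
def MajorityUnique {α β : Type} {d : ℕ} (k : ℕ) (Γ : α → Fin d → β) : Prop :=
  ∀ S : Finset α, S.Nonempty → S.card ≤ k →
    ∃ x ∈ S, (d : ℝ) / 2 < ((nbrs Γ {x} \ nbrs Γ (S.erase x)).card : ℝ)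

/-- The family `(f s)`, with `s` uniformly random, is `k`-independent: on every set of at most `k`
keys the values are independent and uniformly distributed. -/
def KIndependent {Ω : Type} [Fintype Ω] {u r : ℕ} (k : ℕ) (f : Ω → Fin u → Fin r) : Prop :=
  ∀ X : Finset (Fin u), X.card ≤ k → ∀ y : Fin u → Fin r,
    uniformProb {s | ∀ x ∈ X, f s x = y x} = ((1 : ℝ) / r) ^ X.card

end Hashing

open WordRAM Hashing

set_option linter.constructorNameAsVariable false
set_option linter.unusedSimpArgs false
set_option linter.unusedVariables false

namespace WordRAM

/-! ### A structured language that compiles to the word RAM -/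

/-- The variables of the structured programs. -/
inductive Var
  | l | n | ka | ga | mu | h | ib | eA | eB | es | gm | hm | mm | pm | bm | bw | tb | cur | nxt | pc | pn
  | i | j | nu | z | g | q | s | x | y | al | be | c | ch | row | sa | sp | da | dp | dm | ct | lim
  | pct | pdm | dl | sg | dA | dB | dS | nn | hj | lr | nq | t1 | t2 | t3 | t4 | w | u | lu | r | nr | t | k | sr | rg | rm | rmm | rgm | rb | ab | vb | bo | va | vp
  deriving DecidableEq

theorem Var.ctorIdx_injective : Function.Injective Var.ctorIdx := by
  intro a b h
  cases a <;> cases b <;> first | rfl | exact absurd h (by decide)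

/-- Expressions. -/
inductive Ex
  | v (x : Var)
  | lit (n : ℕ)
  | op (o : Op) (a b : Ex)
  | ld (a : Ex)
  | inp (a b : Ex)
  | len (a : Ex)

instance : Coe Var Ex := ⟨.v⟩
instance (n : ℕ) : OfNat Ex n := ⟨.lit n⟩
instance : Add Ex := ⟨.op .add⟩
instance : Sub Ex := ⟨.op .sub⟩
instance : AndOp Ex := ⟨.op .and⟩
instance : XorOp Ex := ⟨.op .xor⟩
instance : OrOp Ex := ⟨.op .or⟩
instance : ShiftLeft Ex := ⟨.op .shl⟩
instance : ShiftRight Ex := ⟨.op .shr⟩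

/-- Structured programs. -/
inductive Cmd
  | skip
  | asg (x : Var) (e : Ex)
  | st (a e : Ex)
  | out (e : Ex)
  | seq (p q : Cmd)
  | ite (lt : Bool) (a b : Ex) (p q : Cmd)
  | loop (lt : Bool) (a b : Ex) (p : Cmd)

infixr:51 " ;; " => Cmd.seq
infix:52 " ::= " => Cmd.asg

/-- States of structured programs; all values are natural numbers. -/
structure HSt where
  v : Var → ℕ
  m : ℕ → ℕ
  o : List ℕ

/-- Assign a value to a variable. -/
def HSt.set (h : HSt) (x : Var) (a : ℕ) : HSt := { h with v := Function.update h.v x a }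

/-- Write a value to a memory cell. -/
def HSt.put (h : HSt) (a b : ℕ) : HSt := { h with m := Function.update h.m a b }

/-- Append a value to the output. -/
def HSt.app (h : HSt) (a : ℕ) : HSt := { h with o := h.o ++ [a] }

section
variable (h : HSt) (x y : Var) (a b : ℕ)
@[simp] theorem HSt.set_v : (h.set x a).v y = if y = x then a else h.v y := by
  simp [HSt.set, Function.update_apply]
@[simp] theorem HSt.set_m : (h.set x a).m = h.m := rfl
@[simp] theorem HSt.set_o : (h.set x a).o = h.o := rfl
@[simp] theorem HSt.put_v : (h.put a b).v = h.v := rfl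
theorem HSt.put_m : (h.put a b).m = Function.update h.m a b := rfl
@[simp] theorem HSt.put_o : (h.put a b).o = h.o := rfl
@[simp] theorem HSt.app_v : (h.app a).v = h.v := rfl
@[simp] theorem HSt.app_m : (h.app a).m = h.m := rfl
@[simp] theorem HSt.app_o : (h.app a).o = h.o ++ [a] := rfl
end

/-- Word length, number of memory cells and input of an execution. -/
structure Env where
  w : ℕ
  S : ℕ
  inp : List ℕ

/-- The effect of an arithmetic instruction on natural numbers. -/
def opN (w : ℕ) : Op → ℕ → ℕ → ℕ
  | .add, a, b => (a + b) % 2 ^ w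
  | .sub, a, b => (2 ^ w - b + a) % 2 ^ w
  | .and, a, b => a &&& b
  | .or, a, b => a ||| b
  | .xor, a, b => a ^^^ b
  | .shl, a, b => (a <<< b) % 2 ^ w
  | .shr, a, b => a >>> b

/-- Word `j` of input number `i`. -/
def Env.word (E : Env) (i j : ℕ) : ℕ := E.inp.getD i 0 / 2 ^ (E.w * j) % 2 ^ E.w

/-- Number of words of input number `i`. -/
def Env.words (E : Env) (i : ℕ) : ℕ := (Nat.digits (2 ^ E.w) (E.inp.getD i 0)).length

/-- The value of an expression. -/
def Ex.ev (E : Env) (h : HSt) : Ex → ℕ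
  | .v x => h.v x
  | .lit n => n % 2 ^ E.w
  | .op o a b => opN E.w o (a.ev E h) (b.ev E h)
  | .ld a => h.m (a.ev E h)
  | .inp a b => E.word (a.ev E h) (b.ev E h)
  | .len a => E.words (a.ev E h) % 2 ^ E.w

/-- All loads of an expression access existing cells. -/
def Ex.ok (E : Env) (h : HSt) : Ex → Prop
  | .v _ => True
  | .lit _ => True
  | .op _ a b => a.ok E h ∧ b.ok E h
  | .ld a => a.ok E h ∧ a.ev E h < E.S
  | .inp a b => a.ok E h ∧ b.ok E h
  | .len a => a.ok E h

/-- Number of instructions that evaluate an expression. -/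
def Ex.cost : Ex → ℕ
  | .v _ => 1
  | .lit _ => 1
  | .op _ a b => a.cost + b.cost + 1
  | .ld a => a.cost + 1
  | .inp a b => a.cost + b.cost + 1
  | .len a => a.cost + 1

section
variable (E : Env) (h : HSt) (a b : Ex) (n : ℕ) (x : Var)
@[simp] theorem Ex.ev_v : Ex.ev E h (.v x) = h.v x := rfl
@[simp] theorem Ex.ev_lit : Ex.ev E h (.lit n) = n % 2 ^ E.w := rfl
@[simp] theorem Ex.ev_ofNat : Ex.ev E h (no_index (OfNat.ofNat n)) = n % 2 ^ E.w := rfl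
@[simp] theorem Ex.ev_add : Ex.ev E h (a + b) = (a.ev E h + b.ev E h) % 2 ^ E.w := rfl
@[simp] theorem Ex.ev_sub : Ex.ev E h (a - b) = (2 ^ E.w - b.ev E h + a.ev E h) % 2 ^ E.w := rfl
@[simp] theorem Ex.ev_and : Ex.ev E h (a &&& b) = a.ev E h &&& b.ev E h := rfl
@[simp] theorem Ex.ev_or : Ex.ev E h (a ||| b) = a.ev E h ||| b.ev E h := rfl
@[simp] theorem Ex.ev_xor : Ex.ev E h (a ^^^ b) = a.ev E h ^^^ b.ev E h := rfl
@[simp] theorem Ex.ev_shl :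
    Ex.ev E h (a <<< b) = (a.ev E h * 2 ^ b.ev E h) % 2 ^ E.w := by
  rw [← Nat.shiftLeft_eq]; rfl
@[simp] theorem Ex.ev_shr : Ex.ev E h (a >>> b) = a.ev E h / 2 ^ b.ev E h := by
  rw [← Nat.shiftRight_eq_div_pow]; rfl
@[simp] theorem Ex.ev_ld : Ex.ev E h (.ld a) = h.m (a.ev E h) := rfl
@[simp] theorem Ex.ev_inp : Ex.ev E h (.inp a b) = E.word (a.ev E h) (b.ev E h) := rfl
@[simp] theorem Ex.ev_len : Ex.ev E h (.len a) = E.words (a.ev E h) % 2 ^ E.w := rfl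
@[simp] theorem Ex.ok_v : Ex.ok E h (.v x) := trivial
@[simp] theorem Ex.ok_lit : Ex.ok E h (.lit n) := trivial
@[simp] theorem Ex.ok_ofNat : Ex.ok E h (no_index (OfNat.ofNat n)) := trivial
@[simp] theorem Ex.ok_add : Ex.ok E h (a + b) ↔ a.ok E h ∧ b.ok E h := Iff.rfl
@[simp] theorem Ex.ok_sub : Ex.ok E h (a - b) ↔ a.ok E h ∧ b.ok E h := Iff.rfl
@[simp] theorem Ex.ok_and : Ex.ok E h (a &&& b) ↔ a.ok E h ∧ b.ok E h := Iff.rfl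
@[simp] theorem Ex.ok_or : Ex.ok E h (a ||| b) ↔ a.ok E h ∧ b.ok E h := Iff.rfl
@[simp] theorem Ex.ok_xor : Ex.ok E h (a ^^^ b) ↔ a.ok E h ∧ b.ok E h := Iff.rfl
@[simp] theorem Ex.ok_shl : Ex.ok E h (a <<< b) ↔ a.ok E h ∧ b.ok E h := Iff.rfl
@[simp] theorem Ex.ok_shr : Ex.ok E h (a >>> b) ↔ a.ok E h ∧ b.ok E h := Iff.rfl
@[simp] theorem Ex.ok_ld : Ex.ok E h (.ld a) ↔ a.ok E h ∧ a.ev E h < E.S := Iff.rfl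
@[simp] theorem Ex.ok_inp : Ex.ok E h (.inp a b) ↔ a.ok E h ∧ b.ok E h := Iff.rfl
@[simp] theorem Ex.ok_len : Ex.ok E h (.len a) ↔ a.ok E h := Iff.rfl
@[simp] theorem Ex.cost_v : Ex.cost (.v x) = 1 := rfl
@[simp] theorem Ex.cost_lit : Ex.cost (.lit n) = 1 := rfl
@[simp] theorem Ex.cost_ofNat : Ex.cost (no_index (OfNat.ofNat n)) = 1 := rfl
@[simp] theorem Ex.cost_add : Ex.cost (a + b) = a.cost + b.cost + 1 := rfl
@[simp] theorem Ex.cost_sub : Ex.cost (a - b) = a.cost + b.cost + 1 := rfl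
@[simp] theorem Ex.cost_and : Ex.cost (a &&& b) = a.cost + b.cost + 1 := rfl
@[simp] theorem Ex.cost_or : Ex.cost (a ||| b) = a.cost + b.cost + 1 := rfl
@[simp] theorem Ex.cost_xor : Ex.cost (a ^^^ b) = a.cost + b.cost + 1 := rfl
@[simp] theorem Ex.cost_shl : Ex.cost (a <<< b) = a.cost + b.cost + 1 := rfl
@[simp] theorem Ex.cost_shr : Ex.cost (a >>> b) = a.cost + b.cost + 1 := rfl
@[simp] theorem Ex.cost_ld : Ex.cost (.ld a) = a.cost + 1 := rfl
@[simp] theorem Ex.cost_inp : Ex.cost (.inp a b) = a.cost + b.cost + 1 := rfl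
@[simp] theorem Ex.cost_len : Ex.cost (.len a) = a.cost + 1 := rfl
end

/-- The test of a conditional or a loop. -/
def condHolds (E : Env) (h : HSt) (lt : Bool) (a b : Ex) : Prop :=
  if lt then a.ev E h < b.ev E h else a.ev E h = b.ev E h

/-- Terminating executions of structured programs, with their costs. -/
inductive Run (E : Env) : Cmd → HSt → ℕ → HSt → Prop
  | skip (h) : Run E .skip h 1 h
  | asg (h x e) (ho : e.ok E h) : Run E (.asg x e) h (e.cost + 1) (h.set x (e.ev E h))
  | st (h a e) (ha : a.ok E h) (he : e.ok E h) (hS : a.ev E h < E.S) :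
      Run E (.st a e) h (a.cost + e.cost + 1) (h.put (a.ev E h) (e.ev E h))
  | out (h e) (ho : e.ok E h) : Run E (.out e) h (e.cost + 1) (h.app (e.ev E h))
  | seq {p q h₁ h₂ h₃ τ₁ τ₂} (r₁ : Run E p h₁ τ₁ h₂) (r₂ : Run E q h₂ τ₂ h₃) :
      Run E (.seq p q) h₁ (τ₁ + τ₂) h₃
  | iteTrue {lt a b p q h₁ h₂ τ} (ha : a.ok E h₁) (hb : b.ok E h₁) (hc : condHolds E h₁ lt a b)
      (r : Run E p h₁ τ h₂) : Run E (.ite lt a b p q) h₁ (a.cost + b.cost + (τ + 1)) h₂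
  | iteFalse {lt a b p q h₁ h₂ τ} (ha : a.ok E h₁) (hb : b.ok E h₁)
      (hc : ¬ condHolds E h₁ lt a b)
      (r : Run E q h₁ τ h₂) : Run E (.ite lt a b p q) h₁ (a.cost + b.cost + (τ + 1)) h₂
  | loopDone {lt a b p h} (ha : a.ok E h) (hb : b.ok E h) (hc : ¬ condHolds E h lt a b) :
      Run E (.loop lt a b p) h (a.cost + b.cost + 1) h
  | loopStep {lt a b p h₁ h₂ h₃ τ₁ τ₂} (ha : a.ok E h₁) (hb : b.ok E h₁)
      (hc : condHolds E h₁ lt a b)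
      (r₁ : Run E p h₁ τ₁ h₂) (r₂ : Run E (.loop lt a b p) h₂ τ₂ h₃) :
      Run E (.loop lt a b p) h₁ (a.cost + b.cost + (τ₁ + τ₂ + 1)) h₃

/-- The register of a variable. -/
def Var.reg (x : Var) : ℕ := 2 * x.ctorIdx

/-- Code that evaluates an expression into temporary register number `d`. -/
def Ex.comp : Ex → ℕ → Prog
  | .v x, d => .op .or (2 * d + 1) x.reg x.reg
  | .lit n, d => .const (2 * d + 1) n
  | .op o a b, d => .seq (a.comp d) (.seq (b.comp (d + 1))
      (.op o (2 * d + 1) (2 * d + 1) (2 * (d + 1) + 1)))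
  | .ld a, d => .seq (a.comp d) (.load (2 * d + 1) (2 * d + 1))
  | .inp a b, d => .seq (a.comp d) (.seq (b.comp (d + 1))
      (.input (2 * d + 1) (2 * d + 1) (2 * (d + 1) + 1)))
  | .len a, d => .seq (a.comp d) (.inputLen (2 * d + 1) (2 * d + 1))

/-- The test on the first two temporary registers. -/
def tmpTest (lt : Bool) : Test := if lt then .lt 1 3 else .eq 1 3

/-- Compilation of structured programs. -/
def Cmd.comp : Cmd → Prog
  | .skip => .skip
  | .asg x e => .seq (e.comp 0) (.op .or x.reg 1 1)
  | .st a e => .seq (a.comp 0) (.seq (e.comp 1) (.store 1 3))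
  | .out e => .seq (e.comp 0) (.output 1)
  | .seq p q => .seq p.comp q.comp
  | .ite lt a b p q => .seq (.seq (a.comp 0) (b.comp 1)) (.ite (tmpTest lt) p.comp q.comp)
  | .loop lt a b p => .seq (.seq (a.comp 0) (b.comp 1))
      (.loop (tmpTest lt) (.seq p.comp (.seq (a.comp 0) (b.comp 1))))

/-- A machine state represents a state of a structured program. -/
structure Rel {w : ℕ} (σ : State w) (h : HSt) : Prop where
  v : ∀ x : Var, (σ.reg x.reg).toNat = h.v x
  m : ∀ a < 2 ^ w, (σ.mem (BitVec.ofNat w a)).toNat = h.m a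
  o : σ.out.map BitVec.toNat = h.o

theorem Rel.setTmp {w : ℕ} {σ : State w} {h : HSt} (r : Rel σ h) (d : ℕ) (b : BitVec w) :
    Rel (σ.setReg (2 * d + 1) b) h where
  v x := by
    rw [← r.v x, State.setReg]; congr 1
    exact Function.update_of_ne (by unfold Var.reg; omega) _ _
  m := r.m
  o := r.o

theorem Op.toNat_eval {w : ℕ} (o : Op) (a b : BitVec w) :
    (o.eval a b).toNat = opN w o a.toNat b.toNat := by
  cases o <;> simp [Op.eval, opN, BitVec.toNat_sub]

theorem Ex.comp_exec (E : Env) (hS : E.S ≤ 2 ^ E.w) (h : HSt) (e : Ex) :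
    ∀ (d : ℕ) (σ : State E.w), Rel σ h → e.ok E h →
      ∃ σ', Exec E.S E.inp (e.comp d) σ e.cost σ' ∧ Rel σ' h ∧
        (σ'.reg (2 * d + 1)).toNat = e.ev E h ∧
        ∀ d' < d, σ'.reg (2 * d' + 1) = σ.reg (2 * d' + 1) := by
  have upd : ∀ (σ : State E.w) (d : ℕ) (b : BitVec E.w), ∀ d' < d,
      (σ.setReg (2 * d + 1) b).reg (2 * d' + 1) = σ.reg (2 * d' + 1) := fun σ d b d' hd =>
    Function.update_of_ne (by omega) _ _
  have self : ∀ (σ : State E.w) (d : ℕ) (b : BitVec E.w),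
      (σ.setReg (2 * d + 1) b).reg (2 * d + 1) = b := fun σ d b => Function.update_self _ _ _
  induction e with
  | v x =>
    intro d σ r _
    refine ⟨_, Exec.op σ _ _ _ _, r.setTmp d _, ?_, upd σ d _⟩
    rw [self, Op.toNat_eval, r.v]
    simp [opN]
  | lit n =>
    intro d σ r _
    refine ⟨_, Exec.const σ _ _, r.setTmp d _, ?_, upd σ d _⟩
    rw [self]; simp
  | op o a b iha ihb =>
    intro d σ r ho
    obtain ⟨σ₁, e₁, r₁, v₁, f₁⟩ := iha d σ r ho.1
    obtain ⟨σ₂, e₂, r₂, v₂, f₂⟩ := ihb (d + 1) σ₁ r₁ ho.2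
    refine ⟨_, ?_, r₂.setTmp d (o.eval (σ₂.reg (2 * d + 1)) (σ₂.reg (2 * (d + 1) + 1))), ?_, ?_⟩
    · have := Exec.seq e₁ (Exec.seq e₂ (Exec.op σ₂ o (2 * d + 1) (2 * d + 1) (2 * (d + 1) + 1)))
      rwa [← add_assoc] at this
    · rw [self, Op.toNat_eval, f₂ d (by omega), v₁, v₂]; rfl
    · intro d' hd
      rw [upd _ _ _ d' hd, f₂ d' (by omega), f₁ d' hd]
  | ld a iha =>
    intro d σ r ho
    obtain ⟨σ₁, e₁, r₁, v₁, f₁⟩ := iha d σ r ho.1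
    refine ⟨_, Exec.seq e₁ (Exec.load σ₁ (2 * d + 1) (2 * d + 1) (by rw [v₁]; exact ho.2)),
      r₁.setTmp d _, ?_, ?_⟩
    · rw [self, Ex.ev_ld, ← v₁, ← r₁.m _ (BitVec.isLt _)]; simp
    · intro d' hd
      rw [upd _ _ _ d' hd, f₁ d' hd]
  | inp a b iha ihb =>
    intro d σ r ho
    obtain ⟨σ₁, e₁, r₁, v₁, f₁⟩ := iha d σ r ho.1
    obtain ⟨σ₂, e₂, r₂, v₂, f₂⟩ := ihb (d + 1) σ₁ r₁ ho.2
    refine ⟨_, ?_, r₂.setTmp d (BitVec.ofNat E.w (E.inp.getD (σ₂.reg (2 * d + 1)).toNat 0 /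
      2 ^ (E.w * (σ₂.reg (2 * (d + 1) + 1)).toNat))), ?_, ?_⟩
    · have := Exec.seq e₁ (Exec.seq e₂
        (Exec.input (S := E.S) (inp := E.inp) σ₂ (2 * d + 1) (2 * d + 1) (2 * (d + 1) + 1)))
      rwa [← add_assoc] at this
    · rw [self, f₂ d (by omega), v₁, v₂]; simp [Env.word]
    · intro d' hd
      rw [upd _ _ _ d' hd, f₂ d' (by omega), f₁ d' hd]
  | len a iha =>
    intro d σ r ho
    obtain ⟨σ₁, e₁, r₁, v₁, f₁⟩ := iha d σ r ho
    refine ⟨_, Exec.seq e₁ (Exec.inputLen σ₁ (2 * d + 1) (2 * d + 1)), r₁.setTmp d _, ?_, ?_⟩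
    · rw [self, v₁]; simp [Env.words]
    · intro d' hd
      rw [upd _ _ _ d' hd, f₁ d' hd]

theorem Ex.comp_exec₂ (E : Env) (hS : E.S ≤ 2 ^ E.w) {h : HSt} {a b : Ex} {σ : State E.w}
    (r : Rel σ h) (ha : a.ok E h) (hb : b.ok E h) :
    ∃ σ', Exec E.S E.inp (.seq (a.comp 0) (b.comp 1)) σ (a.cost + b.cost) σ' ∧ Rel σ' h ∧
        (σ'.reg 1).toNat = a.ev E h ∧ (σ'.reg 3).toNat = b.ev E h := by
  obtain ⟨σ₁, e₁, r₁, v₁, -⟩ := a.comp_exec E hS h 0 σ r ha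
  obtain ⟨σ₂, e₂, r₂, v₂, f₂⟩ := b.comp_exec E hS h 1 σ₁ r₁ hb
  exact ⟨σ₂, .seq e₁ e₂, r₂, by rw [← v₁]; exact congrArg _ (f₂ 0 one_pos), v₂⟩

theorem tmpTest_holds {E : Env} {h : HSt} {a b : Ex} {σ : State E.w} (lt : Bool)
    (ha : (σ.reg 1).toNat = a.ev E h) (hb : (σ.reg 3).toNat = b.ev E h) :
    (tmpTest lt).Holds σ ↔ condHolds E h lt a b := by
  cases lt
  · simp [tmpTest, Test.Holds, condHolds, ← ha, ← hb, BitVec.toNat_inj]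
  · simp [tmpTest, Test.Holds, condHolds, ← ha, ← hb]

theorem Run.comp_exec {E : Env} (hS : E.S ≤ 2 ^ E.w) {c : Cmd} {h h' : HSt} {τ : ℕ}
    (R : Run E c h τ h') : ∀ σ : State E.w, Rel σ h →
      ∃ σ', Exec E.S E.inp c.comp σ τ σ' ∧ Rel σ' h' := by
  induction R with
  | skip h => exact fun σ r => ⟨σ, .skip σ, r⟩
  | asg h x e ho =>
    intro σ r
    obtain ⟨σ₁, e₁, r₁, v₁, -⟩ := e.comp_exec E hS h 0 σ r ho
    refine ⟨_, .seq e₁ (.op σ₁ .or x.reg 1 1), ?_, r₁.m, r₁.o⟩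
    intro y
    rw [HSt.set_v]; simp only [State.setReg, Function.update_apply]
    by_cases hxy : y = x
    · subst hxy
      simp only [if_true, Op.toNat_eval, opN]
      rw [← v₁]; simp
    · rw [if_neg hxy, if_neg, r₁.v]
      intro hh
      exact hxy (Var.ctorIdx_injective (by unfold Var.reg at hh; omega))
  | st h a e ha he hs =>
    intro σ r
    obtain ⟨σ₁, e₁, r₁, v₁, -⟩ := a.comp_exec E hS h 0 σ r ha
    obtain ⟨σ₂, e₂, r₂, v₂, f₂⟩ := e.comp_exec E hS h 1 σ₁ r₁ he
    have hv : (σ₂.reg 1).toNat = a.ev E h := by rw [← v₁]; exact congrArg _ (f₂ 0 one_pos)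
    have := Exec.seq e₁ (Exec.seq e₂ (Exec.store (inp := E.inp) σ₂ 1 3 (by rw [hv]; exact hs)))
    rw [← add_assoc] at this
    refine ⟨_, this, r₂.v, ?_, r₂.o⟩
    · intro b hb
      simp only [HSt.put_m, Function.update_apply]
      by_cases hab : b = a.ev E h
      · rw [if_pos hab, if_pos, ← v₂]
        rw [hab, ← hv]; simp
      · rw [if_neg hab, if_neg, r₂.m b hb]
        intro hh
        apply hab
        rw [← hv, ← hh, BitVec.toNat_ofNat, Nat.mod_eq_of_lt hb]
  | out h e ho =>
    intro σ r
    obtain ⟨σ₁, e₁, r₁, v₁, -⟩ := e.comp_exec E hS h 0 σ r ho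
    refine ⟨_, .seq e₁ (.output σ₁ 1), r₁.v, r₁.m, ?_⟩
    simp only [List.map_append, r₁.o, HSt.app_o, List.map_cons, List.map_nil]
    rw [← v₁]
  | seq _ _ ih₁ ih₂ =>
    intro σ r
    obtain ⟨σ₁, e₁, r₁⟩ := ih₁ σ r
    obtain ⟨σ₂, e₂, r₂⟩ := ih₂ σ₁ r₁
    exact ⟨σ₂, .seq e₁ e₂, r₂⟩
  | iteTrue ha hb hc _ ih =>
    intro σ r
    obtain ⟨σ₁, e₁, r₁, v₁, v₂⟩ := Ex.comp_exec₂ E hS r ha hb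
    obtain ⟨σ₂, e₂, r₂⟩ := ih σ₁ r₁
    exact ⟨σ₂, .seq e₁ (.iteTrue ((tmpTest_holds _ v₁ v₂).2 hc) e₂), r₂⟩
  | iteFalse ha hb hc _ ih =>
    intro σ r
    obtain ⟨σ₁, e₁, r₁, v₁, v₂⟩ := Ex.comp_exec₂ E hS r ha hb
    obtain ⟨σ₂, e₂, r₂⟩ := ih σ₁ r₁
    exact ⟨σ₂, .seq e₁ (.iteFalse (fun hh => hc ((tmpTest_holds _ v₁ v₂).1 hh)) e₂), r₂⟩
  | loopDone ha hb hc =>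
    intro σ r
    obtain ⟨σ₁, e₁, r₁, v₁, v₂⟩ := Ex.comp_exec₂ E hS r ha hb
    exact ⟨σ₁, .seq e₁ (.loopDone (fun hh => hc ((tmpTest_holds _ v₁ v₂).1 hh))), r₁⟩
  | @loopStep lt a b p h₁ h₂ h₃ τ₁ τ₂ ha hb hc _ _ ih₁ ih₂ =>
    intro σ r
    obtain ⟨σ₁, e₁, r₁, v₁, v₂⟩ := Ex.comp_exec₂ E hS r ha hb
    obtain ⟨σ₂, e₂, r₂⟩ := ih₁ σ₁ r₁
    obtain ⟨σ₃, e₃, r₃⟩ := ih₂ σ₂ r₂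
    refine ⟨σ₃, .seq e₁ ?_, r₃⟩
    cases e₃ with
    | seq x y =>
      have := Exec.loopStep ((tmpTest_holds _ v₁ v₂).2 hc) (.seq e₂ x) y
      rwa [add_assoc τ₁] at this

/-! ### Total correctness with time bounds -/

/-- The variables a program assigns. -/
def Cmd.wr : Cmd → List Var
  | .skip => []
  | .asg x _ => [x]
  | .st _ _ => []
  | .out _ => []
  | .seq p q => p.wr ++ q.wr
  | .ite _ _ _ p q => p.wr ++ q.wr
  | .loop _ _ _ p => p.wr

/-- The program has no output instruction. -/
def Cmd.silent : Cmd → Bool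
  | .skip => true
  | .asg _ _ => true
  | .st _ _ => true
  | .out _ => false
  | .seq p q => p.silent && q.silent
  | .ite _ _ _ p q => p.silent && q.silent
  | .loop _ _ _ p => p.silent

theorem Run.frame {E : Env} {c : Cmd} {h h' : HSt} {τ : ℕ} (R : Run E c h τ h') :
    ∀ x ∉ c.wr, h'.v x = h.v x := by
  induction R with
  | asg h y e ho => intro x hx; simp [Cmd.wr] at hx; simp [hx]
  | seq _ _ ih₁ ih₂ =>
    intro x hx; simp [Cmd.wr] at hx; rw [ih₂ x hx.2, ih₁ x hx.1]
  | iteTrue _ _ _ _ ih => intro x hx; simp [Cmd.wr] at hx; exact ih x hx.1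
  | iteFalse _ _ _ _ ih => intro x hx; simp [Cmd.wr] at hx; exact ih x hx.2
  | loopStep _ _ _ _ _ ih₁ ih₂ => intro x hx; rw [ih₂ x hx, ih₁ x hx]
  | _ => intro x _; rfl

theorem Run.out_eq {E : Env} {c : Cmd} {h h' : HSt} {τ : ℕ} (R : Run E c h τ h') :
    c.silent = true → h'.o = h.o := by
  induction R with
  | out => intro hx; simp [Cmd.silent] at hx
  | seq _ _ ih₁ ih₂ =>
    intro hx; simp [Cmd.silent] at hx; rw [ih₂ hx.2, ih₁ hx.1]
  | iteTrue _ _ _ _ ih => intro hx; simp [Cmd.silent] at hx; exact ih hx.1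
  | iteFalse _ _ _ _ ih => intro hx; simp [Cmd.silent] at hx; exact ih hx.2
  | loopStep _ _ _ _ _ ih₁ ih₂ => intro hx; rw [ih₂ hx, ih₁ hx]
  | _ => intro _; rfl

/-- From state `h` the program `c` halts within `T` steps in a state that satisfies `Q`. -/
def WP (E : Env) (c : Cmd) (h : HSt) (T : ℕ) (Q : HSt → Prop) : Prop :=
  ∃ τ h', τ ≤ T ∧ Run E c h τ h' ∧ Q h'

section WP
variable {E : Env} {c p q : Cmd} {h : HSt} {T T' T₁ T₂ : ℕ} {Q Q' : HSt → Prop}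
  {x : Var} {e a b : Ex}

theorem WP.mono (H : WP E c h T Q) (hT : T ≤ T') (hQ : ∀ h', Q h' → Q' h') : WP E c h T' Q' := by
  obtain ⟨τ, h', h1, h2, h3⟩ := H
  exact ⟨τ, h', h1.trans hT, h2, hQ _ h3⟩

theorem WP.time (hT : T ≤ T') (H : WP E c h T Q) : WP E c h T' Q := H.mono hT fun _ => id

theorem WP.post (H : WP E c h T Q) (hQ : ∀ h', Q h' → Q' h') : WP E c h T Q' := H.mono le_rfl hQ

theorem WP.framed (H : WP E c h T Q) :
    WP E c h T fun h' => Q h' ∧ (∀ y ∉ c.wr, h'.v y = h.v y) ∧ (c.silent = true → h'.o = h.o) := by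
  obtain ⟨τ, h', h1, h2, h3⟩ := H
  exact ⟨τ, h', h1, h2, h3, h2.frame, h2.out_eq⟩

theorem WP.skip (hQ : Q h) : WP E .skip h 1 Q := ⟨1, h, le_rfl, .skip h, hQ⟩

theorem WP.asg (v : ℕ) (ho : e.ok E h) (hv : e.ev E h = v) (hQ : Q (h.set x v)) :
    WP E (x ::= e) h (e.cost + 1) Q := ⟨_, _, le_rfl, .asg h x e ho, by rwa [hv]⟩

theorem WP.st (u v : ℕ) (ha : a.ok E h) (he : e.ok E h) (hu : a.ev E h = u) (hS : u < E.S)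
    (hv : e.ev E h = v) (hQ : Q (h.put u v)) : WP E (.st a e) h (a.cost + e.cost + 1) Q :=
  ⟨_, _, le_rfl, .st h a e ha he (by rwa [hu]), by rwa [hv, hu]⟩

theorem WP.out (v : ℕ) (ho : e.ok E h) (hv : e.ev E h = v) (hQ : Q (h.app v)) :
    WP E (.out e) h (e.cost + 1) Q := ⟨_, _, le_rfl, .out h e ho, by rwa [hv]⟩

theorem WP.seq (H : WP E p h T₁ fun h' => WP E q h' T₂ Q) : WP E (p ;; q) h (T₁ + T₂) Q := by
  obtain ⟨τ, h', h1, h2, τ', h'', h3, h4, h5⟩ := H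
  exact ⟨_, h'', add_le_add h1 h3, .seq h2 h4, h5⟩

theorem WP.seqAsg (v : ℕ) (ho : e.ok E h) (hv : e.ev E h = v) (H : WP E q (h.set x v) T Q) :
    WP E (x ::= e ;; q) h (e.cost + 1 + T) Q := WP.seq (WP.asg v ho hv H)

theorem WP.seqSt (u v : ℕ) (ha : a.ok E h) (he : e.ok E h) (hu : a.ev E h = u) (hS : u < E.S)
    (hv : e.ev E h = v) (H : WP E q (h.put u v) T Q) :
    WP E (.st a e ;; q) h (a.cost + e.cost + 1 + T) Q := WP.seq (WP.st u v ha he hu hS hv H)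

theorem WP.ite {lt : Bool} (ha : a.ok E h) (hb : b.ok E h)
    (hp : condHolds E h lt a b → WP E p h T Q) (hq : ¬ condHolds E h lt a b → WP E q h T Q) :
    WP E (.ite lt a b p q) h (a.cost + b.cost + 1 + T) Q := by
  by_cases hc : condHolds E h lt a b
  · obtain ⟨τ, h', h1, h2, h3⟩ := hp hc
    exact ⟨_, h', by omega, .iteTrue ha hb hc h2, h3⟩
  · obtain ⟨τ, h', h1, h2, h3⟩ := hq hc
    exact ⟨_, h', by omega, .iteFalse ha hb hc h2, h3⟩

/-- A loop that runs exactly `n` times, with invariant `I`. -/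
theorem WP.loop {lt : Bool} (n : ℕ) (Tb : ℕ → ℕ) (I : ℕ → HSt → Prop) (h0 : I 0 h)
    (hab : ∀ i ≤ n, ∀ h', I i h' → a.ok E h' ∧ b.ok E h' ∧ (condHolds E h' lt a b ↔ i < n))
    (hI : ∀ i < n, ∀ h', I i h' → WP E p h' (Tb i) (I (i + 1))) (hQ : ∀ h', I n h' → Q h') :
    WP E (.loop lt a b p) h
      ((∑ i ∈ Finset.range n, (Tb i + (a.cost + b.cost + 1))) + (a.cost + b.cost + 1)) Q := by
  have key : ∀ j ≤ n, ∀ h', I (n - j) h' → WP E (.loop lt a b p) h'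
      ((∑ i ∈ Finset.Ico (n - j) n, (Tb i + (a.cost + b.cost + 1))) + (a.cost + b.cost + 1)) Q := by
    intro j
    induction j with
    | zero =>
      intro _ h' hi
      obtain ⟨h1, h2, h3⟩ := hab n le_rfl h' hi
      refine ⟨_, h', ?_, .loopDone h1 h2 (by rw [h3]; omega), hQ _ hi⟩
      simp
    | succ j ih =>
      intro hj h' hi
      obtain ⟨h1, h2, h3⟩ := hab _ (Nat.sub_le _ _) h' hi
      obtain ⟨τ, h'', h4, h5, h6⟩ := hI (n - (j + 1)) (by omega) h' hi
      have e1 : n - (j + 1) + 1 = n - j := by omega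
      rw [e1] at h6
      obtain ⟨τ', h''', h7, h8, h9⟩ := ih (by omega) h'' h6
      refine ⟨_, h''', ?_, .loopStep h1 h2 (h3.2 (by omega)) h5 h8, h9⟩
      rw [Finset.sum_eq_sum_Ico_succ_bot (by omega), e1]
      omega
  have := key n le_rfl h (by simpa using h0)
  simpa using this

/-- `for x := 0, …, y - 1` -/
def Cmd.forLt (x y : Var) (p : Cmd) : Cmd :=
  .asg x 0 ;; .loop true x y (p ;; .asg x (.v x + 1))

/-- Rule for counting loops; variables that the body does not assign keep their values. -/
theorem WP.forLt' {x y : Var} (n : ℕ) (Tb : ℕ → ℕ) (I : ℕ → HSt → Prop)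
    (hw : 1 < 2 ^ E.w) (hn : n < 2 ^ E.w) (hy : h.v y = n) (hxy : x ≠ y) (hx : x ∉ p.wr) (hyp : y ∉ p.wr)
    (h0 : I 0 (h.set x 0))
    (hI : ∀ i < n, ∀ h', I i h' → h'.v x = i → (∀ z, z ≠ x → z ∉ p.wr → h'.v z = h.v z) →
      (p.silent = true → h'.o = h.o) →
      WP E p h' (Tb i) fun h'' => I (i + 1) (h''.set x (i + 1)))
    (hQ : ∀ h', I n h' → h'.v x = n → (∀ z, z ≠ x → z ∉ p.wr → h'.v z = h.v z) →
      (p.silent = true → h'.o = h.o) → Q h') :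
    WP E (.forLt x y p) h ((∑ i ∈ Finset.range n, (Tb i + 7)) + 5) Q := by
  have hxy' : y ≠ x := Ne.symm hxy
  refine WP.time ?_ (WP.seqAsg 0 (by simp) (by simp) (WP.loop n (fun i => Tb i + 4) (fun i h' => I i h' ∧ h'.v x = i ∧
    (∀ z, z ≠ x → z ∉ p.wr → h'.v z = h.v z) ∧ (p.silent = true → h'.o = h.o))
    ⟨h0, by simp, fun z hz _ => by simp [hz], fun _ => rfl⟩ ?_ ?_ ?_))
  · simp [Finset.sum_add_distrib]; omega
  · intro i _ h' ⟨_, h2, h3, _⟩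
    refine ⟨trivial, trivial, ?_⟩
    simp [condHolds, h2, h3 y hxy' hyp, hy]
  · intro i hi h' ⟨h1, h2, h3, h4⟩
    refine WP.seq ?_
    refine (hI i hi h' h1 h2 h3 h4).framed.post ?_
    intro h'' ⟨k1, k2, k3⟩
    refine WP.asg (i + 1) (by simp) ?_ ⟨k1, by simp, ?_, ?_⟩
    · simp only [Ex.ev_add, Ex.ev_v, k2 x hx, h2, Ex.ev_ofNat, Nat.mod_eq_of_lt hw]
      exact Nat.mod_eq_of_lt (by omega)
    · intro z hz hz'
      simp [hz, k2 z hz', h3 z hz hz']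
    · intro hs
      simp [k3 hs, h4 hs]
  · intro h' ⟨h1, h2, h3, h4⟩
    exact hQ h' h1 h2 h3 h4

theorem WP.forLt {x y : Var} (n : ℕ) (Tb : ℕ) (I : ℕ → HSt → Prop)
    (hw : 1 < 2 ^ E.w) (hn : n < 2 ^ E.w) (hy : h.v y = n) (hxy : x ≠ y) (hx : x ∉ p.wr) (hyp : y ∉ p.wr)
    (h0 : I 0 (h.set x 0))
    (hI : ∀ i < n, ∀ h', I i h' → h'.v x = i → (∀ z, z ≠ x → z ∉ p.wr → h'.v z = h.v z) →
      (p.silent = true → h'.o = h.o) →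
      WP E p h' Tb fun h'' => I (i + 1) (h''.set x (i + 1)))
    (hQ : ∀ h', I n h' → h'.v x = n → (∀ z, z ≠ x → z ∉ p.wr → h'.v z = h.v z) →
      (p.silent = true → h'.o = h.o) → Q h') :
    WP E (.forLt x y p) h (n * (Tb + 7) + 5) Q := by
  have := WP.forLt' n (fun _ => Tb) I hw hn hy hxy hx hyp h0 hI hQ
  simpa using this

end WP

/-- From a verified structured program to an execution of its compilation. -/
theorem WP.runs {w S : ℕ} {inp : List ℕ} {c : Cmd} {T : ℕ} {T' : ℝ} {Q : HSt → Prop}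
    (hS : S ≤ 2 ^ w) (M : Mem w) (hT : (T : ℝ) ≤ T')
    (H : WP ⟨w, S, inp⟩ c ⟨fun _ => 0, fun a => (M (BitVec.ofNat w a)).toNat, []⟩ T Q) :
    ∃ (M' : Mem w) (out : List (BitVec w)) (h : HSt), Runs S T' c.comp inp M M' out ∧ Q h ∧
      (∀ a < 2 ^ w, (M' (BitVec.ofNat w a)).toNat = h.m a) ∧ out.map BitVec.toNat = h.o := by
  obtain ⟨τ, h', h1, h2, h3⟩ := H
  obtain ⟨σ', e, r⟩ := h2.comp_exec hS ⟨fun _ => 0, M, []⟩ ⟨fun _ => by simp, fun a _ => rfl, rfl⟩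
  exact ⟨σ'.mem, σ'.out, h', ⟨τ, σ', le_trans (by exact_mod_cast h1) hT, e, rfl, rfl⟩, h3, r.m, r.o⟩

end WordRAM

namespace WordRAM

/-! ### Packed arrays of characters -/

/-- A format for packed arrays: `2 ^ γ` characters of `m` bits per word, in fields of `2 ^ μ` bits. -/
structure Pack where
  γ : ℕ
  μ : ℕ
  m : ℕ

/-- The fields fit into words of `w` bits. -/
structure Pack.Fits (p : Pack) (w : ℕ) : Prop where
  field : p.m ≤ 2 ^ p.μ
  word : p.m ≤ w
  fits : p.γ = 0 ∨ 2 ^ (p.γ + p.μ) ≤ w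

/-- Character number `z` of the packed array that starts at address `b`. -/
def Pack.chr (p : Pack) (mem : ℕ → ℕ) (b z : ℕ) : ℕ :=
  mem (b + z / 2 ^ p.γ) / 2 ^ (z % 2 ^ p.γ * 2 ^ p.μ) % 2 ^ p.m

theorem Pack.chr_lt (p : Pack) (mem : ℕ → ℕ) (b z : ℕ) : p.chr mem b z < 2 ^ p.m :=
  Nat.mod_lt _ (by positivity)

theorem Pack.testBit_chr (p : Pack) (mem : ℕ → ℕ) (b z i : ℕ) :
    (p.chr mem b z).testBit i =
      (decide (i < p.m) && (mem (b + z / 2 ^ p.γ)).testBit (z % 2 ^ p.γ * 2 ^ p.μ + i)) := by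
  simp [Pack.chr, Nat.testBit_mod_two_pow, Nat.testBit_div_two_pow, add_comm]

/-- Address of the first word of block `ν` of `2 ^ e` characters. -/
def Pack.blk (p : Pack) (e ν : ℕ) : ℕ := ν * 2 ^ (e - p.γ) / 2 ^ (p.γ - e)

/-- Bit position of block `ν` of `2 ^ e` characters in its first word. -/
def Pack.pos (p : Pack) (e ν : ℕ) : ℕ := ν % 2 ^ (p.γ - e) * 2 ^ (min e p.γ + p.μ)

theorem Pack.block_div (p : Pack) (e ν y : ℕ) (hy : y < 2 ^ e) :
    (ν * 2 ^ e + y) / 2 ^ p.γ = p.blk e ν + y / 2 ^ p.γ := by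
  unfold Pack.blk
  rcases le_total p.γ e with h | h
  · obtain ⟨f, rfl⟩ := Nat.exists_eq_add_of_le h
    have : p.γ - (p.γ + f) = 0 := by omega
    rw [this, pow_zero, Nat.div_one, Nat.add_sub_cancel_left, pow_add, add_comm,
      show ν * (2 ^ p.γ * 2 ^ f) = 2 ^ p.γ * (ν * 2 ^ f) by ring,
      Nat.add_mul_div_left _ _ (by positivity), add_comm]
  · obtain ⟨f, hf⟩ := Nat.exists_eq_add_of_le h
    have h0 : y / 2 ^ p.γ = 0 := Nat.div_eq_of_lt (hy.trans_le (Nat.pow_le_pow_right two_pos h))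
    rw [h0, hf, Nat.add_sub_cancel_left, show e - (e + f) = 0 by omega, pow_zero, mul_one, pow_add,
      ← Nat.div_div_eq_div_mul, add_comm, Nat.add_mul_div_right _ _ (by positivity),
      Nat.div_eq_of_lt hy]
    simp

theorem Pack.block_mod (p : Pack) (e ν y : ℕ) (hy : y < 2 ^ e) :
    (ν * 2 ^ e + y) % 2 ^ p.γ * 2 ^ p.μ = p.pos e ν + y % 2 ^ p.γ * 2 ^ p.μ := by
  unfold Pack.pos
  rcases le_total p.γ e with h | h
  · obtain ⟨f, rfl⟩ := Nat.exists_eq_add_of_le h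
    have : p.γ - (p.γ + f) = 0 := by omega
    rw [this, pow_zero, Nat.mod_one, zero_mul, zero_add, pow_add,
      show ν * (2 ^ p.γ * 2 ^ f) = 2 ^ p.γ * (ν * 2 ^ f) by ring, Nat.mul_add_mod]
  · obtain ⟨f, hf⟩ := Nat.exists_eq_add_of_le h
    have h0 : y % 2 ^ p.γ = y := Nat.mod_eq_of_lt (hy.trans_le (Nat.pow_le_pow_right two_pos h))
    have h1 : (ν * 2 ^ e + y) % 2 ^ e = y := by
      rw [Nat.mul_add_mod_self_right, Nat.mod_eq_of_lt hy]
    have h2 : (ν * 2 ^ e + y) / 2 ^ e = ν := by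
      rw [add_comm, Nat.add_mul_div_right _ _ (by positivity), Nat.div_eq_of_lt hy, zero_add]
    rw [h0, min_eq_left h, hf, Nat.add_sub_cancel_left, pow_add, Nat.mod_mul, h1, h2, pow_add]
    ring

theorem testBit_mask {w k i : ℕ} : (2 ^ (min w k) - 1).testBit i = (decide (i < w) && decide (i < k)) := by
  simp [Nat.testBit_two_pow_sub_one, lt_min_iff]


/-- Adding a block of one array to a block of another array, word by word. -/
theorem Pack.chr_xor {p : Pack} {w : ℕ} (hp : p.Fits w) {e e' : ℕ} (he : e ≤ e')
    {mem mem' : ℕ → ℕ} {D B ν κ : ℕ}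
    (hm : ∀ a, mem' a = if D + p.blk e ν ≤ a ∧ a < D + p.blk e ν + 2 ^ (e - p.γ) then
      mem a ^^^ ((((mem (B + p.blk e' κ + (a - (D + p.blk e ν)))) / 2 ^ p.pos e' κ) &&&
        (2 ^ (min w (2 ^ (min e p.γ + p.μ))) - 1)) * 2 ^ p.pos e ν) % 2 ^ w else mem a) (z : ℕ) :
    p.chr mem' D z = if z / 2 ^ e = ν then
      p.chr mem D z ^^^ p.chr mem B (κ * 2 ^ e' + z % 2 ^ e) else p.chr mem D z := by
  obtain ⟨ξ, y, hy, rfl⟩ : ∃ ξ y, y < 2 ^ e ∧ z = ξ * 2 ^ e + y :=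
    ⟨z / 2 ^ e, z % 2 ^ e, Nat.mod_lt _ (by positivity), (Nat.div_add_mod' _ _).symm⟩
  have hd : (ξ * 2 ^ e + y) / 2 ^ e = ξ := by
    rw [add_comm, Nat.add_mul_div_right _ _ (by positivity), Nat.div_eq_of_lt hy, zero_add]
  have hmo : (ξ * 2 ^ e + y) % 2 ^ e = y := by
    rw [Nat.mul_add_mod_self_right, Nat.mod_eq_of_lt hy]
  rw [hd, hmo]
  have hY0 := Nat.zero_le (y / 2 ^ p.γ)
  have hy' : y < 2 ^ e' := hy.trans_le (Nat.pow_le_pow_right two_pos he)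
  have hyw : y / 2 ^ p.γ < 2 ^ (e - p.γ) := by
    rw [Nat.div_lt_iff_lt_mul (by positivity), ← pow_add]
    exact hy.trans_le (Nat.pow_le_pow_right two_pos (by omega))
  have hyg : y % 2 ^ p.γ < 2 ^ min e p.γ := by
    rcases le_total e p.γ with h | h
    · rw [min_eq_left h]; exact (Nat.mod_le _ _).trans_lt hy
    · rw [min_eq_right h]; exact Nat.mod_lt _ (by positivity)
  have hpos : p.pos e ν + 2 ^ (min e p.γ + p.μ) ≤ w ∨ p.γ = 0 := by
    rcases hp.fits with h | h
    · exact Or.inr h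
    · left
      refine le_trans ?_ h
      unfold Pack.pos
      have : ν % 2 ^ (p.γ - e) + 1 ≤ 2 ^ (p.γ - e) := Nat.mod_lt _ (by positivity)
      calc ν % 2 ^ (p.γ - e) * 2 ^ (min e p.γ + p.μ) + 2 ^ (min e p.γ + p.μ)
          = (ν % 2 ^ (p.γ - e) + 1) * 2 ^ (min e p.γ + p.μ) := by ring
        _ ≤ 2 ^ (p.γ - e) * 2 ^ (min e p.γ + p.μ) := Nat.mul_le_mul_right _ this
        _ = 2 ^ (p.γ + p.μ) := by rw [← pow_add]; congr 1; omega
  have fld : ∀ b < p.m, y % 2 ^ p.γ * 2 ^ p.μ + b < 2 ^ (min e p.γ + p.μ) := by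
    intro b hb
    have := hp.field
    calc y % 2 ^ p.γ * 2 ^ p.μ + b < y % 2 ^ p.γ * 2 ^ p.μ + 2 ^ p.μ := by omega
      _ = (y % 2 ^ p.γ + 1) * 2 ^ p.μ := by ring
      _ ≤ 2 ^ min e p.γ * 2 ^ p.μ := Nat.mul_le_mul_right _ hyg
      _ = _ := by rw [← pow_add]
  apply Nat.eq_of_testBit_eq
  intro b
  by_cases hb : b < p.m
  swap
  · have : p.m ≤ b := by omega
    split_ifs <;> simp [Pack.testBit_chr, hb]
  have hbw : p.pos e ν + (y % 2 ^ p.γ * 2 ^ p.μ + b) < w := by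
    rcases hpos with h | h
    · have := fld b hb; omega
    · have h1 := hp.word
      have : p.pos e ν = 0 := by simp [Pack.pos, h, Nat.mod_one]
      rw [this, h]; simp [Nat.mod_one]; omega
  split_ifs with hξ
  · subst hξ
    rw [Nat.testBit_xor, p.testBit_chr, p.testBit_chr, p.testBit_chr, hm, if_pos]
    · rw [p.block_div e _ y hy, p.block_mod e _ y hy, p.block_div e' _ y hy', p.block_mod e' _ y hy']
      have e1 : D + (p.blk e ξ + y / 2 ^ p.γ) - (D + p.blk e ξ) = y / 2 ^ p.γ := by omega
      rw [e1, ← Nat.shiftLeft_eq (_ &&& _)]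
      have h3 := fld b hb
      have e2 : p.pos e ξ + y % 2 ^ p.γ * 2 ^ p.μ + b - p.pos e ξ = y % 2 ^ p.γ * 2 ^ p.μ + b := by
        omega
      have e3 : p.pos e ξ + y % 2 ^ p.γ * 2 ^ p.μ + b < w := by omega
      have e4 : y % 2 ^ p.γ * 2 ^ p.μ + b < w := by omega
      have e5 : p.pos e ξ ≤ p.pos e ξ + y % 2 ^ p.γ * 2 ^ p.μ + b := by omega
      simp only [hb, decide_true, Bool.true_and, Nat.testBit_xor, Nat.testBit_mod_two_pow, e3,
        Nat.testBit_shiftLeft, e2, Nat.testBit_and, testBit_mask, h3, e4, e5, Bool.and_true,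
        Nat.testBit_div_two_pow, ge_iff_le]
      rw [← add_assoc B, show y % 2 ^ p.γ * 2 ^ p.μ + b + p.pos e' κ =
        p.pos e' κ + y % 2 ^ p.γ * 2 ^ p.μ + b by ring]
    · rw [p.block_div e _ y hy]; omega
  · rw [p.testBit_chr, p.testBit_chr, hm]
    split_ifs with hr
    swap
    · rfl
    rw [p.block_div e _ y hy, p.block_mod e _ y hy] at *
    have hlt : e < p.γ := by
      by_contra hge
      push Not at hge
      have e0 : p.γ - e = 0 := by omega
      simp only [Pack.blk, e0, pow_zero, Nat.div_one] at hr
      apply hξ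
      have h1 : ν * 2 ^ (e - p.γ) ≤ ξ * 2 ^ (e - p.γ) + y / 2 ^ p.γ := by omega
      have h2 : ξ * 2 ^ (e - p.γ) + y / 2 ^ p.γ < (ν + 1) * 2 ^ (e - p.γ) := by
        rw [add_mul]; omega
      have h3 : ξ < ν + 1 := by
        by_contra h; push Not at h
        have := Nat.mul_le_mul_right (2 ^ (e - p.γ)) h
        omega
      have h4 : ν < ξ + 1 := by
        by_contra h; push Not at h
        have := Nat.mul_le_mul_right (2 ^ (e - p.γ)) h
        rw [add_mul] at this
        omega
      omega
    have e0 : e - p.γ = 0 := by omega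
    have hy0 : y / 2 ^ p.γ = 0 := by rw [e0, pow_zero] at hyw; omega
    have hblk : p.blk e ξ = p.blk e ν := by
      rw [e0] at hr; omega
    have hne : p.pos e ξ ≠ p.pos e ν := by
      intro h
      apply hξ
      unfold Pack.pos at h
      unfold Pack.blk at hblk
      have h1 := Nat.eq_of_mul_eq_mul_right (by positivity) h
      simp only [e0, pow_zero, mul_one] at hblk
      rw [← Nat.div_add_mod ξ (2 ^ (p.γ - e)), ← Nat.div_add_mod ν (2 ^ (p.γ - e)), h1, hblk]
    have h3 := fld b hb
    have hbits : ∀ t, ((t &&& (2 ^ (min w (2 ^ (min e p.γ + p.μ))) - 1)) * 2 ^ p.pos e ν % 2 ^ w).testBit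
        (p.pos e ξ + y % 2 ^ p.γ * 2 ^ p.μ + b) = false := by
      intro t
      rw [← Nat.shiftLeft_eq (_ &&& _)]
      simp only [Nat.testBit_mod_two_pow, Nat.testBit_shiftLeft, Nat.testBit_and, testBit_mask]
      rcases Nat.lt_or_gt_of_ne hne with h | h
      · have h4 : p.pos e ξ + 2 ^ (min e p.γ + p.μ) ≤ p.pos e ν := by
          unfold Pack.pos at h ⊢
          have := lt_of_mul_lt_mul_right h (Nat.zero_le _)
          calc _ = (ξ % 2 ^ (p.γ - e) + 1) * 2 ^ (min e p.γ + p.μ) := by ring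
            _ ≤ _ := Nat.mul_le_mul_right _ this
        have : ¬ (p.pos e ν ≤ p.pos e ξ + y % 2 ^ p.γ * 2 ^ p.μ + b) := by omega
        simp [this]
      · have h4 : p.pos e ν + 2 ^ (min e p.γ + p.μ) ≤ p.pos e ξ := by
          unfold Pack.pos at h ⊢
          have := lt_of_mul_lt_mul_right h (Nat.zero_le _)
          calc _ = (ν % 2 ^ (p.γ - e) + 1) * 2 ^ (min e p.γ + p.μ) := by ring
            _ ≤ _ := Nat.mul_le_mul_right _ this
        have : ¬ (p.pos e ξ + y % 2 ^ p.γ * 2 ^ p.μ + b - p.pos e ν < 2 ^ (min e p.γ + p.μ)) := by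
          omega
        simp [this]
    rw [Nat.testBit_xor, hbits]
    simp

theorem Pack.chr_congr (p : Pack) {mem mem' : ℕ → ℕ} {b z : ℕ}
    (h : mem' (b + z / 2 ^ p.γ) = mem (b + z / 2 ^ p.γ)) : p.chr mem' b z = p.chr mem b z := by
  simp [Pack.chr, h]

/-- Adding a value to a single character. -/
theorem Pack.chr_update {p : Pack} {w : ℕ} (hp : p.Fits w) {mem : ℕ → ℕ} {D z c : ℕ} (hc : c < 2 ^ p.m)
    (z' : ℕ) :
    p.chr (Function.update mem (D + z / 2 ^ p.γ) (mem (D + z / 2 ^ p.γ) ^^^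
      (c * 2 ^ (z % 2 ^ p.γ * 2 ^ p.μ) % 2 ^ w))) D z' =
    if z' = z then p.chr mem D z ^^^ c else p.chr mem D z' := by
  apply Nat.eq_of_testBit_eq
  intro b
  by_cases hb : b < p.m
  swap
  · have h1 : c.testBit b = false := Nat.testBit_lt_two_pow (hc.trans_le
      (Nat.pow_le_pow_right two_pos (by omega)))
    split_ifs <;> simp [Pack.testBit_chr, hb, h1]
  have hbw : z % 2 ^ p.γ * 2 ^ p.μ + b < w := by
    rcases hp.fits with h | h
    · have h1 := hp.word
      rw [h]; simp [Nat.mod_one]; omega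
    · refine lt_of_lt_of_le ?_ h
      have h1 := hp.field
      have h2 : z % 2 ^ p.γ + 1 ≤ 2 ^ p.γ := Nat.mod_lt _ (by positivity)
      calc z % 2 ^ p.γ * 2 ^ p.μ + b < z % 2 ^ p.γ * 2 ^ p.μ + 2 ^ p.μ := by omega
      _ = (z % 2 ^ p.γ + 1) * 2 ^ p.μ := by ring
      _ ≤ 2 ^ p.γ * 2 ^ p.μ := Nat.mul_le_mul_right _ h2
      _ = _ := by rw [← pow_add]
  have hfm := hp.field
  split_ifs with hz
  · subst hz
    rw [Nat.testBit_xor, p.testBit_chr, p.testBit_chr, Function.update_self, Nat.testBit_xor,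
      ← Nat.shiftLeft_eq c]
    simp [hb, Nat.testBit_mod_two_pow, hbw]
  · rw [p.testBit_chr, p.testBit_chr, Function.update_apply]
    split_ifs with h
    · have h1 : z' / 2 ^ p.γ = z / 2 ^ p.γ := by omega
      have h2 : z' % 2 ^ p.γ ≠ z % 2 ^ p.γ := by
        intro h2
        exact hz (by rw [← Nat.div_add_mod z' (2 ^ p.γ), ← Nat.div_add_mod z (2 ^ p.γ), h1, h2])
      rw [← h, Nat.testBit_xor, ← Nat.shiftLeft_eq c]
      have : ((c <<< (z % 2 ^ p.γ * 2 ^ p.μ)) % 2 ^ w).testBit (z' % 2 ^ p.γ * 2 ^ p.μ + b) = false := by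
        simp only [Nat.testBit_mod_two_pow, Nat.testBit_shiftLeft]
        rcases Nat.lt_or_gt_of_ne h2 with h3 | h3
        · have h4 : (z' % 2 ^ p.γ + 1) * 2 ^ p.μ ≤ z % 2 ^ p.γ * 2 ^ p.μ := Nat.mul_le_mul_right _ h3
          have : ¬ (z % 2 ^ p.γ * 2 ^ p.μ ≤ z' % 2 ^ p.γ * 2 ^ p.μ + b) := by
            rw [add_mul] at h4; omega
          simp [this]
        · have h4 : (z % 2 ^ p.γ + 1) * 2 ^ p.μ ≤ z' % 2 ^ p.γ * 2 ^ p.μ := Nat.mul_le_mul_right _ h3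
          have : c.testBit (z' % 2 ^ p.γ * 2 ^ p.μ + b - z % 2 ^ p.γ * 2 ^ p.μ) = false := by
            apply Nat.testBit_lt_two_pow
            refine hc.trans_le (Nat.pow_le_pow_right two_pos ?_)
            rw [add_mul] at h4; omega
          simp [this]
      rw [this]; simp
    · rfl

/-- Adding up values bitwise. -/
def xorSum (t : ℕ → ℕ) : ℕ → ℕ
  | 0 => 0
  | d + 1 => xorSum t d ^^^ t d

theorem xorSum_congr {t t' : ℕ → ℕ} {d : ℕ} (h : ∀ i < d, t i = t' i) : xorSum t d = xorSum t' d := by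
  induction d with
  | zero => rfl
  | succ d ih => simp [xorSum, ih fun i hi => h i (by omega), h d (by omega)]

theorem xorSum_xor (t t' : ℕ → ℕ) (d : ℕ) :
    xorSum (fun i => t i ^^^ t' i) d = xorSum t d ^^^ xorSum t' d := by
  induction d with
  | zero => simp [xorSum]
  | succ d ih =>
    simp only [xorSum, ih]
    ac_rfl

theorem xorSum_lt {t : ℕ → ℕ} {d m : ℕ} (h : ∀ i < d, t i < 2 ^ m) : xorSum t d < 2 ^ m := by
  induction d with
  | zero => simp [xorSum]
  | succ d ih => exact Nat.xor_lt_two_pow (ih fun i hi => h i (by omega)) (h d (by omega))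

end WordRAM

namespace WordRAM

/-! ### The recursive construction -/

/-- Parameters of the construction: `2 ^ l` characters of `n` bits, sets of `2 ^ κ` keys. -/
structure Par where
  (l n κ γ μ δ Q σ : ℕ)

namespace Par
variable (p : Par)

/-- chunk length -/
def h : ℕ := (p.n + 1) / 2
/-- character length -/
def m : ℕ := p.n + p.κ + 4
/-- character length in the evaluation of pairs -/
def pm : ℕ := p.κ + p.h + 4
/-- index length -/
def ib : ℕ := p.pm + p.h
/-- logarithm of the number of characters of a table entry -/
def E : ℕ := p.l + 3 + p.δ
/-- logarithm of the number of table entries -/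
def NE : ℕ := p.l + p.σ + 1 + p.δ + p.ib
/-- logarithm of the number of characters of the table -/
def Z : ℕ := p.NE + p.E
/-- the format of all arrays -/
def pack : Pack := ⟨p.γ, p.μ, p.m⟩
/-- number of words of a buffer -/
def bw : ℕ := 2 ^ (p.E - p.γ)
/-- address of buffer number `i` -/
def buf (i : ℕ) : ℕ := 32 + i * p.bw
/-- address of the table -/
def tb : ℕ := p.buf 4
/-- number of words of the table -/
def tw : ℕ := 2 ^ (p.Z - p.γ)

variable (tab : ℕ → ℕ)

/-- The table entry of an index. -/
def entry (J g i : ℕ) : ℕ := (J * 2 ^ p.δ + g) * 2 ^ p.ib + i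

/-- Simple tabulation of `2 ^ δ` characters, each combined with the chunk `k`, in table row `J`. -/
def stageF (J : ℕ) (c : ℕ → ℕ) (k y : ℕ) : ℕ :=
  xorSum (fun g => tab (p.entry J g (c g * 2 ^ p.h + k) * 2 ^ p.E + y)) (2 ^ p.δ)

/-- Processing a pair of characters chunk by chunk. -/
def pairSt (a b : ℕ) : ℕ → (ℕ → ℕ) × ℕ × ℕ
  | 0 => (fun _ => 0, a, b)
  | s + 1 => (p.stageF tab s (fun g => (pairSt a b s).1 g % 2 ^ p.pm) ((pairSt a b s).2.1 % 2 ^ p.h),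
      (pairSt a b s).2.2, (pairSt a b s).2.1 / 2 ^ p.h)

theorem stageF_congr {p : Par} {tab c c' : ℕ → ℕ} (h : ∀ g < 2 ^ p.δ, c g = c' g) (J k y : ℕ) :
    p.stageF tab J c k y = p.stageF tab J c' k y := xorSum_congr fun g hg => by rw [h g hg]

/-- The hash characters of a pair. -/
def pairF (a b g : ℕ) : ℕ := (p.pairSt tab a b p.Q).1 g % 2 ^ p.pm

/-- Combining the characters of two halves of a key. -/
def levelF (i : ℕ) (α β : ℕ → ℕ) (y : ℕ) : ℕ :=
  xorSum (fun j => p.stageF tab (2 ^ (i + 1 + p.σ) + j) (p.pairF tab (α j) (β j)) 0 y) (2 ^ (i + 3))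

/-- The function on keys of `2 ^ i` characters. -/
def lev : ℕ → (ℕ → ℕ) → ℕ → ℕ
  | 0, x => fun _ => x 0
  | i + 1, x => p.levelF tab i (lev i x) (lev i fun c => x (2 ^ i + c))

end Par

/-! ### The program for the recursive construction -/

/-- The parameters fit the environment. -/
structure Par.Ok (p : Par) (E : Env) : Prop where
  fits : p.pack.Fits E.w
  idx : p.NE < E.w
  sh : 2 ^ (p.γ + p.μ) < 2 ^ E.w
  shl : p.γ + p.μ < 2 ^ E.w
  lw : p.E + p.σ + 8 < E.w
  top : p.tb + p.tw ≤ E.S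
  S : E.S ≤ 2 ^ E.w
  hn : 0 < p.n
  hσ : 2 ≤ p.σ
  hQ : p.Q ≤ 2 ^ (p.σ + 1)

theorem Par.Ok.lit {p : Par} {E : Env} (hp : p.Ok E) {n : ℕ} (hn : n ≤ 255) : n % 2 ^ E.w = n := by
  apply Nat.mod_eq_of_lt
  have := hp.lw
  exact lt_of_lt_of_le (by omega) (Nat.pow_le_pow_right two_pos (show 8 ≤ E.w by omega))

/-- The mask of a block of `2 ^ e` characters. -/
def Par.mask (p : Par) (E : Env) (e : ℕ) : ℕ := 2 ^ (min E.w (2 ^ (min e p.γ + p.μ))) - 1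

/-- The variables that hold the parameters. -/
structure Core (p : Par) (E : Env) (s : HSt) : Prop where
  l : s.v .l = p.l
  ga : s.v .ga = p.γ
  mu : s.v .mu = p.μ
  h : s.v .h = p.h
  ib : s.v .ib = p.ib
  eA : s.v .eA = p.E - p.γ
  eB : s.v .eB = p.γ - p.E
  es : s.v .es = min p.E p.γ + p.μ
  gm : s.v .gm = 2 ^ p.γ - 1
  hm : s.v .hm = 2 ^ p.h - 1
  mm : s.v .mm = 2 ^ p.m - 1
  pm : s.v .pm = 2 ^ p.pm - 1
  bm : s.v .bm = 2 ^ (p.γ - p.E) - 1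
  bw : s.v .bw = p.bw
  tb : s.v .tb = p.tb
  pct : s.v .pct = 2 ^ (p.δ - p.γ)
  pdm : s.v .pdm = p.mask E p.δ
  lim : s.v .lim = 2 ^ p.δ
  dl : s.v .dl = p.δ
  sg : s.v .sg = p.σ
  nq : s.v .nq = p.Q

def coreVars : List Var :=
  [.l, .ga, .mu, .h, .ib, .eA, .eB, .es, .gm, .hm, .mm, .pm, .bm, .bw, .tb, .pct, .pdm, .lim, .dl, .sg, .nq]

theorem Core.congr {p : Par} {E : Env} {h h' : HSt} (c : Core p E h)
    (hh : ∀ x ∈ coreVars, h'.v x = h.v x) : Core p E h' := by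
  simp only [coreVars, List.forall_mem_cons, List.not_mem_nil, false_imp_iff, implies_true,
    and_true] at hh
  obtain ⟨h1, h2, h3, h4, h5, h6, h7, h8, h9, h10, h11, h12, h13, h14, h15, h16, h17, h18, h19, h20, h21⟩ := hh
  exact ⟨h1.trans c.1, h2.trans c.2, h3.trans c.3, h4.trans c.4, h5.trans c.5, h6.trans c.6,
    h7.trans c.7, h8.trans c.8, h9.trans c.9, h10.trans c.10, h11.trans c.11, h12.trans c.12,
    h13.trans c.13, h14.trans c.14, h15.trans c.15, h16.trans c.16, h17.trans c.17, h18.trans c.18,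
    h19.trans c.19, h20.trans c.20, h21.trans c.21⟩

/-- Set `ct` words, starting at the address in `b`, to zero. -/
def zeroC (b ct : Var) : Cmd := .forLt .q ct (.st (.v b + .v .q) 0)

theorem zeroC_wp {p : Par} {E : Env} (hp : p.Ok E) {h : HSt} {b ct : Var} {B N : ℕ} (hb : h.v b = B)
    (hct : h.v ct = N) (hN : B + N ≤ E.S) (h1 : b ≠ .q) (h2 : ct ≠ .q) (hN1 : N < 2 ^ E.w) :
    WP E (zeroC b ct) h (N * 12 + 5) fun h' =>
      ∀ a, h'.m a = if B ≤ a ∧ a < B + N then 0 else h.m a := by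
  have hS := hp.S
  refine WP.forLt N 5 (fun i h' => ∀ a, h'.m a = if B ≤ a ∧ a < B + i then 0 else h.m a)
    (by have := hp.lit (n := 1) (by norm_num); by_contra hh; interval_cases 2 ^ E.w <;> omega) hN1 hct h2.symm (by simp [Cmd.wr]) (by simp [Cmd.wr]) ?_ ?_ ?_
  · intro a; simp
  · intro i hi h' hI hq hf _
    have hb' : h'.v b = B := by rw [hf b h1 (by simp [Cmd.wr]), hb]
    refine WP.time ?_ (WP.st (B + i) 0 (by simp) (by simp) ?_ (by omega) (by simp) ?_)
    · simp
    · simp [hb', hq, Nat.mod_eq_of_lt (show B + i < 2 ^ E.w by omega)]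
    · intro a
      simp only [HSt.set_m, HSt.put_m, Function.update_apply, hI]
      split_ifs <;> first | rfl | omega
  · intro h' hI _ _ _
    exact hI

/-- Add the `ct` words at `sa`, shifted and masked, to the words at `da`. -/
def xorC : Cmd := .forLt .q .ct (.st (.v .da + .v .q)
  (.ld (.v .da + .v .q) ^^^ ((((.ld (.v .sa + .v .q)) >>> .v .sp) &&& .v .dm) <<< .v .dp)))

theorem xorC_wp {p : Par} {E : Env} (hp : p.Ok E) {h : HSt} {DA SA N SP DM DP : ℕ} (h1 : h.v .da = DA)
    (h2 : h.v .sa = SA) (h3 : h.v .ct = N) (h4 : h.v .sp = SP) (h5 : h.v .dm = DM) (h6 : h.v .dp = DP)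
    (hD : DA + N ≤ E.S) (hA : SA + N ≤ E.S) (hd : SA + N ≤ DA ∨ DA + N ≤ SA) (hN : N < 2 ^ E.w) :
    WP E xorC h (N * 26 + 5) fun h' =>
      ∀ a, h'.m a = if DA ≤ a ∧ a < DA + N then
        h.m a ^^^ (((h.m (SA + (a - DA)) / 2 ^ SP) &&& DM) * 2 ^ DP) % 2 ^ E.w else h.m a := by
  have hS := hp.S
  refine WP.forLt N 19 (fun i h' => ∀ a, h'.m a = if DA ≤ a ∧ a < DA + i then
        h.m a ^^^ (((h.m (SA + (a - DA)) / 2 ^ SP) &&& DM) * 2 ^ DP) % 2 ^ E.w else h.m a)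
    (by have := hp.lit (n := 1) (by norm_num); by_contra hh; interval_cases 2 ^ E.w <;> omega) hN
    h3 (by decide) (by decide) (by decide) ?_ ?_ ?_
  · intro a; simp
  · intro i hi h' hI hq hf _
    have g1 : h'.v .da = DA := by rw [hf _ (by decide) (by decide), h1]
    have g2 : h'.v .sa = SA := by rw [hf _ (by decide) (by decide), h2]
    have g4 : h'.v .sp = SP := by rw [hf _ (by decide) (by decide), h4]
    have g5 : h'.v .dm = DM := by rw [hf _ (by decide) (by decide), h5]
    have g6 : h'.v .dp = DP := by rw [hf _ (by decide) (by decide), h6]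
    have e1 : (DA + i) % 2 ^ E.w = DA + i := Nat.mod_eq_of_lt (by omega)
    have e2 : (SA + i) % 2 ^ E.w = SA + i := Nat.mod_eq_of_lt (by omega)
    have m1 : h'.m (DA + i) = h.m (DA + i) := by rw [hI, if_neg (by omega)]
    have m2 : h'.m (SA + i) = h.m (SA + i) := by rw [hI, if_neg (by omega)]
    refine WP.time ?_ (WP.st (DA + i) (h.m (DA + i) ^^^ (((h.m (SA + i) / 2 ^ SP) &&& DM) * 2 ^ DP) % 2 ^ E.w)
      (by simp) ?_ ?_ (by omega) ?_ ?_)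
    · simp
    · simp [g1, hq, g2, e1, e2]; omega
    · simp [g1, hq, e1]
    · simp [g1, hq, g2, e1, e2, g4, g5, g6, m1, m2]
    · intro a
      simp only [HSt.set_m, HSt.put_m, Function.update_apply, hI]
      by_cases ha : a = DA + i
      · subst ha; simp
      · rw [if_neg ha]
        by_cases hb : DA ≤ a ∧ a < DA + i
        · rw [if_pos hb, if_pos (by omega)]
        · rw [if_neg hb, if_neg (by omega)]
  · intro h' hI _ _ _
    exact hI

/-- Character number `z` of the array at `b`. -/
def chrE (b ga gm mu mask : Var) (z : Ex) : Ex :=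
  ((.ld (.v b + (z >>> .v ga))) >>> ((z &&& .v gm) <<< .v mu)) &&& .v mask

theorem chrE_ev {pk : Pack} {E : Env} {h : HSt} (hp : pk.Fits E.w) {b ga gm mu mask : Var} {z : Ex} {B z' k : ℕ}
    (hw : E.w < 2 ^ E.w)
    (hb : h.v b = B) (hga : h.v ga = pk.γ) (hgm : h.v gm = 2 ^ pk.γ - 1) (hmu : h.v mu = pk.μ)
    (hmask : h.v mask = 2 ^ k - 1) (hk : k ≤ pk.m) (hz : z.ev E h = z') (hS : B + z' / 2 ^ pk.γ < 2 ^ E.w) :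
    (chrE b ga gm mu mask z).ev E h = pk.chr h.m B z' % 2 ^ k := by
  have e1 : z' % 2 ^ pk.γ * 2 ^ pk.μ < 2 ^ E.w := by
    rcases hp.fits with hh | hh
    · rw [hh]; simp [Nat.mod_one]
    · refine lt_of_lt_of_le (lt_of_lt_of_le ?_ hh) hw.le
      rw [pow_add]
      exact Nat.mul_lt_mul_of_pos_right (Nat.mod_lt _ (by positivity)) (by positivity)
  simp only [chrE, Ex.ev_and, Ex.ev_shr, Ex.ev_ld, Ex.ev_add, Ex.ev_v, hb, hz, hga, Ex.ev_shl, hgm, hmu,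
    Nat.and_two_pow_sub_one_eq_mod, hmask, Nat.mod_eq_of_lt hS, Nat.mod_eq_of_lt e1, Pack.chr]
  rw [Nat.mod_mod_of_dvd _ (pow_dvd_pow 2 hk)]

theorem chrE_ok {pk : Pack} {E : Env} {h : HSt} {b ga gm mu mask : Var} {z : Ex} {B z' : ℕ}
    (hb : h.v b = B) (hga : h.v ga = pk.γ) (hzo : z.ok E h) (hz : z.ev E h = z') (hS : B + z' / 2 ^ pk.γ < E.S)
    (hSw : E.S ≤ 2 ^ E.w) : (chrE b ga gm mu mask z).ok E h := by
  simp [chrE, hzo, hz, hb, hga, Nat.mod_eq_of_lt (lt_of_lt_of_le hS hSw), hS]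

end WordRAM

namespace WordRAM

theorem Pack.blk_add_le (p : Pack) {e N y : ℕ} (hy : y < 2 ^ N) :
    p.blk e y + 2 ^ (e - p.γ) ≤ 2 ^ (N + e - p.γ) := by
  unfold Pack.blk
  rcases le_total p.γ e with h | h
  · rw [show p.γ - e = 0 by omega, pow_zero, Nat.div_one, show N + e - p.γ = N + (e - p.γ) by omega,
      pow_add, ← Nat.succ_mul]
    exact Nat.mul_le_mul_right _ hy
  · rw [show e - p.γ = 0 by omega, pow_zero, mul_one, Nat.add_one_le_iff]
    rw [Nat.div_lt_iff_lt_mul (by positivity), ← pow_add]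
    exact hy.trans_le (Nat.pow_le_pow_right two_pos (by omega))

theorem Par.entry_lt (p : Par) {J g i : ℕ} (hJ : J < 2 ^ (p.l + p.σ + 1)) (hg : g < 2 ^ p.δ)
    (hi : i < 2 ^ p.ib) : p.entry J g i < 2 ^ p.NE := by
  have h1 : J * 2 ^ p.δ + g < 2 ^ (p.l + p.σ + 1 + p.δ) := by
    calc J * 2 ^ p.δ + g < (J + 1) * 2 ^ p.δ := by rw [add_mul]; omega
      _ ≤ 2 ^ (p.l + p.σ + 1) * 2 ^ p.δ := Nat.mul_le_mul_right _ hJ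
      _ = _ := by rw [← pow_add]
  calc p.entry J g i < (J * 2 ^ p.δ + g + 1) * 2 ^ p.ib := by unfold entry; rw [add_mul _ 1]; omega
    _ ≤ 2 ^ (p.l + p.σ + 1 + p.δ) * 2 ^ p.ib := Nat.mul_le_mul_right _ h1
    _ = _ := by rw [← pow_add]; rfl

theorem Par.idx_lt (p : Par) {c k : ℕ} (hc : c < 2 ^ p.pm) (hk : k < 2 ^ p.h) :
    c * 2 ^ p.h + k < 2 ^ p.ib := by
  calc c * 2 ^ p.h + k < (c + 1) * 2 ^ p.h := by rw [add_mul]; omega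
    _ ≤ 2 ^ p.pm * 2 ^ p.h := Nat.mul_le_mul_right _ hc
    _ = _ := by rw [← pow_add]; rfl

/-- The table in memory. -/
def Par.TabOk (p : Par) (tab mem : ℕ → ℕ) : Prop := ∀ z < 2 ^ p.Z, p.pack.chr mem p.tb z = tab z

theorem Par.TabOk.congr {p : Par} {tab mem mem' : ℕ → ℕ} (h : p.TabOk tab mem)
    (hm : ∀ a, p.tb ≤ a → mem' a = mem a) : p.TabOk tab mem' := fun z hz => by
  rw [Pack.chr_congr _ (hm _ (Nat.le_add_right _ _)), h z hz]

theorem Par.E_le (p : Par) (hn : 0 < p.n) : p.pm ≤ p.m := by unfold pm m h; omega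

/-- A block of an array as the target of additions. -/
structure Dest (p : Par) (E : Env) (s : HSt) (D e ν : ℕ) : Prop where
  da : s.v .da = D + p.pack.blk e ν
  dp : s.v .dp = p.pack.pos e ν
  dm : s.v .dm = p.mask E e
  ct : s.v .ct = 2 ^ (e - p.γ)
  he : ∃ N, ν < 2 ^ N ∧ N + e ≤ p.E

/-- One step of simple tabulation. -/
def stageC : Cmd := .forLt .g .lim (
  .c ::= chrE .pc .ga .gm .mu .pm (Ex.v .g) ;;
  .y ::= (((Ex.v .row <<< Ex.v .dl) + Ex.v .g) <<< Ex.v .ib) + ((Ex.v .c <<< Ex.v .h) + Ex.v .ch) ;;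
  .sa ::= Ex.v .tb + ((Ex.v .y <<< Ex.v .eA) >>> Ex.v .eB) ;;
  .sp ::= (Ex.v .y &&& Ex.v .bm) <<< Ex.v .es ;;
  xorC)

theorem Par.Ok.one_lt {p : Par} {E : Env} (hp : p.Ok E) : 1 < 2 ^ E.w := by
  have := hp.lw
  exact Nat.one_lt_two_pow (by omega)

theorem Par.chr_addr (p : Par) {z e : ℕ} (hz : z < 2 ^ e) (he : e ≤ p.E) : z / 2 ^ p.γ < p.bw := by
  unfold bw
  rw [Nat.div_lt_iff_lt_mul (by positivity), ← pow_add]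
  exact hz.trans_le (Nat.pow_le_pow_right two_pos (by omega))

theorem stageC_wp {p : Par} {E : Env} (hp : p.Ok E) (hn : 0 < p.n) {h : HSt} (hc : Core p E h)
    {tab : ℕ → ℕ} (ht : p.TabOk tab h.m) {J k PC D e ν : ℕ} (hrow : h.v .row = J)
    (hJ : J < 2 ^ (p.l + p.σ + 1)) (hch : h.v .ch = k) (hk : k < 2 ^ p.h) (hpc : h.v .pc = PC)
    (hd : Dest p E h D e ν) (hD : D + p.bw ≤ p.tb) (hPC : PC + p.bw ≤ p.tb)
    (hdis : PC + p.bw ≤ D ∨ D + p.bw ≤ PC) :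
    WP E stageC h (2 ^ p.δ * (26 * 2 ^ (e - p.γ) + 60) + 5) fun h' =>
      (∀ z, p.pack.chr h'.m D z = if z / 2 ^ e = ν then p.pack.chr h.m D z ^^^
        p.stageF tab J (fun g => p.pack.chr h.m PC g % 2 ^ p.pm) k (z % 2 ^ e)
        else p.pack.chr h.m D z) ∧
      ∀ a, a < D ∨ D + p.bw ≤ a → h'.m a = h.m a := by
  obtain ⟨N, hN, hNe⟩ := hd.he
  have hS := hp.S
  have htop := hp.top
  have hidx := hp.idx
  have hblk := p.pack.blk_add_le (e := e) hN
  have hNb : 2 ^ (N + e - p.γ) ≤ p.bw := Nat.pow_le_pow_right two_pos (by omega)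
  have hpg : p.pack.γ = p.γ := rfl
  rw [hpg] at hblk
  have hct : 2 ^ (e - p.γ) < 2 ^ E.w := by
    refine Nat.pow_lt_pow_right (by norm_num) ?_
    have := hp.lw; omega
  have hww : E.w < 2 ^ E.w := Nat.lt_two_pow_self
  refine WP.time ?_ (WP.forLt (2 ^ p.δ) (26 * 2 ^ (e - p.γ) + 53) (fun g h' =>
      (∀ z, p.pack.chr h'.m D z = if z / 2 ^ e = ν then p.pack.chr h.m D z ^^^
        xorSum (fun g => tab (p.entry J g (p.pack.chr h.m PC g % 2 ^ p.pm * 2 ^ p.h + k) * 2 ^ p.E + z % 2 ^ e)) g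
        else p.pack.chr h.m D z) ∧
      ∀ a, a < D ∨ D + p.bw ≤ a → h'.m a = h.m a) hp.one_lt ?_ hc.lim (by decide) (by decide) (by decide)
      ?_ ?_ ?_)
  · exact le_of_eq (by ring)
  · refine Nat.pow_lt_pow_right (by norm_num) ?_
    have := hp.lw; unfold Par.E at this; omega
  · simp [xorSum]
  · intro g hg h' ⟨hI, hfr⟩ hvg hf _
    have hc' : Core p E h' := hc.congr fun x hx => hf x
      (fun hx' => by subst hx'; revert hx; decide) (fun hx' => by revert hx hx'; cases x <;> decide)
    have v1 : h'.v .row = J := by rw [hf _ (by decide) (by decide), hrow]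
    have v2 : h'.v .ch = k := by rw [hf _ (by decide) (by decide), hch]
    have v3 : h'.v .pc = PC := by rw [hf _ (by decide) (by decide), hpc]
    have v4 := (hf .da (by decide) (by decide)).trans hd.da
    have v5 := (hf .dp (by decide) (by decide)).trans hd.dp
    have v6 := (hf .dm (by decide) (by decide)).trans hd.dm
    have v7 := (hf .ct (by decide) (by decide)).trans hd.ct
    have hga : PC + g / 2 ^ p.γ < p.tb := by
      have := p.chr_addr hg (by unfold Par.E; omega)
      omega
    have hchr : p.pack.chr h'.m PC g = p.pack.chr h.m PC g := by
      refine Pack.chr_congr _ (hfr _ ?_)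
      have := p.chr_addr hg (by unfold Par.E; omega)
      have h0 := Nat.zero_le (g / 2 ^ p.γ)
      rw [hpg]
      omega
    generalize hcv : p.pack.chr h.m PC g % 2 ^ p.pm = c
    have hcl : c < 2 ^ p.pm := by rw [← hcv]; exact Nat.mod_lt _ (by positivity)
    have hix := p.idx_lt hcl hk
    have hyl := p.entry_lt hJ hg hix
    have hyw : p.entry J g (c * 2 ^ p.h + k) < 2 ^ E.w :=
      hyl.trans (Nat.pow_lt_pow_right (by norm_num) hidx)
    have hsrc := p.pack.blk_add_le (e := p.E) hyl
    rw [hpg] at hsrc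
    change _ ≤ p.tw at hsrc
    have hyA : p.entry J g (c * 2 ^ p.h + k) * 2 ^ (p.E - p.γ) < 2 ^ E.w := by
      rcases le_total p.γ p.E with hh | hh
      · refine lt_of_lt_of_le ?_ hS
        refine lt_of_lt_of_le ?_ htop
        have : p.entry J g (c * 2 ^ p.h + k) * 2 ^ (p.E - p.γ) < p.tw := by
          unfold Par.tw
          rw [show p.Z - p.γ = p.NE + (p.E - p.γ) by unfold Par.Z; omega, pow_add]
          exact Nat.mul_lt_mul_of_pos_right hyl (by positivity)
        omega
      · rw [show p.E - p.γ = 0 by omega, pow_zero, mul_one]; exact hyw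
    have hSP : p.pack.pos p.E (p.entry J g (c * 2 ^ p.h + k)) < 2 ^ E.w := by
      refine lt_of_lt_of_le ?_ hp.sh.le
      unfold Pack.pos
      calc _ < 2 ^ (p.pack.γ - p.E) * 2 ^ (min p.E p.pack.γ + p.pack.μ) :=
            Nat.mul_lt_mul_of_pos_right (Nat.mod_lt _ (by positivity)) (by positivity)
        _ = 2 ^ (p.γ + p.μ) := by rw [← pow_add, hpg]; congr 1; change _ + (_ + p.μ) = _; omega
    have hcE : (chrE .pc .ga .gm .mu .pm (.v .g)).ev E h' = c := by
      rw [chrE_ev hp.fits hww v3 hc'.ga hc'.gm hc'.mu hc'.pm (p.E_le hn) (z' := g) (by simp [hvg]), hchr, hcv]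
      rw [hpg]; omega
    have tbl : p.tb + p.pack.blk p.E (p.entry J g (c * 2 ^ p.h + k)) + 2 ^ (e - p.γ) ≤ E.S := by
      have : 2 ^ (e - p.γ) ≤ 2 ^ (p.E - p.γ) := Nat.pow_le_pow_right two_pos (by omega)
      omega
    refine WP.time ?_ (WP.seqAsg c ?_ hcE (WP.seqAsg (p.entry J g (c * 2 ^ p.h + k)) (by simp) ?_
      (WP.seqAsg (p.tb + p.pack.blk p.E (p.entry J g (c * 2 ^ p.h + k))) (by simp) ?_
      (WP.seqAsg (p.pack.pos p.E (p.entry J g (c * 2 ^ p.h + k))) (by simp) ?_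
      ((xorC_wp hp (DA := D + p.pack.blk e ν) (SA := p.tb + p.pack.blk p.E (p.entry J g (c * 2 ^ p.h + k)))
        (N := 2 ^ (e - p.γ)) (SP := p.pack.pos p.E (p.entry J g (c * 2 ^ p.h + k)))
        (DM := p.mask E e) (DP := p.pack.pos e ν) (by simp [v4]) (by simp)
        (by simp [v7]) (by simp) (by simp [v6]) (by simp [v5]) ?_ tbl ?_ hct).post ?_)))))
    · simp [chrE]; omega
    · exact chrE_ok (pk := p.pack) v3 hc'.ga (by simp) (z' := g) (by simp [hvg]) (by rw [hpg]; omega) hS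
    · have a1 : p.entry J g (c * 2 ^ p.h + k) = (J * 2 ^ p.δ + g) * 2 ^ p.ib + (c * 2 ^ p.h + k) := rfl
      have a2 : J * 2 ^ p.δ + g ≤ (J * 2 ^ p.δ + g) * 2 ^ p.ib := Nat.le_mul_of_pos_right _ (by positivity)
      simp only [Ex.ev_add, Ex.ev_shl, Ex.ev_v, HSt.set_v, reduceCtorEq, if_true, if_false, v1, v2, hvg, hc'.dl,
        hc'.ib, hc'.h]
      rw [Nat.mod_eq_of_lt (show J * 2 ^ p.δ < 2 ^ E.w by omega),
        Nat.mod_eq_of_lt (show J * 2 ^ p.δ + g < 2 ^ E.w by omega),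
        Nat.mod_eq_of_lt (show (J * 2 ^ p.δ + g) * 2 ^ p.ib < 2 ^ E.w by omega),
        Nat.mod_eq_of_lt (show c * 2 ^ p.h < 2 ^ E.w by omega),
        Nat.mod_eq_of_lt (show c * 2 ^ p.h + k < 2 ^ E.w by omega), ← a1, Nat.mod_eq_of_lt hyw]
    · simp only [Ex.ev_add, Ex.ev_shl, Ex.ev_shr, Ex.ev_v, HSt.set_v, reduceCtorEq, if_true, if_false, hc'.tb,
        hc'.eA, hc'.eB]
      rw [Nat.mod_eq_of_lt hyA]
      change (p.tb + p.pack.blk p.E _) % _ = _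
      rw [Nat.mod_eq_of_lt]
      have : 0 < 2 ^ (p.E - p.γ) := by positivity
      omega
    · simp only [Ex.ev_and, Ex.ev_shl, Ex.ev_v, HSt.set_v, reduceCtorEq, if_true, if_false, hc'.bm, hc'.es,
        Nat.and_two_pow_sub_one_eq_mod]
      exact Nat.mod_eq_of_lt hSP
    · omega
    · right; omega
    · intro h'' hm
      simp only [HSt.set_m] at hm ⊢
      constructor
      · intro z
        rw [Pack.chr_xor hp.fits (e := e) (e' := p.E) (by omega) hm, hI]
        have : p.pack.chr h'.m p.tb (p.entry J g (c * 2 ^ p.h + k) * 2 ^ p.E + z % 2 ^ e) =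
            tab (p.entry J g (c * 2 ^ p.h + k) * 2 ^ p.E + z % 2 ^ e) := by
          refine ht.congr (fun a ha => hfr a (by omega)) _ ?_
          have h3 : z % 2 ^ e < 2 ^ p.E := lt_of_lt_of_le (Nat.mod_lt _ (by positivity))
            (Nat.pow_le_pow_right two_pos (by omega))
          calc _ < (p.entry J g (c * 2 ^ p.h + k) + 1) * 2 ^ p.E := by rw [add_mul]; omega
            _ ≤ 2 ^ p.NE * 2 ^ p.E := Nat.mul_le_mul_right _ hyl
            _ = _ := by rw [← pow_add]; rfl
        rw [this]
        split_ifs with hz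
        · rw [xorSum, Nat.xor_assoc, hcv]
        · rfl
      · intro a ha
        rw [hm, if_neg (by omega), hfr a ha]
  · intro h' hI _ _ _
    exact hI

end WordRAM

namespace WordRAM

/-- The two buffers for the evaluation of pairs. -/
def PBuf (p : Par) (s : HSt) : Prop :=
  (s.v .pc = p.buf 2 ∧ s.v .pn = p.buf 3) ∨ (s.v .pc = p.buf 3 ∧ s.v .pn = p.buf 2)

/-- One step of the evaluation of a pair. -/
def pairStepC : Cmd :=
  zeroC .pn .pct ;;
  .da ::= .v .pn ;; .dp ::= 0 ;; .dm ::= .v .pdm ;; .ct ::= .v .pct ;;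
  .row ::= .v .s ;; .ch ::= Ex.v .al &&& Ex.v .hm ;;
  stageC ;;
  .y ::= .v .be ;; .be ::= Ex.v .al >>> Ex.v .h ;; .al ::= .v .y ;;
  .y ::= .v .pc ;; .pc ::= .v .pn ;; .pn ::= .v .y

/-- Evaluation of a pair, whose hash characters are then looked up in row `lr`. -/
def pairC : Cmd :=
  zeroC .pc .pct ;;
  .forLt .s .nq pairStepC ;;
  .da ::= .v .t1 ;; .dp ::= .v .t2 ;; .dm ::= .v .t3 ;; .ct ::= .v .t4 ;;
  .row ::= .v .lr ;; .ch ::= 0 ;; stageC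

theorem Par.buf_le (p : Par) {i j : ℕ} (h : i < j) : p.buf i + p.bw ≤ p.buf j := by
  unfold buf
  have := Nat.mul_le_mul_right p.bw (Nat.succ_le_of_lt h)
  rw [Nat.succ_mul] at this
  omega

theorem PBuf.bounds {p : Par} {s : HSt} (h : PBuf p s) :
    p.buf 2 ≤ s.v .pc ∧ s.v .pc + p.bw ≤ p.tb ∧ p.buf 2 ≤ s.v .pn ∧ s.v .pn + p.bw ≤ p.tb ∧
      (s.v .pc + p.bw ≤ s.v .pn ∨ s.v .pn + p.bw ≤ s.v .pc) := by
  have h1 := p.buf_le (i := 2) (j := 3) (by norm_num)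
  have h2 := p.buf_le (i := 3) (j := 4) (by norm_num)
  unfold Par.tb
  rcases h with ⟨a, b⟩ | ⟨a, b⟩ <;> rw [a, b] <;> omega

theorem Par.pct_le (p : Par) : 2 ^ (p.δ - p.γ) ≤ p.bw := by
  unfold bw E; exact Nat.pow_le_pow_right two_pos (by omega)

theorem Par.blk_zero (p : Pack) (e : ℕ) : p.blk e 0 = 0 := by simp [Pack.blk]
theorem Par.pos_zero (p : Pack) (e : ℕ) : p.pos e 0 = 0 := by simp [Pack.pos]

theorem Par.chr_of_zero (p : Pack) {mem : ℕ → ℕ} {B z : ℕ} (h : mem (B + z / 2 ^ p.γ) = 0) :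
    p.chr mem B z = 0 := by
  simp [Pack.chr, h]

theorem chrs_zero {p : Par} {mem : ℕ → ℕ} {B e z : ℕ} (hm : ∀ a, B ≤ a → a < B + 2 ^ (e - p.γ) → mem a = 0)
    (hz : z < 2 ^ e) : p.pack.chr mem B z = 0 := by
  refine Par.chr_of_zero _ (hm _ (Nat.le_add_right _ _) ?_)
  have : z / 2 ^ p.pack.γ < 2 ^ (e - p.γ) := by
    rw [Nat.div_lt_iff_lt_mul (by positivity), ← pow_add]
    refine hz.trans_le (Nat.pow_le_pow_right two_pos ?_)
    change e ≤ e - p.γ + p.γ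
    omega
  omega

theorem Par.Ok.tb_lt {p : Par} {E : Env} (hp : p.Ok E) : p.tb < 2 ^ E.w := by
  have h1 := hp.top
  have h2 := hp.S
  have : 0 < p.tw := by unfold Par.tw; positivity
  omega

/-- Time of one step. -/
def Par.stepT (p : Par) : ℕ := 12 * 2 ^ p.δ + 2 ^ p.δ * (26 * 2 ^ p.δ + 60) + 100

theorem pairStepC_wp {p : Par} {E : Env} (hp : p.Ok E) {h : HSt} (hc : Core p E h)
    {tab : ℕ → ℕ} (ht : p.TabOk tab h.m) (hb : PBuf p h) {s a b : ℕ} (hs : h.v .s = s) (hsl : s < p.Q)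
    (ha : h.v .al = (p.pairSt tab a b s).2.1) (hbe : h.v .be = (p.pairSt tab a b s).2.2)
    (hst : ∀ g < 2 ^ p.δ, p.pack.chr h.m (h.v .pc) g = (p.pairSt tab a b s).1 g) :
    WP E pairStepC h p.stepT fun h' => PBuf p h' ∧
      h'.v .al = (p.pairSt tab a b (s + 1)).2.1 ∧ h'.v .be = (p.pairSt tab a b (s + 1)).2.2 ∧
      (∀ g < 2 ^ p.δ, p.pack.chr h'.m (h'.v .pc) g = (p.pairSt tab a b (s + 1)).1 g) ∧
      ∀ a, a < p.buf 2 ∨ p.tb ≤ a → h'.m a = h.m a := by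
  obtain ⟨b1, b2, b3, b4, b5⟩ := hb.bounds
  have hS := hp.S
  have htop := hp.top
  have hpct := p.pct_le
  have htb := hp.tb_lt
  have hd : 2 ^ (p.δ - p.γ) ≤ 2 ^ p.δ := Nat.pow_le_pow_right two_pos (by omega)
  refine WP.time ?_ (WP.seq (T₂ := 2 ^ p.δ * (26 * 2 ^ (p.δ - p.γ) + 60) + 50) ((zeroC_wp hp (B := h.v .pn)
    (N := 2 ^ (p.δ - p.γ)) rfl hc.pct (by omega) (by decide) (by decide) (by omega)).framed.post ?_))
  swap
  · intro h1 ⟨hm1, hf1, _⟩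
    have hc1 : Core p E h1 := hc.congr fun x hx => hf1 x (by revert hx; cases x <;> decide)
    have v1 : h1.v .pn = h.v .pn := hf1 _ (by decide)
    have v2 : h1.v .pc = h.v .pc := hf1 _ (by decide)
    have v3 : h1.v .s = s := (hf1 _ (by decide)).trans hs
    have v4 := (hf1 .al (by decide)).trans ha
    have v5 := (hf1 .be (by decide)).trans hbe
    have hout : ∀ a, (a < h.v .pn ∨ h.v .pn + p.bw ≤ a) → h1.m a = h.m a := fun a ha => by
      rw [hm1, if_neg (by omega)]
    refine WP.time ?_ (WP.seqAsg (h.v .pn) (by simp) (by simp [v1]) (WP.seqAsg 0 (by simp) (by simp)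
      (WP.seqAsg (p.mask E p.δ) (by simp) (by simp [hc1.pdm]) (WP.seqAsg (2 ^ (p.δ - p.γ)) (by simp)
      (by simp [hc1.pct]) (WP.seqAsg s (by simp) (by simp [v3])
      (WP.seqAsg ((p.pairSt tab a b s).2.1 % 2 ^ p.h) (by simp)
        (by simp [v4, hc1.hm, Nat.and_two_pow_sub_one_eq_mod]) (WP.seq (T₂ := 14)
      ((stageC_wp hp hp.hn (J := s) (k := (p.pairSt tab a b s).2.1 % 2 ^ p.h) (PC := h.v .pc) (D := h.v .pn)
        (e := p.δ) (ν := 0) (tab := tab) ?_ ?_ (by simp) ?_ (by simp) (Nat.mod_lt _ (by positivity))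
        (by simp [v2]) ?_ (by omega) (by omega) b5).framed.post ?_))))))))
    rotate_right
    · intro h2 ⟨⟨hm2, hf2⟩, hv2, _⟩
      have w1 : h2.v .be = (p.pairSt tab a b s).2.2 := by rw [hv2 _ (by decide)]; simp [v5]
      have w2 : h2.v .al = (p.pairSt tab a b s).2.1 := by rw [hv2 _ (by decide)]; simp [v4]
      have w3 : h2.v .pc = h.v .pc := by rw [hv2 _ (by decide)]; simp [v2]
      have w4 : h2.v .pn = h.v .pn := by rw [hv2 _ (by decide)]; simp [v1]
      have w5 : h2.v .h = p.h := by rw [hv2 _ (by decide)]; simp [hc1.h]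
      refine WP.time ?_ (WP.seqAsg _ (by simp) rfl (WP.seqAsg ((p.pairSt tab a b s).2.1 / 2 ^ p.h) (by simp) (by simp [w2, w5])
        (WP.seqAsg (p.pairSt tab a b s).2.2 (by simp) (by simp [w1]) (WP.seqAsg _ (by simp) rfl
        (WP.seqAsg (h.v .pn) (by simp) (by simp [w4]) (WP.asg (h.v .pc) (by simp) (by simp [w3]) ?_))))))
      · simp
      refine ⟨?_, by simp [Par.pairSt], by simp [Par.pairSt], ?_, ?_⟩
      · rcases hb with hb | hb
        · right; simp [hb]
        · left; simp [hb]
      · intro g hg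
        have : g / 2 ^ p.δ = 0 := Nat.div_eq_of_lt hg
        simp only [HSt.set_m, HSt.set_v, reduceCtorEq, if_true, if_false, Par.pairSt]
        rw [hm2, this, if_pos rfl, Nat.mod_eq_of_lt hg]
        simp only [HSt.set_m]
        rw [chrs_zero (e := p.δ) (fun a ha ha' => by rw [hm1, if_pos ⟨ha, ha'⟩]) hg, Nat.zero_xor]
        refine Par.stageF_congr (fun g hg => ?_) _ _ _
        rw [← hst g hg]
        congr 1
        refine Pack.chr_congr _ (hout _ ?_)
        have h0 := Nat.zero_le (g / 2 ^ p.γ)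
        have := p.chr_addr hg (by unfold Par.E; omega)
        change h.v .pc + g / 2 ^ p.γ < _ ∨ _ ≤ h.v .pc + g / 2 ^ p.γ
        omega
      · intro a ha
        simp only [HSt.set_m] at hf2 ⊢
        rw [hf2 a (by omega), hout a (by omega)]
    · simp only [Ex.cost_v, Ex.cost_ofNat, Ex.cost_and]
      omega
    · exact hc1.congr fun x hx => by revert hx; cases x <;> simp [coreVars]
    · simp only [HSt.set_m]
      exact ht.congr fun a ha => hout a (by omega)
    · refine hsl.trans_le (hp.hQ.trans (Nat.pow_le_pow_right two_pos (by omega)))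
    · exact ⟨by simp [Par.blk_zero], by simp [Par.pos_zero], by simp, by simp, 0, by simp, by unfold Par.E; omega⟩
  · have hm : 2 ^ p.δ * (26 * 2 ^ (p.δ - p.γ) + 60) ≤ 2 ^ p.δ * (26 * 2 ^ p.δ + 60) :=
      Nat.mul_le_mul_left _ (by omega)
    simp only [Ex.cost_v, Ex.cost_ofNat, Ex.cost_and, Ex.cost_shr, Par.stepT]
    omega

theorem pairC_wp {p : Par} {E : Env} (hp : p.Ok E) {h : HSt} (hc : Core p E h)
    {tab : ℕ → ℕ} (ht : p.TabOk tab h.m) (hb : PBuf p h) {J a b D e ν : ℕ} (ha : h.v .al = a) (hbe : h.v .be = b)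
    (hlr : h.v .lr = J) (hJ : J < 2 ^ (p.l + p.σ + 1))
    (h1 : h.v .t1 = D + p.pack.blk e ν) (h2 : h.v .t2 = p.pack.pos e ν) (h3 : h.v .t3 = p.mask E e)
    (h4 : h.v .t4 = 2 ^ (e - p.γ)) (he : ∃ N, ν < 2 ^ N ∧ N + e ≤ p.E) (hD : D + p.bw ≤ p.buf 2) :
    WP E pairC h ((p.Q + 1) * (p.stepT + 7) + 2 ^ p.δ * (26 * 2 ^ (e - p.γ) + 60)) fun h' => PBuf p h' ∧
      (∀ z < 2 ^ p.E, p.pack.chr h'.m D z = if z / 2 ^ e = ν then p.pack.chr h.m D z ^^^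
        p.stageF tab J (p.pairF tab a b) 0 (z % 2 ^ e) else p.pack.chr h.m D z) ∧
      ∀ a, (a < D ∨ D + p.bw ≤ a) → (a < p.buf 2 ∨ p.tb ≤ a) → h'.m a = h.m a := by
  obtain ⟨b1, b2, b3, b4, b5⟩ := hb.bounds
  have hS := hp.S
  have htop := hp.top
  have hpct := p.pct_le
  have htb := hp.tb_lt
  have hd : 2 ^ (p.δ - p.γ) ≤ 2 ^ p.δ := Nat.pow_le_pow_right two_pos (by omega)
  have hQ : p.Q < 2 ^ E.w := by
    refine hp.hQ.trans_lt (Nat.pow_lt_pow_right (by norm_num) ?_)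
    have := hp.lw; omega
  refine WP.time ?_ (WP.seq (T₂ := p.Q * (p.stepT + 7) + 2 ^ p.δ * (26 * 2 ^ (e - p.γ) + 60) + 30)
    ((zeroC_wp hp (B := h.v .pc) (N := 2 ^ (p.δ - p.γ)) rfl hc.pct (by omega)
    (by decide) (by decide) (by omega)).framed.post ?_))
  swap
  · intro h1' ⟨hm1, hf1, _⟩
    have hc1 : Core p E h1' := hc.congr fun x hx => hf1 x (by revert hx; cases x <;> decide)
    refine WP.time ?_ (WP.seq (T₂ := 2 ^ p.δ * (26 * 2 ^ (e - p.γ) + 60) + 25)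
      (WP.forLt p.Q p.stepT (fun s h' => PBuf p h' ∧
      h'.v .al = (p.pairSt tab a b s).2.1 ∧ h'.v .be = (p.pairSt tab a b s).2.2 ∧
      (∀ g < 2 ^ p.δ, p.pack.chr h'.m (h'.v .pc) g = (p.pairSt tab a b s).1 g) ∧
      ∀ a, a < p.buf 2 ∨ p.tb ≤ a → h'.m a = h.m a) hp.one_lt hQ hc1.nq (by decide) (by decide) (by decide) ?_ ?_ ?_))
    · omega
    · have v1 : h1'.v .pn = h.v .pn := hf1 _ (by decide)
      have v2 : h1'.v .pc = h.v .pc := hf1 _ (by decide)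
      have v4 := (hf1 .al (by decide)).trans ha
      have v5 := (hf1 .be (by decide)).trans hbe
      refine ⟨?_, by simp [v4, Par.pairSt], by simp [v5, Par.pairSt], ?_, ?_⟩
      · simpa [PBuf, v1, v2] using hb
      · intro g hg
        simp only [HSt.set_m, HSt.set_v, reduceCtorEq, if_false, v2, Par.pairSt]
        exact chrs_zero (e := p.δ) (fun a ha ha' => by rw [hm1, if_pos ⟨ha, ha'⟩]) hg
      · intro a ha
        simp only [HSt.set_m]
        rw [hm1, if_neg (by omega)]
    · intro i hi h' ⟨i1, i2, i3, i4, i5⟩ hs hf _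
      have hc' : Core p E h' := hc1.congr fun x hx => hf x
        (fun hx' => by subst hx'; revert hx; decide) (fun hx' => by revert hx hx'; cases x <;> decide)
      refine (pairStepC_wp hp hc' (ht.congr fun a ha => i5 a (Or.inr ha)) i1 hs hi i2 i3 i4).post ?_
      intro h'' ⟨j1, j2, j3, j4, j5⟩
      refine ⟨by simpa [PBuf] using j1, by simpa using j2, by simpa using j3, by simpa using j4, ?_⟩
      intro a ha
      simp only [HSt.set_m]
      rw [j5 a ha, i5 a ha]
    · intro h' ⟨i1, i2, i3, i4, i5⟩ hs hf _
      have hc' : Core p E h' := hc1.congr fun x hx => hf x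
        (fun hx' => by subst hx'; revert hx; decide) (fun hx' => by revert hx hx'; cases x <;> decide)
      obtain ⟨c1, c2, -, -, -⟩ := i1.bounds
      have w1 := ((hf .t1 (by decide) (by decide)).trans (hf1 .t1 (by decide))).trans h1
      have w2 := ((hf .t2 (by decide) (by decide)).trans (hf1 .t2 (by decide))).trans h2
      have w3 := ((hf .t3 (by decide) (by decide)).trans (hf1 .t3 (by decide))).trans h3
      have w4 := ((hf .t4 (by decide) (by decide)).trans (hf1 .t4 (by decide))).trans h4
      have w5 := ((hf .lr (by decide) (by decide)).trans (hf1 .lr (by decide))).trans hlr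
      have hch : ∀ z < 2 ^ p.E, p.pack.chr h'.m D z = p.pack.chr h.m D z := fun z hz => by
        refine Pack.chr_congr _ (i5 _ ?_)
        have := p.chr_addr hz le_rfl
        change D + z / 2 ^ p.γ < _ ∨ _
        omega
      refine WP.time ?_ (WP.seqAsg (D + p.pack.blk e ν) (by simp) (by simp [w1]) (WP.seqAsg (p.pack.pos e ν) (by simp)
        (by simp [w2]) (WP.seqAsg (p.mask E e) (by simp) (by simp [w3]) (WP.seqAsg (2 ^ (e - p.γ)) (by simp)
        (by simp [w4]) (WP.seqAsg J (by simp) (by simp [w5]) (WP.seqAsg 0 (by simp) (by simp)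
        ((stageC_wp hp hp.hn (J := J) (k := 0) (PC := h'.v .pc) (D := D)
        (e := e) (ν := ν) (tab := tab) ?_ ?_ (by simp) hJ (by simp) (by positivity)
        (by simp) ⟨by simp, by simp, by simp, by simp, he⟩ (by omega) (by omega) (by omega)).framed.post ?_)))))))
      · simp only [Ex.cost_v, Ex.cost_ofNat]
        omega
      · exact hc'.congr fun x hx => by revert hx; cases x <;> simp [coreVars]
      · simp only [HSt.set_m]
        exact ht.congr fun a ha => i5 a (Or.inr ha)
      · intro h2 ⟨⟨hm2, hf2⟩, hv2, _⟩
        simp only [HSt.set_m] at hm2 hf2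
        refine ⟨?_, ?_, ?_⟩
        · have x1 : h2.v .pc = h'.v .pc := by rw [hv2 _ (by decide)]; simp
          have x2 : h2.v .pn = h'.v .pn := by rw [hv2 _ (by decide)]; simp
          unfold PBuf
          rw [x1, x2]; exact i1
        · intro z hz
          have hst : p.stageF tab J (fun g => p.pack.chr h'.m (h'.v .pc) g % 2 ^ p.pm) 0 (z % 2 ^ e) =
              p.stageF tab J (p.pairF tab a b) 0 (z % 2 ^ e) :=
            Par.stageF_congr (fun g hg => by rw [i4 g hg]; rfl) _ _ _
          rw [hm2, hst, hch z hz]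
        · intro a ha ha'
          rw [hf2 a ha, i5 a ha']
  · rw [add_mul]
    simp only [Par.stepT]
    omega

end WordRAM

namespace WordRAM

/-- Memory outside the buffers is unchanged. -/
def Par.Keep (p : Par) (m m' : ℕ → ℕ) : Prop := ∀ a, a < 32 ∨ p.tb ≤ a → m' a = m a

/-- The two buffers for the levels. -/
def LBuf (p : Par) (s : HSt) : Prop :=
  (s.v .cur = p.buf 0 ∧ s.v .nxt = p.buf 1) ∨ (s.v .cur = p.buf 1 ∧ s.v .nxt = p.buf 0)

theorem LBuf.bounds {p : Par} {s : HSt} (h : LBuf p s) :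
    32 ≤ s.v .cur ∧ s.v .cur + p.bw ≤ p.buf 2 ∧ 32 ≤ s.v .nxt ∧ s.v .nxt + p.bw ≤ p.buf 2 ∧
      (s.v .cur + p.bw ≤ s.v .nxt ∨ s.v .nxt + p.bw ≤ s.v .cur) := by
  have h1 := p.buf_le (i := 0) (j := 1) (by norm_num)
  have h2 := p.buf_le (i := 1) (j := 2) (by norm_num)
  have h3 : p.buf 0 = 32 := by simp [Par.buf]
  rcases h with ⟨a, b⟩ | ⟨a, b⟩ <;> rw [a, b] <;> omega

/-- The address and format of the blocks on a level. -/
structure Blocks (p : Par) (E : Env) (s : HSt) (i : ℕ) : Prop where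
  dA : s.v .dA = i + 4 - p.γ
  dB : s.v .dB = p.γ - (i + 4)
  dS : s.v .dS = min (i + 4) p.γ + p.μ
  t3 : s.v .t3 = p.mask E (i + 4)
  t4 : s.v .t4 = 2 ^ (i + 4 - p.γ)
  nn : s.v .nn = 2 ^ (p.l - 1 - i)
  hj : s.v .hj = 2 ^ (i + 3)
  bo : s.v .bo = 2 ^ (p.γ - (i + 4)) - 1
  i : s.v .i = i

theorem Blocks.congr {p : Par} {E : Env} {i : ℕ} {h h' : HSt} (c : Blocks p E h i)
    (hh : ∀ x ∈ [Var.dA, .dB, .dS, .t3, .t4, .nn, .hj, .bo, .i], h'.v x = h.v x) : Blocks p E h' i := by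
  simp only [List.forall_mem_cons, List.not_mem_nil, false_imp_iff, implies_true, and_true] at hh
  obtain ⟨h1, h2, h3, h4, h5, h6, h7, h8, h9⟩ := hh
  exact ⟨h1.trans c.1, h2.trans c.2, h3.trans c.3, h4.trans c.4, h5.trans c.5, h6.trans c.6,
    h7.trans c.7, h8.trans c.8, h9.trans c.9⟩

/-- Combining two adjacent halves of a key. -/
def blockC : Cmd :=
  .forLt .j .hj (
    .x ::= (Ex.v .nu <<< (Ex.v .i + 4)) + .v .j ;;
    .al ::= chrE .cur .ga .gm .mu .mm (Ex.v .x) ;;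
    .be ::= chrE .cur .ga .gm .mu .mm (Ex.v .x + .v .hj) ;;
    .lr ::= ((1 : Ex) <<< (Ex.v .i + 1 + .v .sg)) + .v .j ;;
    pairC)

/-- Time for a pair. -/
def Par.pairT (p : Par) (e : ℕ) : ℕ := (p.Q + 1) * (p.stepT + 7) + 2 ^ p.δ * (26 * 2 ^ (e - p.γ) + 60)

theorem Par.levelF_congr {p : Par} {tab α β α' β' : ℕ → ℕ} {i : ℕ} (h : ∀ j < 2 ^ (i + 3), α j = α' j)
    (h' : ∀ j < 2 ^ (i + 3), β j = β' j) (y : ℕ) : p.levelF tab i α β y = p.levelF tab i α' β' y :=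
  xorSum_congr fun j hj => by rw [h j hj, h' j hj]

theorem blockC_wp {p : Par} {E : Env} (hp : p.Ok E) {h : HSt} (hc : Core p E h)
    {tab : ℕ → ℕ} (ht : p.TabOk tab h.m) (hb : PBuf p h) (hl : LBuf p h) {i ν : ℕ} (hB : Blocks p E h i) (hi : i < p.l)
    (hν : ν < 2 ^ (p.l - 1 - i)) (hnu : h.v .nu = ν)
    (h1 : h.v .t1 = h.v .nxt + p.pack.blk (i + 4) ν) (h2 : h.v .t2 = p.pack.pos (i + 4) ν) :
    WP E blockC h (2 ^ (i + 3) * (p.pairT (i + 4) + 67) + 5) fun h' => PBuf p h' ∧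
      (∀ z < 2 ^ p.E, p.pack.chr h'.m (h.v .nxt) z = if z / 2 ^ (i + 4) = ν then p.pack.chr h.m (h.v .nxt) z ^^^
        p.levelF tab i (fun j => p.pack.chr h.m (h.v .cur) (ν * 2 ^ (i + 4) + j))
          (fun j => p.pack.chr h.m (h.v .cur) (ν * 2 ^ (i + 4) + j + 2 ^ (i + 3))) (z % 2 ^ (i + 4))
        else p.pack.chr h.m (h.v .nxt) z) ∧
      ∀ a, (a < h.v .nxt ∨ h.v .nxt + p.bw ≤ a) → (a < p.buf 2 ∨ p.tb ≤ a) → h'.m a = h.m a := by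
  obtain ⟨b1, b2, b3, b4, b5⟩ := hl.bounds
  have hS := hp.S
  have htop := hp.top
  have htb := hp.tb_lt
  have hlw := hp.lw
  have hww : E.w < 2 ^ E.w := Nat.lt_two_pow_self
  have hσ := hp.hσ
  have hE : p.l + 3 ≤ p.E := by unfold Par.E; omega
  have hle : (ν + 1) * 2 ^ (i + 4) ≤ 2 ^ (p.l + 3) := by
    calc _ ≤ 2 ^ (p.l - 1 - i) * 2 ^ (i + 4) := Nat.mul_le_mul_right _ hν
      _ = _ := by rw [← pow_add]; congr 1; omega
  rw [add_mul, one_mul] at hle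
  have h34 : 2 ^ (i + 4) = 2 * 2 ^ (i + 3) := by ring
  have hlE : 2 ^ (p.l + 3) ≤ 2 ^ p.E := Nat.pow_le_pow_right two_pos hE
  have hEw : 2 ^ p.E < 2 ^ E.w := Nat.pow_lt_pow_right (by norm_num) (by omega)
  have hb2 := p.buf_le (i := 2) (j := 4) (by norm_num)
  change _ ≤ p.tb at hb2
  have bd : ∀ j < 2 ^ (i + 3), ν * 2 ^ (i + 4) + j < 2 ^ p.E ∧ ν * 2 ^ (i + 4) + j + 2 ^ (i + 3) < 2 ^ p.E := by
    intro j hj; omega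
  have hcd : ∀ z < 2 ^ p.E, h.v .cur + z / 2 ^ p.pack.γ < p.tb := fun z hz => by
    have := p.chr_addr hz le_rfl
    change h.v .cur + z / 2 ^ p.γ < _
    omega
  refine WP.forLt (2 ^ (i + 3)) (p.pairT (i + 4) + 60) (fun j h' => PBuf p h' ∧
      (∀ z < 2 ^ p.E, p.pack.chr h'.m (h.v .nxt) z = if z / 2 ^ (i + 4) = ν then p.pack.chr h.m (h.v .nxt) z ^^^
        xorSum (fun j => p.stageF tab (2 ^ (i + 1 + p.σ) + j) (p.pairF tab
          (p.pack.chr h.m (h.v .cur) (ν * 2 ^ (i + 4) + j))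
          (p.pack.chr h.m (h.v .cur) (ν * 2 ^ (i + 4) + j + 2 ^ (i + 3)))) 0 (z % 2 ^ (i + 4))) j
        else p.pack.chr h.m (h.v .nxt) z) ∧
      ∀ a, (a < h.v .nxt ∨ h.v .nxt + p.bw ≤ a) → (a < p.buf 2 ∨ p.tb ≤ a) → h'.m a = h.m a)
      hp.one_lt (by omega) hB.hj (by decide) (by decide) (by decide) ?_ ?_ ?_
  · exact ⟨by simpa [PBuf] using hb, by simp [xorSum], by simp⟩
  · intro j hj h' ⟨i1, i2, i3⟩ hvj hf _
    have hc' : Core p E h' := hc.congr fun x hx => hf x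
      (fun hx' => by subst hx'; revert hx; decide) (fun hx' => by revert hx hx'; cases x <;> decide)
    have hB' : Blocks p E h' i := hB.congr fun x hx => hf x
      (fun hx' => by subst hx'; revert hx; decide) (fun hx' => by revert hx hx'; cases x <;> decide)
    have v1 := (hf .cur (by decide) (by decide))
    have v2 := (hf .nu (by decide) (by decide)).trans hnu
    have w1 := (hf .t1 (by decide) (by decide)).trans h1
    have w2 := (hf .t2 (by decide) (by decide)).trans h2
    obtain ⟨d1, d2⟩ := bd j hj
    have hch : ∀ z < 2 ^ p.E, p.pack.chr h'.m (h.v .cur) z = p.pack.chr h.m (h.v .cur) z := fun z hz => by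
      have := p.chr_addr hz le_rfl
      have h0 := Nat.zero_le (z / 2 ^ p.γ)
      refine Pack.chr_congr _ (i3 _ ?_ ?_)
      · change h.v .cur + z / 2 ^ p.γ < _ ∨ _ ≤ h.v .cur + z / 2 ^ p.γ
        omega
      · change h.v .cur + z / 2 ^ p.γ < _ ∨ _ ≤ h.v .cur + z / 2 ^ p.γ
        omega
    have hJ : 2 ^ (i + 1 + p.σ) + j < 2 ^ (p.l + p.σ + 1) := by
      have e1 : 2 ^ (i + 3) ≤ 2 ^ (i + 1 + p.σ) := Nat.pow_le_pow_right two_pos (by omega)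
      have e2 : 2 ^ (i + 1 + p.σ + 1) ≤ 2 ^ (p.l + p.σ + 1) := Nat.pow_le_pow_right two_pos (by omega)
      rw [pow_succ] at e2
      omega
    have hJw : 2 ^ (p.l + p.σ + 1) < 2 ^ E.w := Nat.pow_lt_pow_right (by norm_num) (by unfold Par.E at hlw; omega)
    have hpw : 2 ^ (i + 1 + p.σ) < 2 ^ E.w := by omega
    have hiw : i + 4 < 2 ^ E.w := by unfold Par.E at hlw; omega
    have hiw' : i + 1 + p.σ < 2 ^ E.w := by unfold Par.E at hlw; omega
    refine WP.time ?_ (WP.seqAsg (ν * 2 ^ (i + 4) + j) (by simp) ?_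
      (WP.seqAsg (p.pack.chr h.m (h.v .cur) (ν * 2 ^ (i + 4) + j)) ?_ ?_
      (WP.seqAsg (p.pack.chr h.m (h.v .cur) (ν * 2 ^ (i + 4) + j + 2 ^ (i + 3))) ?_ ?_
      (WP.seqAsg (2 ^ (i + 1 + p.σ) + j) (by simp) ?_
      ((pairC_wp hp (J := 2 ^ (i + 1 + p.σ) + j) (D := h.v .nxt) (e := i + 4) (ν := ν) (tab := tab)
        (a := p.pack.chr h.m (h.v .cur) (ν * 2 ^ (i + 4) + j))
        (b := p.pack.chr h.m (h.v .cur) (ν * 2 ^ (i + 4) + j + 2 ^ (i + 3)))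
        ?_ ?_ ?_ (by simp) (by simp) (by simp) hJ (by simp [w1]) (by simp [w2]) (by simp [hB'.t3]) (by simp [hB'.t4])
        ⟨_, hν, by omega⟩ (by omega)).post ?_)))))
    · simp [chrE, Par.pairT]; omega
    · simp only [Ex.ev_add, Ex.ev_shl, Ex.ev_v, v2, hB'.i, hvj, Ex.ev_ofNat]
      rw [hp.lit (n := 4) (by norm_num), Nat.mod_eq_of_lt hiw, Nat.mod_eq_of_lt (show ν * 2 ^ (i + 4) < 2 ^ E.w by omega),
        Nat.mod_eq_of_lt (by omega)]
    · exact chrE_ok (pk := p.pack) (B := h.v .cur) (by simp [v1]) (by simp [hc'.ga]; rfl) (by simp) (by simp)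
        ((hcd _ d1).trans (by have : 0 < p.tw := (by unfold Par.tw; positivity); omega)) hS
    · rw [chrE_ev hp.fits hww (B := h.v .cur) (k := p.m) (z' := ν * 2 ^ (i + 4) + j) (by simp [v1])
        (by simp [hc'.ga]; rfl) (by simp [hc'.gm]; rfl) (by simp [hc'.mu]; rfl) (by simp [hc'.mm]) le_rfl (by simp)
        ((hcd _ d1).trans htb)]
      simp only [HSt.set_m]
      rw [hch _ d1]; exact Nat.mod_eq_of_lt (Pack.chr_lt _ _ _ _)
    · exact chrE_ok (pk := p.pack) (B := h.v .cur) (z' := ν * 2 ^ (i + 4) + j + 2 ^ (i + 3)) (by simp [v1]) (by simp [hc'.ga]; rfl) (by simp)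
        (by simp [hB'.hj]; exact Nat.mod_eq_of_lt (by omega))
        ((hcd _ d2).trans (by have : 0 < p.tw := (by unfold Par.tw; positivity); omega)) hS
    · rw [chrE_ev hp.fits hww (B := h.v .cur) (k := p.m) (z' := ν * 2 ^ (i + 4) + j + 2 ^ (i + 3)) (by simp [v1])
        (by simp [hc'.ga]; rfl) (by simp [hc'.gm]; rfl) (by simp [hc'.mu]; rfl) (by simp [hc'.mm]) le_rfl
        (by simp [hB'.hj]; exact Nat.mod_eq_of_lt (by omega)) ((hcd _ d2).trans htb)]
      simp only [HSt.set_m]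
      rw [hch _ d2]; exact Nat.mod_eq_of_lt (Pack.chr_lt _ _ _ _)
    · simp only [Ex.ev_add, Ex.ev_shl, Ex.ev_v, HSt.set_v, reduceCtorEq, if_false, hB'.i, hvj, Ex.ev_ofNat, hc'.sg]
      rw [hp.lit (n := 1) (by norm_num), Nat.mod_eq_of_lt (show i + 1 < 2 ^ E.w by omega), Nat.mod_eq_of_lt hiw', one_mul,
        Nat.mod_eq_of_lt hpw, Nat.mod_eq_of_lt (by omega)]
    · exact hc'.congr fun x hx => by revert hx; cases x <;> simp [coreVars]
    · simp only [HSt.set_m]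
      exact ht.congr fun a ha => i3 a (by omega) (Or.inr ha)
    · simpa [PBuf] using i1
    · intro h'' ⟨k1, k2, k3⟩
      simp only [HSt.set_m] at k2 k3
      refine ⟨by simpa [PBuf] using k1, ?_, ?_⟩
      · intro z hz
        simp only [HSt.set_m]
        rw [k2 z hz, i2 z hz]
        split_ifs
        · simp only [xorSum, Nat.xor_assoc]
        · rfl
      · intro a ha ha'
        simp only [HSt.set_m]
        rw [k3 a ha ha', i3 a ha ha']
  · intro h' hI _ _ _
    exact hI

/-- Time for a level. -/
def Par.levelT (p : Par) (i : ℕ) : ℕ :=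
  p.bw * 12 + 2 ^ (p.l - 1 - i) * (2 ^ (i + 3) * (p.pairT (i + 4) + 67) + 35) + 100

theorem Ex.ev_sub_of_le {E : Env} {h : HSt} {a b : Ex} {x y : ℕ} (ha : a.ev E h = x) (hb : b.ev E h = y)
    (hx : x < 2 ^ E.w) (hy : y ≤ x) : (a - b).ev E h = x - y := by
  rw [Ex.ev_sub, ha, hb, show 2 ^ E.w - y + x = 2 ^ E.w + (x - y) by omega, Nat.add_mod_left, Nat.mod_eq_of_lt (by omega)]

/-- Computation of the parameters of a level. -/
def levelHead (rest : Cmd) : Cmd :=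
  .ite true (.v .ga) (Ex.v .i + 4)
    (.dA ::= Ex.v .i + 4 - .v .ga ;; .dB ::= 0 ;; .dS ::= Ex.v .ga + .v .mu)
    (.dA ::= 0 ;; .dB ::= Ex.v .ga - (Ex.v .i + 4) ;; .dS ::= Ex.v .i + 4 + .v .mu) ;;
  .t3 ::= ((1 : Ex) <<< ((1 : Ex) <<< Ex.v .dS)) - 1 ;;
  .t4 ::= (1 : Ex) <<< Ex.v .dA ;;
  .nn ::= (1 : Ex) <<< (Ex.v .l - 1 - .v .i) ;;
  .hj ::= (1 : Ex) <<< (Ex.v .i + 3) ;;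
  .bo ::= ((1 : Ex) <<< Ex.v .dB) - 1 ;; rest

/-- The word with `min w k` ones. -/
theorem ones_mod (w k : ℕ) (hw : 0 < w) : (2 ^ w - 1 + 2 ^ k % 2 ^ w) % 2 ^ w = 2 ^ (min w k) - 1 := by
  have h1 : 1 < 2 ^ w := Nat.one_lt_two_pow hw.ne'
  rcases lt_or_ge k w with h | h
  · have : 2 ^ k < 2 ^ w := Nat.pow_lt_pow_right (by norm_num) h
    have h0 : 0 < 2 ^ k := by positivity
    rw [min_eq_right h.le, Nat.mod_eq_of_lt this, show 2 ^ w - 1 + 2 ^ k = 2 ^ w + (2 ^ k - 1) by omega,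
      Nat.add_mod_left, Nat.mod_eq_of_lt (by omega)]
  · rw [min_eq_left h, Nat.mod_eq_zero_of_dvd (pow_dvd_pow 2 h), add_zero, Nat.mod_eq_of_lt (by omega)]

theorem levelHead_wp {p : Par} {E : Env} (hp : p.Ok E) {h : HSt} (hc : Core p E h) {i : ℕ} (hi : i < p.l)
    (hvi : h.v .i = i) {rest : Cmd} {T : ℕ} {Q : HSt → Prop}
    (H : ∀ h', h'.m = h.m → h'.o = h.o → (∀ x ∉ [Var.dA, .dB, .dS, .t3, .t4, .nn, .hj, .bo], h'.v x = h.v x) →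
      Blocks p E h' i → WP E rest h' T Q) : WP E (levelHead rest) h (70 + T) Q := by
  have hlw := hp.lw
  have hshl := hp.shl
  have hw : E.w < 2 ^ E.w := Nat.lt_two_pow_self
  unfold Par.E at hlw
  have hone := hp.one_lt
  have pw : ∀ k < E.w, 2 ^ k < 2 ^ E.w := fun k hk => Nat.pow_lt_pow_right (by norm_num) hk
  have l1 := hp.lit (n := 1) (by norm_num)
  have l3 := hp.lit (n := 3) (by norm_num)
  have l4 := hp.lit (n := 4) (by norm_num)
  have hi4 : (i + 4) % 2 ^ E.w = i + 4 := Nat.mod_eq_of_lt (by omega)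
  have hga : p.γ < E.w := by
    have := hp.sh
    by_contra hh
    push Not at hh
    have := Nat.pow_le_pow_right two_pos (show E.w ≤ p.γ + p.μ by omega)
    omega
  refine WP.time ?_ (WP.seq (T₂ := 42 + T) (WP.ite (T := 20) (by simp) (by simp) ?_ ?_))
  · simp; omega
  all_goals
    intro hcond
    simp only [condHolds, if_true, Ex.ev_v, Ex.ev_add, hvi, Ex.ev_ofNat, l4, hi4, hc.ga] at hcond
  · refine WP.time ?_ (WP.seqAsg (i + 4 - p.γ) (by simp) ?_ (WP.seqAsg 0 (by simp) (by simp)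
      (WP.asg (p.γ + p.μ) (by simp) ?_ ?_)))
    · simp
    · exact Ex.ev_sub_of_le (by simp [hvi, l4, hi4]) (by simp [hc.ga]) (by omega) (by omega)
    · simp [hc.ga, hc.mu]; exact Nat.mod_eq_of_lt hshl
    refine WP.time ?_ (WP.seqAsg (p.mask E (i + 4)) (by simp) ?_ (WP.seqAsg (2 ^ (i + 4 - p.γ)) (by simp) ?_
      (WP.seqAsg (2 ^ (p.l - 1 - i)) (by simp) ?_ (WP.seqAsg (2 ^ (i + 3)) (by simp) ?_
      (WP.seqAsg (2 ^ (p.γ - (i + 4)) - 1) (by simp) ?_ (H _ ?_ ?_ ?_ ?_))))))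
    · simp; omega
    · simp only [Ex.ev_sub, Ex.ev_shl, Ex.ev_ofNat, Ex.ev_v, HSt.set_v, reduceCtorEq, if_true, if_false, l1, one_mul,
        Nat.mod_eq_of_lt hp.sh, ones_mod _ _ (show 0 < E.w by omega), Par.mask, min_eq_right hcond.le]
    · simp [l1]; exact Nat.mod_eq_of_lt (pw _ (by omega))
    · have : (Ex.v .l - 1 - .v .i).ev E h = p.l - 1 - i :=
        Ex.ev_sub_of_le (Ex.ev_sub_of_le (x := p.l) (y := 1) (by simp [hc.l]) (by simp [l1]) (by omega) (by omega))
          (by simp [hvi]) (by omega) (by omega)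
      have e : ∀ h' : HSt, h'.v .l = h.v .l → h'.v .i = h.v .i → (Ex.v .l - 1 - .v .i).ev E h' = p.l - 1 - i := by
        intro h' e1 e2
        rw [← this]; simp [e1, e2]
      rw [Ex.ev_shl, e _ (by simp) (by simp)]
      simp [l1]; exact Nat.mod_eq_of_lt (pw _ (by omega))
    · simp [l1, l3, hvi, Nat.mod_eq_of_lt (show i + 3 < 2 ^ E.w by omega)]; exact Nat.mod_eq_of_lt (pw _ (by omega))
    · rw [show p.γ - (i + 4) = 0 by omega]
      exact Ex.ev_sub_of_le (x := 1) (by simp [l1]) (by simp [l1]) (by omega) le_rfl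
    · simp
    · simp
    · intro x hx; simp at hx; simp [hx]
    · constructor <;> simp [hvi] <;> omega
  · refine WP.time ?_ (WP.seqAsg 0 (by simp) (by simp) (WP.seqAsg (p.γ - (i + 4)) (by simp) ?_
      (WP.asg (i + 4 + p.μ) (by simp) ?_ ?_)))
    · simp
    · exact Ex.ev_sub_of_le (by simp [hc.ga]) (by simp [hvi, l4, hi4]) (by omega) (by omega)
    · simp [hc.mu, hvi, l4, hi4]; exact Nat.mod_eq_of_lt (by omega)
    have hle : 2 ^ (i + 4 + p.μ) < 2 ^ E.w :=
      lt_of_le_of_lt (Nat.pow_le_pow_right two_pos (by omega)) hp.sh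
    refine WP.time ?_ (WP.seqAsg (p.mask E (i + 4)) (by simp) ?_ (WP.seqAsg (2 ^ (i + 4 - p.γ)) (by simp) ?_
      (WP.seqAsg (2 ^ (p.l - 1 - i)) (by simp) ?_ (WP.seqAsg (2 ^ (i + 3)) (by simp) ?_
      (WP.seqAsg (2 ^ (p.γ - (i + 4)) - 1) (by simp) ?_ (H _ ?_ ?_ ?_ ?_))))))
    · simp; omega
    · simp only [Ex.ev_sub, Ex.ev_shl, Ex.ev_ofNat, Ex.ev_v, HSt.set_v, reduceCtorEq, if_true, if_false, l1, one_mul,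
        Nat.mod_eq_of_lt hle, ones_mod _ _ (show 0 < E.w by omega), Par.mask, min_eq_left (show i + 4 ≤ p.γ by omega)]
    · simp [l1, show i + 4 - p.γ = 0 by omega]
    · have : (Ex.v .l - 1 - .v .i).ev E h = p.l - 1 - i :=
        Ex.ev_sub_of_le (Ex.ev_sub_of_le (x := p.l) (y := 1) (by simp [hc.l]) (by simp [l1]) (by omega) (by omega))
          (by simp [hvi]) (by omega) (by omega)
      have e : ∀ h' : HSt, h'.v .l = h.v .l → h'.v .i = h.v .i → (Ex.v .l - 1 - .v .i).ev E h' = p.l - 1 - i := by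
        intro h' e1 e2
        rw [← this]; simp [e1, e2]
      rw [Ex.ev_shl, e _ (by simp) (by simp)]
      simp [l1]; exact Nat.mod_eq_of_lt (pw _ (by omega))
    · simp [l1, l3, hvi, Nat.mod_eq_of_lt (show i + 3 < 2 ^ E.w by omega)]; exact Nat.mod_eq_of_lt (pw _ (by omega))
    · refine Ex.ev_sub_of_le (x := 2 ^ (p.γ - (i + 4))) ?_ (by simp [l1]) (pw _ (by omega)) Nat.one_le_two_pow
      simp [l1]; exact Nat.mod_eq_of_lt (pw _ (by omega))
    · simp
    · simp
    · intro x hx; simp at hx; simp [hx]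
    · constructor <;> simp [hvi] <;> omega

/-- Combining all pairs of adjacent characters or blocks on a level. -/
def levelC : Cmd := zeroC .nxt .bw ;; levelHead (.forLt .nu .nn (
    .t1 ::= Ex.v .nxt + ((Ex.v .nu <<< Ex.v .dA) >>> Ex.v .dB) ;;
    .t2 ::= (Ex.v .nu &&& Ex.v .bo) <<< Ex.v .dS ;;
    blockC) ;;
  .y ::= .v .cur ;; .cur ::= .v .nxt ;; .nxt ::= .v .y)


/-- The characters after `i` levels. -/
def LevChr (p : Par) (tab x : ℕ → ℕ) (i : ℕ) (mem : ℕ → ℕ) (B : ℕ) : Prop :=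
  ∀ z < 2 ^ (p.l + 3), p.pack.chr mem B z =
    p.lev tab i (fun c => x (z / 2 ^ (i + 3) * 2 ^ i + c)) (z % 2 ^ (i + 3))

theorem levelC_wp {p : Par} {E : Env} (hp : p.Ok E) {h : HSt} (hc : Core p E h)
    {tab : ℕ → ℕ} (ht : p.TabOk tab h.m) (hb : PBuf p h) (hl : LBuf p h) {i : ℕ} (hi : i < p.l)
    (hvi : h.v .i = i) {x : ℕ → ℕ} (hx : LevChr p tab x i h.m (h.v .cur)) :
    WP E levelC h (p.levelT i) fun h' => PBuf p h' ∧ LBuf p h' ∧ LevChr p tab x (i + 1) h'.m (h'.v .cur) ∧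
      p.Keep h.m h'.m := by
  obtain ⟨b1, b2, b3, b4, b5⟩ := hl.bounds
  have hS := hp.S
  have htop := hp.top
  have htb := hp.tb_lt
  have hlw := hp.lw
  have hb2 := p.buf_le (i := 2) (j := 4) (by norm_num)
  change _ ≤ p.tb at hb2
  have hbw : p.bw < 2 ^ E.w := by omega
  have hEw : 2 ^ p.E < 2 ^ E.w := Nat.pow_lt_pow_right (by norm_num) (by omega)
  have hlE : 2 ^ (p.l + 3) ≤ 2 ^ p.E := Nat.pow_le_pow_right two_pos (by unfold Par.E; omega)
  refine WP.time ?_ (WP.seq (T₂ := 2 ^ (p.l - 1 - i) * (2 ^ (i + 3) * (p.pairT (i + 4) + 67) + 35) + 95)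
    ((zeroC_wp hp (B := h.v .nxt) (N := p.bw) rfl hc.bw (by omega) (by decide) (by decide) hbw).framed.post ?_))
  · unfold Par.levelT; omega
  intro h1 ⟨hm1, hf1, _⟩
  have hc1 : Core p E h1 := hc.congr fun x hx => hf1 x (by revert hx; cases x <;> decide)
  refine WP.time ?_ (levelHead_wp hp hc1 hi (by rw [hf1 _ (by decide), hvi])
    (T := 2 ^ (p.l - 1 - i) * (2 ^ (i + 3) * (p.pairT (i + 4) + 67) + 35) + 25) ?_)
  · omega
  intro h2 hm2 ho2 hf2 hB2
  have hc2 : Core p E h2 := hc1.congr fun x hx => hf2 x (by revert hx; cases x <;> decide)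
  have v1 : h2.v .cur = h.v .cur := by rw [hf2 _ (by decide), hf1 _ (by decide)]
  have v2 : h2.v .nxt = h.v .nxt := by rw [hf2 _ (by decide), hf1 _ (by decide)]
  have v3 : h2.v .pc = h.v .pc := by rw [hf2 _ (by decide), hf1 _ (by decide)]
  have v4 : h2.v .pn = h.v .pn := by rw [hf2 _ (by decide), hf1 _ (by decide)]
  have hch : ∀ z < 2 ^ p.E, p.pack.chr h2.m (h.v .cur) z = p.pack.chr h.m (h.v .cur) z := fun z hz => by
    have := p.chr_addr hz le_rfl
    have h0 := Nat.zero_le (z / 2 ^ p.γ)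
    refine Pack.chr_congr _ ?_
    rw [hm2, hm1, if_neg]
    change ¬ (_ ≤ h.v .cur + z / 2 ^ p.γ ∧ h.v .cur + z / 2 ^ p.γ < _)
    omega
  have hzero : ∀ z < 2 ^ p.E, p.pack.chr h2.m (h.v .nxt) z = 0 := fun z hz => by
    refine chrs_zero (p := p) (e := p.E) (fun a ha ha' => ?_) hz
    rw [hm2, hm1, if_pos ⟨ha, ha'⟩]
  let F : ℕ → ℕ := fun z => p.levelF tab i
    (fun j => p.pack.chr h.m (h.v .cur) (z / 2 ^ (i + 4) * 2 ^ (i + 4) + j))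
    (fun j => p.pack.chr h.m (h.v .cur) (z / 2 ^ (i + 4) * 2 ^ (i + 4) + j + 2 ^ (i + 3))) (z % 2 ^ (i + 4))
  have hnn : 2 ^ (p.l - 1 - i) < 2 ^ E.w := Nat.pow_lt_pow_right (by norm_num) (by unfold Par.E at hlw; omega)
  refine WP.time ?_ (WP.seq (T₂ := 6) (WP.forLt (2 ^ (p.l - 1 - i)) (2 ^ (i + 3) * (p.pairT (i + 4) + 67) + 25)
    (fun ν h' => PBuf p h' ∧ (∀ z < 2 ^ p.E, p.pack.chr h'.m (h.v .nxt) z = if z / 2 ^ (i + 4) < ν then F z else 0) ∧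
      ∀ a, (a < h.v .nxt ∨ h.v .nxt + p.bw ≤ a) → (a < p.buf 2 ∨ p.tb ≤ a) → h'.m a = h2.m a)
      hp.one_lt hnn hB2.nn (by decide) (by decide) (by decide) ?_ ?_ ?_))
  · rw [show 2 ^ (i + 3) * (p.pairT (i + 4) + 67) + 25 + 7 = 2 ^ (i + 3) * (p.pairT (i + 4) + 67) + 32 by ring]
    have : 2 ^ (p.l - 1 - i) * (2 ^ (i + 3) * (p.pairT (i + 4) + 67) + 32) ≤
      2 ^ (p.l - 1 - i) * (2 ^ (i + 3) * (p.pairT (i + 4) + 67) + 35) := Nat.mul_le_mul_left _ (by omega)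
    omega
  · refine ⟨by simpa [PBuf, v3, v4] using hb, fun z hz => ?_, fun a _ _ => rfl⟩
    simp [hzero z hz]
  · intro ν hν h' ⟨i1, i2, i3⟩ hvν hf _
    have hc' : Core p E h' := hc2.congr fun x hx => hf x
      (fun hx' => by subst hx'; revert hx; decide) (fun hx' => by revert hx hx'; cases x <;> decide)
    have hB' : Blocks p E h' i := hB2.congr fun x hx => hf x
      (fun hx' => by subst hx'; revert hx; decide) (fun hx' => by revert hx hx'; cases x <;> decide)
    have w1 := (hf .cur (by decide) (by decide)).trans v1
    have w2 := (hf .nxt (by decide) (by decide)).trans v2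
    have hle : (ν + 1) * 2 ^ (i + 4) ≤ 2 ^ (p.l + 3) := by
      calc _ ≤ 2 ^ (p.l - 1 - i) * 2 ^ (i + 4) := Nat.mul_le_mul_right _ hν
        _ = _ := by rw [← pow_add]; congr 1; omega
    have hblk := p.pack.blk_add_le (e := i + 4) hν
    have hNb : 2 ^ (p.l - 1 - i + (i + 4) - p.γ) ≤ p.bw := Nat.pow_le_pow_right two_pos (by unfold Par.E; omega)
    have hpg : p.pack.γ = p.γ := rfl
    rw [hpg] at hblk
    have hdA : ν * 2 ^ (i + 4 - p.γ) < 2 ^ E.w := by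
      calc _ ≤ ν * 2 ^ (i + 4) := Nat.mul_le_mul_left _ (Nat.pow_le_pow_right two_pos (by omega))
        _ < 2 ^ E.w := by rw [add_mul] at hle; have : 0 < 2 ^ (i + 4) := (by positivity); omega
    have hpos : p.pack.pos (i + 4) ν < 2 ^ E.w := by
      refine lt_of_lt_of_le ?_ hp.sh.le
      have : ν % 2 ^ (p.γ - (i + 4)) < 2 ^ (p.γ - (i + 4)) := Nat.mod_lt _ (by positivity)
      calc p.pack.pos (i + 4) ν = ν % 2 ^ (p.γ - (i + 4)) * 2 ^ (min (i + 4) p.γ + p.μ) := rfl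
        _ < 2 ^ (p.γ - (i + 4)) * 2 ^ (min (i + 4) p.γ + p.μ) := Nat.mul_lt_mul_of_pos_right this (by positivity)
        _ = _ := by rw [← pow_add]; congr 1; omega
    have h0 : 0 < 2 ^ (i + 4 - p.γ) := by positivity
    have hoth : ∀ z < 2 ^ p.E, p.pack.chr h'.m (h.v .cur) z = p.pack.chr h.m (h.v .cur) z := fun z hz => by
      rw [← hch z hz]
      have := p.chr_addr hz le_rfl
      have h0 := Nat.zero_le (z / 2 ^ p.γ)
      refine Pack.chr_congr _ (i3 _ ?_ ?_)
      · change h.v .cur + z / 2 ^ p.γ < _ ∨ _ ≤ h.v .cur + z / 2 ^ p.γ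
        omega
      · change h.v .cur + z / 2 ^ p.γ < _ ∨ _ ≤ h.v .cur + z / 2 ^ p.γ
        omega
    refine WP.time ?_ (WP.seqAsg (h.v .nxt + p.pack.blk (i + 4) ν) (by simp) ?_
      (WP.seqAsg (p.pack.pos (i + 4) ν) (by simp) ?_
      ((blockC_wp hp (i := i) (ν := ν) (tab := tab) ?_ ?_ ?_ ?_ ?_ hi hν (by simp [hvν]) (by simp [w2]) (by simp)).post ?_)))
    · simp; omega
    · simp only [Ex.ev_add, Ex.ev_shl, Ex.ev_shr, Ex.ev_v, w2, hvν, hB'.dA, hB'.dB, Nat.mod_eq_of_lt hdA]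
      change (h.v .nxt + p.pack.blk (i + 4) ν) % _ = _
      exact Nat.mod_eq_of_lt (by omega)
    · simp only [Ex.ev_and, Ex.ev_shl, Ex.ev_v, HSt.set_v, reduceCtorEq, if_false, hvν, hB'.bo, hB'.dS,
        Nat.and_two_pow_sub_one_eq_mod]
      exact Nat.mod_eq_of_lt hpos
    · exact hc'.congr fun x hx => by revert hx; cases x <;> simp [coreVars]
    · simp only [HSt.set_m]
      refine ht.congr fun a ha => ?_
      rw [i3 a (by omega) (Or.inr ha), hm2, hm1, if_neg (by omega)]
    · simpa [PBuf] using i1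
    · simpa [LBuf, w1, w2] using hl
    · exact hB'.congr fun x hx => by revert hx; cases x <;> simp
    · intro h'' ⟨k1, k2, k3⟩
      simp only [HSt.set_m, HSt.set_v, reduceCtorEq, if_false, w1, w2] at k2 k3
      refine ⟨by simpa [PBuf] using k1, ?_, ?_⟩
      · intro z hz
        simp only [HSt.set_m]
        rw [k2 z hz, i2 z hz]
        by_cases hzν : z / 2 ^ (i + 4) = ν
        · rw [if_pos hzν, if_neg (by omega), if_pos (by omega), Nat.zero_xor]
          simp only [F, hzν]
          have h34 : 2 ^ (i + 4) = 2 * 2 ^ (i + 3) := by ring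
          rw [add_mul] at hle
          exact Par.levelF_congr (fun j hj => hoth _ (by omega)) (fun j hj => hoth _ (by omega)) _
        · rw [if_neg hzν]
          by_cases hl : z / 2 ^ (i + 4) < ν
          · rw [if_pos hl, if_pos (by omega)]
          · rw [if_neg hl, if_neg (by omega)]
      · intro a ha ha'
        simp only [HSt.set_m]
        rw [k3 a ha ha', i3 a ha ha']
  · intro h' ⟨i1, i2, i3⟩ hs hf _
    have w1 := (hf .cur (by decide) (by decide)).trans v1
    have w2 := (hf .nxt (by decide) (by decide)).trans v2
    refine WP.time ?_ (WP.seqAsg _ (by simp) rfl (WP.seqAsg (h.v .nxt) (by simp) (by simp [w2])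
      (WP.asg (h.v .cur) (by simp) (by simp [w1]) ?_)))
    · simp
    refine ⟨by simpa [PBuf] using i1, ?_, ?_, ?_⟩
    · rcases hl with hl | hl
      · right; simp [hl]
      · left; simp [hl]
    · intro z hz
      simp only [HSt.set_m, HSt.set_v, reduceCtorEq, if_true, if_false]
      have hzn : z / 2 ^ (i + 4) < 2 ^ (p.l - 1 - i) := by
        rw [Nat.div_lt_iff_lt_mul (by positivity), ← pow_add]
        rwa [show p.l - 1 - i + (i + 4) = p.l + 3 by omega]
      have hle : (z / 2 ^ (i + 4) + 1) * 2 ^ (i + 4) ≤ 2 ^ (p.l + 3) := by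
        calc _ ≤ 2 ^ (p.l - 1 - i) * 2 ^ (i + 4) := Nat.mul_le_mul_right _ hzn
          _ = _ := by rw [← pow_add]; congr 1; omega
      rw [add_mul] at hle
      have h34 : 2 ^ (i + 4) = 2 * 2 ^ (i + 3) := by ring
      rw [i2 z (by omega), if_pos hzn]
      simp only [F]
      rw [show i + 1 + 3 = i + 4 by ring]
      change _ = p.levelF tab i _ _ _
      set ζ := z / 2 ^ (i + 4)
      refine Par.levelF_congr (fun j hj => ?_) (fun j hj => ?_) _
      · rw [hx _ (by omega)]
        have e1 : (ζ * 2 ^ (i + 4) + j) / 2 ^ (i + 3) = 2 * ζ := by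
          rw [h34, show ζ * (2 * 2 ^ (i + 3)) + j = j + 2 * ζ * 2 ^ (i + 3) by ring,
            Nat.add_mul_div_right _ _ (by positivity), Nat.div_eq_of_lt hj, zero_add]
        have e2 : (ζ * 2 ^ (i + 4) + j) % 2 ^ (i + 3) = j := by
          rw [h34, show ζ * (2 * 2 ^ (i + 3)) + j = j + 2 * ζ * 2 ^ (i + 3) by ring,
            Nat.add_mul_mod_self_right, Nat.mod_eq_of_lt hj]
        rw [e1, e2, show 2 * ζ * 2 ^ i = ζ * 2 ^ (i + 1) by ring]
      · rw [hx _ (by omega)]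
        have e1 : (ζ * 2 ^ (i + 4) + j + 2 ^ (i + 3)) / 2 ^ (i + 3) = 2 * ζ + 1 := by
          rw [h34, show ζ * (2 * 2 ^ (i + 3)) + j + 2 ^ (i + 3) = j + (2 * ζ + 1) * 2 ^ (i + 3) by ring,
            Nat.add_mul_div_right _ _ (by positivity), Nat.div_eq_of_lt hj, zero_add]
        have e2 : (ζ * 2 ^ (i + 4) + j + 2 ^ (i + 3)) % 2 ^ (i + 3) = j := by
          rw [h34, show ζ * (2 * 2 ^ (i + 3)) + j + 2 ^ (i + 3) = j + (2 * ζ + 1) * 2 ^ (i + 3) by ring,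
            Nat.add_mul_mod_self_right, Nat.mod_eq_of_lt hj]
        rw [e1, e2]
        congr 1
        funext c
        congr 1
        ring
    · intro a ha
      simp only [HSt.set_m]
      rw [i3 a (by omega) (by omega), hm2, hm1, if_neg (by omega)]

/-- All levels. -/
def levelsC : Cmd := .forLt .i .l levelC

theorem levelsC_wp {p : Par} {E : Env} (hp : p.Ok E) {h : HSt} (hc : Core p E h)
    {tab : ℕ → ℕ} (ht : p.TabOk tab h.m) (hb : PBuf p h) (hl : LBuf p h)
    {x : ℕ → ℕ} (hx : LevChr p tab x 0 h.m (h.v .cur)) :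
    WP E levelsC h ((∑ i ∈ Finset.range p.l, (p.levelT i + 7)) + 5) fun h' => LBuf p h' ∧
      LevChr p tab x p.l h'.m (h'.v .cur) ∧ p.Keep h.m h'.m := by
  have hlw := hp.lw
  have hww : E.w < 2 ^ E.w := Nat.lt_two_pow_self
  unfold Par.E at hlw
  refine WP.forLt' p.l p.levelT (fun i h' => PBuf p h' ∧ LBuf p h' ∧ LevChr p tab x i h'.m (h'.v .cur) ∧
      p.Keep h.m h'.m) hp.one_lt (by omega) hc.l (by decide) (by decide) (by decide) ?_ ?_ ?_
  · exact ⟨by simpa [PBuf] using hb, by simpa [LBuf] using hl, by simpa using hx, fun a _ => rfl⟩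
  · intro i hi h' ⟨i1, i2, i3, i4⟩ hvi hf _
    have hc' : Core p E h' := hc.congr fun x hx => hf x
      (fun hx' => by subst hx'; revert hx; decide) (fun hx' => by revert hx hx'; cases x <;> decide)
    refine (levelC_wp hp hc' (ht.congr fun a ha => i4 a (Or.inr ha)) i1 i2 hi hvi i3).post ?_
    intro h'' ⟨k1, k2, k3, k4⟩
    exact ⟨by simpa [PBuf] using k1, by simpa [LBuf] using k2, by simpa using k3,
      fun a ha => (k4 a ha).trans (i4 a ha)⟩
  · intro h' ⟨_, i2, i3, i4⟩ _ _ _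
    exact ⟨i2, i3, i4⟩

end WordRAM

namespace WordRAM

/-- The cells that hold the parameters. -/
structure Par.Cells (p : Par) (w : ℕ) (mem : ℕ → ℕ) : Prop where
  l : mem 0 = p.l
  n : mem 1 = p.n
  κ : mem 2 = p.κ
  γ : mem 3 = p.γ
  μ : mem 4 = p.μ
  w : mem 5 = w

theorem Par.Cells.congr {p : Par} {w : ℕ} {mem mem' : ℕ → ℕ} (h : p.Cells w mem) (hm : ∀ a < 6, mem' a = mem a) :
    p.Cells w mem' :=
  ⟨(hm 0 (by norm_num)).trans h.l, (hm 1 (by norm_num)).trans h.n, (hm 2 (by norm_num)).trans h.κ,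
    (hm 3 (by norm_num)).trans h.γ, (hm 4 (by norm_num)).trans h.μ, (hm 5 (by norm_num)).trans h.w⟩

/-- Loading the parameters. -/
def loadC (δ Q σ : ℕ) : Cmd :=
  .l ::= .ld 0 ;; .n ::= .ld 1 ;; .ka ::= .ld 2 ;; .ga ::= .ld 3 ;; .mu ::= .ld 4 ;; .w ::= .ld 5 ;;
  .dl ::= .lit δ ;; .nq ::= .lit Q ;; .sg ::= .lit σ

/-- Lengths and masks that are independent of the word length. -/
def lenC : Cmd :=
  .lim ::= (1 : Ex) <<< Ex.v .dl ;;
  .h ::= (Ex.v .n + 1) >>> (1 : Ex) ;;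
  .mm ::= ((1 : Ex) <<< (Ex.v .n + .v .ka + 4)) - 1 ;;
  .x ::= Ex.v .ka + .v .h + 4 ;;
  .pm ::= ((1 : Ex) <<< Ex.v .x) - 1 ;;
  .ib ::= Ex.v .x + .v .h ;;
  .hm ::= ((1 : Ex) <<< Ex.v .h) - 1 ;;
  .gm ::= ((1 : Ex) <<< Ex.v .ga) - 1

/-- The format of table entries. -/
def entC : Cmd :=
  .x ::= Ex.v .l + 3 + .v .dl ;;
  .ite true (.v .ga) (.v .x)
    (.eA ::= Ex.v .x - .v .ga ;; .eB ::= 0 ;; .es ::= Ex.v .ga + .v .mu)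
    (.eA ::= 0 ;; .eB ::= Ex.v .ga - .v .x ;; .es ::= Ex.v .x + .v .mu) ;;
  .bm ::= ((1 : Ex) <<< Ex.v .eB) - 1 ;;
  .bw ::= (1 : Ex) <<< Ex.v .eA

/-- The format of buffers for pairs, and the addresses of the buffers. -/
def bufC : Cmd :=
  .ite true (.v .ga) (.v .dl)
    (.x ::= Ex.v .dl - .v .ga ;; .y ::= Ex.v .ga + .v .mu)
    (.x ::= 0 ;; .y ::= Ex.v .dl + .v .mu) ;;
  .pct ::= (1 : Ex) <<< Ex.v .x ;;
  .pdm ::= ((1 : Ex) <<< ((1 : Ex) <<< Ex.v .y)) - 1 ;;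
  .cur ::= 32 ;; .nxt ::= Ex.v .cur + .v .bw ;; .pc ::= Ex.v .nxt + .v .bw ;; .pn ::= Ex.v .pc + .v .bw ;;
  .tb ::= Ex.v .pn + .v .bw

/-- Computation of all parameters. -/
def preludeC (δ Q σ : ℕ) : Cmd := loadC δ Q σ ;; lenC ;; entC ;; bufC

theorem Par.Ok.ga_lt {p : Par} {E : Env} (hp : p.Ok E) : p.γ + p.μ < E.w := by
  by_contra hh
  exact absurd hp.sh (not_lt.2 (Nat.pow_le_pow_right two_pos (not_lt.1 hh)))

theorem Ex.ev_ones {E : Env} {h : HSt} {a : Ex} {k : ℕ} (ha : a.ev E h = k) (hk : k ≤ E.w) (hw : 1 < 2 ^ E.w) :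
    (((1 : Ex) <<< a) - 1).ev E h = 2 ^ k - 1 := by
  have h0 : 0 < E.w := by by_contra hh; simp [show E.w = 0 by omega] at hw
  have e : 2 ^ min E.w k - 1 = 2 ^ k - 1 := by rw [min_eq_right hk]
  rw [← e, ← ones_mod _ _ h0]
  simp [ha, Nat.mod_eq_of_lt hw]

theorem preludeC_wp {p : Par} {E : Env} (hp : p.Ok E) {h : HSt} (hc : p.Cells E.w h.m) :
    WP E (preludeC p.δ p.Q p.σ) h 250 fun h' => Core p E h' ∧ h'.m = h.m ∧ LBuf p h' ∧ PBuf p h' ∧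
      h'.v .cur = p.buf 0 ∧ h'.v .w = E.w ∧ h'.v .n = p.n ∧ h'.v .ka = p.κ := by
  have hlw := hp.lw
  have hga := hp.ga_lt
  have hw : E.w < 2 ^ E.w := Nat.lt_two_pow_self
  have hS := hp.S
  have htop := hp.top
  have htb := hp.tb_lt
  unfold Par.E at hlw
  have hone := hp.one_lt
  have pw : ∀ k < E.w, 2 ^ k < 2 ^ E.w := fun k hk => Nat.pow_lt_pow_right (by norm_num) hk
  have l0 := hp.lit (n := 0) (by norm_num)
  have l1 := hp.lit (n := 1) (by norm_num)
  have l2 := hp.lit (n := 2) (by norm_num)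
  have l3 := hp.lit (n := 3) (by norm_num)
  have l4 := hp.lit (n := 4) (by norm_num)
  have l5 := hp.lit (n := 5) (by norm_num)
  have l32 := hp.lit (n := 32) (by norm_num)
  have hQ : p.Q < 2 ^ E.w := by
    refine hp.hQ.trans_lt (Nat.pow_lt_pow_right (by norm_num) ?_)
    omega
  have hm : p.n + p.κ + 4 ≤ E.w := hp.fits.word
  have hidx := hp.idx
  unfold Par.NE at hidx
  have hib : p.ib = p.κ + p.h + 4 + p.h := rfl
  have hpm : p.pm = p.κ + p.h + 4 := rfl
  have hh : p.h = (p.n + 1) / 2 := rfl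
  have hb0 : p.buf 0 = 32 := by simp [Par.buf]
  have hb1 : p.buf 1 = 32 + p.bw := by simp [Par.buf]
  have hb2 : p.buf 2 = 32 + p.bw + p.bw := by simp [Par.buf]; ring
  have hb3 : p.buf 3 = 32 + p.bw + p.bw + p.bw := by simp [Par.buf]; ring
  have hb4 : p.tb = 32 + p.bw + p.bw + p.bw + p.bw := by simp [Par.tb, Par.buf]; ring
  have htw : 0 < p.tw := by unfold Par.tw; positivity
  refine WP.time (T := 27 + 200) (by norm_num) (WP.seq (WP.time (T := 27) (by norm_num) (WP.post (WP.framed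
    (WP.time ?_ (WP.seqAsg p.l ?_ ?_ (WP.seqAsg p.n ?_ ?_ (WP.seqAsg p.κ ?_ ?_ (WP.seqAsg p.γ ?_ ?_ (WP.seqAsg p.μ ?_ ?_
    (WP.seqAsg E.w ?_ ?_ (WP.seqAsg p.δ ?_ ?_ (WP.seqAsg p.Q ?_ ?_ (WP.asg p.σ ?_ ?_
    (Q := fun h' => h'.m = h.m ∧ h'.v .l = p.l ∧ h'.v .n = p.n ∧ h'.v .ka = p.κ ∧ h'.v .ga = p.γ ∧ h'.v .mu = p.μ ∧
      h'.v .w = E.w ∧ h'.v .dl = p.δ ∧ h'.v .nq = p.Q ∧ h'.v .sg = p.σ) ?_))))))))))) ?_)))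
  any_goals first
    | (simp [l0, l1, l2, l3, l4, l5]; omega)
    | simp [l0, l1, l2, l3, l4, l5, hc.l, hc.n, hc.κ, hc.γ, hc.μ, hc.w]
  · exact Nat.mod_eq_of_lt (by omega)
  · exact Nat.mod_eq_of_lt hQ
  · exact Nat.mod_eq_of_lt (by omega)
  rintro h1 e0 e1 e2 e3 e4 e5 e6 e7 e8 e9 - -
  have A : WP E lenC h1 60 fun h' => h'.m = h.m ∧ h'.v .lim = 2 ^ p.δ ∧ h'.v .h = p.h ∧ h'.v .mm = 2 ^ p.m - 1 ∧
      h'.v .pm = 2 ^ p.pm - 1 ∧ h'.v .ib = p.ib ∧ h'.v .hm = 2 ^ p.h - 1 ∧ h'.v .gm = 2 ^ p.γ - 1 := by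
    refine WP.time ?_ (WP.seqAsg (2 ^ p.δ) (by simp) ?_ (WP.seqAsg p.h (by simp) ?_ (WP.seqAsg (2 ^ p.m - 1) (by simp) ?_
      (WP.seqAsg p.pm (by simp) ?_ (WP.seqAsg (2 ^ p.pm - 1) (by simp) ?_ (WP.seqAsg p.ib (by simp) ?_
      (WP.seqAsg (2 ^ p.h - 1) (by simp) ?_ (WP.asg (2 ^ p.γ - 1) (by simp) ?_ ?_))))))))
    · simp
    · simp [l1, e7]; exact Nat.mod_eq_of_lt (pw _ (by omega))
    · simp [l1, e2]; rw [Nat.mod_eq_of_lt (by omega)]; rfl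
    · exact Ex.ev_ones (by simp [l4, e2, e3]; exact Nat.mod_eq_of_lt (by omega)) hp.fits.word hone
    · simp [l4, e3]; exact Nat.mod_eq_of_lt (by omega)
    · exact Ex.ev_ones (by simp) (by omega) hone
    · simp; exact Nat.mod_eq_of_lt (by omega)
    · exact Ex.ev_ones (by simp) (by omega) hone
    · exact Ex.ev_ones (by simp [e4]) (by omega) hone
    · simp [e0]
  refine WP.time (T := 60 + (60 + 80)) (by norm_num) (WP.seq (A.framed.post ?_))
  rintro h2 ⟨⟨f0, f1, f2, f3, f4, f5, f6, f7⟩, hv2, -⟩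
  have hE : p.E = p.l + 3 + p.δ := rfl
  have eE : (p.l + 3 + p.δ) % 2 ^ E.w = p.l + 3 + p.δ := Nat.mod_eq_of_lt (by omega)
  refine WP.seq (WP.time (T := 60) le_rfl (WP.post (WP.framed (Q := fun h' => h'.m = h.m ∧ h'.v .eA = p.E - p.γ ∧
      h'.v .eB = p.γ - p.E ∧ h'.v .es = min p.E p.γ + p.μ ∧ h'.v .bm = 2 ^ (p.γ - p.E) - 1 ∧ h'.v .bw = p.bw)
    (WP.time ?_ (WP.seqAsg p.E (by simp) ?_ (WP.seq (T₂ := 12) (WP.ite (T := 20) (by simp) (by simp) ?_ ?_))))) ?_))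
  · simp
  · simp [l3, hv2 .l (by decide), e1, hv2 .dl (by decide), e7]; rw [← hE]; exact eE
  · intro hcond
    simp [condHolds, hv2 .ga (by decide), e4] at hcond
    refine WP.time ?_ (WP.seqAsg (p.E - p.γ) (by simp) ?_ (WP.seqAsg 0 (by simp) (by simp)
      (WP.asg (p.γ + p.μ) (by simp) ?_ (WP.time ?_ (WP.seqAsg (2 ^ (p.γ - p.E) - 1) (by simp) ?_
      (WP.asg p.bw (by simp) ?_ ?_))))))
    · simp
    · exact Ex.ev_sub_of_le (by simp) (by simp [hv2 .ga (by decide), e4]) (by omega) (by omega)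
    · simp [hv2 .ga (by decide), hv2 .mu (by decide), e4, e5]; exact Nat.mod_eq_of_lt (by omega)
    · simp
    · rw [show p.γ - p.E = 0 by omega]
      exact Ex.ev_sub_of_le (x := 1) (by simp [l1]) (by simp [l1]) (by omega) le_rfl
    · simp [l1]; exact Nat.mod_eq_of_lt (pw _ (by omega))
    · refine ⟨f0, ?_, ?_, ?_, ?_, ?_⟩ <;> simp <;> omega
  · intro hcond
    simp [condHolds, hv2 .ga (by decide), e4] at hcond
    refine WP.time ?_ (WP.seqAsg 0 (by simp) (by simp) (WP.seqAsg (p.γ - p.E) (by simp) ?_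
      (WP.asg (p.E + p.μ) (by simp) ?_ (WP.time ?_ (WP.seqAsg (2 ^ (p.γ - p.E) - 1) (by simp) ?_
      (WP.asg p.bw (by simp) ?_ ?_))))))
    · simp
    · exact Ex.ev_sub_of_le (by simp [hv2 .ga (by decide), e4]) (by simp) (by omega) (by omega)
    · simp [hv2 .mu (by decide), e5]; exact Nat.mod_eq_of_lt (by omega)
    · simp
    · refine Ex.ev_sub_of_le (x := 2 ^ (p.γ - p.E)) ?_ (by simp [l1]) (pw _ (by omega)) Nat.one_le_two_pow
      simp [l1]; exact Nat.mod_eq_of_lt (pw _ (by omega))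
    · simp [l1]; unfold Par.bw; rw [show p.E - p.γ = 0 by omega, pow_zero]
    · refine ⟨f0, ?_, ?_, ?_, ?_, ?_⟩ <;> simp <;> omega
  rintro h3 ⟨⟨g0, g1, g2, g3, g4, g5⟩, hv3, -⟩
  have hbw : p.bw < 2 ^ E.w := by omega
  have fin : ∀ h' : HSt, h'.m = h.m → (∀ z ∉ [Var.x, .y], h'.v z = h3.v z) → h'.v .x = p.δ - p.γ →
      h'.v .y = min p.δ p.γ + p.μ → WP E (.pct ::= (1 : Ex) <<< Ex.v .x ;;
        .pdm ::= ((1 : Ex) <<< ((1 : Ex) <<< Ex.v .y)) - 1 ;;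
        .cur ::= 32 ;; .nxt ::= Ex.v .cur + .v .bw ;; .pc ::= Ex.v .nxt + .v .bw ;; .pn ::= Ex.v .pc + .v .bw ;;
        .tb ::= Ex.v .pn + .v .bw) h' 40 fun h' => Core p E h' ∧ h'.m = h.m ∧ LBuf p h' ∧ PBuf p h' ∧
      h'.v .cur = p.buf 0 ∧ h'.v .w = E.w ∧ h'.v .n = p.n ∧ h'.v .ka = p.κ := by
    intro h' k0 k1 k2 k3
    have hle : 2 ^ (min p.δ p.γ + p.μ) < 2 ^ E.w := pw _ (by omega)
    have k4 : h'.v .bw = p.bw := (k1 _ (by decide)).trans g5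
    refine WP.time ?_ (WP.seqAsg (2 ^ (p.δ - p.γ)) (by simp) ?_ (WP.seqAsg (p.mask E p.δ) (by simp) ?_
      (WP.seqAsg (p.buf 0) (by simp) ?_ (WP.seqAsg (p.buf 1) (by simp) ?_ (WP.seqAsg (p.buf 2) (by simp) ?_
      (WP.seqAsg (p.buf 3) (by simp) ?_ (WP.asg p.tb (by simp) ?_ ?_)))))))
    · simp
    · simp [l1, k2]; exact Nat.mod_eq_of_lt (pw _ (by omega))
    · unfold Par.mask
      rw [← ones_mod _ _ (show 0 < E.w by omega)]
      simp [l1, k3, Nat.mod_eq_of_lt hle]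
    · simp [l32, hb0]
    · simp [k4, hb0, hb1]; exact Nat.mod_eq_of_lt (by omega)
    · simp [k4, hb1, hb2]; exact Nat.mod_eq_of_lt (by omega)
    · simp [k4, hb2, hb3]; exact Nat.mod_eq_of_lt (by omega)
    · simp [k4, hb3, hb4]; exact Nat.mod_eq_of_lt (by omega)
    have c3 : ∀ z, z ∉ [Var.x, .y, .pct, .pdm, .cur, .nxt, .pc, .pn, .tb] → h'.v z = h3.v z := fun z hz =>
      k1 z (by simp at hz ⊢; tauto)
    have c2 : ∀ z, z ∉ [Var.x, .y, .pct, .pdm, .cur, .nxt, .pc, .pn, .tb] ++ entC.wr → h'.v z = h2.v z := fun z hz => by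
      rw [c3 z (fun h => hz (List.mem_append_left _ h)), hv3 z (fun h => hz (List.mem_append_right _ h))]
    have c1 : ∀ z, z ∉ ([Var.x, .y, .pct, .pdm, .cur, .nxt, .pc, .pn, .tb] ++ entC.wr) ++ lenC.wr → h'.v z = h1.v z := fun z hz => by
      rw [c2 z (fun h => hz (List.mem_append_left _ h)), hv2 z (fun h => hz (List.mem_append_right _ h))]
    refine ⟨?_, by simpa using k0, ?_, ?_, by simp, ?_, ?_, ?_⟩
    · constructor
      · simp [c1 .l (by decide), e1]
      · simp [c1 .ga (by decide), e4]
      · simp [c1 .mu (by decide), e5]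
      · simp [c2 .h (by decide), f2]
      · simp [c2 .ib (by decide), f5]
      · simp [c3 .eA (by decide), g1]
      · simp [c3 .eB (by decide), g2]
      · simp [c3 .es (by decide), g3]
      · simp [c2 .gm (by decide), f7]
      · simp [c2 .hm (by decide), f6]
      · simp [c2 .mm (by decide), f3]
      · simp [c2 .pm (by decide), f4]
      · simp [c3 .bm (by decide), g4]
      · simp [k4]
      · simp
      · simp
      · simp
      · simp [c2 .lim (by decide), f1]
      · simp [c1 .dl (by decide), e7]
      · simp [c1 .sg (by decide), e9]
      · simp [c1 .nq (by decide), e8]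
    · left; simp
    · left; simp
    · simp [c1 .w (by decide), e6]
    · simp [c1 .n (by decide), e2]
    · simp [c1 .ka (by decide), e3]
  have d1 : h3.v .ga = p.γ := by rw [hv3 _ (by decide), hv2 _ (by decide), e4]
  have d2 : h3.v .dl = p.δ := by rw [hv3 _ (by decide), hv2 _ (by decide), e7]
  have d3 : h3.v .mu = p.μ := by rw [hv3 _ (by decide), hv2 _ (by decide), e5]
  refine WP.time ?_ (WP.seq (T₂ := 40) (WP.ite (T := 20) (by simp) (by simp) ?_ ?_))
  · simp
  · intro hcond
    simp [condHolds, d1, d2] at hcond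
    refine WP.time ?_ (WP.seqAsg (p.δ - p.γ) (by simp) ?_ (WP.asg (p.γ + p.μ) (by simp) ?_ (fin _ ?_ ?_ ?_ ?_)))
    · simp
    · exact Ex.ev_sub_of_le (by simp [d2]) (by simp [d1]) (by omega) (by omega)
    · simp [d1, d3]; exact Nat.mod_eq_of_lt (by omega)
    · simpa using g0
    · intro z hz; simp at hz; simp [hz]
    · simp
    · simp; omega
  · intro hcond
    simp [condHolds, d1, d2] at hcond
    refine WP.time ?_ (WP.seqAsg 0 (by simp) (by simp) (WP.asg (p.δ + p.μ) (by simp) ?_ (fin _ ?_ ?_ ?_ ?_)))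
    · simp
    · simp [d2, d3]; exact Nat.mod_eq_of_lt (by omega)
    · simpa using g0
    · intro z hz; simp at hz; simp [hz]
    · simp; omega
    · simp; omega

end WordRAM

namespace WordRAM

/-- Add the value of `e` to character `z` of the array at `b`. -/
def addChr (b ga gm mu : Var) (z e : Ex) : Cmd :=
  .st (Ex.v b + (z >>> .v ga)) (.ld (Ex.v b + (z >>> .v ga)) ^^^ (e <<< ((z &&& .v gm) <<< .v mu)))

theorem addChr_wp {pk : Pack} {E : Env} {h : HSt} {Q : HSt → Prop} (hp : pk.Fits E.w) {b ga gm mu : Var} {z e : Ex}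
    {B z' c : ℕ} (hb : h.v b = B) (hga : h.v ga = pk.γ) (hgm : h.v gm = 2 ^ pk.γ - 1) (hmu : h.v mu = pk.μ)
    (hzo : z.ok E h) (hz : z.ev E h = z') (heo : e.ok E h) (he : e.ev E h = c) (hc : c < 2 ^ pk.m)
    (hS : B + z' / 2 ^ pk.γ < E.S) (hSw : E.S ≤ 2 ^ E.w)
    (H : ∀ h' : HSt, h'.v = h.v → h'.o = h.o →
      (∀ z, pk.chr h'.m B z = if z = z' then pk.chr h.m B z' ^^^ c else pk.chr h.m B z) →
      (∀ a, a ≠ B + z' / 2 ^ pk.γ → h'.m a = h.m a) → Q h') :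
    WP E (addChr b ga gm mu z e) h (3 * z.cost + e.cost + 20) Q := by
  have hww : E.w < 2 ^ E.w := Nat.lt_two_pow_self
  have e1 : z' % 2 ^ pk.γ * 2 ^ pk.μ < 2 ^ E.w := by
    rcases hp.fits with hh | hh
    · rw [hh]; simp [Nat.mod_one]
    · refine lt_of_lt_of_le (lt_of_lt_of_le ?_ hh) hww.le
      rw [pow_add]
      exact Nat.mul_lt_mul_of_pos_right (Nat.mod_lt _ (by positivity)) (by positivity)
  have e2 : (B + z' / 2 ^ pk.γ) % 2 ^ E.w = B + z' / 2 ^ pk.γ := Nat.mod_eq_of_lt (by omega)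
  refine WP.time ?_ (WP.st (B + z' / 2 ^ pk.γ) (h.m (B + z' / 2 ^ pk.γ) ^^^ (c * 2 ^ (z' % 2 ^ pk.γ * 2 ^ pk.μ) % 2 ^ E.w))
    (by simp [hzo]) ?_ ?_ hS ?_ (H _ rfl rfl ?_ ?_))
  · simp; omega
  · simp only [Ex.ok_xor, Ex.ok_ld, Ex.ok_add, Ex.ok_shr, Ex.ok_shl, Ex.ok_and, Ex.ok_v, hzo, heo, true_and, and_true,
      Ex.ev_add, Ex.ev_shr, Ex.ev_v, hb, hga, hz, e2, hS]
  · simp only [Ex.ev_add, Ex.ev_shr, Ex.ev_v, hb, hga, hz, e2]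
  · simp only [Ex.ev_xor, Ex.ev_ld, Ex.ev_and, Ex.ev_shl, Ex.ev_add, Ex.ev_shr, Ex.ev_v, hb, hga, hgm, hmu, hz, he, e2,
      Nat.and_two_pow_sub_one_eq_mod, Nat.mod_eq_of_lt e1]
  · intro z
    exact Pack.chr_update hp hc z
  · intro a ha
    simp [HSt.put_m, ha]

/-- Eight copies of every character of the key.  The program `rd` reads a character. -/
def fillC (rd : Cmd) : Cmd :=
  .va ::= 0 ;; .bo ::= 0 ;; .hj ::= 8 ;; .nn ::= (1 : Ex) <<< Ex.v .l ;;
  zeroC .cur .bw ;;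
  .forLt .nu .nn (rd ;; .forLt .j .hj (.x ::= (Ex.v .nu <<< (3 : Ex)) + .v .j ;;
    addChr .cur .ga .gm .mu (.v .x) (.v .al)))

/-- A program that reads the characters of a key. -/
structure Reads (p : Par) (E : Env) (rd : Cmd) (T : ℕ) (x A B : ℕ → ℕ) : Prop where
  wp : ∀ ν < 2 ^ p.l, ∀ h : HSt, Core p E h → h.v .w = E.w → h.v .n = p.n → h.v .nu = ν → h.v .va = A ν → h.v .bo = B ν →
    WP E rd h T fun h' => h'.m = h.m ∧ h'.v .al = x ν ∧ h'.v .va = A (ν + 1) ∧ h'.v .bo = B (ν + 1)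
  wr : ∀ z ∈ rd.wr, z ∈ [Var.al, .va, .bo, .x, .y]
  silent : rd.silent = true
  A0 : A 0 = 0
  B0 : B 0 = 0
  lt : ∀ ν < 2 ^ p.l, x ν < 2 ^ p.m

theorem fillC_wp {p : Par} {E : Env} (hp : p.Ok E) {h : HSt} (hc : Core p E h) (hcur : h.v .cur = p.buf 0)
    (hw : h.v .w = E.w) (hn : h.v .n = p.n) {rd : Cmd} {T : ℕ} {x A B : ℕ → ℕ} (hrd : Reads p E rd T x A B) :
    WP E (fillC rd) h (p.bw * 12 + 2 ^ p.l * (T + 316) + 30) fun h' =>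
      (∀ z < 2 ^ (p.l + 3), p.pack.chr h'.m (p.buf 0) z = x (z / 8)) ∧ p.Keep h.m h'.m := by
  have hlw := hp.lw
  have hww : E.w < 2 ^ E.w := Nat.lt_two_pow_self
  have hS := hp.S
  have htop := hp.top
  have htb := hp.tb_lt
  have hb0 : p.buf 0 = 32 := by simp [Par.buf]
  have hb1 := p.buf_le (i := 0) (j := 4) (by norm_num)
  change _ ≤ p.tb at hb1
  have htw : 0 < p.tw := by unfold Par.tw; positivity
  have l1 := hp.lit (n := 1) (by norm_num)
  have l3 := hp.lit (n := 3) (by norm_num)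
  have l8 := hp.lit (n := 8) (by norm_num)
  have hE : p.E = p.l + 3 + p.δ := rfl
  have hlE : 2 ^ (p.l + 3) ≤ 2 ^ p.E := Nat.pow_le_pow_right two_pos (by omega)
  have hEw : 2 ^ p.E < 2 ^ E.w := Nat.pow_lt_pow_right (by norm_num) (by omega)
  have hl3 : 2 ^ (p.l + 3) = 2 ^ p.l * 8 := by rw [pow_add]; norm_num
  have hwr : ∀ z, z ∉ [Var.al, .va, .bo, .x, .y] → z ∉ rd.wr := fun z hz hz' => hz (hrd.wr z hz')
  refine WP.time ?_ (WP.seqAsg 0 (by simp) (by simp) (WP.seqAsg 0 (by simp) (by simp) (WP.seqAsg 8 (by simp) (by simp [l8])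
    (WP.seqAsg (2 ^ p.l) (by simp) ?_ (WP.seq (T₂ := 2 ^ p.l * (T + 316) + 5)
    ((zeroC_wp hp (B := p.buf 0) (N := p.bw) (by simp [hcur]) (by simp [hc.bw]) (by omega) (by decide) (by decide)
      (by omega)).framed.post ?_))))))
  · simp; omega
  · simp [hc.l, l1]; exact Nat.mod_eq_of_lt (by omega)
  intro h1 ⟨hm1, hf1, _⟩
  have hc1 : Core p E h1 := hc.congr fun x hx => by
    rw [hf1 x (by revert hx; cases x <;> decide)]
    revert hx; cases x <;> simp [coreVars]
  have hzero : ∀ z < 2 ^ p.E, p.pack.chr h1.m (p.buf 0) z = 0 := fun z hz => by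
    refine chrs_zero (p := p) (e := p.E) (fun a ha ha' => ?_) hz
    rw [hm1, if_pos ⟨ha, ha'⟩]
  have hk1 : p.Keep h.m h1.m := fun a ha => by
    rw [hm1, if_neg (by omega)]; simp
  have v1 : h1.v .nn = 2 ^ p.l := by rw [hf1 _ (by decide)]; simp
  have v2 : h1.v .hj = 8 := by rw [hf1 _ (by decide)]; simp
  have v3 : h1.v .va = 0 := by rw [hf1 _ (by decide)]; simp
  have v4 : h1.v .bo = 0 := by rw [hf1 _ (by decide)]; simp
  have v5 : h1.v .w = E.w := by rw [hf1 _ (by decide)]; simp [hw]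
  have v6 : h1.v .n = p.n := by rw [hf1 _ (by decide)]; simp [hn]
  have v7 : h1.v .cur = p.buf 0 := by rw [hf1 _ (by decide)]; simp [hcur]
  have hwr' : ∀ z, z ∉ [Var.al, .va, .bo, .x, .y, .j] → z ∉ (rd ;; Cmd.forLt .j .hj (.x ::= (Ex.v .nu <<< (3 : Ex)) + .v .j ;;
    addChr .cur .ga .gm .mu (.v .x) (.v .al))).wr := by
    intro z hz
    simp only [Cmd.wr, List.mem_append, not_or, Cmd.forLt, addChr]
    simp at hz
    exact ⟨hwr z (by simp; tauto), by simp; tauto, by simp; tauto⟩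
  refine WP.time ?_ (WP.forLt (2 ^ p.l) (T + 309) (fun ν h' =>
      (∀ z < 2 ^ (p.l + 3), p.pack.chr h'.m (p.buf 0) z = if z / 8 < ν then x (z / 8) else 0) ∧ p.Keep h.m h'.m ∧
      h'.v .va = A ν ∧ h'.v .bo = B ν)
    hp.one_lt (by omega) v1 (by decide) (hwr' _ (by decide)) (hwr' _ (by decide)) ?_ ?_ ?_)
  · simp [add_assoc]
  · refine ⟨fun z hz => ?_, hk1, by simp [v3, hrd.A0], by simp [v4, hrd.B0]⟩
    simp [hzero z (by omega)]
  · intro ν hν h' ⟨i1, i2, i3, i4⟩ hvν hf _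
    have hf' : ∀ z, z ∉ [Var.al, .va, .bo, .x, .y, .j, .nu] → h'.v z = h1.v z := fun z hz =>
      hf z (by simp at hz; tauto) (hwr' z (by simp at hz ⊢; tauto))
    have hc' : Core p E h' := hc1.congr fun x hx => hf' x (by revert hx; cases x <;> decide)
    refine WP.time (T := T + 309) (by omega) (WP.seq ((hrd.wp ν hν h' hc' ((hf' _ (by decide)).trans v5)
      ((hf' _ (by decide)).trans v6) hvν i3 i4).framed.post ?_))
    intro h2 ⟨⟨j1, j2, j3, j4⟩, hf2, _⟩
    have hf2' : ∀ z, z ∉ [Var.al, .va, .bo, .x, .y] → h2.v z = h'.v z := fun z hz => hf2 z (hwr z hz)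
    have hc2 : Core p E h2 := hc'.congr fun x hx => hf2' x (by revert hx; cases x <;> decide)
    have w1 : h2.v .hj = 8 := by rw [hf2' _ (by decide), hf' _ (by decide), v2]
    have w2 : h2.v .nu = ν := by rw [hf2' _ (by decide), hvν]
    have w3 : h2.v .cur = p.buf 0 := by rw [hf2' _ (by decide), hf' _ (by decide), v7]
    refine WP.time ?_ (WP.forLt 8 31 (fun j h3 =>
      (∀ z < 2 ^ (p.l + 3), p.pack.chr h3.m (p.buf 0) z = if z < ν * 8 + j then x (z / 8) else 0) ∧ p.Keep h.m h3.m)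
      hp.one_lt (by omega) w1 (by decide) (by decide) (by decide) ?_ ?_ ?_)
    · norm_num
    · simp only [HSt.set_m, j1]
      refine ⟨fun z hz => ?_, i2⟩
      rw [i1 z hz]
      refine if_congr ?_ rfl rfl
      omega
    · intro j hj h3 ⟨k1, k2⟩ hvj hf3 _
      have hc3 : Core p E h3 := hc2.congr fun x hx => hf3 x
        (fun hx' => by subst hx'; revert hx; decide) (fun hx' => by revert hx hx'; cases x <;> decide)
      have y1 : h3.v .nu = ν := by rw [hf3 _ (by decide) (by decide), w2]
      have y2 : h3.v .cur = p.buf 0 := by rw [hf3 _ (by decide) (by decide), w3]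
      have y3 : h3.v .al = x ν := by rw [hf3 _ (by decide) (by decide), j2]
      have hz : ν * 8 + j < 2 ^ p.E := by omega
      have hz3 : ν * 8 + j < 2 ^ (p.l + 3) := by omega
      have had := p.chr_addr hz le_rfl
      refine WP.time ?_ (WP.seqAsg (ν * 8 + j) (by simp) ?_ (addChr_wp hp.fits (B := p.buf 0) (z' := ν * 8 + j)
        (c := x ν) (by simp [y2]) (by simp [hc3.ga]; rfl) (by simp [hc3.gm]; rfl) (by simp [hc3.mu]; rfl) (by simp) (by simp) (by simp)
        (by simp [y3]) (hrd.lt ν hν) ?_ hS ?_))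
      · simp
      · simp [y1, hvj, l3]
        exact Nat.mod_eq_of_lt (by omega)
      · change p.buf 0 + (ν * 8 + j) / 2 ^ p.γ < _
        omega
      · intro h4 g1 g2 g3 g4
        simp only [HSt.set_m] at g3 g4 ⊢
        refine ⟨fun z hz => ?_, fun a ha => ?_⟩
        · rw [g3]
          split_ifs with h5 h6 h6
          · subst h5
            rw [k1 _ hz, if_neg (by omega), Nat.zero_xor]
            congr 1; omega
          · omega
          · rw [k1 z hz, if_pos (by omega)]
          · rw [k1 z hz, if_neg (by omega)]
        · rw [g4 a, k2 a ha]
          change a ≠ p.buf 0 + (ν * 8 + j) / 2 ^ p.γ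
          have h0 := Nat.zero_le ((ν * 8 + j) / 2 ^ p.γ)
          omega
    · intro h3 ⟨k1, k2⟩ _ hf3 _
      refine ⟨?_, by simpa using k2, ?_, ?_⟩
      · intro z hz
        simp only [HSt.set_m]
        rw [k1 z hz]
        refine if_congr ?_ rfl rfl
        omega
      · simp [hf3 .va (by decide) (by decide), j3]
      · simp [hf3 .bo (by decide) (by decide), j4]
  · intro h' ⟨i1, i2, _, _⟩ _ _ _
    refine ⟨fun z hz => ?_, i2⟩
    rw [i1 z hz, if_pos (by omega)]

/-- Evaluation of the recursive construction. -/
def coreC (δ Q σ : ℕ) (rd : Cmd) : Cmd := preludeC δ Q σ ;; fillC rd ;; levelsC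

/-- Time of the evaluation. -/
def Par.coreT (p : Par) (T : ℕ) : ℕ :=
  p.bw * 12 + 2 ^ p.l * (T + 316) + (∑ i ∈ Finset.range p.l, (p.levelT i + 7)) + 300

theorem coreC_wp {p : Par} {E : Env} (hp : p.Ok E) {h : HSt} (hcl : p.Cells E.w h.m)
    {tab : ℕ → ℕ} (ht : p.TabOk tab h.m) {rd : Cmd} {T : ℕ} {x A B : ℕ → ℕ} (hrd : Reads p E rd T x A B) :
    WP E (coreC p.δ p.Q p.σ rd) h (p.coreT T) fun h' => Core p E h' ∧ LBuf p h' ∧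
      (∀ z < 2 ^ (p.l + 3), p.pack.chr h'.m (h'.v .cur) z = p.lev tab p.l x z) ∧ p.Keep h.m h'.m ∧
      h'.v .w = E.w ∧ h'.v .n = p.n ∧ h'.v .ka = p.κ := by
  have hwr : ∀ z, z ∉ [Var.al, .va, .bo, .x, .y] → z ∉ rd.wr := fun z hz hz' => hz (hrd.wr z hz')
  have hwf : ∀ z, z ∉ [Var.al, .va, .bo, .x, .y, .hj, .nn, .q, .nu, .j] → z ∉ (fillC rd).wr := by
    intro z hz
    simp only [fillC, Cmd.wr, List.mem_append, not_or, Cmd.forLt, addChr, zeroC]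
    simp at hz
    refine ⟨?_, ?_, ?_, ?_, ?_, ?_, ⟨hwr z (by simp; tauto), ?_, ?_⟩, ?_⟩ <;> simp <;> tauto
  refine WP.time ?_ (WP.seq ((preludeC_wp hp hcl).post fun h1 ⟨a1, a2, a3, a4, a5, a6, a7, a8⟩ =>
    WP.seq ((fillC_wp hp a1 a5 a6 a7 hrd).framed.post fun h2 ⟨⟨b1, b2⟩, hf2, _⟩ =>
    ((levelsC_wp (tab := tab) (x := x) hp (a1.congr fun x hx => hf2 x (hwf x (by revert hx; cases x <;> decide)))
      (ht.congr fun a ha => ?_) ?_ ?_ ?_).framed.post ?_))))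
  · unfold Par.coreT; omega
  · rw [b2 a (Or.inr ha), a2]
  · simpa [PBuf, hf2 .pc (hwf _ (by decide)), hf2 .pn (hwf _ (by decide))] using a4
  · simpa [LBuf, hf2 .cur (hwf _ (by decide)), hf2 .nxt (hwf _ (by decide))] using a3
  · intro z hz
    rw [hf2 .cur (hwf _ (by decide)), a5, b1 z hz]
    simp [Par.lev]
  · intro h3 ⟨⟨c1, c2, c3⟩, hf3, _⟩
    have hf : ∀ z, z ∉ [Var.al, .va, .bo, .x, .y, .hj, .nn, .q, .nu, .j] → z ∉ levelsC.wr → h3.v z = h1.v z :=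
      fun z h1 h2 => (hf3 z h2).trans (hf2 z (hwf z h1))
    refine ⟨a1.congr fun x hx => hf x (by revert hx; cases x <;> decide) (by revert hx; cases x <;> decide), c1, ?_, ?_, ?_, ?_, ?_⟩
    · intro z hz
      rw [c2 z hz, Nat.div_eq_of_lt hz, Nat.mod_eq_of_lt hz]
      simp
    · intro a ha
      rw [c3 a ha, b2 a ha, a2]
    · rw [hf _ (by decide) (by decide), a6]
    · rw [hf _ (by decide) (by decide), a7]
    · rw [hf _ (by decide) (by decide), a8]

end WordRAM

namespace WordRAM

/-- Computation of the word length. -/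
def widthC : Cmd := .w ::= 0 ;; .x ::= 1 ;; .loop true 0 (.v .x) (.x ::= Ex.v .x + .v .x ;; .w ::= Ex.v .w + 1)

theorem widthC_wp {E : Env} (hw : 0 < E.w) (h : HSt) :
    WP E widthC h (E.w * 11 + 7) fun h' => h'.v .w = E.w ∧ h'.m = h.m := by
  have hone : 1 < 2 ^ E.w := Nat.one_lt_two_pow hw.ne'
  have hww : E.w < 2 ^ E.w := Nat.lt_two_pow_self
  refine WP.time ?_ (WP.seqAsg 0 (by simp) (by simp) (WP.seqAsg 1 (by simp) (by simp [Nat.mod_eq_of_lt hone])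
    (WP.loop E.w (fun _ => 8) (fun i h' => h'.v .w = i ∧ h'.v .x = 2 ^ i % 2 ^ E.w ∧ h'.m = h.m) ?_ ?_ ?_ ?_)))
  · simp; omega
  · simp [Nat.mod_eq_of_lt hone]
  · intro i hi h' ⟨h1, h2, h3⟩
    refine ⟨by simp, by simp, ?_⟩
    simp only [condHolds, if_true, Ex.ev_ofNat, Nat.zero_mod, Ex.ev_v, h2]
    rcases hi.lt_or_eq with h | h
    · rw [Nat.mod_eq_of_lt (Nat.pow_lt_pow_right (by norm_num) h)]
      simp [h]
    · subst h; simp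
  · intro i hi h' ⟨h1, h2, h3⟩
    refine WP.time ?_ (WP.seqAsg (2 ^ (i + 1) % 2 ^ E.w) (by simp) ?_ (WP.asg (i + 1) (by simp) ?_ ⟨by simp, by simp, by simpa using h3⟩))
    · simp
    · simp only [Ex.ev_add, Ex.ev_v, h2, ← Nat.add_mod, pow_succ, mul_two]
    · simp only [Ex.ev_add, Ex.ev_v, HSt.set_v, reduceCtorEq, if_false, h1, Ex.ev_ofNat, Nat.mod_eq_of_lt hone]
      exact Nat.mod_eq_of_lt (by omega)
  · intro h' ⟨h1, h2, h3⟩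
    exact ⟨h1, h3⟩

/-- The format for characters of `m` bits in words of `w` bits. -/
def Pack.std (w m : ℕ) : Pack := ⟨Nat.log 2 w - Nat.clog 2 m, Nat.clog 2 m, m⟩

theorem Pack.std_fits {w m : ℕ} (h : m ≤ w) (hw : 0 < w) : (Pack.std w m).Fits w where
  field := Nat.le_pow_clog (by norm_num) m
  word := h
  fits := by
    simp only [Pack.std]
    rcases le_total (Nat.log 2 w) (Nat.clog 2 m) with h1 | h1
    · left; omega
    · right
      rw [Nat.sub_add_cancel h1]
      exact Nat.pow_log_le_self 2 hw.ne'

theorem Pack.std_lt (w m : ℕ) : w < 2 ^ ((Pack.std w m).γ + (Pack.std w m).μ + 1) := by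
  simp only [Pack.std]
  refine (Nat.lt_pow_succ_log_self (b := 2) (by norm_num) w).trans_le (Nat.pow_le_pow_right two_pos ?_)
  omega

theorem two_pow_clog_lt {m : ℕ} (hm : 0 < m) : 2 ^ Nat.clog 2 m < 2 * m := by
  rcases Nat.lt_or_ge 1 m with h | h
  · have h1 := Nat.pow_pred_clog_lt_self (b := 2) (by norm_num) h
    have h2 : 0 < Nat.clog 2 m := Nat.clog_pos (by norm_num) h
    obtain ⟨c, hc⟩ := Nat.exists_eq_succ_of_ne_zero h2.ne'
    rw [hc] at h1 ⊢
    rw [Nat.pow_succ]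
    simp at h1
    omega
  · obtain rfl : m = 1 := by omega
    simp

/-- Computation of the length of the number in `x`, added to `y`. -/
def sizeC (y : Var) : Cmd := .loop true 0 (.v .x) (.x ::= Ex.v .x >>> (1 : Ex) ;; y ::= Ex.v y + 1)

theorem sizeC_wp {E : Env} {h : HSt} {y : Var} (hy : y ≠ .x) {X Y : ℕ} (hx : h.v .x = X) (hyv : h.v y = Y)
    (hw : 1 < 2 ^ E.w) (hlt : Y + Nat.size X < 2 ^ E.w) :
    WP E (sizeC y) h (Nat.size X * 11 + 3) fun h' => h'.v y = Y + Nat.size X ∧ h'.m = h.m := by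
  refine WP.time ?_ (WP.loop (Nat.size X) (fun _ => 8) (fun i h' => h'.v y = Y + i ∧ h'.v .x = X / 2 ^ i ∧ h'.m = h.m)
    ?_ ?_ ?_ ?_)
  · simp
  · simp [hx, hyv]
  · intro i hi h' ⟨h1, h2, h3⟩
    refine ⟨by simp, by simp, ?_⟩
    simp only [condHolds, if_true, Ex.ev_ofNat, Nat.zero_mod, Ex.ev_v, h2]
    rw [Nat.div_pos_iff, Nat.lt_size]
    simp
  · intro i hi h' ⟨h1, h2, h3⟩
    refine WP.time ?_ (WP.seqAsg (X / 2 ^ (i + 1)) (by simp) ?_ (WP.asg (Y + (i + 1)) (by simp) ?_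
      ⟨by simp, by simp [hy.symm], by simpa using h3⟩))
    · simp
    · simp [h2, Nat.mod_eq_of_lt hw, Nat.div_div_eq_div_mul, pow_succ]
    · simp only [Ex.ev_add, Ex.ev_v, HSt.set_v, hy, if_false, h1, Ex.ev_ofNat, Nat.mod_eq_of_lt hw]
      rw [Nat.mod_eq_of_lt (by omega), add_assoc]
  · intro h' ⟨h1, h2, h3⟩
    exact ⟨h1, h3⟩

/-- Computation of the rounded up binary logarithm of `m`. -/
def clogC (m y : Var) : Cmd :=
  y ::= 0 ;; .x ::= 1 ;; .loop true (.v .x) (.v m) (.x ::= Ex.v .x + .v .x ;; y ::= Ex.v y + 1)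

theorem clogC_wp {E : Env} {h : HSt} {m y : Var} (hw : 1 < 2 ^ E.w) {m' : ℕ} (hm : h.v m = m') (hm0 : 0 < m')
    (hmw : 2 * m' ≤ 2 ^ E.w) (h1 : m ≠ .x) (h2 : m ≠ y) (h3 : y ≠ .x) :
    WP E (clogC m y) h (Nat.clog 2 m' * 11 + 7) fun h' => h'.v y = Nat.clog 2 m' ∧ h'.v .x = 2 ^ Nat.clog 2 m' ∧
      h'.m = h.m := by
  have hcl := two_pow_clog_lt hm0
  have hcw : Nat.clog 2 m' < 2 ^ Nat.clog 2 m' := Nat.lt_two_pow_self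
  refine WP.time ?_ (WP.seqAsg 0 (by simp) (by simp) (WP.seqAsg 1 (by simp) (by simp [Nat.mod_eq_of_lt hw])
    (WP.loop (Nat.clog 2 m') (fun _ => 8) (fun i h' => h'.v y = i ∧ h'.v .x = 2 ^ i ∧
      h'.v m = m' ∧ h'.m = h.m) ?_ ?_ ?_ ?_)))
  · simp; omega
  · simp [h1, h2, hm, h3]
  · intro i hi h' ⟨a1, a2, a3, a5⟩
    refine ⟨by simp, by simp, ?_⟩
    simp only [condHolds, if_true, Ex.ev_v, a2, a3]
    rw [Nat.lt_clog_iff_pow_lt (by norm_num)]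
  · intro i hi h' ⟨a1, a2, a3, a5⟩
    have : 2 ^ (i + 1) < 2 ^ E.w := by
      have : 2 ^ (i + 1) ≤ 2 ^ Nat.clog 2 m' := Nat.pow_le_pow_right two_pos hi
      omega
    refine WP.time ?_ (WP.seqAsg (2 ^ (i + 1)) (by simp) ?_ (WP.asg (i + 1) (by simp) ?_
      ⟨by simp, by simp [h3.symm], by simp [h1, h2, a3], by simpa using a5⟩))
    · simp
    · simp only [Ex.ev_add, Ex.ev_v, a2]
      rw [← mul_two, ← pow_succ, Nat.mod_eq_of_lt this]
    · simp only [Ex.ev_add, Ex.ev_v, HSt.set_v, h3, if_false, a1, Ex.ev_ofNat, Nat.mod_eq_of_lt hw]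
      exact Nat.mod_eq_of_lt (by omega)
  · exact fun h' ⟨a1, a2, a3, a5⟩ => ⟨a1, a2, a5⟩

/-- Computation of a format. -/
def packC (m mu ga : Var) : Cmd :=
  clogC m mu ;; ga ::= 0 ;;
  .loop true (Ex.v .x + .v .x) (Ex.v .w + 1) (.x ::= Ex.v .x + .v .x ;; ga ::= Ex.v ga + 1)

theorem packC_wp {E : Env} {h : HSt} {m mu ga : Var} (hw : h.v .w = E.w) (hw5 : 5 ≤ E.w) {m' : ℕ} (hm : h.v m = m')
    (hmw : m' ≤ E.w) (hm0 : 0 < m') (h1 : m ≠ .x) (h2 : m ≠ mu) (h3 : mu ≠ .x) (h4 : ga ≠ .x) (h5 : mu ≠ .w)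
    (h6 : ga ≠ mu) (h7 : ga ≠ .w) :
    WP E (packC m mu ga) h (E.w * 30 + 30) fun h' => h'.v mu = (Pack.std E.w m').μ ∧ h'.v ga = (Pack.std E.w m').γ ∧
      h'.m = h.m := by
  have hone : 1 < 2 ^ E.w := Nat.one_lt_two_pow (by omega)
  have hww : E.w < 2 ^ E.w := Nat.lt_two_pow_self
  have h4w : 4 * E.w < 2 ^ E.w := by
    obtain ⟨c, hc⟩ := Nat.exists_eq_add_of_le hw5
    rw [hc]
    clear * -
    induction c with
    | zero => norm_num
    | succ c ih => rw [← add_assoc, pow_succ]; omega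
  have hcl := two_pow_clog_lt hm0
  have hcm : Nat.clog 2 m' ≤ E.w := by
    have : Nat.clog 2 m' < 2 ^ Nat.clog 2 m' := Nat.lt_two_pow_self
    rw [Nat.clog_le_iff_le_pow (by norm_num)]
    omega
  have hlw : Nat.log 2 E.w ≤ E.w := Nat.log_le_self 2 E.w
  have hpl : 2 ^ Nat.log 2 E.w ≤ E.w := Nat.pow_log_le_self 2 (by omega)
  refine WP.time ?_ (WP.seq (T₂ := E.w * 18 + 9) ((clogC_wp hone hm hm0 (by omega) h1 h2 h3).framed.post ?_))
  · omega
  intro h1' ⟨⟨a1, a2, a5⟩, hf, _⟩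
  have a4 : h1'.v .w = E.w := by rw [hf _ (by simp [Cmd.wr, clogC, h5.symm]), hw]
  refine WP.time ?_ (WP.seqAsg 0 (by simp) (by simp)
    (WP.loop (Nat.log 2 E.w - Nat.clog 2 m') (fun _ => 8) (fun i h' => h'.v ga = i ∧ h'.v .x = 2 ^ (Nat.clog 2 m' + i) ∧
      h'.v mu = Nat.clog 2 m' ∧ h'.v .w = E.w ∧ h'.m = h.m) ?_ ?_ ?_ ?_))
  · simp; omega
  · simp [h4.symm, h6.symm, h7.symm, a1, a2, a4, a5]
  · intro i hi h' ⟨b1, b2, b3, b4, b5⟩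
    refine ⟨by simp, by simp, ?_⟩
    have hov : 2 ^ (Nat.clog 2 m' + i + 1) < 2 ^ E.w := by
      rw [pow_succ]
      rcases Nat.eq_zero_or_pos i with h0 | h0
      · subst h0; rw [add_zero]; omega
      · have : 2 ^ (Nat.clog 2 m' + i) ≤ 2 ^ Nat.log 2 E.w := Nat.pow_le_pow_right two_pos (by omega)
        omega
    simp only [condHolds, if_true, Ex.ev_add, Ex.ev_v, b2, b4, Ex.ev_ofNat, Nat.mod_eq_of_lt hone]
    rw [← mul_two, ← pow_succ, Nat.mod_eq_of_lt hov, Nat.mod_eq_of_lt (show E.w + 1 < 2 ^ E.w by omega), Nat.lt_succ_iff,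
      ← Nat.le_log_iff_pow_le (by norm_num) (by omega)]
    omega
  · intro i hi h' ⟨b1, b2, b3, b4, b5⟩
    have : 2 ^ (Nat.clog 2 m' + (i + 1)) < 2 ^ E.w := by
      have : 2 ^ (Nat.clog 2 m' + (i + 1)) ≤ 2 ^ Nat.log 2 E.w := Nat.pow_le_pow_right two_pos (by omega)
      omega
    refine WP.time ?_ (WP.seqAsg (2 ^ (Nat.clog 2 m' + (i + 1))) (by simp) ?_ (WP.asg (i + 1) (by simp) ?_
      ⟨by simp, by simp [h4.symm], by simp [h3, h6.symm, b3], by simp [h7.symm, b4], by simpa using b5⟩))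
    · simp
    · simp only [Ex.ev_add, Ex.ev_v, b2]
      rw [← mul_two, ← pow_succ, add_assoc, Nat.mod_eq_of_lt this]
    · simp only [Ex.ev_add, Ex.ev_v, HSt.set_v, h4, if_false, b1, Ex.ev_ofNat, Nat.mod_eq_of_lt hone]
      exact Nat.mod_eq_of_lt (by omega)
  · intro h' ⟨b1, b2, b3, b4, b5⟩
    exact ⟨b3, b1, b5⟩

/-- Storing the parameters. -/
def saveC : Cmd := .st 0 (.v .l) ;; .st 1 (.v .n) ;; .st 2 (.v .ka) ;; .st 3 (.v .ga) ;; .st 4 (.v .mu) ;; .st 5 (.v .w)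

/-- Copying the random words from the inputs with numbers `o`, `o + 1`, … to the table. -/
def tableC (o : ℕ) : Cmd :=
  .x ::= (Ex.v .l + .v .sg + 1 + .v .dl + .v .ib) + (Ex.v .l + 3 + .v .dl) ;;
  .ite true (.v .ga) (.v .x) (.nn ::= (1 : Ex) <<< (Ex.v .x - .v .ga)) (.nn ::= 1) ;;
  .forLt .j .nn (.st (Ex.v .tb + .v .j) (.inp (Ex.v .j + .lit o) 0))

/-- Initialization of the recursive construction. -/
def initC (δ Q σ o : ℕ) : Cmd :=
  .y ::= Ex.v .n + .v .ka + 4 ;; packC .y .mu .ga ;; saveC ;; preludeC δ Q σ ;; tableC o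

theorem initC_wp {p : Par} {E : Env} (hp : p.Ok E) (hpk : p.pack = Pack.std E.w p.m) {h : HSt} (hl : h.v .l = p.l)
    (hn : h.v .n = p.n) (hk : h.v .ka = p.κ) (hw : h.v .w = E.w) {o : ℕ} (ho : o ≤ 31) (hZ : p.Z < 2 ^ E.w) :
    WP E (initC p.δ p.Q p.σ o) h (E.w * 30 + p.tw * 16 + 400) fun h' => Core p E h' ∧ p.Cells E.w h'.m ∧
      h'.v .w = E.w ∧ h'.v .n = p.n ∧ h'.v .ka = p.κ ∧
      (∀ a, 6 ≤ a → h'.m a = if p.tb ≤ a ∧ a < p.tb + p.tw then E.word (o + (a - p.tb)) 0 else h.m a) ∧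
      h'.v .nn = p.tw := by
  have hlw := hp.lw
  have hww : E.w < 2 ^ E.w := Nat.lt_two_pow_self
  have hS := hp.S
  have htop := hp.top
  have htb := hp.tb_lt
  have hone := hp.one_lt
  have hlit := fun n hn => hp.lit (n := n) hn
  have hm : p.m ≤ E.w := hp.fits.word
  have hm' : p.m = p.n + p.κ + 4 := rfl
  have hmu : p.μ = (Pack.std E.w p.m).μ := by rw [← hpk]; rfl
  have hga : p.γ = (Pack.std E.w p.m).γ := by rw [← hpk]; rfl
  have htw : 0 < p.tw := by unfold Par.tw; positivity
  have htb32 : 32 ≤ p.tb := by unfold Par.tb Par.buf; omega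
  refine WP.time ?_ (WP.seqAsg p.m (by simp) (by simp [hn, hk, hlit 4]; exact Nat.mod_eq_of_lt (by omega))
    (WP.seq (T₂ := p.tw * 16 + 350) ((packC_wp (m := .y) (mu := .mu) (ga := .ga) (m' := p.m) (by simp [hw])
    (by omega) (by simp) hm (by omega) (by decide) (by decide) (by decide) (by decide) (by decide) (by decide) (by decide)).framed.post ?_)))
  · simp; omega
  intro h1 ⟨⟨a1, a2, a3⟩, hf1, _⟩
  have v1 : h1.v .l = p.l := by rw [hf1 _ (by decide)]; simp [hl]
  have v2 : h1.v .n = p.n := by rw [hf1 _ (by decide)]; simp [hn]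
  have v3 : h1.v .ka = p.κ := by rw [hf1 _ (by decide)]; simp [hk]
  have v4 : h1.v .w = E.w := by rw [hf1 _ (by decide)]; simp [hw]
  simp only [HSt.set_m] at a3
  have A : WP E saveC h1 30 fun h' => p.Cells E.w h'.m ∧ ∀ a, 6 ≤ a → h'.m a = h.m a := by
    refine WP.time ?_ (WP.seqSt 0 p.l (by simp) (by simp) (by simp) (by omega) (by simp [v1]) (WP.seqSt 1 p.n (by simp) (by simp)
      (by simp [hlit 1]) (by omega) (by simp [v2]) (WP.seqSt 2 p.κ (by simp) (by simp) (by simp [hlit 2]) (by omega) (by simp [v3])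
      (WP.seqSt 3 p.γ (by simp) (by simp) (by simp [hlit 3]) (by omega) (by simp [a2, hga])
      (WP.seqSt 4 p.μ (by simp) (by simp) (by simp [hlit 4]) (by omega) (by simp [a1, hmu])
      (WP.st 5 E.w (by simp) (by simp) (by simp [hlit 5]) (by omega) (by simp [v4]) ?_))))))
    · simp
    · constructor
      · constructor <;> simp [HSt.put_m, Function.update_apply]
      · intro a ha
        simp only [HSt.put_m, Function.update_apply, a3]
        rw [if_neg (by omega), if_neg (by omega), if_neg (by omega), if_neg (by omega), if_neg (by omega), if_neg (by omega)]
  refine WP.time ?_ (WP.seq (T₂ := p.tw * 16 + 310) (A.post fun h2 ⟨b1, b2⟩ => WP.time ?_ (WP.seq (T₂ := p.tw * 16 + 60)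
    ((preludeC_wp hp b1).post fun h3 ⟨c1, c2, c3, c4, c5, c6, c7, c8⟩ => ?_))))
  · omega
  · omega
  have hZe : p.Z = p.l + p.σ + 1 + p.δ + p.ib + (p.l + 3 + p.δ) := rfl
  have fin : ∀ h' : HSt, h'.m = h3.m → (∀ z ∉ [Var.x, .nn], h'.v z = h3.v z) → h'.v .nn = p.tw →
      WP E (.forLt .j .nn (.st (Ex.v .tb + .v .j) (.inp (Ex.v .j + .lit o) 0))) h' (p.tw * 16 + 5) fun h' =>
      Core p E h' ∧ p.Cells E.w h'.m ∧
      h'.v .w = E.w ∧ h'.v .n = p.n ∧ h'.v .ka = p.κ ∧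
      (∀ a, 6 ≤ a → h'.m a = if p.tb ≤ a ∧ a < p.tb + p.tw then E.word (o + (a - p.tb)) 0 else h.m a) ∧
      h'.v .nn = p.tw := by
    intro h4 d1 d2 d3
    refine WP.forLt p.tw 9 (fun j h' => p.Cells E.w h'.m ∧
      ∀ a, 6 ≤ a → h'.m a = if p.tb ≤ a ∧ a < p.tb + j then E.word (o + (a - p.tb)) 0 else h.m a) hone (by omega) d3
      (by decide) (by simp [Cmd.wr]) (by simp [Cmd.wr]) ?_ ?_ ?_
    · simp only [HSt.set_m, d1, c2]
      refine ⟨b1, fun a ha => ?_⟩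
      rw [if_neg (by omega), b2 a ha]
    · intro j hj h' ⟨i1, i2⟩ hvj hf _
      have w1 : h'.v .tb = p.tb := by rw [hf _ (by decide) (by simp [Cmd.wr]), d2 _ (by decide), c1.tb]
      refine WP.time ?_ (WP.st (p.tb + j) (E.word (o + j) 0) (by simp) (by simp) ?_ (by omega) ?_ ?_)
      · simp
      · simp [w1, hvj]; exact Nat.mod_eq_of_lt (by omega)
      · simp [hvj, Nat.mod_eq_of_lt (show o < 2 ^ E.w by omega), add_comm j o, Nat.mod_eq_of_lt (show o + j < 2 ^ E.w by omega)]
      · simp only [HSt.set_m]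
        refine ⟨i1.congr fun a ha => ?_, fun a ha => ?_⟩
        · simp only [HSt.put_m, Function.update_apply]
          rw [if_neg (by omega)]
        · simp only [HSt.put_m, Function.update_apply]
          by_cases hh : a = p.tb + j
          · rw [if_pos hh, if_pos (by omega)]
            congr 1; omega
          · rw [if_neg hh, i2 a ha]
            refine if_congr ?_ rfl rfl
            omega
    · intro h' ⟨i1, i2⟩ _ hf _
      have hf' : ∀ z ∉ [Var.x, .nn, .j], h'.v z = h3.v z := fun z hz => by
        simp at hz
        rw [hf z (by tauto) (by simp [Cmd.wr]), d2 z (by simp; tauto)]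
      refine ⟨c1.congr fun x hx => hf' x (by revert hx; cases x <;> decide), i1, ?_, ?_, ?_, i2, ?_⟩
      · rw [hf' _ (by decide), c6]
      · rw [hf' _ (by decide), c7]
      · rw [hf' _ (by decide), c8]
      · rw [hf _ (by decide) (by simp [Cmd.wr]), d3]
  have hpw : ∀ k < E.w, 2 ^ k < 2 ^ E.w := fun k hk => Nat.pow_lt_pow_right (by norm_num) hk
  refine WP.time ?_ (WP.seqAsg p.Z (by simp) ?_ (WP.seq (T₂ := p.tw * 16 + 5) (WP.ite (T := 12) (by simp) (by simp) ?_ ?_)))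
  · simp; omega
  · simp [c1.l, c1.sg, c1.dl, c1.ib, hlit 1, hlit 3]
    rw [← hZe]; exact Nat.mod_eq_of_lt hZ
  · intro hcond
    simp [condHolds, c1.ga] at hcond
    have htw' : p.tw < 2 ^ E.w := by omega
    refine WP.time ?_ (WP.asg p.tw (by simp) ?_ (fin _ ?_ ?_ ?_))
    · simp
    · rw [Ex.ev_shl, Ex.ev_sub_of_le (x := p.Z) (y := p.γ) (by simp) (by simp [c1.ga]) hZ hcond.le]
      simp [hlit 1]; exact Nat.mod_eq_of_lt htw'
    · simp
    · intro z hz; simp at hz; simp [hz]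
    · simp
  · intro hcond
    simp [condHolds, c1.ga] at hcond
    refine WP.time ?_ (WP.asg p.tw (by simp) ?_ (fin _ ?_ ?_ ?_))
    · simp
    · simp [hlit 1]; unfold Par.tw; rw [show p.Z - p.γ = 0 by omega, pow_zero]
    · simp
    · intro z hz; simp at hz; simp [hz]
    · simp

end WordRAM

namespace WordRAM

/-! ### The data structure for the recursive construction -/

/-- Initialization for keys given character by character. -/
def buildC (δ Q σ : ℕ) : Cmd :=
  .l ::= .inp 0 0 ;; .n ::= .inp 1 0 ;; .ka ::= .inp 2 0 ;; widthC ;; initC δ Q σ 3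

/-- Output of an array of characters. -/
def outC : Cmd := .nn ::= (1 : Ex) <<< (Ex.v .l + 3) ;; .forLt .z .nn (.out (chrE .cur .ga .gm .mu .mm (Ex.v .z)))

/-- Reading a character from its own input. -/
def readC : Cmd := .al ::= .inp (.v .nu) 0

/-- Evaluation for keys given character by character. -/
def evalC (δ Q σ : ℕ) : Cmd := coreC δ Q σ readC ;; outC

theorem outC_wp {p : Par} {E : Env} (hp : p.Ok E) {h : HSt} (hc : Core p E h) (hl : LBuf p h) :
    WP E outC h (2 ^ (p.l + 3) * 23 + 15) fun h' => h'.m = h.m ∧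
      h'.o = h.o ++ (List.range (2 ^ (p.l + 3))).map (p.pack.chr h.m (h.v .cur)) := by
  obtain ⟨b1, b2, b3, b4, b5⟩ := hl.bounds
  have hS := hp.S
  have htop := hp.top
  have hlw := hp.lw
  have hww : E.w < 2 ^ E.w := Nat.lt_two_pow_self
  have hb2 := p.buf_le (i := 2) (j := 4) (by norm_num)
  change _ ≤ p.tb at hb2
  have htb := hp.tb_lt
  have hE : p.E = p.l + 3 + p.δ := rfl
  have hlE : 2 ^ (p.l + 3) ≤ 2 ^ p.E := Nat.pow_le_pow_right two_pos (by omega)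
  have hEw : 2 ^ p.E < 2 ^ E.w := Nat.pow_lt_pow_right (by norm_num) (by omega)
  refine WP.time ?_ (WP.seqAsg (2 ^ (p.l + 3)) (by simp) ?_ (WP.forLt (2 ^ (p.l + 3)) 16 (fun z h' => h'.m = h.m ∧
      h'.o = h.o ++ (List.range z).map (p.pack.chr h.m (h.v .cur))) hp.one_lt (by omega) (by simp) (by decide) (by decide)
      (by decide) ?_ ?_ ?_))
  · simp; omega
  · simp [hc.l, hp.lit (n := 3), hp.lit (n := 1), Nat.mod_eq_of_lt (show p.l + 3 < 2 ^ E.w by omega)]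
    exact Nat.mod_eq_of_lt (by omega)
  · simp
  · intro z hz h' ⟨i1, i2⟩ hvz hf _
    have hc' : Core p E h' := hc.congr fun x hx => by
      rw [hf x (fun hx' => by subst hx'; revert hx; decide) (fun hx' => by revert hx hx'; cases x <;> decide)]
      revert hx; cases x <;> simp [coreVars]
    have v1 : h'.v .cur = h.v .cur := by rw [hf _ (by decide) (by decide)]; simp
    have hz' := p.chr_addr (show z < 2 ^ p.E by omega) le_rfl
    have hpg : p.pack.γ = p.γ := rfl
    refine WP.time ?_ (WP.out (p.pack.chr h.m (h.v .cur) z) ?_ ?_ ⟨by simpa using i1, ?_⟩)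
    · simp [chrE]
    · exact chrE_ok (pk := p.pack) (B := h.v .cur) (z' := z) v1 (by simp [hc'.ga]; rfl) (by simp) (by simp [hvz]) (by rw [hpg]; omega) hS
    · rw [chrE_ev hp.fits hww (B := h.v .cur) (k := p.m) (z' := z) v1
        (by simp [hc'.ga]; rfl) (by simp [hc'.gm]; rfl) (by simp [hc'.mu]; rfl) (by simp [hc'.mm]) le_rfl (by simp [hvz])
        (by rw [hpg]; omega), i1]
      exact Nat.mod_eq_of_lt (Pack.chr_lt _ _ _ _)
    · simp [i2, List.range_succ]
  · intro h' hI _ _ _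
    exact hI

theorem evalC_wp {p : Par} {E : Env} (hp : p.Ok E) {h : HSt} (hcl : p.Cells E.w h.m)
    {tab : ℕ → ℕ} (ht : p.TabOk tab h.m) {x : ℕ → ℕ} (hx : ∀ ν < 2 ^ p.l, E.word ν 0 = x ν ∧ x ν < 2 ^ p.m) :
    WP E (evalC p.δ p.Q p.σ) h (p.coreT 10 + (2 ^ (p.l + 3) * 23 + 15)) fun h' =>
      p.Keep h.m h'.m ∧ h'.o = h.o ++ (List.range (2 ^ (p.l + 3))).map (p.lev tab p.l x) := by
  have hrd : Reads p E readC 10 x (fun _ => 0) (fun _ => 0) := by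
    refine ⟨?_, by decide, rfl, rfl, rfl, fun ν hν => (hx ν hν).2⟩
    intro ν hν h hc _ _ hnu hva hbo
    exact WP.time (by simp) (WP.asg (x ν) (by simp) (by simp [hnu, (hx ν hν).1]) ⟨rfl, by simp, by simpa using hva, by simpa using hbo⟩)
  refine WP.seq ((coreC_wp hp hcl ht hrd).framed.post ?_)
  intro h1 ⟨⟨a1, a2, a3, a4, _⟩, _, ho⟩
  refine (outC_wp hp a1 a2).post fun h2 ⟨b1, b2⟩ => ⟨fun a ha => by rw [b1, a4 a ha], ?_⟩
  rw [b2, ho rfl]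
  congr 1
  exact List.map_congr_left fun z hz => a3 z (List.mem_range.1 hz)

theorem buildC_wp {p : Par} {E : Env} (hp : p.Ok E) (hpk : p.pack = Pack.std E.w p.m) {h : HSt}
    (hl : E.word 0 0 = p.l) (hn : E.word 1 0 = p.n) (hk : E.word 2 0 = p.κ) (hZ : p.Z < 2 ^ E.w) :
    WP E (buildC p.δ p.Q p.σ) h (E.w * 41 + p.tw * 16 + 450) fun h' => p.Cells E.w h'.m ∧
      ∀ a, p.tb ≤ a → a < p.tb + p.tw → h'.m a = E.word (3 + (a - p.tb)) 0 := by
  have hlw := hp.lw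
  have htb32 : 32 ≤ p.tb := by unfold Par.tb Par.buf; omega
  refine WP.time ?_ (WP.seqAsg p.l (by simp) (by simp [hl]) (WP.seqAsg p.n (by simp) (by simp [hp.lit (n := 1), hn])
    (WP.seqAsg p.κ (by simp) (by simp [hp.lit (n := 2), hk]) (WP.seq (T₂ := E.w * 30 + p.tw * 16 + 400)
    ((widthC_wp (by omega) _).framed.post ?_)))))
  · simp; omega
  · intro h1 ⟨⟨a1, a2⟩, hf, _⟩
    refine (initC_wp hp hpk ?_ ?_ ?_ a1 (by norm_num) hZ).post ?_
    · rw [hf _ (by decide)]; simp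
    · rw [hf _ (by decide)]; simp
    · rw [hf _ (by decide)]; simp
    · intro h2 ⟨_, b2, _, _, _, b6, _⟩
      refine ⟨b2, fun a h3 h4 => ?_⟩
      rw [b6 a (by omega), if_pos ⟨h3, h4⟩]

end WordRAM

namespace WordRAM

/-! ### The data structure for functions that are sums of table entries -/

/-- Parameters for a table of numbers of `nr` words. -/
structure VPar extends Par where
  (nr σr γr μr mr : ℕ)

namespace VPar
variable (q : VPar)
/-- the format of the table -/
def rp : Pack := ⟨q.γr, q.μr, q.mr⟩
/-- address of the modulus -/
def rb : ℕ := q.tb + q.tw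
/-- address of the accumulator -/
def ab : ℕ := q.rb + 2 ^ q.σr
/-- address of the table of numbers -/
def vb : ℕ := q.ab + 2 ^ q.σr
/-- logarithm of the number of characters of the table of numbers -/
def vz : ℕ := q.l + 3 + q.m + q.σr
/-- number of words of the table of numbers -/
def vw : ℕ := 2 ^ (q.vz - q.γr)
end VPar

/-- The parameters fit the environment. -/
structure VPar.Ok (q : VPar) (E : Env) : Prop where
  par : q.toPar.Ok E
  fits : q.rp.Fits E.w
  pos : 0 < q.nr
  le : q.nr ≤ 2 ^ q.σr
  top : q.vb + q.vw ≤ E.S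
  vz : q.vz < E.w
  sh : q.γr + q.μr < E.w

/-- The cells that hold the parameters. -/
structure VPar.Cells (q : VPar) (mem : ℕ → ℕ) : Prop where
  nr : mem 6 = q.nr
  sr : mem 7 = q.σr
  rg : mem 8 = q.γr
  vp : mem 9 = q.μr
  rm : mem 10 = q.mr
  rb : mem 11 = q.rb
  ab : mem 12 = q.ab
  vb : mem 13 = q.vb

theorem VPar.Cells.congr {q : VPar} {mem mem' : ℕ → ℕ} (h : q.Cells mem) (hm : ∀ a, 6 ≤ a → a < 14 → mem' a = mem a) :
    q.Cells mem' :=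
  ⟨(hm 6 (by norm_num) (by norm_num)).trans h.nr, (hm 7 (by norm_num) (by norm_num)).trans h.sr,
    (hm 8 (by norm_num) (by norm_num)).trans h.rg, (hm 9 (by norm_num) (by norm_num)).trans h.vp,
    (hm 10 (by norm_num) (by norm_num)).trans h.rm, (hm 11 (by norm_num) (by norm_num)).trans h.rb,
    (hm 12 (by norm_num) (by norm_num)).trans h.ab, (hm 13 (by norm_num) (by norm_num)).trans h.vb⟩

/-- The variables that hold the parameters. -/
structure VCore (q : VPar) (s : HSt) : Prop where
  nr : s.v .nr = q.nr
  sr : s.v .sr = q.σr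
  rg : s.v .rg = q.γr
  vp : s.v .vp = q.μr
  rmm : s.v .rmm = 2 ^ q.mr - 1
  rgm : s.v .rgm = 2 ^ q.γr - 1
  rb : s.v .rb = q.rb
  ab : s.v .ab = q.ab
  vb : s.v .vb = q.vb
  k : s.v .k = q.m

def vcoreVars : List Var := [.nr, .sr, .rg, .vp, .rmm, .rgm, .rb, .ab, .vb, .k]

theorem VCore.congr {q : VPar} {h h' : HSt} (c : VCore q h) (hh : ∀ x ∈ vcoreVars, h'.v x = h.v x) : VCore q h' := by
  simp only [vcoreVars, List.forall_mem_cons, List.not_mem_nil, false_imp_iff, implies_true, and_true] at hh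
  obtain ⟨h1, h2, h3, h4, h5, h6, h7, h8, h9, h10⟩ := hh
  exact ⟨h1.trans c.1, h2.trans c.2, h3.trans c.3, h4.trans c.4, h5.trans c.5, h6.trans c.6,
    h7.trans c.7, h8.trans c.8, h9.trans c.9, h10.trans c.10⟩

/-- Loading the parameters. -/
def loadRC : Cmd :=
  .nr ::= .ld 6 ;; .sr ::= .ld 7 ;; .rg ::= .ld 8 ;; .vp ::= .ld 9 ;; .rm ::= .ld 10 ;;
  .rb ::= .ld 11 ;; .ab ::= .ld 12 ;; .vb ::= .ld 13 ;;
  .rmm ::= ((1 : Ex) <<< Ex.v .rm) - 1 ;; .rgm ::= ((1 : Ex) <<< Ex.v .rg) - 1 ;; .k ::= Ex.v .n + .v .ka + 4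

theorem loadRC_wp {q : VPar} {E : Env} (hq : q.Ok E) {h : HSt} (hc : q.Cells h.m) (hn : h.v .n = q.n) (hk : h.v .ka = q.κ) :
    WP E loadRC h 60 fun h' => VCore q h' ∧ h'.m = h.m := by
  have hlw := hq.par.lw
  have hww : E.w < 2 ^ E.w := Nat.lt_two_pow_self
  have hone := hq.par.one_lt
  have htop := hq.par.top
  have htb : 32 ≤ q.tb := by unfold Par.tb Par.buf; omega
  have hsh := hq.sh
  have hlit := fun n hn => hq.par.lit (n := n) hn
  have hm : q.n + q.κ + 4 ≤ E.w := hq.par.fits.word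
  refine WP.time ?_ (WP.seqAsg q.nr ?_ ?_ (WP.seqAsg q.σr ?_ ?_ (WP.seqAsg q.γr ?_ ?_ (WP.seqAsg q.μr ?_ ?_
    (WP.seqAsg q.mr ?_ ?_ (WP.seqAsg q.rb ?_ ?_ (WP.seqAsg q.ab ?_ ?_ (WP.seqAsg q.vb ?_ ?_
    (WP.seqAsg (2 ^ q.mr - 1) ?_ (Ex.ev_ones (k := q.mr) ?_ hq.fits.word hone)
    (WP.seqAsg (2 ^ q.γr - 1) ?_ (Ex.ev_ones (k := q.γr) ?_ (by omega) hone) (WP.asg q.m ?_ ?_ ?_)))))))))))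
  · simp
  any_goals first
    | (simp [hlit]; omega)
    | simp [hlit, hc.nr, hc.sr, hc.rg, hc.vp, hc.rm, hc.rb, hc.ab, hc.vb]
  · simp [hlit, hn, hk]; exact Nat.mod_eq_of_lt (by omega)
  · constructor <;> simp

/-- The value of the digits at the addresses from `B` on. -/
def digs (w : ℕ) (m : ℕ → ℕ) (B n : ℕ) : ℕ := ∑ i ∈ Finset.range n, m (B + i) * 2 ^ (w * i)

theorem digs_lt {w : ℕ} {m : ℕ → ℕ} {B n : ℕ} (h : ∀ i < n, m (B + i) < 2 ^ w) : digs w m B n < 2 ^ (w * n) := by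
  induction n with
  | zero => simp [digs]
  | succ n ih =>
    have h1 := ih fun i hi => h i (by omega)
    have h2 : (m (B + n) + 1) * 2 ^ (w * n) ≤ 2 ^ w * 2 ^ (w * n) := Nat.mul_le_mul_right _ (h n (by omega))
    unfold digs at h1 ⊢
    rw [Finset.sum_range_succ, mul_add, mul_one, pow_add, mul_comm (2 ^ (w * n))]
    rw [add_mul] at h2
    omega

theorem digs_congr {w : ℕ} {m m' : ℕ → ℕ} {B n : ℕ} (h : ∀ i < n, m' (B + i) = m (B + i)) :
    digs w m' B n = digs w m B n :=
  Finset.sum_congr rfl fun i hi => by rw [h i (Finset.mem_range.1 hi)]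

/-- Subtracting a number given by the expressions `e` for its digits from the accumulator. -/
def subC (e : Ex) : Cmd :=
  .g ::= 0 ;;
  .forLt .q .nr (
    .be ::= e ;; .al ::= .ld (Ex.v .ab + .v .q) ;;
    .row ::= Ex.v .al - .v .be ;; .ch ::= Ex.v .row - .v .g ;;
    .ite true (.v .al) (.v .be) (.s ::= 1) (.ite true (.v .row) (.v .g) (.s ::= 1) (.s ::= 0)) ;;
    .st (Ex.v .ab + .v .q) (.v .ch) ;; .g ::= .v .s)

/-- Adding the modulus to the accumulator. -/
def addC : Cmd :=
  .g ::= 0 ;;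
  .forLt .q .nr (
    .be ::= .ld (Ex.v .rb + .v .q) ;; .al ::= .ld (Ex.v .ab + .v .q) ;;
    .row ::= Ex.v .al + .v .be ;; .ch ::= Ex.v .row + .v .g ;;
    .ite true (.v .row) (.v .al) (.s ::= 1) (.ite true (.v .ch) (.v .row) (.s ::= 1) (.s ::= 0)) ;;
    .st (Ex.v .ab + .v .q) (.v .ch) ;; .g ::= .v .s)

/-- The memory agrees except for the accumulator. -/
def VPar.KeepA (q : VPar) (m m' : ℕ → ℕ) : Prop := ∀ a, a < q.ab ∨ q.ab + q.nr ≤ a → m' a = m a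

theorem wp_ite_flag {E : Env} {h : HSt} {a b c d : Ex} {x : Var} {Q : HSt → Prop} (hw : 1 < 2 ^ E.w) (ha : a.ok E h) (hb : b.ok E h)
    (hc : c.ok E h) (hd : d.ok E h)
    (hQ : ∀ s, s = (if a.ev E h < b.ev E h ∨ c.ev E h < d.ev E h then 1 else 0) → Q (h.set x s)) :
    WP E (.ite true a b (.asg x 1) (.ite true c d (.asg x 1) (.asg x 0))) h
      (a.cost + b.cost + 1 + (c.cost + d.cost + 1 + 2)) Q := by
  refine WP.ite ha hb (fun h1 => ?_) (fun h1 => ?_)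
  · refine WP.time ?_ (WP.asg 1 (by simp) (by simp [Nat.mod_eq_of_lt hw]) (hQ 1 ?_))
    · simp
    · simp [condHolds] at h1
      simp [h1]
  · refine WP.ite hc hd (fun h2 => ?_) (fun h2 => ?_)
    · refine WP.time ?_ (WP.asg 1 (by simp) (by simp [Nat.mod_eq_of_lt hw]) (hQ 1 ?_))
      · simp
      · simp [condHolds] at h2
        simp [h2]
    · refine WP.time ?_ (WP.asg 0 (by simp) (by simp) (hQ 0 ?_))
      · simp
      · simp [condHolds] at h1 h2
        rw [if_neg]; omega

theorem VPar.addrs {q : VPar} {E : Env} (hq : q.Ok E) : q.rb + q.nr ≤ q.ab ∧ q.ab + q.nr ≤ q.vb ∧ q.vb < E.S ∧ 32 ≤ q.tb ∧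
    q.tb < q.rb := by
  have h1 := hq.top
  have h2 := hq.le
  have h3 : 0 < q.vw := by unfold VPar.vw; positivity
  have h4 : 0 < q.tw := by unfold Par.tw; positivity
  have h5 : 32 ≤ q.tb := by unfold Par.tb Par.buf; omega
  have e1 : q.ab = q.rb + 2 ^ q.σr := rfl
  have e2 : q.vb = q.ab + 2 ^ q.σr := rfl
  have e3 : q.rb = q.tb + q.tw := rfl
  omega

theorem subC_wp {q : VPar} {E : Env} (hq : q.Ok E) {h : HSt} (hc : VCore q h) {e : Ex} {d : ℕ → ℕ}
    (hA : ∀ i < q.nr, h.m (q.ab + i) < 2 ^ E.w) (hd : ∀ i < q.nr, d i < 2 ^ E.w)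
    (he : ∀ i < q.nr, ∀ h' : HSt, h'.v .q = i → (∀ z ∉ [Var.g, .q, .be, .al, .row, .ch, .s], h'.v z = h.v z) → q.KeepA h.m h'.m →
      e.ok E h' ∧ e.ev E h' = d i) :
    WP E (subC e) h (q.nr * (e.cost + 60) + 10) fun h' => q.KeepA h.m h'.m ∧ (∀ i < q.nr, h'.m (q.ab + i) < 2 ^ E.w) ∧
      h'.v .g ≤ 1 ∧ digs E.w h.m q.ab q.nr + h'.v .g * 2 ^ (E.w * q.nr) =
        (∑ i ∈ Finset.range q.nr, d i * 2 ^ (E.w * i)) + digs E.w h'.m q.ab q.nr := by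
  have hone := hq.par.one_lt
  obtain ⟨h1, h2, h3, h4, h5⟩ := VPar.addrs hq
  have hS := hq.par.S
  refine WP.time ?_ (WP.seqAsg 0 (by simp) (by simp) (WP.forLt q.nr (e.cost + 35) (fun i h' => q.KeepA h.m h'.m ∧
    (∀ j < q.nr, h'.m (q.ab + j) < 2 ^ E.w) ∧ (∀ j < q.nr, i ≤ j → h'.m (q.ab + j) = h.m (q.ab + j)) ∧
      h'.v .g ≤ 1 ∧ digs E.w h.m q.ab i + h'.v .g * 2 ^ (E.w * i) =
        (∑ j ∈ Finset.range i, d j * 2 ^ (E.w * j)) + digs E.w h'.m q.ab i) hone (by omega) (by simp [hc.nr]) (by decide)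
        (by simp [Cmd.wr]) (by simp [Cmd.wr]) ?_ ?_ ?_))
  · have : q.nr * (e.cost + 35 + 7) ≤ q.nr * (e.cost + 60) := Nat.mul_le_mul_left _ (by omega)
    simp; omega
  · refine ⟨fun a _ => rfl, hA, fun _ _ _ => rfl, by simp, by simp [digs]⟩
  · intro i hi h' ⟨i1, i2, i3, i4, i5⟩ hvi hf _
    have hf' : ∀ z ∉ [Var.g, .q, .be, .al, .row, .ch, .s], h'.v z = h.v z := fun z hz => by
      simp at hz
      rw [hf z (by tauto) (by simp [Cmd.wr]; tauto)]; simp; tauto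
    have hc' : VCore q h' := hc.congr fun x hx => hf' x (by revert hx; cases x <;> decide)
    obtain ⟨he1, he2⟩ := he i hi h' hvi hf' i1
    have ha := i2 i hi
    have hd' := hd i hi
    set α := h'.m (q.ab + i) with hα
    have hw1 : (q.ab + i) % 2 ^ E.w = q.ab + i := Nat.mod_eq_of_lt (by omega)
    refine WP.time ?_ (WP.seqAsg (d i) he1 he2 (WP.seqAsg α ?_ ?_
      (WP.seqAsg ((2 ^ E.w - d i + α) % 2 ^ E.w) (by simp) (by simp)
      (WP.seqAsg ((2 ^ E.w - h'.v .g + (2 ^ E.w - d i + α) % 2 ^ E.w) % 2 ^ E.w) (by simp) (by simp)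
      (WP.seq (T₂ := 10) (wp_ite_flag hone (by simp) (by simp) (by simp) (by simp) (fun s hs => WP.time ?_ (WP.seqSt (q.ab + i)
        ((2 ^ E.w - h'.v .g + (2 ^ E.w - d i + α) % 2 ^ E.w) % 2 ^ E.w) (by simp) (by simp) ?_ (by omega) (by simp)
        (WP.asg s (by simp) (by simp) ?_)))))))))
    · simp
    · simp [hc'.ab, hvi, hw1]; omega
    · simp [hc'.ab, hvi, hw1, hα]
    · simp
    · simp [hc'.ab, hvi, hw1]
    · simp only [Ex.ev_v, HSt.set_v, reduceCtorEq, if_true, if_false] at hs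
      set β := (2 ^ E.w - h'.v .g + (2 ^ E.w - d i + α) % 2 ^ E.w) % 2 ^ E.w with hβ
      have key : s ≤ 1 ∧ β < 2 ^ E.w ∧ α + s * 2 ^ E.w = d i + h'.v .g + β := by
        refine ⟨by rw [hs]; split_ifs <;> omega, Nat.mod_lt _ (by omega), ?_⟩
        rcases lt_or_ge α (d i) with hlt | hge
        · rw [Nat.mod_eq_of_lt (show 2 ^ E.w - d i + α < 2 ^ E.w by omega)] at hβ hs
          rw [if_pos (Or.inl hlt)] at hs
          rw [show 2 ^ E.w - h'.v .g + (2 ^ E.w - d i + α) = 2 ^ E.w + (2 ^ E.w - d i + α - h'.v .g) by omega,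
            Nat.add_mod_left, Nat.mod_eq_of_lt (by omega)] at hβ
          rw [hs]; omega
        · have e1 : (2 ^ E.w - d i + α) % 2 ^ E.w = α - d i := by
            rw [show 2 ^ E.w - d i + α = 2 ^ E.w + (α - d i) by omega, Nat.add_mod_left, Nat.mod_eq_of_lt (by omega)]
          rw [e1] at hβ hs
          by_cases hg : α - d i < h'.v .g
          · rw [if_pos (Or.inr hg)] at hs
            rw [Nat.mod_eq_of_lt (by omega)] at hβ
            rw [hs]; omega
          · rw [if_neg (by omega)] at hs
            rw [show 2 ^ E.w - h'.v .g + (α - d i) = 2 ^ E.w + (α - d i - h'.v .g) by omega, Nat.add_mod_left,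
              Nat.mod_eq_of_lt (by omega)] at hβ
            rw [hs]; omega
      obtain ⟨k1, k2, k3⟩ := key
      clear_value β α
      simp only [HSt.set_m, HSt.put_m, HSt.set_v, HSt.put_v, reduceCtorEq, if_true, if_false]
      refine ⟨fun a ha' => ?_, fun j hj => ?_, fun j hj hij => ?_, k1, ?_⟩
      · rw [Function.update_apply, if_neg (by omega), i1 a ha']
      · rw [Function.update_apply]; split_ifs
        · exact k2
        · exact i2 j hj
      · rw [Function.update_apply, if_neg (by omega), i3 j hj (by omega)]
      · have e1 : digs E.w (Function.update h'.m (q.ab + i) β) q.ab (i + 1) = digs E.w h'.m q.ab i + β * 2 ^ (E.w * i) := by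
          unfold digs
          rw [Finset.sum_range_succ, Function.update_self]
          congr 1
          refine Finset.sum_congr rfl fun j hj => ?_
          rw [Function.update_apply, if_neg]
          have := Finset.mem_range.1 hj; omega
        have e2 : digs E.w h.m q.ab (i + 1) = digs E.w h.m q.ab i + α * 2 ^ (E.w * i) := by
          unfold digs
          rw [Finset.sum_range_succ, hα, i3 i hi le_rfl]
        rw [e1, e2, Finset.sum_range_succ]
        have e3 : s * 2 ^ (E.w * (i + 1)) = s * 2 ^ E.w * 2 ^ (E.w * i) := by rw [mul_add, mul_one, pow_add]; ring
        rw [e3]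
        have e4 : (α + s * 2 ^ E.w) * 2 ^ (E.w * i) = (d i + h'.v .g + β) * 2 ^ (E.w * i) := by rw [k3]
        simp only [add_mul] at e4; linarith
  · intro h' ⟨i1, i2, i3, i4, i5⟩ _ _ _
    exact ⟨i1, i2, i4, i5⟩

theorem addC_wp {q : VPar} {E : Env} (hq : q.Ok E) {h : HSt} (hc : VCore q h)
    (hA : ∀ i < q.nr, h.m (q.ab + i) < 2 ^ E.w) (hR : ∀ i < q.nr, h.m (q.rb + i) < 2 ^ E.w) :
    WP E addC h (q.nr * 60 + 10) fun h' => q.KeepA h.m h'.m ∧ (∀ i < q.nr, h'.m (q.ab + i) < 2 ^ E.w) ∧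
      digs E.w h.m q.ab q.nr + digs E.w h.m q.rb q.nr = h'.v .g * 2 ^ (E.w * q.nr) + digs E.w h'.m q.ab q.nr := by
  have hone := hq.par.one_lt
  obtain ⟨h1, h2, h3, h4, h5⟩ := VPar.addrs hq
  have hS := hq.par.S
  refine WP.time ?_ (WP.seqAsg 0 (by simp) (by simp) (WP.forLt q.nr 45 (fun i h' => q.KeepA h.m h'.m ∧
    (∀ j < q.nr, h'.m (q.ab + j) < 2 ^ E.w) ∧ (∀ j < q.nr, i ≤ j → h'.m (q.ab + j) = h.m (q.ab + j)) ∧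
      h'.v .g ≤ 1 ∧ digs E.w h.m q.ab i + digs E.w h.m q.rb i = h'.v .g * 2 ^ (E.w * i) + digs E.w h'.m q.ab i)
      hone (by omega) (by simp [hc.nr]) (by decide)
        (by simp [Cmd.wr]) (by simp [Cmd.wr]) ?_ ?_ ?_))
  · simp; omega
  · refine ⟨fun a _ => rfl, hA, fun _ _ _ => rfl, by simp, by simp [digs]⟩
  · intro i hi h' ⟨i1, i2, i3, i4, i5⟩ hvi hf _
    have hf' : ∀ z ∉ [Var.g, .q, .be, .al, .row, .ch, .s], h'.v z = h.v z := fun z hz => by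
      simp at hz
      rw [hf z (by tauto) (by simp [Cmd.wr]; tauto)]; simp; tauto
    have hc' : VCore q h' := hc.congr fun x hx => hf' x (by revert hx; cases x <;> decide)
    have ha := i2 i hi
    have hd' := hR i hi
    have hρ : h'.m (q.rb + i) = h.m (q.rb + i) := i1 _ (by omega)
    set ρ := h.m (q.rb + i) with hρ'
    set α := h'.m (q.ab + i) with hα
    have hw1 : (q.ab + i) % 2 ^ E.w = q.ab + i := Nat.mod_eq_of_lt (by omega)
    have hw2 : (q.rb + i) % 2 ^ E.w = q.rb + i := Nat.mod_eq_of_lt (by omega)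
    refine WP.time ?_ (WP.seqAsg ρ ?_ ?_ (WP.seqAsg α ?_ ?_
      (WP.seqAsg ((α + ρ) % 2 ^ E.w) (by simp) (by simp)
      (WP.seqAsg (((α + ρ) % 2 ^ E.w + h'.v .g) % 2 ^ E.w) (by simp) (by simp)
      (WP.seq (T₂ := 10) (wp_ite_flag hone (by simp) (by simp) (by simp) (by simp) (fun s hs => WP.time ?_ (WP.seqSt (q.ab + i)
        (((α + ρ) % 2 ^ E.w + h'.v .g) % 2 ^ E.w) (by simp) (by simp) ?_ (by omega) (by simp)
        (WP.asg s (by simp) (by simp) ?_)))))))))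
    · simp
    · simp [hc'.rb, hvi, hw2]; omega
    · simp [hc'.rb, hvi, hw2, hρ]
    · simp [hc'.ab, hvi, hw1]; omega
    · simp [hc'.ab, hvi, hw1, hα]
    · simp
    · simp [hc'.ab, hvi, hw1]
    · simp only [Ex.ev_v, HSt.set_v, reduceCtorEq, if_true, if_false] at hs
      set β := ((α + ρ) % 2 ^ E.w + h'.v .g) % 2 ^ E.w with hβ
      have key : s ≤ 1 ∧ β < 2 ^ E.w ∧ α + ρ + h'.v .g = s * 2 ^ E.w + β := by
        refine ⟨by rw [hs]; split_ifs <;> omega, Nat.mod_lt _ (by omega), ?_⟩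
        rcases lt_or_ge (α + ρ) (2 ^ E.w) with hlt | hge
        · rw [Nat.mod_eq_of_lt hlt] at hβ hs
          rcases lt_or_ge (α + ρ + h'.v .g) (2 ^ E.w) with hlt' | hge'
          · rw [Nat.mod_eq_of_lt hlt'] at hβ
            rw [if_neg (by omega)] at hs
            rw [hs]; omega
          · rw [show α + ρ + h'.v .g = 2 ^ E.w + (α + ρ + h'.v .g - 2 ^ E.w) by omega, Nat.add_mod_left,
              Nat.mod_eq_of_lt (by omega)] at hβ
            rw [if_pos (by omega)] at hs
            rw [hs]; omega
        · have e1 : (α + ρ) % 2 ^ E.w = α + ρ - 2 ^ E.w := by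
            rw [show α + ρ = 2 ^ E.w + (α + ρ - 2 ^ E.w) by omega, Nat.add_mod_left, Nat.mod_eq_of_lt (by omega)]
            omega
          rw [e1] at hβ hs
          rw [Nat.mod_eq_of_lt (by omega)] at hβ
          rw [if_pos (by omega)] at hs
          rw [hs]; omega
      obtain ⟨k1, k2, k3⟩ := key
      clear_value β α
      simp only [HSt.set_m, HSt.put_m, HSt.set_v, HSt.put_v, reduceCtorEq, if_true, if_false]
      refine ⟨fun a ha' => ?_, fun j hj => ?_, fun j hj hij => ?_, k1, ?_⟩
      · rw [Function.update_apply, if_neg (by omega), i1 a ha']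
      · rw [Function.update_apply]; split_ifs
        · exact k2
        · exact i2 j hj
      · rw [Function.update_apply, if_neg (by omega), i3 j hj (by omega)]
      · have e1 : digs E.w (Function.update h'.m (q.ab + i) β) q.ab (i + 1) = digs E.w h'.m q.ab i + β * 2 ^ (E.w * i) := by
          unfold digs
          rw [Finset.sum_range_succ, Function.update_self]
          congr 1
          refine Finset.sum_congr rfl fun j hj => ?_
          rw [Function.update_apply, if_neg]
          have := Finset.mem_range.1 hj; omega
        have e2 : digs E.w h.m q.ab (i + 1) = digs E.w h.m q.ab i + α * 2 ^ (E.w * i) := by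
          unfold digs
          rw [Finset.sum_range_succ, hα, i3 i hi le_rfl]
        have e5 : digs E.w h.m q.rb (i + 1) = digs E.w h.m q.rb i + ρ * 2 ^ (E.w * i) := by
          unfold digs
          rw [Finset.sum_range_succ]
        rw [e1, e2, e5]
        have e3 : s * 2 ^ (E.w * (i + 1)) = s * 2 ^ E.w * 2 ^ (E.w * i) := by rw [mul_add, mul_one, pow_add]; ring
        rw [e3]
        have e4 : (α + ρ + h'.v .g) * 2 ^ (E.w * i) = (s * 2 ^ E.w + β) * 2 ^ (E.w * i) := by rw [k3]
        simp only [add_mul] at e4; linarith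
  · intro h' ⟨i1, i2, i3, i4, i5⟩ _ _ _
    exact ⟨i1, i2, i5⟩

/-- Subtraction modulo the modulus. -/
def subModC (e : Ex) : Cmd := subC e ;; .ite true 0 (.v .g) addC .skip

theorem subModC_wp {q : VPar} {E : Env} (hq : q.Ok E) {h : HSt} (hc : VCore q h) {e : Ex} {d : ℕ → ℕ} {r : ℕ}
    (hA : ∀ i < q.nr, h.m (q.ab + i) < 2 ^ E.w) (hR : ∀ i < q.nr, h.m (q.rb + i) < 2 ^ E.w) (hd : ∀ i < q.nr, d i < 2 ^ E.w)
    (hr : digs E.w h.m q.rb q.nr = r) (hAr : digs E.w h.m q.ab q.nr < r)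
    (hdr : (∑ i ∈ Finset.range q.nr, d i * 2 ^ (E.w * i)) < r)
    (he : ∀ i < q.nr, ∀ h' : HSt, h'.v .q = i → (∀ z ∉ [Var.g, .q, .be, .al, .row, .ch, .s], h'.v z = h.v z) → q.KeepA h.m h'.m →
      e.ok E h' ∧ e.ev E h' = d i) :
    WP E (subModC e) h (q.nr * (e.cost + 120) + 30) fun h' => q.KeepA h.m h'.m ∧ (∀ i < q.nr, h'.m (q.ab + i) < 2 ^ E.w) ∧
      digs E.w h'.m q.ab q.nr = if (∑ i ∈ Finset.range q.nr, d i * 2 ^ (E.w * i)) ≤ digs E.w h.m q.ab q.nr then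
        digs E.w h.m q.ab q.nr - ∑ i ∈ Finset.range q.nr, d i * 2 ^ (E.w * i)
        else digs E.w h.m q.ab q.nr + r - ∑ i ∈ Finset.range q.nr, d i * 2 ^ (E.w * i) := by
  obtain ⟨h1, h2, h3, h4, h5⟩ := VPar.addrs hq
  have hrlt : r < 2 ^ (E.w * q.nr) := by rw [← hr]; exact digs_lt hR
  refine WP.time ?_ (WP.seq (T₂ := q.nr * 60 + 13) ((subC_wp hq hc hA hd he).framed.post ?_))
  · rw [show q.nr * (e.cost + 120) = q.nr * (e.cost + 60) + q.nr * 60 by ring]; omega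
  intro h' ⟨⟨a1, a2, a3, a4⟩, hf, _⟩
  have hlt' := digs_lt a2
  have hc' : VCore q h' := hc.congr fun x hx => hf x (by
    simp only [subC, Cmd.wr, Cmd.forLt]; revert hx; cases x <;> simp [vcoreVars])
  refine WP.time ?_ (WP.ite (T := q.nr * 60 + 10) (by simp) (by simp) (fun hcond => ?_) (fun hcond => ?_))
  · simp; omega
  · simp [condHolds] at hcond
    have hg : h'.v .g = 1 := by omega
    rw [hg, one_mul] at a4
    have hrb : ∀ i < q.nr, h'.m (q.rb + i) = h.m (q.rb + i) := fun i hi => a1 _ (by omega)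
    refine (addC_wp hq hc' a2 (fun i hi => by rw [hrb i hi]; exact hR i hi)).post fun h'' ⟨b1, b2, b3⟩ => ?_
    refine ⟨fun a ha => (b1 a ha).trans (a1 a ha), b2, ?_⟩
    rw [digs_congr hrb, hr] at b3
    have hlt'' := digs_lt b2
    have hne : h''.v .g = 1 := by
      rcases Nat.lt_trichotomy (h''.v .g) 1 with h0 | h0 | h0
      · have : h''.v .g = 0 := by omega
        rw [this] at b3; omega
      · exact h0
      · have := Nat.mul_le_mul_right (2 ^ (E.w * q.nr)) h0
        omega
    rw [hne, one_mul] at b3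
    rw [if_neg (by omega)]; omega
  · simp [condHolds] at hcond
    rw [hcond, zero_mul, add_zero] at a4
    refine WP.time (by omega) (WP.skip ⟨a1, a2, ?_⟩)
    rw [if_pos (by omega)]; omega

end WordRAM

namespace WordRAM

/-- Reading the next `n` bits of input number 0. -/
def readBitsC : Cmd :=
  .al ::= (((Ex.inp 0 (.v .va)) >>> Ex.v .bo) ||| ((Ex.inp 0 (Ex.v .va + 1)) <<< (Ex.v .w - .v .bo))) &&&
    (((1 : Ex) <<< Ex.v .n) - 1) ;;
  .bo ::= Ex.v .bo + .v .n ;;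
  .ite true (.v .bo) (.v .w) .skip (.bo ::= Ex.v .bo - .v .w ;; .va ::= Ex.v .va + 1)

theorem bits_eq (X w n a b : ℕ) (hb : b < w) (hn : n ≤ w) :
    ((X / 2 ^ (w * a) % 2 ^ w / 2 ^ b) ||| (X / 2 ^ (w * (a + 1)) % 2 ^ w * 2 ^ (w - b) % 2 ^ w)) &&& (2 ^ n - 1) =
      X / 2 ^ (w * a + b) % 2 ^ n := by
  apply Nat.eq_of_testBit_eq
  intro i
  rw [← Nat.shiftLeft_eq (X / 2 ^ (w * (a + 1)) % 2 ^ w)]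
  simp only [Nat.testBit_and, Nat.testBit_or, Nat.testBit_div_two_pow, Nat.testBit_mod_two_pow, Nat.testBit_shiftLeft,
    Nat.testBit_two_pow_sub_one]
  by_cases hi : i < n
  · rcases lt_or_ge (i + b) w with h | h
    · have h1 : ¬ (w - b ≤ i) := by omega
      have h2 : b + i < w := by omega
      simp [hi, h, h1, h2, add_assoc, add_comm, add_left_comm]
    · have h1 : w - b ≤ i := by omega
      have h2 : ¬ (b + i < w) := by omega
      have h3 : i < w := by omega
      have h4 : i - (w - b) < w := by omega
      have h5 : i - (w - b) + w * (a + 1) = i + (w * a + b) := by rw [mul_add, mul_one]; omega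
      simp [hi, h, h1, h2, h3, h4, h5, not_lt.2 h]
  · simp [hi]

theorem readBitsC_reads {p : Par} {E : Env} (hp : p.Ok E) {X : ℕ} (hX : E.inp.getD 0 0 = X) :
    Reads p E readBitsC 60 (fun ν => X / 2 ^ (ν * p.n) % 2 ^ p.n) (fun ν => ν * p.n / E.w) (fun ν => ν * p.n % E.w) := by
  have hlw := hp.lw
  have hww : E.w < 2 ^ E.w := Nat.lt_two_pow_self
  have hone := hp.one_lt
  have hmw : p.n + p.κ + 4 ≤ E.w := hp.fits.word
  have hm' : p.m = p.n + p.κ + 4 := rfl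
  have hidx := hp.idx
  refine ⟨?_, by decide, rfl, by simp, by simp, fun ν _ => (Nat.mod_lt _ (by positivity)).trans_le
    (Nat.pow_le_pow_right two_pos (by omega))⟩
  intro ν hν h hc hw hn hnu hva hbo
  have hb : ν * p.n % E.w < E.w := Nat.mod_lt _ (by omega)
  have hva' : ν * p.n / E.w + 1 < 2 ^ E.w := by
    have h1 : ν * p.n / E.w ≤ ν := by
      refine Nat.div_le_of_le_mul ?_
      rw [mul_comm]; exact Nat.mul_le_mul_right _ (by omega)
    have h2 : 2 ^ p.l < 2 ^ E.w := Nat.pow_lt_pow_right (by norm_num) (by unfold Par.E at hlw; omega)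
    omega
  have hdm := Nat.div_add_mod (ν * p.n) E.w
  have h2w : 2 * E.w ≤ 2 ^ E.w := by
    obtain ⟨c, hc⟩ := Nat.exists_eq_add_of_lt (show 0 < E.w by omega)
    rw [hc, zero_add, pow_succ]
    have : c < 2 ^ c := Nat.lt_two_pow_self
    omega
  have hnw : p.n < E.w := by omega
  have hsucc : (ν + 1) * p.n = ν * p.n + p.n := by ring
  refine WP.time ?_ (WP.seqAsg (X / 2 ^ (ν * p.n) % 2 ^ p.n) (by simp) ?_ (WP.seqAsg (ν * p.n % E.w + p.n) (by simp) ?_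
    (WP.ite (T := 12) (by simp) (by simp) ?_ ?_)))
  · simp
  · rw [Ex.ev_and, Ex.ev_ones (k := p.n) (by simp [hn]) (by omega) hone]
    have e1 : (Ex.v .w - .v .bo).ev E h = E.w - ν * p.n % E.w :=
      Ex.ev_sub_of_le (by simp [hw]) (by simp [hbo]) hww hb.le
    simp only [Ex.ev_or, Ex.ev_shr, Ex.ev_shl, e1, Ex.ev_inp, Ex.ev_ofNat, Nat.zero_mod, Ex.ev_v, hva, hbo, Ex.ev_add,
      Nat.mod_eq_of_lt hone, Nat.mod_eq_of_lt hva', Env.word, hX]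
    rw [bits_eq _ _ _ _ _ hb (by omega), hdm]
  · simp [hbo, hn]; exact Nat.mod_eq_of_lt (by omega)
  · intro hcond
    simp [condHolds, hw] at hcond
    refine WP.time (by omega) (WP.skip ⟨by simp, by simp, ?_, ?_⟩)
    · simp [hva, hsucc, Nat.add_div (show 0 < E.w by omega), Nat.mod_eq_of_lt hnw, Nat.div_eq_of_lt hnw, hcond]
    · simp [hsucc]
      rw [Nat.add_mod_of_add_mod_lt (by rwa [Nat.mod_eq_of_lt hnw]), Nat.mod_eq_of_lt hnw]
  · intro hcond
    simp [condHolds, hw] at hcond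
    refine WP.time ?_ (WP.seqAsg (ν * p.n % E.w + p.n - E.w) (by simp) ?_ (WP.asg (ν * p.n / E.w + 1) (by simp) ?_
      ⟨by simp, by simp, ?_, ?_⟩))
    · simp
    · exact Ex.ev_sub_of_le (by simp) (by simp [hw]) (by omega) (by omega)
    · simp [hva, Nat.mod_eq_of_lt hone]; exact Nat.mod_eq_of_lt hva'
    · simp [hsucc, Nat.add_div (show 0 < E.w by omega), Nat.mod_eq_of_lt hnw, Nat.div_eq_of_lt hnw, hcond]
    · simp only [HSt.set_v, reduceCtorEq, if_true, if_false, hsucc]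
      have := Nat.add_mod_add_of_le_add_mod (a := ν * p.n) (b := p.n) (c := E.w) (by rwa [Nat.mod_eq_of_lt hnw])
      rw [Nat.mod_eq_of_lt hnw] at this
      omega

/-- Negated partial sums modulo `r`. -/
def accF (r : ℕ) (e : ℕ → ℕ) : ℕ → ℕ
  | 0 => 0
  | z + 1 => if e z ≤ accF r e z then accF r e z - e z else accF r e z + r - e z

theorem accF_lt {r : ℕ} {e : ℕ → ℕ} (hr : 0 < r) {z : ℕ} (he : ∀ i < z, e i < r) : accF r e z < r := by
  induction z with
  | zero => exact hr
  | succ z ih =>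
    have h1 := ih fun i hi => he i (by omega)
    have h2 := he z (by omega)
    simp only [accF]
    split_ifs <;> omega

/-- Summation of the table entries of all neighbours of a key. -/
def sumC : Cmd :=
  zeroC .ab .nr ;;
  .nn ::= (1 : Ex) <<< (Ex.v .l + 3) ;;
  .forLt .z .nn (
    .y ::= ((Ex.v .z <<< Ex.v .k) + chrE .cur .ga .gm .mu .mm (Ex.v .z)) <<< Ex.v .sr ;;
    subModC (chrE .vb .rg .rgm .vp .rmm (Ex.v .y + .v .q)))

/-- The table of numbers and the modulus in memory. -/
structure VPar.Tab (q : VPar) (w : ℕ) (V : ℕ → ℕ → ℕ) (R : ℕ → ℕ) (mem : ℕ → ℕ) : Prop where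
  chr : ∀ i < 2 ^ (q.l + 3 + q.m), ∀ j < q.nr, q.rp.chr mem q.vb (i * 2 ^ q.σr + j) = V i j
  R : ∀ j < q.nr, mem (q.rb + j) = R j

theorem VPar.Tab.congr {q : VPar} {w : ℕ} {V : ℕ → ℕ → ℕ} {R mem mem' : ℕ → ℕ} (h : q.Tab w V R mem)
    (h1 : q.rb + q.nr ≤ q.ab) (h2 : q.ab + q.nr ≤ q.vb) (hm : ∀ a, q.rb ≤ a → a < q.ab ∨ q.ab + q.nr ≤ a → mem' a = mem a) :
    q.Tab w V R mem' where
  chr i hi j hj := by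
    rw [← h.chr i hi j hj]
    refine Pack.chr_congr _ (hm _ ?_ ?_)
    · have := Nat.zero_le ((i * 2 ^ q.σr + j) / 2 ^ q.rp.γ); omega
    · have := Nat.zero_le ((i * 2 ^ q.σr + j) / 2 ^ q.rp.γ); omega
  R j hj := by rw [hm _ (by omega) (by omega), h.R j hj]

theorem VPar.vaddr {q : VPar} {i j : ℕ} (hi : i < 2 ^ (q.l + 3 + q.m)) (hj : j < 2 ^ q.σr) :
    i * 2 ^ q.σr + j < 2 ^ q.vz ∧ (i * 2 ^ q.σr + j) / 2 ^ q.γr < q.vw := by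
  have h1 : i * 2 ^ q.σr + j < 2 ^ q.vz := by
    calc i * 2 ^ q.σr + j < (i + 1) * 2 ^ q.σr := by rw [add_mul]; omega
      _ ≤ 2 ^ (q.l + 3 + q.m) * 2 ^ q.σr := Nat.mul_le_mul_right _ hi
      _ = _ := by rw [← pow_add]; rfl
  refine ⟨h1, ?_⟩
  unfold vw
  rw [Nat.div_lt_iff_lt_mul (by positivity), ← pow_add]
  exact h1.trans_le (Nat.pow_le_pow_right two_pos (by omega))

theorem sumC_wp {q : VPar} {E : Env} (hq : q.Ok E) {h : HSt} (hc : Core q.toPar E h) (hv : VCore q h)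
    (hl : LBuf q.toPar h) {V : ℕ → ℕ → ℕ} {R : ℕ → ℕ} (ht : q.Tab E.w V R h.m) {r : ℕ} (hr0 : 0 < r) {s : ℕ → ℕ}
    (hR : ∑ j ∈ Finset.range q.nr, R j * 2 ^ (E.w * j) = r) (hRw : ∀ j < q.nr, R j < 2 ^ E.w)
    (hV : ∀ i < 2 ^ (q.l + 3 + q.m), (∀ j < q.nr, V i j < 2 ^ E.w) ∧
      ∑ j ∈ Finset.range q.nr, V i j * 2 ^ (E.w * j) = s i ∧ s i < r) :
    WP E sumC h (2 ^ (q.l + 3) * (q.nr * 160 + 80) + q.nr * 12 + 25) fun h' => q.KeepA h.m h'.m ∧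
      (∀ i < q.nr, h'.m (q.ab + i) < 2 ^ E.w) ∧ digs E.w h'.m q.ab q.nr =
        accF r (fun z => s (z * 2 ^ q.m + q.pack.chr h.m (h.v .cur) z)) (2 ^ (q.l + 3)) := by
  have hp := hq.par
  obtain ⟨b1, b2, b3, b4, b5⟩ := hl.bounds
  obtain ⟨a1, a2, a3, a4, a5⟩ := VPar.addrs hq
  have hS := hp.S
  have htop := hp.top
  have hlw := hp.lw
  have hone := hp.one_lt
  have hww : E.w < 2 ^ E.w := Nat.lt_two_pow_self
  have hb2 := q.toPar.buf_le (i := 2) (j := 4) (by norm_num)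
  change _ ≤ q.tb at hb2
  have hE : q.E = q.l + 3 + q.δ := rfl
  have hlE : 2 ^ (q.l + 3) ≤ 2 ^ q.E := Nat.pow_le_pow_right two_pos (by omega)
  have hEw : 2 ^ q.E < 2 ^ E.w := Nat.pow_lt_pow_right (by norm_num) (by omega)
  have hvz := hq.vz
  have hvzw : 2 ^ q.vz < 2 ^ E.w := Nat.pow_lt_pow_right (by norm_num) hvz
  have hle := hq.le
  have hvtop := hq.top
  refine WP.time ?_ (WP.seq (T₂ := 2 ^ (q.l + 3) * (q.nr * 160 + 80) + 15)
    ((zeroC_wp hp (b := .ab) (ct := .nr) hv.ab hv.nr (by omega) (by decide) (by decide) (by omega)).framed.post ?_))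
  · omega
  intro h1 ⟨hm1, hf1, _⟩
  have hc1 : Core q.toPar E h1 := hc.congr fun x hx => hf1 x (by revert hx; cases x <;> decide)
  have hv1 : VCore q h1 := hv.congr fun x hx => hf1 x (by revert hx; cases x <;> decide)
  have hk1 : q.KeepA h.m h1.m := fun a ha => by rw [hm1, if_neg (by omega)]
  have hcur : h1.v .cur = h.v .cur := hf1 _ (by decide)
  refine WP.time ?_ (WP.seqAsg (2 ^ (q.l + 3)) (by simp) ?_ (WP.forLt (2 ^ (q.l + 3)) (q.nr * 160 + 70)
    (fun z h' => q.KeepA h.m h'.m ∧ (∀ i < q.nr, h'.m (q.ab + i) < 2 ^ E.w) ∧ digs E.w h'.m q.ab q.nr =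
        accF r (fun z => s (z * 2 ^ q.m + q.pack.chr h.m (h.v .cur) z)) z) hone (by omega) (by simp) (by decide)
        (by decide) (by decide) ?_ ?_ ?_))
  · have : 2 ^ (q.l + 3) * (q.nr * 160 + 70 + 7) ≤ 2 ^ (q.l + 3) * (q.nr * 160 + 80) := Nat.mul_le_mul_left _ (by omega)
    simp; omega
  · simp [hc1.l, hp.lit (n := 3), hp.lit (n := 1), Nat.mod_eq_of_lt (show q.l + 3 < 2 ^ E.w by omega)]
    exact Nat.mod_eq_of_lt (by omega)
  · refine ⟨by simpa using hk1, fun i hi => ?_, ?_⟩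
    · simp only [HSt.set_m]
      rw [hm1, if_pos (by omega)]; omega
    · unfold digs
      refine Finset.sum_eq_zero fun i hi => ?_
      have := Finset.mem_range.1 hi
      simp only [HSt.set_m]
      rw [hm1, if_pos (by omega), zero_mul]
  · intro z hz h' ⟨i1, i2, i3⟩ hvz' hf _
    have hf' : ∀ x, x ≠ .z → x ≠ .nn → x ∉ [Var.y, .g, .q, .be, .al, .row, .ch, .s] → h'.v x = h1.v x := fun x h1 h2 h3 => by
      rw [hf x h1 (by revert h3; cases x <;> decide)]; simp [h2]
    have hc' : Core q.toPar E h' := hc1.congr fun x hx => hf' x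
      (by revert hx; cases x <;> decide) (by revert hx; cases x <;> decide) (by revert hx; cases x <;> decide)
    have hv' : VCore q h' := hv1.congr fun x hx => hf' x
      (by revert hx; cases x <;> decide) (by revert hx; cases x <;> decide) (by revert hx; cases x <;> decide)
    have v1 : h'.v .cur = h.v .cur := by rw [hf' _ (by decide) (by decide) (by decide), hcur]
    have had := q.toPar.chr_addr (show z < 2 ^ q.E by omega) le_rfl
    have hpg : q.pack.γ = q.γ := rfl
    have hrg : q.rp.γ = q.γr := rfl
    set c := q.pack.chr h.m (h.v .cur) z with hcdef
    have hcm : c < 2 ^ q.m := Pack.chr_lt _ _ _ _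
    have hcc : q.pack.chr h'.m (h.v .cur) z = c := by
      refine Pack.chr_congr _ (i1 _ (Or.inl ?_))
      rw [hpg]; omega
    set i := z * 2 ^ q.m + c with hidef
    have hi : i < 2 ^ (q.l + 3 + q.m) := by
      calc i < (z + 1) * 2 ^ q.m := by rw [add_mul]; omega
        _ ≤ 2 ^ (q.l + 3) * 2 ^ q.m := Nat.mul_le_mul_right _ hz
        _ = _ := by rw [← pow_add]
    obtain ⟨d1, d2⟩ := VPar.vaddr (q := q) hi (j := 0) (by positivity)
    rw [add_zero] at d1
    have hii : i ≤ i * 2 ^ q.σr := Nat.le_mul_of_pos_right _ (by positivity)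
    obtain ⟨s1, s2, s3⟩ := hV i hi
    have hAr : digs E.w h'.m q.ab q.nr < r := by
      rw [i3]; refine accF_lt hr0 fun y hy => ?_
      refine (hV _ ?_).2.2
      calc y * 2 ^ q.m + q.pack.chr h.m (h.v .cur) y < (y + 1) * 2 ^ q.m := by
            have : q.pack.chr h.m (h.v .cur) y < 2 ^ q.m := Pack.chr_lt _ _ _ _
            rw [add_mul]; omega
        _ ≤ 2 ^ (q.l + 3) * 2 ^ q.m := Nat.mul_le_mul_right _ (by omega)
        _ = _ := by rw [← pow_add]
    have hRm : ∀ j < q.nr, h'.m (q.rb + j) = R j := fun j hj => by rw [i1 _ (by omega), ht.R j hj]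
    have ecost : (chrE .vb .rg .rgm .vp .rmm (Ex.v .y + .v .q)).cost ≤ 30 := by simp [chrE]
    refine WP.time ?_ (WP.seqAsg (i * 2 ^ q.σr) ?_ ?_ ((subModC_wp hq (d := V i) (r := r) ?_ ?_ ?_ s1 ?_ ?_ ?_ ?_).post ?_))
    · have : q.nr * ((chrE .vb .rg .rgm .vp .rmm (Ex.v .y + .v .q)).cost + 120) ≤ q.nr * 160 :=
        Nat.mul_le_mul_left _ (by omega)
      simp only [Ex.cost_shl, Ex.cost_add, Ex.cost_v] at this ⊢
      simp only [chrE, Ex.cost_and, Ex.cost_shr, Ex.cost_ld, Ex.cost_add, Ex.cost_v, Ex.cost_shl] at this ⊢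
      omega
    · simp only [Ex.ok_shl, Ex.ok_add, Ex.ok_v, true_and, and_true]
      exact chrE_ok (pk := q.pack) (B := h.v .cur) (z' := z) v1 (by simp [hc'.ga]; rfl) (by simp) (by simp [hvz']) (by rw [hpg]; omega) hS
    · rw [Ex.ev_shl, Ex.ev_add, chrE_ev hp.fits hww (B := h.v .cur) (k := q.m) (z' := z) v1
        (by simp [hc'.ga]; rfl) (by simp [hc'.gm]; rfl) (by simp [hc'.mu]; rfl) (by simp [hc'.mm]) le_rfl (by simp [hvz'])
        (by rw [hpg]; omega), hcc, Nat.mod_eq_of_lt hcm]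
      simp only [Ex.ev_shl, Ex.ev_v, hvz', hv'.k, hv'.sr]
      rw [Nat.mod_eq_of_lt (show z * 2 ^ q.m < 2 ^ E.w by omega), ← hidef, Nat.mod_eq_of_lt (show i < 2 ^ E.w by omega),
        Nat.mod_eq_of_lt (by omega)]
    · exact hv'.congr fun x hx => by revert hx; cases x <;> simp [vcoreVars]
    · simpa using i2
    · intro j hj
      simp only [HSt.set_m]
      rw [hRm j hj]; exact hRw j hj
    · rw [← hR]
      exact Finset.sum_congr rfl fun j hj => by simp only [HSt.set_m]; rw [hRm j (Finset.mem_range.1 hj)]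
    · simpa using hAr
    · rw [s2]; exact s3
    · intro j hj h'' hvq hf'' hk''
      simp only [HSt.set_m] at hk''
      have f : ∀ x ∉ [Var.y, .g, .q, .be, .al, .row, .ch, .s], h''.v x = h'.v x := fun x hx => by
        rw [hf'' x (fun hx' => hx (List.mem_cons_of_mem _ hx'))]
        have : x ≠ .y := fun hh => hx (by simp [hh])
        simp [this]
      obtain ⟨d3, d4⟩ := VPar.vaddr (q := q) hi (j := j) (by omega)
      have w1 : h''.v .y = i * 2 ^ q.σr := by rw [hf'' _ (by decide)]; simp
      have hz' : (Ex.v .y + .v .q).ev E h'' = i * 2 ^ q.σr + j := by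
        simp [w1, hvq]; exact Nat.mod_eq_of_lt (by omega)
      have hchr : q.rp.chr h''.m q.vb (i * 2 ^ q.σr + j) = V i j := by
        rw [← ht.chr i hi j hj]
        refine Pack.chr_congr _ ?_
        have h0 := Nat.zero_le ((i * 2 ^ q.σr + j) / 2 ^ q.rp.γ)
        rw [hk'' _ (by omega), i1 _ (by omega)]
      have w2 : h''.v .vb = q.vb := by rw [f _ (by decide), hv'.vb]
      have w3 : h''.v .rg = q.γr := by rw [f _ (by decide), hv'.rg]
      have w4 : h''.v .rgm = 2 ^ q.γr - 1 := by rw [f _ (by decide), hv'.rgm]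
      have w5 : h''.v .vp = q.μr := by rw [f _ (by decide), hv'.vp]
      have w6 : h''.v .rmm = 2 ^ q.mr - 1 := by rw [f _ (by decide), hv'.rmm]
      refine ⟨chrE_ok (pk := q.rp) w2 w3 (by simp) hz' (by rw [hrg]; omega) hS, ?_⟩
      rw [chrE_ev hq.fits hww w2 w3 w4 w5 w6 le_rfl hz' (by rw [hrg]; omega), hchr, ← hchr]
      exact Nat.mod_eq_of_lt (Pack.chr_lt _ _ _ _)
    · intro h'' ⟨k1, k2, k3⟩
      simp only [HSt.set_m] at k1 k2 k3 ⊢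
      refine ⟨fun a ha => (k1 a ha).trans (i1 a ha), k2, ?_⟩
      simp only [s2, i3] at k3
      exact k3
  · intro h' hI _ _ _
    exact hI

/-- Output of the accumulator. -/
def outAccC : Cmd := .forLt .q .nr (.out (.ld (Ex.v .ab + .v .q)))

theorem outAccC_wp {q : VPar} {E : Env} (hq : q.Ok E) {h : HSt} (hv : VCore q h) :
    WP E outAccC h (q.nr * 12 + 5) fun h' => h'.m = h.m ∧ h'.o = h.o ++ (List.range q.nr).map fun j => h.m (q.ab + j) := by
  obtain ⟨a1, a2, a3, a4, a5⟩ := VPar.addrs hq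
  have hS := hq.par.S
  refine WP.forLt q.nr 5 (fun j h' => h'.m = h.m ∧ h'.o = h.o ++ (List.range j).map fun j => h.m (q.ab + j))
    hq.par.one_lt (by omega) hv.nr (by decide) (by decide) (by decide) ?_ ?_ ?_
  · simp
  · intro j hj h' ⟨i1, i2⟩ hvj hf _
    have v1 : h'.v .ab = q.ab := by rw [hf _ (by decide) (by decide), hv.ab]
    have e : (q.ab + j) % 2 ^ E.w = q.ab + j := Nat.mod_eq_of_lt (by omega)
    refine WP.time ?_ (WP.out (h.m (q.ab + j)) ?_ ?_ ⟨by simpa using i1, ?_⟩)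
    · simp
    · simp [v1, hvj, e]; omega
    · simp [v1, hvj, e, i1]
    · simp [i2, List.range_succ]
  · intro h' hI _ _ _
    exact hI

/-- Evaluation of the sum of the table entries of the neighbours of a key. -/
def evalSumC (δ Q σ : ℕ) : Cmd := coreC δ Q σ readBitsC ;; loadRC ;; sumC ;; outAccC

theorem evalSumC_wp {q : VPar} {E : Env} (hq : q.Ok E) {h : HSt} (hcl : q.toPar.Cells E.w h.m) (hvc : q.Cells h.m)
    {tab : ℕ → ℕ} (ht : q.TabOk tab h.m) {X : ℕ} (hX : E.inp.getD 0 0 = X)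
    {V : ℕ → ℕ → ℕ} {R : ℕ → ℕ} (hT : q.Tab E.w V R h.m) {r : ℕ} (hr0 : 0 < r) {s : ℕ → ℕ}
    (hR : ∑ j ∈ Finset.range q.nr, R j * 2 ^ (E.w * j) = r) (hRw : ∀ j < q.nr, R j < 2 ^ E.w)
    (hV : ∀ i < 2 ^ (q.l + 3 + q.m), (∀ j < q.nr, V i j < 2 ^ E.w) ∧
      ∑ j ∈ Finset.range q.nr, V i j * 2 ^ (E.w * j) = s i ∧ s i < r) :
    WP E (evalSumC q.δ q.Q q.σ) h (q.coreT 60 + (60 + ((2 ^ (q.l + 3) * (q.nr * 160 + 80) + q.nr * 12 + 25) + (q.nr * 12 + 5))))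
      fun h' => (∀ a, (a < 32 ∨ q.tb ≤ a) → (a < q.ab ∨ q.ab + q.nr ≤ a) → h'.m a = h.m a) ∧
        ∃ D : ℕ → ℕ, (∀ j < q.nr, D j < 2 ^ E.w) ∧ h'.o = h.o ++ (List.range q.nr).map D ∧
          ∑ j ∈ Finset.range q.nr, D j * 2 ^ (E.w * j) = accF r (fun z => s (z * 2 ^ q.m +
            q.lev tab q.l (fun ν => X / 2 ^ (ν * q.n) % 2 ^ q.n) z)) (2 ^ (q.l + 3)) := by
  obtain ⟨a1, a2, a3, a4, a5⟩ := VPar.addrs hq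
  refine WP.seq ((coreC_wp hq.par hcl ht (readBitsC_reads hq.par hX)).framed.post ?_)
  intro h1 ⟨⟨b1, b2, b3, b4, _, b6, b7⟩, _, ho1⟩
  refine WP.seq ((loadRC_wp hq (hvc.congr fun a ha ha' => b4 a (by omega)) b6 b7).framed.post ?_)
  intro h2 ⟨⟨c1, c2⟩, hf2, ho2⟩
  have hcur : h2.v .cur = h1.v .cur := hf2 _ (by decide)
  refine WP.seq ((sumC_wp hq (b1.congr fun x hx => hf2 x (by revert hx; cases x <;> decide)) c1 ?_
    (hT.congr a1 a2 fun a ha ha' => ?_) hr0 hR hRw hV).framed.post ?_)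
  · simpa [LBuf, hcur, hf2 .nxt (by decide)] using b2
  · rw [c2, b4 a (by omega)]
  intro h3 ⟨⟨d1, d2, d3⟩, hf3, ho3⟩
  refine (outAccC_wp hq (c1.congr fun x hx => hf3 x (by revert hx; cases x <;> decide))).post ?_
  intro h4 ⟨e1, e2⟩
  refine ⟨fun a h5 h6 => by rw [e1, d1 a h6, c2, b4 a h5], fun j => h3.m (q.ab + j), d2, ?_, ?_⟩
  · rw [e2, ho3 rfl, ho2 rfl, ho1 (by rfl)]
  · refine d3.trans ?_
    have : ∀ n ≤ 2 ^ (q.l + 3), accF r (fun z => s (z * 2 ^ q.m + q.pack.chr h2.m (h2.v .cur) z)) n =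
        accF r (fun z => s (z * 2 ^ q.m + q.lev tab q.l (fun ν => X / 2 ^ (ν * q.n) % 2 ^ q.n) z)) n := by
      intro n
      induction n with
      | zero => intro _; rfl
      | succ n ih =>
        intro hn
        simp only [accF, ih (by omega)]
        rw [c2, hcur, b3 n (by omega)]
    exact this _ le_rfl

end WordRAM

namespace WordRAM

theorem size_add_div {X k : ℕ} (h : 2 ^ k ≤ X) : k + Nat.size (X / 2 ^ k) = Nat.size X := by
  apply le_antisymm
  · obtain ⟨j, hj⟩ : ∃ j, Nat.size (X / 2 ^ k) = j + 1 :=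
      Nat.exists_eq_succ_of_ne_zero (Nat.size_pos.2 (Nat.div_pos h (by positivity))).ne'
    have h1 : j < Nat.size (X / 2 ^ k) := by omega
    rw [Nat.lt_size, Nat.le_div_iff_mul_le (by positivity), ← pow_add] at h1
    have := Nat.lt_size.2 h1
    omega
  · rw [Nat.size_le]
    have := Nat.lt_size_self (X / 2 ^ k)
    rw [Nat.div_lt_iff_lt_mul (by positivity), ← pow_add] at this
    rwa [add_comm]

theorem Env.lt_words {E : Env} (hw : 0 < E.w) (i j : ℕ) : j < E.words i ↔ 2 ^ (E.w * j) ≤ E.inp.getD i 0 := by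
  rw [Env.words, Nat.lt_digits_length_iff (Nat.one_lt_two_pow hw.ne'), pow_mul]

/-- Computation of the parameters for the keys. -/
def keyParC : Cmd :=
  widthC ;; .y ::= Ex.len 0 - 1 ;; .lu ::= 0 ;; .forLt .q .y (.lu ::= Ex.v .lu + .v .w) ;; .x ::= .inp 0 (.v .y) ;; sizeC .lu ;;
  .ite false (.v .lu) 1 (.t ::= 1) (.ite false (.len 2) 1
    (.t ::= .inp 2 0 ;; .ite true (.v .lu) (.v .t) (.t ::= .v .lu) .skip) (.t ::= .v .lu)) ;;
  .n ::= 1 ;; .x ::= .v .lu ;; .loop true (.v .t) (Ex.v .x + 1) (.x ::= Ex.v .x - .v .t ;; .n ::= Ex.v .n + 1) ;;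
  clogC .t .l ;; .ka ::= 0 ;; .x ::= .inp 3 0 ;; sizeC .ka

theorem keyParC_wp {E : Env} (hw : 5 ≤ E.w) {h : HSt} {u t k : ℕ} (hu : E.inp.getD 0 0 = u) (ht : E.inp.getD 2 0 = t)
    (hk : E.inp.getD 3 0 = k) (hu0 : 0 < u) (ht0 : 0 < t) (hkw : k < 2 ^ E.w) (hlw : 2 * Nat.size u < 2 ^ E.w)
    (htw : Nat.size u = 1 ∨ E.words 2 < 2 ^ E.w) :
    WP E keyParC h (E.w * 60 + E.words 0 * 12 + Nat.size u / min t (Nat.size u) * 20 + Nat.clog 2 (min t (Nat.size u)) * 11 + 150)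
      fun h' => h'.v .w = E.w ∧ h'.v .n = Nat.size u / min t (Nat.size u) + 1 ∧ h'.v .l = Nat.clog 2 (min t (Nat.size u)) ∧
        h'.v .ka = Nat.size k ∧ h'.m = h.m := by
  have hone : 1 < 2 ^ E.w := Nat.one_lt_two_pow (by omega)
  have hww : E.w < 2 ^ E.w := Nat.lt_two_pow_self
  have hl3 : 3 < 2 ^ E.w := by omega
  set nu := E.words 0 with hnu
  have hnu0 : 0 < nu := (Env.lt_words (by omega) 0 0).2 (by rw [hu]; simp; omega)
  have hle : 2 ^ (E.w * (nu - 1)) ≤ u := by rw [← hu, ← Env.lt_words (by omega)]; omega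
  have hlt : u < 2 ^ (E.w * nu) := by
    rw [← hu, ← not_le, ← Env.lt_words (by omega)]; omega
  have htop : u / 2 ^ (E.w * (nu - 1)) < 2 ^ E.w := by
    rw [Nat.div_lt_iff_lt_mul (by positivity), ← pow_add]
    convert hlt using 2
    obtain ⟨c, hc⟩ := Nat.exists_eq_succ_of_ne_zero hnu0.ne'
    rw [hc]; simp; ring
  have hsz := size_add_div hle
  set ℓ := Nat.size u with hℓ
  have hℓ0 : 0 < ℓ := Nat.size_pos.2 hu0
  have hnul : nu - 1 ≤ ℓ := by
    have : nu - 1 ≤ E.w * (nu - 1) := Nat.le_mul_of_pos_left _ (by omega)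
    omega
  have hword : E.word 0 (nu - 1) = u / 2 ^ (E.w * (nu - 1)) := by
    unfold Env.word; rw [hu, Nat.mod_eq_of_lt htop]
  have hsw : Nat.size (u / 2 ^ (E.w * (nu - 1))) ≤ E.w := Nat.size_le.2 htop
  have hskw : Nat.size k ≤ E.w := Nat.size_le.2 hkw
  set t' := min t ℓ with ht'
  have ht'0 : 0 < t' := lt_min ht0 hℓ0
  have ht'l : t' ≤ ℓ := min_le_right _ _
  refine WP.time ?_ (WP.seq (T₂ := nu * 12 + E.w * 49 + ℓ / t' * 20 + Nat.clog 2 t' * 11 + 143) ((widthC_wp (by omega) h).framed.post ?_))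
  · omega
  intro h1 ⟨⟨a1, a2⟩, _, _⟩
  refine WP.time ?_ (WP.seqAsg (nu - 1) (by simp) ?_ (WP.seqAsg 0 (by simp) (by simp)
    (WP.seq (T₂ := E.w * 49 + ℓ / t' * 20 + Nat.clog 2 t' * 11 + 120) (WP.forLt (nu - 1) 4 (fun i h' => h'.v .lu = E.w * i ∧ h'.m = h.m)
    hone (by omega) (by simp) (by decide) (by decide) (by decide) ?_ ?_ ?_))))
  · simp; omega
  · refine Ex.ev_sub_of_le ?_ (by simp [Nat.mod_eq_of_lt hone]) (by omega) (by omega)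
    change E.words (0 % 2 ^ E.w) % 2 ^ E.w = nu
    rw [Nat.zero_mod, ← hnu, Nat.mod_eq_of_lt (by omega)]
  · simp [a2]
  · intro i hi h' ⟨i1, i2⟩ _ hf _
    have w1 : h'.v .w = E.w := by rw [hf _ (by decide) (by decide)]; simp [a1]
    have e1 : E.w * (i + 1) ≤ E.w * (nu - 1) := Nat.mul_le_mul_left _ hi
    refine WP.time ?_ (WP.asg (E.w * (i + 1)) (by simp) ?_ ?_)
    · simp
    · simp [i1, w1]; rw [← mul_add_one]; exact Nat.mod_eq_of_lt (by omega)
    · simp [i2]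
  intro h2 ⟨b1, b2⟩ _ hf2 _
  have w2 : h2.v .w = E.w := by rw [hf2 _ (by decide) (by decide)]; simp [a1]
  have y2 : h2.v .y = nu - 1 := by rw [hf2 _ (by decide) (by decide)]; simp
  refine WP.time ?_ (WP.seqAsg (u / 2 ^ (E.w * (nu - 1))) (by simp) (by simp [y2, hword])
    (WP.seq (T₂ := E.w * 38 + ℓ / t' * 20 + Nat.clog 2 t' * 11 + 110) ((sizeC_wp (y := .lu) (X := u / 2 ^ (E.w * (nu - 1)))
    (Y := E.w * (nu - 1)) (by decide) (by simp) (by simp [b1]) hone (by omega)).framed.mono (T := Nat.size (u / 2 ^ (E.w * (nu - 1))) * 11 + 3)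
    (T' := E.w * 11 + 3) (by omega) ?_)))
  · simp; omega
  intro h3 ⟨⟨c1, c2⟩, hf3, _⟩
  rw [hsz] at c1
  have w3 : h3.v .w = E.w := by rw [hf3 _ (by decide)]; simp [w2]
  have m3 : h3.m = h.m := by rw [c2]; simp [b2]
  have A : WP E (.ite false (.v .lu) 1 (.t ::= 1) (.ite false (.len 2) 1
      (.t ::= .inp 2 0 ;; .ite true (.v .lu) (.v .t) (.t ::= .v .lu) .skip) (.t ::= .v .lu))) h3 18 fun h' => h' = h3.set .t t' := by
    refine WP.time ?_ (WP.ite (T := 13) (by simp) (by simp) (fun hc => ?_) fun hc => ?_)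
    · simp
    · simp [condHolds, c1, Nat.mod_eq_of_lt hone] at hc
      refine WP.time ?_ (WP.asg t' (by simp) ?_ rfl)
      · simp
      · simp [Nat.mod_eq_of_lt hone]; omega
    · simp [condHolds, c1, Nat.mod_eq_of_lt hone] at hc
      have hwd := htw.resolve_left hc
      have hlen : (Ex.len 2).ev E h3 = E.words 2 := by
        change E.words (2 % 2 ^ E.w) % 2 ^ E.w = _
        rw [Nat.mod_eq_of_lt (show 2 < 2 ^ E.w by omega), Nat.mod_eq_of_lt hwd]
      have hiff : condHolds E h3 false (.len 2) 1 ↔ t < 2 ^ E.w := by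
        simp only [condHolds, hlen, Ex.ev_ofNat, Nat.mod_eq_of_lt hone, Bool.false_eq_true, if_false]
        have h5 := Env.lt_words (E := E) (by omega) 2 0
        have h6 := Env.lt_words (E := E) (by omega) 2 1
        rw [ht] at h5 h6
        simp at h5 h6
        have h5' := h5.2 (by omega)
        rw [← not_le, ← h6]
        omega
      refine WP.time ?_ (WP.ite (T := 9) trivial (by simp) (fun hc2 => ?_) fun hc2 => ?_)
      · simp [Ex.cost]
      · rw [hiff] at hc2
        have hwt : E.word 2 0 = t := by unfold Env.word; rw [ht]; simp [Nat.mod_eq_of_lt hc2]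
        refine WP.time ?_ (WP.seqAsg t (by simp) (by simp [Nat.mod_eq_of_lt (show 2 < 2 ^ E.w by omega), hwt])
          (WP.ite (T := 2) (by simp) (by simp) (fun hc3 => ?_) fun hc3 => ?_))
        · simp
        · simp [condHolds, c1] at hc3
          refine WP.time ?_ (WP.asg t' (by simp) ?_ ?_)
          · simp
          · simp [c1]; omega
          · simp [HSt.set]
        · simp [condHolds, c1] at hc3
          refine WP.time (by omega) (WP.skip ?_)
          rw [show t' = t by omega]
      · rw [hiff] at hc2
        refine WP.time ?_ (WP.asg t' (by simp) ?_ rfl)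
        · simp
        · simp [c1]; omega
  refine WP.time ?_ (WP.seq (T₂ := E.w * 38 + ℓ / t' * 20 + Nat.clog 2 t' * 11 + 90) (A.post ?_))
  · omega
  rintro _ rfl
  have hdm := Nat.div_add_mod ℓ t'
  have B : WP E (.loop true (.v .t) (Ex.v .x + 1) (.x ::= Ex.v .x - .v .t ;; .n ::= Ex.v .n + 1))
      (((h3.set .t t').set .n 1).set .x ℓ) (ℓ / t' * 20 + 10)
      fun h' => h'.v .n = ℓ / t' + 1 ∧ h'.m = h.m ∧ h'.v .w = E.w ∧ h'.v .t = t' := by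
    refine WP.time ?_ (WP.loop (ℓ / t') (fun _ => 8) (fun i h' => h'.v .n = i + 1 ∧ h'.v .x = ℓ - t' * i ∧ h'.m = h.m ∧
      h'.v .w = E.w ∧ h'.v .t = t') ?_ ?_ ?_ ?_)
    · simp; omega
    · simp [m3, w3]
    · intro i hi h' ⟨i1, i2, i3, i4, i5⟩
      refine ⟨by simp, by simp, ?_⟩
      have e1 : t' * i ≤ t' * (ℓ / t') := Nat.mul_le_mul_left _ hi
      simp only [condHolds, if_true, Ex.ev_v, Ex.ev_add, Ex.ev_ofNat, i5, i2, Nat.mod_eq_of_lt hone]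
      rw [Nat.mod_eq_of_lt (by omega)]
      constructor
      · intro h5
        rw [Nat.lt_div_iff_mul_lt ht'0]
        have h6 : t' * i + t' ≤ ℓ := by omega
        have : i * t' + (t' - 1) < ℓ := by rw [mul_comm]; omega
        first | exact this | omega
      · intro h5
        have e2 : t' * (i + 1) ≤ t' * (ℓ / t') := Nat.mul_le_mul_left _ h5
        rw [mul_add, mul_one] at e2
        omega
    · intro i hi h' ⟨i1, i2, i3, i4, i5⟩
      have e2 : t' * (i + 1) ≤ t' * (ℓ / t') := Nat.mul_le_mul_left _ hi
      rw [mul_add, mul_one] at e2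
      have e3 : ℓ / t' ≤ ℓ := Nat.div_le_self _ _
      refine WP.time ?_ (WP.seqAsg (ℓ - t' * i - t') (by simp) (Ex.ev_sub_of_le (by simp [i2]) (by simp [i5]) (by omega) (by omega))
        (WP.asg (i + 2) (by simp) ?_ ?_))
      · simp
      · simp [i1, Nat.mod_eq_of_lt hone]; exact Nat.mod_eq_of_lt (by omega)
      · simp [i3, i4, i5, mul_add]; omega
    · intro h' ⟨i1, i2, i3, i4, i5⟩
      exact ⟨i1, i3, i4, i5⟩
  refine WP.time ?_ (WP.seqAsg 1 (by simp) (by simp [Nat.mod_eq_of_lt hone]) (WP.seqAsg ℓ (by simp) (by simp [c1])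
    (WP.seq (T₂ := E.w * 38 + Nat.clog 2 t' * 11 + 70) (B.post ?_))))
  · simp; omega
  intro h4 ⟨d1, d2, d3, d4⟩
  refine WP.time ?_ (WP.seq (T₂ := E.w * 38 + 60) ((clogC_wp (m := .t) (y := .l) hone d4 ht'0 (by omega) (by decide) (by decide)
    (by decide)).framed.post ?_))
  · omega
  intro h5 ⟨⟨e1, _, e3⟩, hf5, _⟩
  have hk3 : E.word 3 0 = k := by unfold Env.word; rw [hk]; simp [Nat.mod_eq_of_lt hkw]
  refine WP.time ?_ (WP.seqAsg 0 (by simp) (by simp) (WP.seqAsg k (by simp) (by simp [Nat.mod_eq_of_lt hl3, hk3])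
    ((sizeC_wp (y := .ka) (X := k) (Y := 0) (by decide) (by simp) (by simp) hone (by omega)).framed.post ?_)))
  · simp; omega
  intro h6 ⟨⟨g1, g2⟩, hf6, _⟩
  refine ⟨?_, ?_, ?_, by rw [g1, zero_add], ?_⟩
  · rw [hf6 _ (by decide)]; simp; rw [hf5 _ (by decide), d3]
  · rw [hf6 _ (by decide)]; simp; rw [hf5 _ (by decide), d1]
  · rw [hf6 _ (by decide)]; simp [e1]
  · rw [g2]; simp [e3, d2]

/-- Computation of the parameters for the table of numbers, and storage of the modulus. -/
def valParC : Cmd :=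
  .nr ::= .len 1 ;;
  .ite false (.v .nr) 1 (.x ::= .inp 1 0 ;; .rm ::= 0 ;; sizeC .rm) (.rm ::= .v .w) ;;
  packC .rm .vp .rg ;; clogC .nr .sr ;;
  .rb ::= Ex.v .tb + .v .nn ;; .ab ::= Ex.v .rb + ((1 : Ex) <<< Ex.v .sr) ;; .vb ::= Ex.v .ab + ((1 : Ex) <<< Ex.v .sr) ;;
  .st 6 (.v .nr) ;; .st 7 (.v .sr) ;; .st 8 (.v .rg) ;; .st 9 (.v .vp) ;; .st 10 (.v .rm) ;;
  .st 11 (.v .rb) ;; .st 12 (.v .ab) ;; .st 13 (.v .vb) ;;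
  .forLt .q .nr (.st (Ex.v .rb + .v .q) (.inp 1 (.v .q)))

theorem valParC_wp {q : VPar} {E : Env} (hq : q.Ok E) {h : HSt} (hnr : q.nr = E.words 1) (hσ : q.σr = Nat.clog 2 q.nr)
    (hmr : q.mr = if q.nr = 1 then Nat.size (E.word 1 0) else E.w) (hmr0 : 0 < q.mr) (hrp : q.rp = Pack.std E.w q.mr)
    (hw : h.v .w = E.w) (htb : h.v .tb = q.tb) (hnn : h.v .nn = q.tw) :
    WP E valParC h (E.w * 60 + q.nr * 16 + 200) fun h' => q.Cells h'.m ∧ (∀ j < q.nr, h'.m (q.rb + j) = E.word 1 j) ∧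
      ∀ a, (a < 6 ∨ 14 ≤ a) → (a < q.rb ∨ q.rb + q.nr ≤ a) → h'.m a = h.m a := by
  obtain ⟨a1, a2, a3, a4, a5⟩ := VPar.addrs hq
  have hS := hq.par.S
  have hone := hq.par.one_lt
  have hlw := hq.par.lw
  have hww : E.w < 2 ^ E.w := Nat.lt_two_pow_self
  have hlit := fun n hn => hq.par.lit (n := n) hn
  have hpos := hq.pos
  have hle := hq.le
  have hmw : q.mr ≤ E.w := hq.fits.word
  have hμ : q.μr = (Pack.std E.w q.mr).μ := by rw [← hrp]; rfl
  have hγ : q.γr = (Pack.std E.w q.mr).γ := by rw [← hrp]; rfl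
  have e1 : q.ab = q.rb + 2 ^ q.σr := rfl
  have e2 : q.vb = q.ab + 2 ^ q.σr := rfl
  have e3 : q.rb = q.tb + q.tw := rfl
  have hcl : Nat.clog 2 q.nr ≤ E.w := by
    rw [← hσ]
    have := Nat.pow_lt_pow_iff_right (a := 2) (n := q.σr) (m := E.w) (by norm_num)
    exact (this.1 (by omega)).le
  have hlen : (Ex.len 1).ev E h = q.nr := by
    change E.words (1 % 2 ^ E.w) % 2 ^ E.w = _
    rw [Nat.mod_eq_of_lt hone, ← hnr, Nat.mod_eq_of_lt (by omega)]
  have A : WP E (.ite false (.v .nr) 1 (.x ::= .inp 1 0 ;; .rm ::= 0 ;; sizeC .rm) (.rm ::= .v .w)) (h.set .nr q.nr)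
      (E.w * 11 + 20) fun h' => h'.v .rm = q.mr ∧ h'.m = h.m ∧ ∀ z ∉ [Var.x, .rm], h'.v z = (h.set .nr q.nr).v z := by
    refine WP.time ?_ (WP.ite (T := E.w * 11 + 12) (by simp) (by simp) (fun hc => ?_) fun hc => ?_)
    · simp; omega
    · simp [condHolds, hlit 1] at hc
      rw [if_pos hc] at hmr
      refine WP.time ?_ (WP.seqAsg (E.word 1 0) (by simp) (by simp [hlit 1]) (WP.seqAsg 0 (by simp) (by simp)
        ((sizeC_wp (y := .rm) (X := E.word 1 0) (Y := 0) (by decide) (by simp) (by simp) hone (by omega)).framed.post ?_)))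
      · simp; omega
      · intro h1 ⟨⟨b1, b2⟩, hf, _⟩
        refine ⟨by rw [b1, hmr, zero_add], by rw [b2]; simp, fun z hz => ?_⟩
        rw [hf z (by simpa [sizeC, Cmd.wr] using hz)]
        simp at hz
        simp [hz]
    · simp [condHolds, hlit 1] at hc
      rw [if_neg hc] at hmr
      refine WP.time ?_ (WP.asg q.mr (by simp) (by simp [hw, hmr]) ?_)
      · simp
      · refine ⟨by simp, by simp, fun z hz => ?_⟩
        simp at hz
        simp [hz]
  refine WP.time ?_ (WP.seqAsg q.nr trivial hlen (WP.seq (T₂ := E.w * 49 + q.nr * 16 + 150) (A.post ?_)))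
  · change (Ex.cost (.lit 1) + 1) + 1 + _ ≤ _
    simp; omega
  intro h1 ⟨b1, b2, b3⟩
  have b4 : h1.v .nr = q.nr := by rw [b3 _ (by decide)]; simp
  have b5 : h1.v .w = E.w := by rw [b3 _ (by decide)]; simp [hw]
  have b6 : h1.v .tb = q.tb := by rw [b3 _ (by decide)]; simp [htb]
  have b7 : h1.v .nn = q.tw := by rw [b3 _ (by decide)]; simp [hnn]
  refine WP.time ?_ (WP.seq (T₂ := E.w * 19 + q.nr * 16 + 120) ((packC_wp (m := .rm) (mu := .vp) (ga := .rg) (m' := q.mr) b5 (by omega)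
    b1 hmw hmr0 (by decide) (by decide) (by decide) (by decide) (by decide) (by decide) (by decide)).framed.post ?_))
  · omega
  intro h2 ⟨⟨c1, c2, c3⟩, hf2, _⟩
  refine WP.time ?_ (WP.seq (T₂ := q.nr * 16 + 100) ((clogC_wp (m := .nr) (y := .sr) (m' := q.nr) hone (by rw [hf2 _ (by decide), b4])
    hpos (by omega) (by decide) (by decide) (by decide)).framed.post ?_))
  · omega
  intro h3 ⟨⟨d1, _, d3⟩, hf3, _⟩
  have f : ∀ z ∉ [Var.x, .vp, .rg, .sr], h3.v z = h1.v z := fun z hz => by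
    simp at hz
    rw [hf3 z (by simp [clogC, Cmd.wr]; tauto), hf2 z (by simp [packC, clogC, Cmd.wr]; tauto)]
  have v1 : h3.v .nr = q.nr := by rw [f _ (by decide), b4]
  have v2 : h3.v .tb = q.tb := by rw [f _ (by decide), b6]
  have v3 : h3.v .nn = q.tw := by rw [f _ (by decide), b7]
  have v4 : h3.v .rm = q.mr := by rw [f _ (by decide), b1]
  have v5 : h3.v .vp = q.μr := by rw [hf3 _ (by decide), c1, hμ]
  have v6 : h3.v .rg = q.γr := by rw [hf3 _ (by decide), c2, hγ]
  have v7 : h3.v .sr = q.σr := by rw [d1, hσ]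
  have hm3 : h3.m = h.m := by rw [d3, c3, b2]
  have hsg : 2 ^ q.σr % 2 ^ E.w = 2 ^ q.σr := Nat.mod_eq_of_lt (by omega)
  have hlit' : ∀ n ≤ 13, n < E.S := fun n hn => by omega
  refine WP.time ?_ (WP.seqAsg q.rb (by simp) ?_ (WP.seqAsg q.ab (by simp) ?_ (WP.seqAsg q.vb (by simp) ?_
    (WP.seqSt 6 q.nr (by simp) (by simp) (by simp [hlit 6]) (hlit' _ (by norm_num)) (by simp [v1])
    (WP.seqSt 7 q.σr (by simp) (by simp) (by simp [hlit 7]) (hlit' _ (by norm_num)) (by simp [v7])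
    (WP.seqSt 8 q.γr (by simp) (by simp) (by simp [hlit 8]) (hlit' _ (by norm_num)) (by simp [v6])
    (WP.seqSt 9 q.μr (by simp) (by simp) (by simp [hlit 9]) (hlit' _ (by norm_num)) (by simp [v5])
    (WP.seqSt 10 q.mr (by simp) (by simp) (by simp [hlit 10]) (hlit' _ (by norm_num)) (by simp [v4])
    (WP.seqSt 11 q.rb (by simp) (by simp) (by simp [hlit 11]) (hlit' _ (by norm_num)) (by simp)
    (WP.seqSt 12 q.ab (by simp) (by simp) (by simp [hlit 12]) (hlit' _ (by norm_num)) (by simp)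
    (WP.seqSt 13 q.vb (by simp) (by simp) (by simp [hlit 13]) (hlit' _ (by norm_num)) (by simp)
    (WP.forLt q.nr 9 (fun j h' => q.Cells h'.m ∧ (∀ i < j, h'.m (q.rb + i) = E.word 1 i) ∧
      ∀ a, (a < 6 ∨ 14 ≤ a) → (a < q.rb ∨ q.rb + q.nr ≤ a) → h'.m a = h.m a) hone (by omega) (by simp [v1]) (by decide) (by decide)
      (by decide) ?_ ?_ ?_))))))))))))
  · simp; omega
  · simp [v2, v3, ← e3]; exact Nat.mod_eq_of_lt (by omega)
  · simp [v7, hlit 1, hsg, ← e1]; exact Nat.mod_eq_of_lt (by omega)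
  · simp [v7, hlit 1, hsg, ← e2]; exact Nat.mod_eq_of_lt (by omega)
  · refine ⟨?_, by simp, fun a ha _ => ?_⟩
    · constructor <;> simp [HSt.put_m, Function.update_apply]
    · simp only [HSt.set_m, HSt.put_m, Function.update_apply, hm3]
      rw [if_neg (by omega), if_neg (by omega), if_neg (by omega), if_neg (by omega), if_neg (by omega), if_neg (by omega),
        if_neg (by omega), if_neg (by omega)]
  · intro j hj h' ⟨i1, i2, i3⟩ hvj hf _
    have w1 : h'.v .rb = q.rb := by rw [hf _ (by decide) (by decide)]; simp
    refine WP.time ?_ (WP.st (q.rb + j) (E.word 1 j) (by simp) (by simp) ?_ (by omega) (by simp [hvj, hlit 1]) ?_)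
    · simp
    · simp [w1, hvj]; exact Nat.mod_eq_of_lt (by omega)
    · refine ⟨i1.congr fun a ha hb => ?_, fun i hi => ?_, fun a ha hb => ?_⟩
      · simp only [HSt.set_m, HSt.put_m, Function.update_apply]
        rw [if_neg (by omega)]
      · simp only [HSt.set_m, HSt.put_m, Function.update_apply]
        split_ifs with hh
        · congr 1; omega
        · exact i2 i (by omega)
      · simp only [HSt.set_m, HSt.put_m, Function.update_apply]
        rw [if_neg (by omega), i3 a ha hb]
  · intro h' hI _ _ _
    exact hI

/-- Selection of the family. -/
def selectC (δ Q σ : ℕ) : Cmd := keyParC ;; initC δ Q σ 4 ;; valParC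

theorem selectC_wp {q : VPar} {E : Env} (hq : q.Ok E) (hpk : q.pack = Pack.std E.w q.m) (hZ : q.Z < 2 ^ E.w)
    {u t k : ℕ} (hu : E.inp.getD 0 0 = u) (ht : E.inp.getD 2 0 = t)
    (hk : E.inp.getD 3 0 = k) (hu0 : 0 < u) (ht0 : 0 < t) (hkw : k < 2 ^ E.w) (hlw : 2 * Nat.size u < 2 ^ E.w)
    (htw : Nat.size u = 1 ∨ E.words 2 < 2 ^ E.w)
    (hl : q.l = Nat.clog 2 (min t (Nat.size u))) (hn : q.n = Nat.size u / min t (Nat.size u) + 1) (hκ : q.κ = Nat.size k)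
    (hnr : q.nr = E.words 1) (hσ : q.σr = Nat.clog 2 q.nr)
    (hmr : q.mr = if q.nr = 1 then Nat.size (E.word 1 0) else E.w) (hmr0 : 0 < q.mr) (hrp : q.rp = Pack.std E.w q.mr) {h : HSt}
    (hm0 : ∀ a, h.m a = 0) :
    WP E (selectC q.δ q.Q q.σ) h (E.w * 190 + E.words 0 * 12 + q.tw * 16 + q.nr * 16 + 750) fun h' => q.toPar.Cells E.w h'.m ∧
      q.Cells h'.m ∧ (∀ a, q.tb ≤ a → a < q.tb + q.tw → h'.m a = E.word (4 + (a - q.tb)) 0) ∧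
      (∀ j < q.nr, h'.m (q.rb + j) = E.word 1 j) ∧ ∀ a, q.ab ≤ a → h'.m a = 0 := by
  obtain ⟨a1, a2, a3, a4, a5⟩ := VPar.addrs hq
  have e3 : q.rb = q.tb + q.tw := rfl
  have hlw' := hq.par.lw
  have hmw : q.n + q.κ + 4 ≤ E.w := hq.par.fits.word
  have hlw2 : q.l ≤ E.w := by unfold Par.E at hlw'; omega
  refine WP.time ?_ (WP.seq (T₂ := E.w * 90 + q.tw * 16 + q.nr * 16 + 600)
    ((keyParC_wp (by omega) hu ht hk hu0 ht0 hkw hlw htw).post ?_))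
  · rw [← hl]; omega
  intro h1 ⟨b1, b2, b3, b4, b5⟩
  refine WP.time ?_ (WP.seq (T₂ := E.w * 60 + q.nr * 16 + 200) ((initC_wp hq.par hpk (by rw [b3, hl]) (by rw [b2, hn])
    (by rw [b4, hκ]) b1 (by norm_num) hZ).post ?_))
  · omega
  intro h2 ⟨c1, c2, c3, _, _, c6, c7⟩
  refine (valParC_wp hq hnr hσ hmr hmr0 hrp c3 c1.tb c7).post ?_
  intro h3 ⟨d1, d2, d3⟩
  refine ⟨c2.congr fun a ha => d3 a (by omega) (by omega), d1, fun a ha hb => ?_, d2, fun a ha => ?_⟩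
  · rw [d3 a (by omega) (by omega), c6 a (by omega), if_pos ⟨ha, hb⟩]
  · rw [d3 a (by omega) (by omega), c6 a (by omega), if_neg (by omega), b5, hm0]

/-- Construction of a function from its index. -/
def sampleC (δ Q σ : ℕ) : Cmd :=
  preludeC δ Q σ ;; loadRC ;; .nn ::= (1 : Ex) <<< (Ex.v .l + 3 + .v .k) ;;
  .forLt .z .nn (.forLt .q .nr (addChr .vb .rg .rgm .vp ((Ex.v .z <<< Ex.v .sr) + .v .q) (.inp (.v .z) (.v .q))))

theorem sampleC_wp {q : VPar} {E : Env} (hq : q.Ok E) {h : HSt} (hcl : q.toPar.Cells E.w h.m) (hvc : q.Cells h.m)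
    (hz : ∀ a, q.ab ≤ a → a < E.S → h.m a = 0) (hs : ∀ i < 2 ^ (q.l + 3 + q.m), ∀ j < q.nr, E.word i j < 2 ^ q.mr) :
    WP E (sampleC q.δ q.Q q.σ) h (2 ^ (q.l + 3 + q.m) * (q.nr * 60 + 15) + 340) fun h' =>
      (∀ a < q.vb, h'.m a = h.m a) ∧ ∀ i < 2 ^ (q.l + 3 + q.m), ∀ j < q.nr, q.rp.chr h'.m q.vb (i * 2 ^ q.σr + j) = E.word i j := by
  obtain ⟨a1, a2, a3, a4, a5⟩ := VPar.addrs hq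
  have hS := hq.par.S
  have hone := hq.par.one_lt
  have hle := hq.le
  have hvz := hq.vz
  have hvzp : 2 ^ q.vz < 2 ^ E.w := Nat.pow_lt_pow_right (by norm_num) hvz
  have hww : E.w < 2 ^ E.w := Nat.lt_two_pow_self
  have hN : 2 ^ (q.l + 3 + q.m) ≤ 2 ^ q.vz := Nat.pow_le_pow_right two_pos (by unfold VPar.vz; omega)
  have hNz : q.l + 3 + q.m ≤ q.vz := by unfold VPar.vz; omega
  refine WP.time ?_ (WP.seq (T₂ := 2 ^ (q.l + 3 + q.m) * (q.nr * 60 + 15) + 80) ((preludeC_wp hq.par hcl).post ?_))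
  · omega
  intro h1 ⟨b1, b2, _, _, _, _, b7, b8⟩
  refine WP.time ?_ (WP.seq (T₂ := 2 ^ (q.l + 3 + q.m) * (q.nr * 60 + 15) + 20) ((loadRC_wp hq (by rw [b2]; exact hvc) b7 b8).framed.post ?_))
  · omega
  intro h2 ⟨⟨c1, c2⟩, hf2, _⟩
  have c3 : Core q.toPar E h2 := b1.congr fun x hx => hf2 x (by revert hx; cases x <;> decide)
  have hm2 : h2.m = h.m := c2.trans b2
  have addr : ∀ i < 2 ^ (q.l + 3 + q.m), ∀ j < q.nr, i * 2 ^ q.σr + j < 2 ^ q.vz ∧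
      q.vb + (i * 2 ^ q.σr + j) / 2 ^ q.rp.γ < E.S := fun i hi j hj => by
    obtain ⟨d1, d2⟩ := VPar.vaddr (q := q) hi (j := j) (by omega)
    have := hq.top
    have hrg : q.rp.γ = q.γr := rfl
    rw [hrg]
    omega
  refine WP.time ?_ (WP.seqAsg (2 ^ (q.l + 3 + q.m)) (by simp) ?_ (WP.forLt (2 ^ (q.l + 3 + q.m)) (q.nr * 60 + 5) (fun i h' =>
    (∀ a < q.vb, h'.m a = h.m a) ∧ (∀ i' < i, ∀ j < q.nr, q.rp.chr h'.m q.vb (i' * 2 ^ q.σr + j) = E.word i' j) ∧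
    ∀ z < 2 ^ q.vz, i * 2 ^ q.σr ≤ z → q.rp.chr h'.m q.vb z = 0) hone (by omega) (by simp) (by decide) (by decide) (by decide) ?_ ?_ ?_))
  · have : 2 ^ (q.l + 3 + q.m) * (q.nr * 60 + 5 + 7) ≤ 2 ^ (q.l + 3 + q.m) * (q.nr * 60 + 15) := Nat.mul_le_mul_left _ (by omega)
    simp; omega
  · simp [c3.l, c1.k, hq.par.lit (n := 3), hq.par.lit (n := 1), Nat.mod_eq_of_lt (show q.l + 3 < 2 ^ E.w by omega),
      Nat.mod_eq_of_lt (show q.l + 3 + q.m < 2 ^ E.w by omega)]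
    exact Nat.mod_eq_of_lt (by omega)
  · refine ⟨fun a _ => by simp [hm2], by simp, fun z hzv _ => ?_⟩
    unfold Pack.chr
    simp only [HSt.set_m, hm2]
    have h0 : z / 2 ^ q.rp.γ < q.vw := by
      unfold VPar.vw
      rw [Nat.div_lt_iff_lt_mul (by positivity), ← pow_add]
      exact hzv.trans_le (Nat.pow_le_pow_right two_pos (by have hrg : q.rp.γ = q.γr := rfl; omega))
    have h1 := hq.top
    have h2 := Nat.zero_le (z / 2 ^ q.rp.γ)
    rw [hz _ (by omega) (by omega)]; simp
  · intro i hi h' ⟨i1, i2, i3⟩ hvi hf _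
    have g : ∀ x ∉ [Var.nn, .z, .q], h'.v x = h2.v x := fun x hx => by
      simp at hx
      rw [hf x hx.2.1 (by simp [Cmd.wr, addChr, Cmd.forLt, hx])]; simp [hx]
    have hv' : VCore q h' := c1.congr fun x hx => g x (by revert hx; cases x <;> decide)
    refine WP.forLt q.nr 45 (fun j h'' =>
      (∀ a < q.vb, h''.m a = h.m a) ∧ (∀ i' j', (i' < i ∧ j' < q.nr ∨ i' = i ∧ j' < j) →
        q.rp.chr h''.m q.vb (i' * 2 ^ q.σr + j') = E.word i' j') ∧
      ∀ z < 2 ^ q.vz, i * 2 ^ q.σr + j ≤ z → q.rp.chr h''.m q.vb z = 0) hone (by omega) hv'.nr (by decide) (by decide) (by decide) ?_ ?_ ?_ |>.time ?_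
    · exact ⟨i1, fun i' j' hh => by
        rcases hh with ⟨h5, h6⟩ | ⟨_, h6⟩
        · exact i2 i' h5 j' h6
        · omega, i3⟩
    · intro j hj h'' ⟨j1, j2, j3⟩ hvj hf' _
      have g' : ∀ x, x ≠ .q → h''.v x = h'.v x := fun x hx => hf' x hx (by simp [Cmd.wr, addChr])
      obtain ⟨d1, d2⟩ := addr i hi j hj
      have hii : i * 2 ^ q.σr < 2 ^ E.w := by omega
      refine (addChr_wp (pk := q.rp) (z' := i * 2 ^ q.σr + j) (c := E.word i j) hq.fits (B := q.vb) (by rw [g' _ (by decide), hv'.vb])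
        (by rw [g' _ (by decide), hv'.rg]; rfl) (by rw [g' _ (by decide), hv'.rgm]; rfl) (by rw [g' _ (by decide), hv'.vp]; rfl)
        (by simp) ?_ (by simp) ?_ (hs i hi j hj) d2 hS ?_).time ?_
      · simp [g' .z (by decide), g' .sr (by decide), hvi, hv'.sr, hvj, Nat.mod_eq_of_lt hii]
        exact Nat.mod_eq_of_lt (by omega)
      · simp [g' .z (by decide), hvi, hvj]
      · intro h3 hv3 _ hc3 hm3
        simp only [HSt.set_m]
        refine ⟨fun a ha => ?_, fun i' j' hh => ?_, fun z hzv hz' => ?_⟩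
        · rw [hm3 a (by have h0 := Nat.zero_le ((i * 2 ^ q.σr + j) / 2 ^ q.rp.γ); omega), j1 a ha]
        · rw [hc3]
          by_cases hcase : i' * 2 ^ q.σr + j' = i * 2 ^ q.σr + j
          · have hji : j' < 2 ^ q.σr := by omega
            have h5 := congrArg (· / 2 ^ q.σr) hcase
            simp only [add_comm (_ * 2 ^ q.σr), Nat.add_mul_div_right _ _ (show 0 < 2 ^ q.σr by positivity),
              Nat.div_eq_of_lt hji, Nat.div_eq_of_lt (show j < 2 ^ q.σr by omega), zero_add] at h5
            subst h5
            rw [if_pos hcase, j3 _ d1 le_rfl, Nat.zero_xor]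
            congr 1; omega
          · rw [if_neg hcase, j2 i' j' ?_]
            rcases hh with h5 | ⟨h5, h6⟩
            · exact Or.inl h5
            · refine Or.inr ⟨h5, ?_⟩
              subst h5
              omega
        · rw [hc3, if_neg (by omega), j3 z hzv (by omega)]
      · simp
    · intro h3 ⟨j1, j2, j3⟩ _ _ _
      simp only [HSt.set_m]
      refine ⟨j1, fun i' hi' j' hj' => j2 i' j' (by omega), fun z hzv hz' => j3 z hzv ?_⟩
      rw [add_mul, one_mul] at hz'
      omega
    · omega
  · intro h3 ⟨j1, j2, _⟩ _ _ _
    exact ⟨j1, j2⟩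

end WordRAM

namespace Hashing

/-! ### Uniform probability -/

theorem uniformProb_mono {Ω : Type} [Fintype Ω] {A B : Set Ω} (h : A ⊆ B) : uniformProb A ≤ uniformProb B :=
  div_le_div_of_nonneg_right (by exact_mod_cast Set.ncard_le_ncard h B.toFinite) (by positivity)

theorem uniformProb_empty {Ω : Type} [Fintype Ω] : uniformProb (∅ : Set Ω) = 0 := by simp [uniformProb]

theorem uniformProb_union_le {Ω : Type} [Fintype Ω] (A B : Set Ω) :
    uniformProb (A ∪ B) ≤ uniformProb A + uniformProb B := by
  unfold uniformProb
  rw [← add_div]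
  exact div_le_div_of_nonneg_right (by exact_mod_cast Set.ncard_union_le A B) (by positivity)

theorem uniformProb_biUnion_le {Ω ι : Type} [Fintype Ω] (s : Finset ι) (A : ι → Set Ω) :
    uniformProb (⋃ i ∈ s, A i) ≤ ∑ i ∈ s, uniformProb (A i) := by
  classical
  induction s using Finset.induction_on with
  | empty => simp [uniformProb_empty]
  | insert i s hi ih =>
    rw [Finset.set_biUnion_insert, Finset.sum_insert hi]
    exact (uniformProb_union_le _ _).trans (by gcongr)

theorem uniformProb_compl {Ω : Type} [Fintype Ω] [Nonempty Ω] (A : Set Ω) : uniformProb Aᶜ = 1 - uniformProb A := by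
  have h := Set.ncard_add_ncard_compl A
  have h0 : (Fintype.card Ω : ℝ) ≠ 0 := by exact_mod_cast Fintype.card_ne_zero
  rw [Nat.card_eq_fintype_card] at h
  unfold uniformProb
  rw [eq_sub_iff_add_eq, ← add_div, div_eq_one_iff_eq h0]
  exact_mod_cast (by omega : Aᶜ.ncard + A.ncard = Fintype.card Ω)

/-- A surjective homomorphism of finite groups preserves the uniform distribution. -/
theorem uniformProb_preimage {G H : Type} [AddGroup G] [AddGroup H] [Fintype G] [Fintype H] (φ : G →+ H)
    (hφ : Function.Surjective φ) (A : Set H) : uniformProb (φ ⁻¹' A) = uniformProb A := by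
  classical
  set c := (Finset.univ.filter fun g => φ g = 0).card with hc
  have hf : ∀ y : H, (Finset.univ.filter fun g => φ g = y).card = c := fun y =>
    AddMonoidHom.card_fiber_eq_of_mem_range φ (hφ y) (hφ 0)
  have h1 : ∀ B : Finset H, (Finset.univ.filter fun g => φ g ∈ B).card = B.card * c := by
    intro B
    rw [Finset.card_eq_sum_card_fiberwise (f := φ) (t := B) (fun g hg => by simpa using hg),
      Finset.sum_const_nat (m := c)]
    intro y hy
    rw [← hf y]
    congr 1
    ext g
    simp only [Finset.mem_filter, Finset.mem_univ, true_and, and_iff_right_iff_imp]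
    rintro rfl; exact hy
  have hcpos : 0 < c := Finset.card_pos.2 ⟨0, by simp⟩
  have hG : Fintype.card G = Fintype.card H * c := by
    have := h1 Finset.univ
    simpa using this
  have hA : (φ ⁻¹' A).ncard = A.ncard * c := by
    have := h1 A.toFinset
    rw [Set.ncard_eq_toFinset_card', Set.ncard_eq_toFinset_card', ← this]
    congr 1
    ext g; simp
  unfold uniformProb
  rw [hA, hG]
  push_cast
  exact mul_div_mul_right _ _ (by positivity)

/-- An event has small probability if this holds whenever the coordinates outside of `W` are fixed. -/
theorem uniformProb_le_of_piecewise {ι A : Type} [Fintype ι] [DecidableEq ι] [Fintype A] [Nonempty A] (W : Set ι)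
    [DecidablePred (· ∈ W)] (B : Set (ι → A)) (ε : ℝ) (h : ∀ ω : ι → A, uniformProb {r | W.piecewise r ω ∈ B} ≤ ε) :
    uniformProb B ≤ ε := by
  classical
  set N := Fintype.card (ι → A) with hN
  have h0 : (0 : ℝ) < N := by exact_mod_cast Fintype.card_pos
  have hinv : Function.Involutive fun q : (ι → A) × (ι → A) => (W.piecewise q.2 q.1, W.piecewise q.1 q.2) := by
    intro q
    ext i <;> by_cases hi : i ∈ W <;> simp [hi]
  have e1 : (Finset.univ.filter fun q : (ι → A) × (ι → A) => W.piecewise q.2 q.1 ∈ B).card = B.ncard * N := by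
    rw [show B.ncard * N = (Finset.univ.filter fun q : (ι → A) × (ι → A) => q.1 ∈ B).card by
      rw [Set.ncard_eq_toFinset_card', hN, ← Finset.card_univ, ← Finset.card_product]
      congr 1
      ext q; simp]
    refine Finset.card_bij (fun q _ => (W.piecewise q.2 q.1, W.piecewise q.1 q.2)) (by simp) (fun a _ b _ hab => hinv.injective hab)
      fun b hb => ⟨_, ?_, hinv b⟩
    simpa [hinv b] using (by
      have := hinv b
      have := congrArg Prod.fst this
      simp only at this
      rw [this]; simpa using hb : W.piecewise (W.piecewise b.1 b.2) (W.piecewise b.2 b.1) ∈ B)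
  have e2 : (Finset.univ.filter fun q : (ι → A) × (ι → A) => W.piecewise q.2 q.1 ∈ B).card =
      ∑ ω : ι → A, {r | W.piecewise r ω ∈ B}.ncard := by
    rw [Finset.card_eq_sum_card_fiberwise (f := Prod.fst) (t := Finset.univ) (by simp)]
    refine Finset.sum_congr rfl fun ω _ => ?_
    rw [Set.ncard_eq_toFinset_card']
    refine Finset.card_bij (fun q _ => q.2) ?_ ?_ ?_
    · rintro ⟨a, b⟩ hq
      simp at hq
      obtain ⟨h1, rfl⟩ := hq
      simpa using h1
    · rintro ⟨a, b⟩ hq ⟨a', b'⟩ hq' e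
      simp at hq hq' e
      rw [hq.2, hq'.2, e]
    · intro b hb
      exact ⟨(ω, b), by simpa using hb, rfl⟩
  have e3 : (B.ncard : ℝ) * N ≤ ε * N * N := by
    have : ((B.ncard * N : ℕ) : ℝ) = ∑ ω : ι → A, ({r | W.piecewise r ω ∈ B}.ncard : ℝ) := by
      rw [← e1, e2]; push_cast; rfl
    rw [← Nat.cast_mul, this]
    refine (Finset.sum_le_card_nsmul _ _ (ε * N) fun ω _ => ?_).trans (by simp [hN]; apply le_of_eq; ring)
    have := h ω
    unfold uniformProb at this
    rwa [div_le_iff₀ h0] at this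
  unfold uniformProb
  rw [div_le_iff₀ h0]
  exact le_of_mul_le_mul_right e3 h0

/-! ### Majority-uniqueness -/

/-- The positions at which the value of `f` at `x` is unique in `S`. -/
def uniq (d : ℕ) (f : ℕ → ℕ → ℕ) (S : Finset ℕ) (x : ℕ) : Finset ℕ :=
  (Finset.range d).filter fun i => ∀ y ∈ S, y ≠ x → f y i ≠ f x i

/-- Majority-uniqueness for keys below `U`. -/
def Maj (U k d : ℕ) (f : ℕ → ℕ → ℕ) : Prop :=
  ∀ S : Finset ℕ, S.Nonempty → S.card ≤ k → (∀ x ∈ S, x < U) → ∃ x ∈ S, d < 2 * (uniq d f S x).card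

theorem Maj.congr {U k d : ℕ} {f f' : ℕ → ℕ → ℕ} (h : Maj U k d f) (hf : ∀ x < U, ∀ i < d, f' x i = f x i) : Maj U k d f' := by
  intro S h1 h2 h3
  obtain ⟨x, hx, h4⟩ := h S h1 h2 h3
  refine ⟨x, hx, ?_⟩
  convert h4 using 3
  refine Finset.filter_congr fun i hi => forall₂_congr fun y hy => ?_
  rw [hf x (h3 x hx) i (Finset.mem_range.1 hi), hf y (h3 y hy) i (Finset.mem_range.1 hi)]

/-- In a bad set at least a quarter of the values are repetitions. -/
theorem card_repeat {D : ℕ} {f : ℕ → ℕ → ℕ} {S : Finset ℕ} (hb : ∀ x ∈ S, 2 * (uniq (4 * D) f S x).card ≤ 4 * D) :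
    S.card * D ≤ ((S ×ˢ Finset.range (4 * D)).filter fun q => ∃ x' ∈ S, x' < q.1 ∧ f x' q.2 = f q.1 q.2).card := by
  classical
  set A := S ×ˢ Finset.range (4 * D) with hA
  set R := A.filter fun q => ∃ x' ∈ S, x' < q.1 ∧ f x' q.2 = f q.1 q.2 with hR
  set N := A.filter fun q => ∃ y ∈ S, y ≠ q.1 ∧ f y q.2 = f q.1 q.2 with hN
  have h1 : S.card * (2 * D) ≤ N.card := by
    rw [Finset.card_eq_sum_card_fiberwise (f := Prod.fst) (s := N) (t := S)
      (fun q hq => by simp [hN, hA] at hq; simpa using hq.1.1), ← smul_eq_mul]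
    refine Finset.card_nsmul_le_sum _ _ _ fun x hx => ?_
    have e : (uniq (4 * D) f S x).card + (N.filter fun q => q.1 = x).card = 4 * D := by
      have e0 : (N.filter fun q => q.1 = x).card =
          ((Finset.range (4 * D)).filter fun i => ¬ ∀ y ∈ S, y ≠ x → f y i ≠ f x i).card := by
        refine Finset.card_bij (fun q _ => q.2) ?_ ?_ ?_
        · rintro ⟨a, i⟩ hq
          simp [hN, hA] at hq
          obtain ⟨⟨⟨_, hi⟩, y, hy, hne, he⟩, rfl⟩ := hq
          simp only [Finset.mem_filter, Finset.mem_range]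
          exact ⟨hi, fun hall => hall y hy hne he⟩
        · rintro ⟨a, i⟩ hq ⟨a', i'⟩ hq' e
          simp at hq hq' e
          rw [hq.2, hq'.2, e]
        · intro i hi
          simp at hi
          obtain ⟨hi, y, hy, hne, he⟩ := hi
          exact ⟨(x, i), by simp [hN, hA]; exact ⟨⟨hx, hi⟩, y, hy, hne, he⟩, rfl⟩
      rw [e0]
      unfold uniq
      rw [Finset.card_filter_add_card_filter_not, Finset.card_range]
    have := hb x hx
    omega
  have h2 : R ⊆ N := by
    intro q hq
    simp [hR, hN] at hq ⊢
    obtain ⟨ha, x', hx', hlt, he⟩ := hq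
    exact ⟨ha, x', hx', hlt.ne, he⟩
  have h3 : (N \ R).card ≤ R.card := by
    have hex : ∀ q ∈ N \ R, ∃ y ∈ S, q.1 < y ∧ f y q.2 = f q.1 q.2 := by
      intro q hq
      simp only [Finset.mem_sdiff, hN, hR, Finset.mem_filter, not_and, not_exists] at hq
      obtain ⟨⟨ha, y, hy, hne, he⟩, hn⟩ := hq
      exact ⟨y, hy, lt_of_le_of_ne (not_lt.1 fun hlt => hn ha y hy hlt he) hne.symm, he⟩
    choose! g hg1 hg2 hg3 using hex
    have hmem : ∀ q ∈ N \ R, q.1 ∈ S ∧ q.2 < 4 * D := by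
      intro q hq
      simp [hN, hA] at hq
      exact hq.1.1
    refine Finset.card_le_card_of_injOn (fun q => (g q, q.2)) ?_ ?_
    · intro q hq
      obtain ⟨m1, m2⟩ := hmem q hq
      simp only [Finset.coe_filter, hR, hA, Finset.mem_product, Finset.mem_range, Set.mem_ofPred_eq]
      exact ⟨⟨hg1 q hq, m2⟩, q.1, m1, hg2 q hq, (hg3 q hq).symm⟩
    · intro q hq q' hq' e
      simp only [Prod.mk.injEq] at e
      have a1 := hg3 q hq
      have a2 := hg3 q' hq'
      rw [e.1, e.2] at a1
      have hno : ∀ p ∈ N \ R, ∀ x' ∈ S, x' < p.1 → f x' p.2 ≠ f p.1 p.2 := by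
        intro p hp x' hx' hlt he
        simp only [Finset.mem_sdiff, hN, hR, Finset.mem_filter, not_and, not_exists] at hp
        exact hp.2 hp.1.1 x' hx' hlt he
      have a3 : f q.1 q'.2 = f q'.1 q'.2 := a1.symm.trans a2
      rcases lt_trichotomy q.1 q'.1 with hlt | heq | hgt
      · exact absurd a3 (hno q' hq' q.1 (hmem q hq).1 hlt)
      · exact Prod.ext heq e.2
      · exact absurd (by rw [e.2]; exact a3.symm) (hno q hq q'.1 (hmem q' hq').1 hgt)
  have h4 := Finset.card_sdiff_add_card_eq_card h2
  have : S.card * (2 * D) = 2 * (S.card * D) := by ring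
  omega

/-- The number of functions with given repetitions. -/
theorem card_repeat_fun {R d : ℕ} (S : Finset ℕ) (K : Finset (S × Fin d)) :
    Fintype.card {τ : S × Fin d → Fin R // ∀ q ∈ K, ∃ x' : S, x' < q.1 ∧ τ (x', q.2) = τ q} ≤
      R ^ (S.card * d - K.card) * S.card ^ K.card := by
  classical
  have hc : Fintype.card (({q // q ∉ K} → Fin R) × ({q // q ∈ K} → S)) = R ^ (S.card * d - K.card) * S.card ^ K.card := by
    simp [Fintype.card_subtype_compl]
  rw [← hc]
  choose π hπ1 hπ2 using fun τ : {τ : S × Fin d → Fin R // ∀ q ∈ K, ∃ x' : S, x' < q.1 ∧ τ (x', q.2) = τ q} => τ.2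
  refine Fintype.card_le_of_injective (fun τ => (fun q => τ.1 q.1, fun q => π τ q.1 q.2)) ?_
  intro τ τ' h
  simp only [Prod.mk.injEq] at h
  obtain ⟨h1, h2⟩ := h
  have key : ∀ x : S, ∀ y, τ.1 (x, y) = τ'.1 (x, y) := by
    intro x
    induction x using WellFoundedLT.induction with
    | ind x ih =>
      intro y
      by_cases hk : (x, y) ∈ K
      · have e1 := hπ2 τ (x, y) hk
        have e2 := hπ2 τ' (x, y) hk
        have e3 : π τ (x, y) hk = π τ' (x, y) hk := congrFun h2 ⟨(x, y), hk⟩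
        rw [← e1, ← e2, e3]
        have := hπ1 τ' (x, y) hk
        exact ih _ this y
      · exact congrFun h1 ⟨(x, y), hk⟩
  exact Subtype.ext (funext fun q => key q.1 q.2)

/-- Random values rarely make a given set bad. -/
theorem uniformProb_bad_le {Ω : Type} [Fintype Ω] {D ρ : ℕ} (F : Ω → ℕ → ℕ → ℕ) (S : Finset ℕ)
    (hF : ∀ ω x y, F ω x y < 2 ^ ρ)
    (hu : ∀ τ : ℕ → ℕ → ℕ, uniformProb {ω | ∀ x ∈ S, ∀ y < 4 * D, F ω x y = τ x y} ≤ (1 / 2 ^ ρ : ℝ) ^ (S.card * (4 * D))) :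
    uniformProb {ω | ∀ x ∈ S, 2 * (uniq (4 * D) (F ω) S x).card ≤ 4 * D} ≤
      (16 * S.card / 2 ^ ρ : ℝ) ^ (S.card * D) := by
  classical
  set s := S.card with hs
  let T := fun K : Finset (S × Fin (4 * D)) =>
    {τ : S × Fin (4 * D) → Fin (2 ^ ρ) // ∀ q ∈ K, ∃ x' : S, x' < q.1 ∧ τ (x', q.2) = τ q}
  let ext := fun (τ : S × Fin (4 * D) → Fin (2 ^ ρ)) (x y : ℕ) => if h : x ∈ S ∧ y < 4 * D then (τ (⟨x, h.1⟩, ⟨y, h.2⟩) : ℕ) else 0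
  have hsub : {ω | ∀ x ∈ S, 2 * (uniq (4 * D) (F ω) S x).card ≤ 4 * D} ⊆
      ⋃ K ∈ (Finset.univ : Finset (S × Fin (4 * D))).powersetCard (s * D), ⋃ τ ∈ (Finset.univ : Finset (T K)),
        {ω | ∀ x ∈ S, ∀ y < 4 * D, F ω x y = ext τ.1 x y} := by
    intro ω hω
    have h1 := card_repeat hω
    set K0 : Finset (S × Fin (4 * D)) := Finset.univ.filter fun q => ∃ x' : S, x' < q.1 ∧ F ω x' q.2 = F ω q.1 q.2 with hK0
    have h2 : ((S ×ˢ Finset.range (4 * D)).filter fun q => ∃ x' ∈ S, x' < q.1 ∧ F ω x' q.2 = F ω q.1 q.2).card ≤ K0.card := by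
      refine Finset.card_le_card_of_surjOn (fun q => ((q.1 : ℕ), (q.2 : ℕ))) ?_
      rintro ⟨x, y⟩ hq
      simp only [Finset.coe_filter, Finset.mem_product, Finset.mem_range, Set.mem_ofPred_eq] at hq
      obtain ⟨⟨hx, hy⟩, x', hx', hlt, he⟩ := hq
      refine ⟨(⟨x, hx⟩, ⟨y, hy⟩), ?_, rfl⟩
      simp only [hK0, Finset.coe_filter, Finset.mem_univ, true_and, Set.mem_ofPred_eq]
      exact ⟨⟨x', hx'⟩, hlt, he⟩
    obtain ⟨K, hK, hKc⟩ := Finset.exists_subset_card_eq (h1.trans h2)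
    simp only [Set.mem_iUnion]
    refine ⟨K, Finset.mem_powersetCard.2 ⟨Finset.subset_univ _, hKc⟩, ⟨fun q => ⟨F ω q.1 q.2, hF _ _ _⟩, ?_⟩, Finset.mem_univ _, ?_⟩
    · intro q hq
      have := hK hq
      simp only [hK0, Finset.mem_filter] at this
      obtain ⟨_, x', hlt, he⟩ := this
      exact ⟨x', hlt, Fin.ext he⟩
    · intro x hx y hy
      simp [ext, hx, hy]
  have hK1 : ((Finset.univ : Finset (S × Fin (4 * D))).powersetCard (s * D)).card ≤ 2 ^ (s * (4 * D)) := by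
    refine (Finset.card_le_card fun K _ => Finset.mem_powerset.2 (Finset.subset_univ K)).trans (le_of_eq ?_)
    rw [Finset.card_powerset, Finset.card_univ]
    simp [hs]
  refine (uniformProb_mono hsub).trans ((uniformProb_biUnion_le _ _).trans ?_)
  have hpos : (0 : ℝ) < 2 ^ ρ := by positivity
  have hin : ∀ K ∈ (Finset.univ : Finset (S × Fin (4 * D))).powersetCard (s * D),
      uniformProb (⋃ τ ∈ (Finset.univ : Finset (T K)), {ω | ∀ x ∈ S, ∀ y < 4 * D, F ω x y = ext τ.1 x y}) ≤
        (s / 2 ^ ρ : ℝ) ^ (s * D) := by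
    intro K hK
    have hKc := (Finset.mem_powersetCard.1 hK).2
    refine (uniformProb_biUnion_le _ _).trans ((Finset.sum_le_card_nsmul _ _ _ fun τ _ => hu _).trans ?_)
    rw [nsmul_eq_mul, Finset.card_univ]
    have h3 : Fintype.card (T K) ≤ (2 ^ ρ) ^ (s * (4 * D) - s * D) * s ^ (s * D) := by
      have := card_repeat_fun (R := 2 ^ ρ) S K
      rwa [hKc] at this
    have h4 : s * D ≤ s * (4 * D) := Nat.mul_le_mul_left _ (by omega)
    calc (Fintype.card (T K) : ℝ) * (1 / 2 ^ ρ) ^ (s * (4 * D))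
        ≤ (((2 ^ ρ) ^ (s * (4 * D) - s * D) * s ^ (s * D) : ℕ) : ℝ) * (1 / 2 ^ ρ) ^ (s * (4 * D)) := by
          gcongr
      _ = _ := by
          obtain ⟨e, he⟩ := Nat.exists_eq_add_of_le h4
          rw [he, Nat.add_sub_cancel_left, div_pow, one_pow, pow_add, div_pow]
          push_cast
          field_simp
  refine (Finset.sum_le_card_nsmul _ _ _ hin).trans ?_
  rw [nsmul_eq_mul]
  calc ((((Finset.univ : Finset (S × Fin (4 * D))).powersetCard (s * D)).card : ℕ) : ℝ) * (s / 2 ^ ρ : ℝ) ^ (s * D)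
      ≤ ((2 ^ (s * (4 * D)) : ℕ) : ℝ) * (s / 2 ^ ρ : ℝ) ^ (s * D) := by gcongr
    _ = _ := by
        rw [mul_div_assoc, mul_pow]
        congr 1
        push_cast
        rw [show s * (4 * D) = 4 * (s * D) by ring, pow_mul]
        norm_num

theorem sum_pow_le {x : ℝ} (h0 : 0 ≤ x) (h1 : x ≤ 1 / 2) (k : ℕ) : ∑ s ∈ Finset.Icc 2 k, x ^ s ≤ 2 * x ^ 2 := by
  have key : ∀ j : ℕ, ∑ s ∈ Finset.range j, x ^ (s + 2) ≤ 2 * x ^ 2 - 2 * x ^ 2 * (1 / 2) ^ j := by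
    intro j
    induction j with
    | zero => simp
    | succ j ih =>
      rw [Finset.sum_range_succ]
      have h2 : x ^ (j + 2) ≤ x ^ 2 * (1 / 2) ^ j := by
        rw [add_comm, pow_add]
        exact mul_le_mul_of_nonneg_left (pow_le_pow_left₀ h0 h1 j) (sq_nonneg x)
      have e : 2 * x ^ 2 * (1 / 2 : ℝ) ^ (j + 1) = x ^ 2 * (1 / 2) ^ j := by rw [pow_succ]; ring
      rw [e]
      linarith
  rcases lt_or_ge k 2 with h | h
  · rw [Finset.Icc_eq_empty (by omega), Finset.sum_empty]; positivity
  · have e : ∑ s ∈ Finset.Icc 2 k, x ^ s = ∑ s ∈ Finset.range (k - 1), x ^ (s + 2) := by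
      rw [Finset.range_eq_Ico, Finset.sum_Ico_add' (fun s => x ^ s) 0 (k - 1) 2]
      refine Finset.sum_congr ?_ fun _ _ => rfl
      ext j; simp; omega
    rw [e]
    have := mul_nonneg (sq_nonneg x) (show (0 : ℝ) ≤ (1 / 2) ^ (k - 1) by positivity)
    linarith [key (k - 1)]

/-- Values that are independent and uniform on small sets are majority-unique with high probability. -/
theorem uniformProb_not_maj_le {Ω : Type} [Fintype Ω] {D u κ g B : ℕ} (F : Ω → ℕ → ℕ → ℕ) (hB : 1 ≤ B)
    (hD : u + B ≤ g * D) (hF : ∀ ω x y, F ω x y < 2 ^ (κ + g + 4))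
    (hu : ∀ S : Finset ℕ, S.card ≤ 2 ^ κ → (∀ x ∈ S, x < 2 ^ u) → ∀ τ : ℕ → ℕ → ℕ,
      uniformProb {ω | ∀ x ∈ S, ∀ y < 4 * D, F ω x y = τ x y} ≤ (1 / 2 ^ (κ + g + 4) : ℝ) ^ (S.card * (4 * D))) :
    uniformProb {ω | ¬ Maj (2 ^ u) (2 ^ κ) (4 * D) (F ω)} ≤ 2 * (1 / 2 ^ B : ℝ) ^ 2 := by
  classical
  have hD0 : 0 < D := by
    rcases Nat.eq_zero_or_pos D with h | h
    · subst h; omega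
    · exact h
  have hsub : {ω | ¬ Maj (2 ^ u) (2 ^ κ) (4 * D) (F ω)} ⊆ ⋃ s ∈ Finset.Icc 2 (2 ^ κ),
      ⋃ S ∈ (Finset.range (2 ^ u)).powersetCard s, {ω | ∀ x ∈ S, 2 * (uniq (4 * D) (F ω) S x).card ≤ 4 * D} := by
    intro ω hω
    simp only [Maj, Set.mem_ofPred_eq, not_forall, not_exists, not_and, not_lt] at hω
    obtain ⟨S, h1, h2, h3, h4⟩ := hω
    simp only [Set.mem_iUnion]
    refine ⟨S.card, ?_, S, ?_, h4⟩
    · rw [Finset.mem_Icc]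
      refine ⟨?_, h2⟩
      by_contra hlt
      have : S.card = 1 := by have := h1.card_pos; omega
      obtain ⟨x, rfl⟩ := Finset.card_eq_one.1 this
      have := h4 x (by simp)
      have e : uniq (4 * D) (F ω) {x} x = Finset.range (4 * D) := by
        unfold uniq
        rw [Finset.filter_true_of_mem]
        intro i _ y hy hne
        exact absurd (Finset.mem_singleton.1 hy) hne
      rw [e, Finset.card_range] at this
      omega
    · exact Finset.mem_powersetCard.2 ⟨fun x hx => Finset.mem_range.2 (h3 x hx), rfl⟩
  refine (uniformProb_mono hsub).trans ((uniformProb_biUnion_le _ _).trans ?_)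
  refine le_trans (Finset.sum_le_sum fun s hs => ?_) (sum_pow_le (x := 1 / 2 ^ B) (by positivity) ?_ (2 ^ κ))
  · obtain ⟨hs1, hs2⟩ := Finset.mem_Icc.1 hs
    refine (uniformProb_biUnion_le _ _).trans ((Finset.sum_le_card_nsmul _ _ ((1 / 2 ^ g : ℝ) ^ (s * D)) fun S hS => ?_).trans ?_)
    · obtain ⟨hS1, hS2⟩ := Finset.mem_powersetCard.1 hS
      refine (uniformProb_bad_le F S hF (hu S (by omega) fun x hx => Finset.mem_range.1 (hS1 hx))).trans ?_
      rw [hS2]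
      refine pow_le_pow_left₀ (by positivity) ?_ _
      rw [div_le_div_iff₀ (by positivity) (by positivity), pow_add, pow_add]
      have : (s : ℝ) ≤ 2 ^ κ := by exact_mod_cast hs2
      have h5 : (0 : ℝ) < 2 ^ g := by positivity
      nlinarith
    · rw [nsmul_eq_mul, Finset.card_powersetCard, Finset.card_range]
      have h5 : ((2 ^ u).choose s : ℝ) ≤ ((2 : ℝ) ^ u) ^ s := by
        exact_mod_cast Nat.choose_le_pow _ _
      have h6 : (2 : ℝ) ^ u * (1 / 2 ^ g) ^ D ≤ 1 / 2 ^ B := by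
        rw [div_pow, one_pow, ← pow_mul, mul_one_div, div_le_div_iff₀ (by positivity) (by positivity), one_mul, ← pow_add]
        exact pow_le_pow_right₀ (by norm_num) hD
      calc ((2 ^ u).choose s : ℝ) * (1 / 2 ^ g) ^ (s * D) ≤ ((2 : ℝ) ^ u) ^ s * (1 / 2 ^ g) ^ (s * D) := by gcongr
        _ = ((2 : ℝ) ^ u * (1 / 2 ^ g) ^ D) ^ s := by rw [mul_pow, mul_comm s D, pow_mul]
        _ ≤ _ := pow_le_pow_left₀ (by positivity) h6 _
  · rw [div_le_div_iff₀ (by positivity) (by norm_num)]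
    have : (2 : ℝ) ^ 1 ≤ 2 ^ B := pow_le_pow_right₀ (by norm_num) hB
    linarith

end Hashing

namespace WordRAM

/-! ### Random tables -/

/-- Words of `m` bits as a group with the exclusive or. -/
def XW (m : ℕ) : Type := Fin (2 ^ m)

namespace XW
variable {m : ℕ}

instance : Fintype (XW m) := inferInstanceAs (Fintype (Fin (2 ^ m)))
instance : Nonempty (XW m) := ⟨⟨0, by positivity⟩⟩

/-- the number of a word -/
def num (a : XW m) : ℕ := Fin.val (n := 2 ^ m) a
/-- the word with a given number -/
def mk (a : ℕ) (h : a < 2 ^ m) : XW m := (⟨a, h⟩ : Fin (2 ^ m))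

theorem num_lt (a : XW m) : a.num < 2 ^ m := Fin.isLt (n := 2 ^ m) a
theorem ext {a b : XW m} (h : a.num = b.num) : a = b := Fin.ext (n := 2 ^ m) h
@[simp] theorem num_mk (a : ℕ) (h : a < 2 ^ m) : (mk a h).num = a := rfl

instance : Add (XW m) := ⟨fun a b => mk (a.num ^^^ b.num) (Nat.xor_lt_two_pow a.num_lt b.num_lt)⟩
instance : Zero (XW m) := ⟨mk 0 (by positivity)⟩
instance : Neg (XW m) := ⟨id⟩

instance : AddCommGroup (XW m) :=
  { AddGroup.ofLeftAxioms (fun a b c : XW m => ext (Nat.xor_assoc _ _ _)) (fun a => ext (Nat.zero_xor _))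
      (fun a => ext (Nat.xor_self _)) with
    add_comm := fun a b => ext (Nat.xor_comm _ _) }

@[simp] theorem num_add (a b : XW m) : (a + b).num = a.num ^^^ b.num := rfl
@[simp] theorem num_zero : (0 : XW m).num = 0 := rfl
theorem card : Fintype.card (XW m) = 2 ^ m := Fintype.card_fin _
end XW

/-- Tables of `K` characters of `m` bits. -/
abbrev Table (K m : ℕ) := Fin K → XW m

/-- The characters of a table. -/
def Table.get {K m : ℕ} (ω : Table K m) (z : ℕ) : ℕ := if h : z < K then (ω ⟨z, h⟩).num else 0

theorem Table.get_lt {K m : ℕ} (ω : Table K m) (z : ℕ) : ω.get z < 2 ^ m := by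
  unfold Table.get; split_ifs
  · exact XW.num_lt _
  · positivity

theorem Table.get_add {K m : ℕ} (ω ω' : Table K m) (z : ℕ) : Table.get (ω + ω') z = ω.get z ^^^ ω'.get z := by
  unfold Table.get; split_ifs <;> simp

theorem Table.get_zero {K m : ℕ} (z : ℕ) : Table.get (0 : Table K m) z = 0 := by
  unfold Table.get; split_ifs <;> simp

/-- A surjective system of linear functions of a random table has uniform values. -/
theorem uniformProb_xor_le {Ω : Type} [AddGroup Ω] [Fintype Ω] {ρ d : ℕ} (Φ : Ω → ℕ → ℕ → ℕ)
    (hadd : ∀ ω ω' x y, Φ (ω + ω') x y = Φ ω x y ^^^ Φ ω' x y) (hlt : ∀ ω x y, Φ ω x y < 2 ^ ρ) (S : Finset ℕ)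
    (hs : ∀ τ : ℕ → ℕ → ℕ, (∀ x y, τ x y < 2 ^ ρ) → ∃ ω, ∀ x ∈ S, ∀ y < d, Φ ω x y = τ x y) (τ : ℕ → ℕ → ℕ) :
    uniformProb {ω | ∀ x ∈ S, ∀ y < d, Φ ω x y = τ x y} ≤ (1 / 2 ^ ρ : ℝ) ^ (S.card * d) := by
  classical
  let φ : Ω →+ (S × Fin d → XW ρ) := AddMonoidHom.mk' (fun ω q => XW.mk (Φ ω q.1 q.2) (hlt _ _ _))
    (fun a b => funext fun q => XW.ext (hadd _ _ _ _))
  have hφ : Function.Surjective φ := by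
    intro f
    obtain ⟨ω, hω⟩ := hs (fun x y => if h : x ∈ S ∧ y < d then (f (⟨x, h.1⟩, ⟨y, h.2⟩)).num else 0) (by
      intro x y
      split_ifs
      · exact XW.num_lt _
      · positivity)
    refine ⟨ω, funext fun ⟨x, y⟩ => XW.ext ?_⟩
    have := hω x x.2 y y.2
    simp only [x.2, y.2, and_self, dif_pos] at this
    exact this
  have hsub : {ω | ∀ x ∈ S, ∀ y < d, Φ ω x y = τ x y} ⊆
      φ ⁻¹' {fun q => XW.mk (τ q.1 q.2 % 2 ^ ρ) (Nat.mod_lt _ (by positivity))} := by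
    intro ω hω
    refine funext fun q => XW.ext ?_
    have h1 := hω q.1 q.1.2 q.2 q.2.2
    change Φ ω q.1 q.2 = τ q.1 q.2 % 2 ^ ρ
    rw [← h1, Nat.mod_eq_of_lt (hlt _ _ _)]
  refine (uniformProb_mono hsub).trans ?_
  rw [uniformProb_preimage φ hφ]
  unfold uniformProb
  simp [XW.card]

/-- Peeling: a system of linear functions is surjective if every set contains a key that can be changed alone. -/
theorem xor_surj_of_isolate {Ω : Type} [AddMonoid Ω] {ρ d : ℕ} (M : AddSubmonoid Ω) (Φ : Ω → ℕ → ℕ → ℕ)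
    (hadd : ∀ ω ω' x y, Φ (ω + ω') x y = Φ ω x y ^^^ Φ ω' x y) (hlt : ∀ ω x y, Φ ω x y < 2 ^ ρ) (S : Finset ℕ)
    (hi : ∀ S' ⊆ S, S'.Nonempty → ∃ x₀ ∈ S', ∀ t : ℕ → ℕ, (∀ y, t y < 2 ^ ρ) → ∃ ω ∈ M, (∀ y < d, Φ ω x₀ y = t y) ∧
      ∀ x ∈ S', x ≠ x₀ → ∀ y < d, Φ ω x y = 0) (τ : ℕ → ℕ → ℕ) (hτ : ∀ x y, τ x y < 2 ^ ρ) :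
    ∃ ω ∈ M, ∀ x ∈ S, ∀ y < d, Φ ω x y = τ x y := by
  classical
  induction S using Finset.strongInduction with
  | H S ih =>
    rcases S.eq_empty_or_nonempty with rfl | hne
    · exact ⟨0, M.zero_mem, by simp⟩
    obtain ⟨x₀, h0, h1⟩ := hi S subset_rfl hne
    obtain ⟨ω₁, hm₁, h2⟩ := ih (S.erase x₀) (Finset.erase_ssubset h0)
      fun S' hS' => hi S' (hS'.trans (Finset.erase_subset _ _))
    obtain ⟨ω₂, hm₂, h3, h4⟩ := h1 (fun y => Φ ω₁ x₀ y ^^^ τ x₀ y) fun y => Nat.xor_lt_two_pow (hlt _ _ _) (hτ _ _)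
    refine ⟨ω₁ + ω₂, M.add_mem hm₁ hm₂, fun x hx y hy => ?_⟩
    rw [hadd]
    by_cases hxx : x = x₀
    · rw [hxx, h3 y hy, ← Nat.xor_assoc, Nat.xor_self, Nat.zero_xor]
    · rw [h2 x (Finset.mem_erase.2 ⟨hxx, hx⟩) y hy, h4 x hx hxx y hy, Nat.xor_zero]

/-- Every subset of `S` contains a key with a unique value. -/
def Sep (S : Finset ℕ) (d : ℕ) (v : ℕ → ℕ → ℕ) : Prop :=
  ∀ S' ⊆ S, S'.Nonempty → ∃ x₀ ∈ S', ∃ g < d, ∀ x ∈ S', x ≠ x₀ → v x g ≠ v x₀ g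

theorem xorSum_zero {t : ℕ → ℕ} {d : ℕ} (h : ∀ i < d, t i = 0) : xorSum t d = 0 := by
  induction d with
  | zero => rfl
  | succ d ih => simp [xorSum, ih fun i hi => h i (by omega), h d (by omega)]

theorem xorSum_single {t : ℕ → ℕ} {d g : ℕ} (hg : g < d) (h : ∀ i < d, i ≠ g → t i = 0) : xorSum t d = t g := by
  induction d with
  | zero => omega
  | succ d ih =>
    rcases eq_or_ne g d with rfl | hne
    · rw [xorSum, xorSum_zero fun i hi => h i (by omega) (by omega), Nat.zero_xor]
    · simp [xorSum, ih (by omega) fun i hi => h i (by omega), h d (by omega) hne.symm]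

namespace Par
variable (p : Par)

/-- The row of a character of the table. -/
def rowOf (z : ℕ) : ℕ := z / 2 ^ (p.E + p.ib + p.δ)

theorem entry_rowOf {J g i y : ℕ} (hg : g < 2 ^ p.δ) (hi : i < 2 ^ p.ib) (hy : y < 2 ^ p.E) :
    p.rowOf (p.entry J g i * 2 ^ p.E + y) = J := by
  unfold rowOf entry
  rw [pow_add, pow_add, mul_assoc, ← Nat.div_div_eq_div_mul, add_comm, Nat.add_mul_div_right _ _ (by positivity),
    Nat.div_eq_of_lt hy, zero_add, ← Nat.div_div_eq_div_mul, add_comm, Nat.add_mul_div_right _ _ (by positivity),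
    Nat.div_eq_of_lt hi, zero_add, add_comm, Nat.add_mul_div_right _ _ (by positivity), Nat.div_eq_of_lt hg, zero_add]

theorem entry_inj {J g i g' i' : ℕ} (hi : i < 2 ^ p.ib) (hi' : i' < 2 ^ p.ib) (h : p.entry J g i = p.entry J g' i') :
    g = g' ∧ i = i' := by
  unfold entry at h
  have h1 := congrArg (· / 2 ^ p.ib) h
  have h2 := congrArg (· % 2 ^ p.ib) h
  simp only [Nat.mul_add_mod_self_right, Nat.mod_eq_of_lt hi, Nat.mod_eq_of_lt hi'] at h2
  simp only [add_comm _ i, add_comm _ i', Nat.add_mul_div_right _ _ (show 0 < 2 ^ p.ib by positivity), Nat.div_eq_of_lt hi,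
    Nat.div_eq_of_lt hi', zero_add] at h1
  exact ⟨by omega, h2⟩

theorem stageF_tab_congr {tab tab' : ℕ → ℕ} {J : ℕ} (ht : ∀ z, p.rowOf z = J → tab' z = tab z) {c : ℕ → ℕ} {k y : ℕ}
    (hc : ∀ g < 2 ^ p.δ, c g * 2 ^ p.h + k < 2 ^ p.ib) (hy : y < 2 ^ p.E) :
    p.stageF tab' J c k y = p.stageF tab J c k y :=
  xorSum_congr fun g hg => ht _ (p.entry_rowOf hg (hc g hg) hy)

theorem stageF_xor {tab tab' tab'' : ℕ → ℕ} (ht : ∀ z, tab'' z = tab z ^^^ tab' z) (J : ℕ) (c : ℕ → ℕ) (k y : ℕ) :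
    p.stageF tab'' J c k y = p.stageF tab J c k y ^^^ p.stageF tab' J c k y := by
  unfold stageF
  rw [← xorSum_xor]
  exact xorSum_congr fun g _ => ht _

theorem stageF_lt {tab : ℕ → ℕ} (ht : ∀ z, tab z < 2 ^ p.m) (J : ℕ) (c : ℕ → ℕ) (k y : ℕ) : p.stageF tab J c k y < 2 ^ p.m :=
  xorSum_lt fun g _ => ht _

/-- The tables that vanish outside of a row. -/
def rowSub (J : ℕ) : AddSubmonoid (Table (2 ^ p.Z) p.m) where
  carrier := {ω | ∀ z, p.rowOf z ≠ J → ω.get z = 0}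
  add_mem' ha hb z hz := by rw [Table.get_add, ha z hz, hb z hz, Nat.xor_zero]
  zero_mem' z _ := Table.get_zero z

/-- Simple tabulation on a set of keys with unique neighbours has all values, for suitable tables. -/
theorem stage_surj {J ρ d : ℕ} (hJ : J < 2 ^ (p.l + p.σ + 1)) (hρ : ρ ≤ p.m) (hd : d ≤ 2 ^ p.E) {c : ℕ → ℕ → ℕ} {k : ℕ → ℕ}
    {S : Finset ℕ} (hc : ∀ x ∈ S, ∀ g < 2 ^ p.δ, c x g * 2 ^ p.h + k x < 2 ^ p.ib)
    (hS : Sep S (2 ^ p.δ) fun x g => c x g * 2 ^ p.h + k x) (τ : ℕ → ℕ → ℕ) (hτ : ∀ x y, τ x y < 2 ^ ρ) :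
    ∃ ω ∈ p.rowSub J, ∀ x ∈ S, ∀ y < d, p.stageF ω.get J (c x) (k x) y % 2 ^ ρ = τ x y := by
  refine xor_surj_of_isolate (p.rowSub J) (fun ω x y => p.stageF ω.get J (c x) (k x) y % 2 ^ ρ) ?_ ?_ S ?_ τ hτ
  · intro ω ω' x y
    rw [← Nat.xor_mod_two_pow, p.stageF_xor (Table.get_add ω ω')]
  · intro ω x y; exact Nat.mod_lt _ (by positivity)
  · intro S' hS' hne
    obtain ⟨x₀, h0, g, hg, h1⟩ := hS S' hS' hne
    refine ⟨x₀, h0, fun t ht => ?_⟩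
    set e := p.entry J g (c x₀ g * 2 ^ p.h + k x₀) with he
    have hi0 := hc x₀ (hS' h0) g hg
    have he1 : e < 2 ^ p.NE := p.entry_lt hJ hg hi0
    let ω : Table (2 ^ p.Z) p.m := fun z => XW.mk (if (z : ℕ) / 2 ^ p.E = e then t ((z : ℕ) % 2 ^ p.E) else 0) (by
      split_ifs
      · exact (ht _).trans_le (Nat.pow_le_pow_right two_pos hρ)
      · positivity)
    have hget : ∀ z, ω.get z = if z / 2 ^ p.E = e then t (z % 2 ^ p.E) else 0 := by
      intro z
      unfold Table.get
      by_cases hz : z < 2 ^ p.Z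
      · simp [hz, ω]
      · rw [dif_neg hz, if_neg]
        intro h
        apply hz
        unfold Par.Z
        rw [pow_add, ← Nat.div_lt_iff_lt_mul (by positivity), h]
        exact he1
    have hent : ∀ e' y, y < 2 ^ p.E → ω.get (e' * 2 ^ p.E + y) = if e' = e then t y else 0 := by
      intro e' y hy
      rw [hget, add_comm, Nat.add_mul_div_right _ _ (by positivity), Nat.div_eq_of_lt hy, zero_add, Nat.add_mul_mod_self_right,
        Nat.mod_eq_of_lt hy]
    refine ⟨ω, ?_, ?_, ?_⟩
    · intro z hz
      rw [hget, if_neg]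
      intro h
      apply hz
      rw [← Nat.div_add_mod' z (2 ^ p.E), h]
      exact p.entry_rowOf hg hi0 (Nat.mod_lt _ (by positivity))
    · intro y hy
      have : p.stageF ω.get J (c x₀) (k x₀) y = t y := by
        unfold stageF
        rw [xorSum_single hg]
        · rw [hent _ _ (hy.trans_le hd), if_pos rfl]
        · intro g' hg' hne
          rw [hent _ _ (hy.trans_le hd), if_neg]
          intro h
          exact hne (p.entry_inj (hc x₀ (hS' h0) g' hg') hi0 h).1
      rw [this, Nat.mod_eq_of_lt (ht y)]
    · intro x hx hxx y hy
      have : p.stageF ω.get J (c x) (k x) y = 0 := by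
        unfold stageF
        refine xorSum_zero fun g' hg' => ?_
        rw [hent _ _ (hy.trans_le hd), if_neg]
        intro h
        obtain ⟨rfl, h2⟩ := p.entry_inj (hc x (hS' hx) g' hg') hi0 h
        exact h1 x hx hxx h2
      rw [this, Nat.zero_mod]

end Par

end WordRAM

namespace WordRAM

/-- Digit `i` of `X` in base `2 ^ b`. -/
def dig (b X i : ℕ) : ℕ := X / 2 ^ (i * b) % 2 ^ b

theorem dig_lt (b X i : ℕ) : dig b X i < 2 ^ b := Nat.mod_lt _ (by positivity)

theorem dig_mod {b X i s : ℕ} (h : i < s) : dig b (X % 2 ^ (s * b)) i = dig b X i := by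
  unfold dig
  obtain ⟨e, rfl⟩ := Nat.exists_eq_add_of_lt h
  rw [show (i + e + 1) * b = i * b + (b + e * b) by ring, pow_add, Nat.mod_mul_right_div_self, pow_add, Nat.mod_mul_right_mod]

theorem dig_div (b X i s : ℕ) : dig b (X / 2 ^ (s * b)) i = dig b X (s + i) := by
  unfold dig
  rw [Nat.div_div_eq_div_mul, ← pow_add, ← add_mul]

theorem dig_inj {b X Y s : ℕ} (hX : X < 2 ^ (s * b)) (hY : Y < 2 ^ (s * b)) (h : ∀ i < s, dig b X i = dig b Y i) : X = Y := by
  induction s generalizing X Y with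
  | zero => simp at hX hY; omega
  | succ s ih =>
    have h1 : X % 2 ^ b = Y % 2 ^ b := by simpa [dig] using h 0 (by omega)
    have h2 : X / 2 ^ b = Y / 2 ^ b := by
      refine ih ?_ ?_ fun i hi => ?_
      · rw [Nat.div_lt_iff_lt_mul (by positivity), ← pow_add]; convert hX using 2; ring
      · rw [Nat.div_lt_iff_lt_mul (by positivity), ← pow_add]; convert hY using 2; ring
      · have := h (1 + i) (by omega)
        have e := dig_div b X i 1
        have e' := dig_div b Y i 1
        rw [one_mul] at e e'
        rw [e, e', this]
    rw [← Nat.div_add_mod X (2 ^ b), ← Nat.div_add_mod Y (2 ^ b), h1, h2]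

theorem exists_dig (b s : ℕ) (q : ℕ → ℕ) (hq : ∀ i < s, q i < 2 ^ b) : ∃ X < 2 ^ (s * b), ∀ i < s, dig b X i = q i := by
  induction s generalizing q with
  | zero => exact ⟨0, by simp, by simp⟩
  | succ s ih =>
    obtain ⟨Y, hY, h1⟩ := ih (fun i => q (i + 1)) fun i hi => hq _ (by omega)
    have h0 := hq 0 (by omega)
    have e : (Y * 2 ^ b + q 0) / 2 ^ b = Y := by
      rw [add_comm, Nat.add_mul_div_right _ _ (by positivity), Nat.div_eq_of_lt h0, zero_add]
    refine ⟨Y * 2 ^ b + q 0, ?_, fun i hi => ?_⟩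
    · calc Y * 2 ^ b + q 0 < (Y + 1) * 2 ^ b := by rw [add_mul]; omega
        _ ≤ 2 ^ (s * b) * 2 ^ b := Nat.mul_le_mul_right _ hY
        _ = _ := by rw [← pow_add]; ring_nf
    · rcases i with _ | i
      · simp [dig, Nat.mul_add_mod_self_right, Nat.mod_eq_of_lt h0]
      · rw [← h1 i (by omega), add_comm i 1]
        have e' := dig_div b (Y * 2 ^ b + q 0) i 1
        rw [one_mul] at e'
        rw [← e', e]

/-- Majority-unique halves give a unique pair of values. -/
theorem _root_.Hashing.Maj.pair {U k d : ℕ} {f : ℕ → ℕ → ℕ} (hf : Maj U k d f) {S : Finset ℕ} (hne : S.Nonempty) (hS : S.card ≤ k) {a b : ℕ → ℕ}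
    (ha : ∀ x ∈ S, a x < U) (hb : ∀ x ∈ S, b x < U) (hab : ∀ x ∈ S, ∀ y ∈ S, a x = a y → b x = b y → x = y) :
    ∃ x ∈ S, ∃ j < d, ∀ y ∈ S, y ≠ x → f (a y) j ≠ f (a x) j ∨ f (b y) j ≠ f (b x) j := by
  classical
  obtain ⟨A, hA, h1⟩ := hf (S.image a) (hne.image a) (Finset.card_image_le.trans hS) (by
    intro x hx
    obtain ⟨y, hy, rfl⟩ := Finset.mem_image.1 hx
    exact ha y hy)
  obtain ⟨x1, hx1, rfl⟩ := Finset.mem_image.1 hA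
  set S2 := S.filter fun x => a x = a x1 with hS2
  obtain ⟨B, hB, h2⟩ := hf (S2.image b) (Finset.Nonempty.image ⟨x1, by simp [hS2, hx1]⟩ b)
    (Finset.card_image_le.trans ((Finset.card_filter_le _ _).trans hS)) (by
    intro x hx
    obtain ⟨y, hy, rfl⟩ := Finset.mem_image.1 hx
    exact hb y (Finset.mem_filter.1 hy).1)
  obtain ⟨x, hx, rfl⟩ := Finset.mem_image.1 hB
  obtain ⟨hxS, hxa⟩ := Finset.mem_filter.1 hx
  have h3 : ∃ j, j ∈ uniq d f (S.image a) (a x1) ∩ uniq d f (S2.image b) (b x) := by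
    by_contra hcon
    push Not at hcon
    have h4 := Finset.card_union_add_card_inter (uniq d f (S.image a) (a x1)) (uniq d f (S2.image b) (b x))
    rw [Finset.eq_empty_of_forall_notMem hcon, Finset.card_empty] at h4
    have h5 : (uniq d f (S.image a) (a x1) ∪ uniq d f (S2.image b) (b x)).card ≤ d := by
      refine (Finset.card_le_card (Finset.union_subset (Finset.filter_subset _ _) (Finset.filter_subset _ _))).trans ?_
      rw [Finset.card_range]
    omega
  obtain ⟨j, hj⟩ := h3
  simp only [uniq, Finset.mem_inter, Finset.mem_filter, Finset.mem_range] at hj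
  obtain ⟨⟨hjd, h4⟩, _, h5⟩ := hj
  refine ⟨x, hxS, j, hjd, fun y hy hne => ?_⟩
  by_cases hya : a y = a x1
  · right
    refine h5 _ (Finset.mem_image_of_mem _ (Finset.mem_filter.2 ⟨hy, hya⟩)) fun h => hne (hab y hy x hxS (hya.trans hxa.symm) h)
  · left
    rw [hxa]
    exact h4 _ (Finset.mem_image_of_mem _ hy) hya

theorem _root_.Hashing.Maj.exists_unique {U k d : ℕ} {f : ℕ → ℕ → ℕ} (hf : Maj U k d f) {S : Finset ℕ} (hne : S.Nonempty) (hS : S.card ≤ k) {a : ℕ → ℕ}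
    (ha : ∀ x ∈ S, a x < U) : ∃ x ∈ S, ∃ j < d, ∀ y ∈ S, a y ≠ a x → f (a y) j ≠ f (a x) j := by
  classical
  obtain ⟨A, hA, h1⟩ := hf (S.image a) (hne.image a) (Finset.card_image_le.trans hS) (by
    intro x hx
    obtain ⟨y, hy, rfl⟩ := Finset.mem_image.1 hx
    exact ha y hy)
  obtain ⟨x, hx, rfl⟩ := Finset.mem_image.1 hA
  have h2 : (uniq d f (S.image a) (a x)).Nonempty := Finset.card_pos.1 (by omega)
  obtain ⟨j, hj⟩ := h2
  simp only [uniq, Finset.mem_filter, Finset.mem_range] at hj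
  exact ⟨x, hx, j, hj.1, fun y hy hne => hj.2 _ (Finset.mem_image_of_mem _ hy) hne⟩

theorem _root_.Hashing.Maj.of_injOn {U k d : ℕ} {f : ℕ → ℕ → ℕ} (hd : 0 < d) (hf : ∀ i < d, ∀ x < U, ∀ y < U, f x i = f y i → x = y) : Maj U k d f := by
  rintro S ⟨x, hx⟩ - hS
  refine ⟨x, hx, ?_⟩
  have : uniq d f S x = Finset.range d :=
    Finset.filter_true_of_mem fun i hi y hy hne h => hne (hf i (Finset.mem_range.1 hi) y (hS y hy) x (hS x hx) h)
  rw [this, Finset.card_range]; omega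

namespace Par
variable (p : Par)

/-- The state after processing `s` chunks. -/
def stQ (tab : ℕ → ℕ) : ℕ → (ℕ → ℕ) → ℕ → ℕ
  | 0, _ => fun _ => 0
  | s + 1, q => p.stageF tab s (fun g => stQ tab s q g % 2 ^ p.pm) (q s)

theorem stQ_congr {tab : ℕ → ℕ} {s : ℕ} {q q' : ℕ → ℕ} (h : ∀ i < s, q i = q' i) : p.stQ tab s q = p.stQ tab s q' := by
  induction s with
  | zero => rfl
  | succ s ih => simp only [stQ, ih fun i hi => h i (by omega), h s (by omega)]

/-- The chunks of a pair. -/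
def chunk (a b i : ℕ) : ℕ := if i % 2 = 0 then dig p.h a (i / 2) else dig p.h b (i / 2)

theorem pairSt_eq (tab : ℕ → ℕ) (a b s : ℕ) : p.pairSt tab a b s = (p.stQ tab s (p.chunk a b),
    if s % 2 = 0 then (a / 2 ^ (s / 2 * p.h), b / 2 ^ (s / 2 * p.h)) else (b / 2 ^ (s / 2 * p.h), a / 2 ^ ((s / 2 + 1) * p.h))) := by
  induction s with
  | zero => simp [pairSt, stQ]
  | succ s ih =>
    rw [pairSt, ih]
    rcases Nat.mod_two_eq_zero_or_one s with h | h
    · have h2 : (s + 1) % 2 = 1 := by omega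
      have h3 : (s + 1) / 2 = s / 2 := by omega
      simp only [h, h2, h3, if_true, one_ne_zero, if_false, stQ, chunk, dig]
      rw [Nat.div_div_eq_div_mul, ← pow_add, add_mul, one_mul]
    · have h2 : (s + 1) % 2 = 0 := by omega
      have h3 : (s + 1) / 2 = s / 2 + 1 := by omega
      simp only [h, h2, h3, if_true, one_ne_zero, if_false, stQ, chunk, dig]
      rw [Nat.div_div_eq_div_mul, ← pow_add, add_mul, one_mul]

theorem pairF_eq (tab : ℕ → ℕ) (a b g : ℕ) : p.pairF tab a b g = p.stQ tab p.Q (p.chunk a b) g % 2 ^ p.pm := by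
  rw [pairF, pairSt_eq]

theorem pairF_lt (tab : ℕ → ℕ) (a b g : ℕ) : p.pairF tab a b g < 2 ^ p.pm := Nat.mod_lt _ (by positivity)

theorem lev_lt {tab : ℕ → ℕ} (ht : ∀ z, tab z < 2 ^ p.m) (i : ℕ) {x : ℕ → ℕ} (hx : ∀ c, x c < 2 ^ p.m) (y : ℕ) :
    p.lev tab i x y < 2 ^ p.m := by
  cases i with
  | zero => exact hx 0
  | succ i => exact xorSum_lt fun j _ => p.stageF_lt ht _ _ _ _

theorem lev_key_congr {tab : ℕ → ℕ} {i : ℕ} {x x' : ℕ → ℕ} (h : ∀ c < 2 ^ i, x c = x' c) (y : ℕ) :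
    p.lev tab i x y = p.lev tab i x' y := by
  induction i generalizing x x' y with
  | zero => exact h 0 (by simp)
  | succ i ih =>
    rw [pow_succ] at h
    simp only [lev]
    congr 1
    · exact funext fun y => ih (fun c hc => h c (by omega)) y
    · exact funext fun y => ih (fun c hc => h _ (by omega)) y

theorem stQ_tab_congr {tab tab' : ℕ → ℕ} {s : ℕ} (ht : ∀ z, p.rowOf z < s → tab' z = tab z) {q : ℕ → ℕ} (hq : ∀ i < s, q i < 2 ^ p.h)
    {y : ℕ} (hy : y < 2 ^ p.E) : p.stQ tab' s q y = p.stQ tab s q y := by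
  induction s generalizing y with
  | zero => rfl
  | succ s ih =>
    simp only [stQ]
    rw [p.stageF_tab_congr (tab := tab) (fun z hz => ht z (by omega))
      (fun g hg => p.idx_lt (Nat.mod_lt _ (by positivity)) (hq s (by omega))) hy]
    refine stageF_congr (fun g hg => ?_) _ _ _
    rw [ih (fun z hz => ht z (by omega)) (fun i hi => hq i (by omega)) (hg.trans_le (Nat.pow_le_pow_right two_pos (by unfold Par.E; omega)))]

theorem chunk_lt (a b i : ℕ) : p.chunk a b i < 2 ^ p.h := by
  unfold chunk; split_ifs <;> exact dig_lt _ _ _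

theorem pairF_tab_congr {tab tab' : ℕ → ℕ} (ht : ∀ z, p.rowOf z < p.Q → tab' z = tab z) {a b y : ℕ} (hy : y < 2 ^ p.E) :
    p.pairF tab' a b y = p.pairF tab a b y := by
  rw [pairF_eq, pairF_eq, p.stQ_tab_congr ht (fun i _ => p.chunk_lt a b i) hy]

theorem idx_zero_lt {c : ℕ} (hc : c < 2 ^ p.pm) : c * 2 ^ p.h + 0 < 2 ^ p.ib := p.idx_lt hc (by positivity)

theorem lev_tab_congr {tab tab' : ℕ → ℕ} (hσ : 2 ≤ p.σ) {i : ℕ} (hi : i ≤ p.l) (ht : ∀ z, p.rowOf z < p.Q → tab' z = tab z)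
    (ht' : ∀ z, p.rowOf z < 2 ^ (i + p.σ + 1) → tab' z = tab z) {x : ℕ → ℕ} {y : ℕ} (hy : y < 2 ^ p.E) :
    p.lev tab' i x y = p.lev tab i x y := by
  induction i generalizing x y with
  | zero => rfl
  | succ i ih =>
    simp only [lev, levelF]
    refine xorSum_congr fun j hj => ?_
    have hjE : j < 2 ^ p.E := hj.trans_le (Nat.pow_le_pow_right two_pos (by unfold Par.E; omega))
    have e1 : 2 ^ (i + 1 + p.σ + 1) = 2 ^ (i + 1 + p.σ) * 2 := pow_succ _ _
    have e2 : 2 ^ (i + 3) ≤ 2 ^ (i + 1 + p.σ) := Nat.pow_le_pow_right two_pos (by omega)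
    have e3 : 2 ^ (i + p.σ + 1) = 2 ^ (i + 1 + p.σ) := by congr 1; omega
    have ih' : ∀ x, p.lev tab' i x j = p.lev tab i x j := fun x => ih (by omega) (fun z hz => ht' z (by omega)) hjE
    rw [p.stageF_tab_congr (tab := tab) (fun z hz => ht' z (by omega)) (fun g hg => p.idx_zero_lt (p.pairF_lt _ _ _ _)) hy]
    refine stageF_congr (fun g hg => ?_) _ _ _
    rw [p.pairF_tab_congr ht (hg.trans_le (Nat.pow_le_pow_right two_pos (by unfold Par.E; omega))), ih', ih']

/-- The values of the function on keys given by numbers. -/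
def keyF (tab : ℕ → ℕ) (i X y : ℕ) : ℕ := p.lev tab i (dig p.n X) y

/-- The states of the chunk processing on chunk sequences given by numbers. -/
def chunkF (tab : ℕ → ℕ) (s C g : ℕ) : ℕ := p.stQ tab s (dig p.h C) g % 2 ^ p.pm

/-- The constraints on the constants. -/
structure Good : Prop where
  hn : 0 < p.n
  hσ : 2 ≤ p.σ
  hQ : p.Q ≤ 2 ^ (p.σ + 1)
  hδ : 2 ≤ p.δ
  hD : 2 * p.Q + 3 ≤ 2 ^ (p.δ - 2)
  even : p.Q % 2 = 0
  cover : p.m ≤ p.Q / 2 * p.h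

variable {p}

theorem Good.four (hg : p.Good) : 2 ^ p.δ = 4 * 2 ^ (p.δ - 2) := by
  have := hg.hδ
  rw [show (4 : ℕ) = 2 ^ 2 by norm_num, ← pow_add]; congr 1; omega

theorem Good.pm_le (hg : p.Good) : p.pm ≤ p.m := p.E_le hg.hn

/-- The next chunk: separated indices. -/
theorem chunk_sep {tab : ℕ → ℕ} {s : ℕ} (hm : Maj (2 ^ (s * p.h)) (2 ^ p.κ) (2 ^ p.δ) (p.chunkF tab s)) {S : Finset ℕ}
    (hS : S.card ≤ 2 ^ p.κ) (hU : ∀ x ∈ S, x < 2 ^ ((s + 1) * p.h)) :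
    Sep S (2 ^ p.δ) fun x g => p.chunkF tab s x g * 2 ^ p.h + dig p.h x s := by
  intro S' hS' hne
  obtain ⟨x, hx, g, hg, h1⟩ := hm.exists_unique hne ((Finset.card_le_card hS').trans hS) (a := fun x => x % 2 ^ (s * p.h))
    fun x _ => Nat.mod_lt _ (by positivity)
  refine ⟨x, hx, g, hg, fun y hy hyx h => ?_⟩
  have e : ∀ x, p.chunkF tab s (x % 2 ^ (s * p.h)) = p.chunkF tab s x := fun x => funext fun g => by
    unfold chunkF; rw [p.stQ_congr fun i hi => dig_mod hi]
  have h2 := congrArg (· / 2 ^ p.h) h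
  have h3 := congrArg (· % 2 ^ p.h) h
  simp only [Nat.mul_add_mod_self_right, Nat.mod_eq_of_lt (dig_lt _ _ _)] at h3
  simp only [add_comm (_ * 2 ^ p.h), Nat.add_mul_div_right _ _ (show 0 < 2 ^ p.h by positivity),
    Nat.div_eq_of_lt (dig_lt _ _ _), zero_add] at h2
  have h4 := h1 y hy
  rw [e, e] at h4
  have h5 : y % 2 ^ (s * p.h) = x % 2 ^ (s * p.h) := by
    by_contra hne'; exact h4 hne' h2
  refine hyx (dig_inj (hU y (hS' hy)) (hU x (hS' hx)) fun i hi => ?_)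
  rcases Nat.lt_succ_iff_lt_or_eq.1 hi with hi' | rfl
  · rw [← dig_mod hi', h5, dig_mod hi']
  · exact h3

theorem chunk_inj (hg : p.Good) {a b a' b' : ℕ} (ha : a < 2 ^ p.m) (hb : b < 2 ^ p.m) (ha' : a' < 2 ^ p.m) (hb' : b' < 2 ^ p.m)
    (h : ∀ i < p.Q, p.chunk a b i = p.chunk a' b' i) : a = a' ∧ b = b' := by
  have hle : 2 ^ p.m ≤ 2 ^ (p.Q / 2 * p.h) := Nat.pow_le_pow_right two_pos hg.cover
  have hev := hg.even
  constructor
  · refine dig_inj (b := p.h) (s := p.Q / 2) (by omega) (by omega) fun i hi => ?_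
    have := h (2 * i) (by omega)
    simpa [chunk, show 2 * i % 2 = 0 by omega, show 2 * i / 2 = i by omega] using this
  · refine dig_inj (b := p.h) (s := p.Q / 2) (by omega) (by omega) fun i hi => ?_
    have := h (2 * i + 1) (by omega)
    simpa [chunk, show (2 * i + 1) % 2 = 1 by omega, show (2 * i + 1) / 2 = i by omega] using this

/-- Pairs of characters, coded by numbers: separated hash characters. -/
theorem pair_sep (hg : p.Good) {tab : ℕ → ℕ} (hm : Maj (2 ^ (p.Q * p.h)) (2 ^ p.κ) (2 ^ p.δ) (p.chunkF tab p.Q)) {S : Finset ℕ}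
    (hS : S.card ≤ 2 ^ p.κ) (hU : ∀ x ∈ S, x < 2 ^ (2 * p.m)) :
    Sep S (2 ^ p.δ) fun x g => p.pairF tab (x / 2 ^ p.m) (x % 2 ^ p.m) g * 2 ^ p.h + 0 := by
  choose C hC1 hC2 using fun x => exists_dig p.h p.Q (p.chunk (x / 2 ^ p.m) (x % 2 ^ p.m)) fun i _ => p.chunk_lt _ _ i
  have e : ∀ x g, p.pairF tab (x / 2 ^ p.m) (x % 2 ^ p.m) g = p.chunkF tab p.Q (C x) g := fun x g => by
    rw [pairF_eq, chunkF, p.stQ_congr fun i hi => (hC2 x i hi).symm]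
  intro S' hS' hne
  obtain ⟨x, hx, g, hgd, h1⟩ := hm.exists_unique hne ((Finset.card_le_card hS').trans hS) (a := C) fun x _ => hC1 x
  refine ⟨x, hx, g, hgd, fun y hy hyx h => ?_⟩
  simp only [add_zero, e] at h
  have h2 := Nat.eq_of_mul_eq_mul_right (by positivity) h
  have h3 : C y = C x := by
    by_contra hne'; exact h1 y hy hne' h2
  have hlt : ∀ z ∈ S', z / 2 ^ p.m < 2 ^ p.m := fun z hz => by
    rw [Nat.div_lt_iff_lt_mul (by positivity), ← pow_add, ← two_mul]; exact hU z (hS' hz)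
  obtain ⟨h4, h5⟩ := chunk_inj hg (hlt y hy) (Nat.mod_lt y (by positivity)) (hlt x hx) (Nat.mod_lt x (by positivity)) fun i hi => by
    rw [← hC2 y i hi, ← hC2 x i hi, h3]
  exact hyx (by rw [← Nat.div_add_mod y (2 ^ p.m), ← Nat.div_add_mod x (2 ^ p.m), h4, h5])

/-- The combination of two halves has all values, for suitable rows of the table. -/
theorem level_surj (hg : p.Good) {tab : ℕ → ℕ} (htab : ∀ z, tab z < 2 ^ p.m)
    (hm : Maj (2 ^ (p.Q * p.h)) (2 ^ p.κ) (2 ^ p.δ) (p.chunkF tab p.Q)) {i : ℕ} (hi : i < p.l)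
    (hl : Maj (2 ^ (2 ^ i * p.n)) (2 ^ p.κ) (2 ^ (i + 3)) (p.keyF tab i)) {S : Finset ℕ}
    (hS : S.card ≤ 2 ^ p.κ) (hU : ∀ x ∈ S, x < 2 ^ (2 ^ (i + 1) * p.n)) (τ : ℕ → ℕ → ℕ) (hτ : ∀ x y, τ x y < 2 ^ p.m) :
    ∃ ω : Table (2 ^ p.Z) p.m, ∀ x ∈ S, ∀ y < 2 ^ (i + 4), xorSum (fun j => p.stageF ω.get (2 ^ (i + 1 + p.σ) + j)
      (p.pairF tab (p.keyF tab i (x % 2 ^ (2 ^ i * p.n)) j) (p.keyF tab i (x / 2 ^ (2 ^ i * p.n)) j)) 0 y) (2 ^ (i + 3)) = τ x y := by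
  classical
  have hmn : p.n ≤ p.m := by unfold Par.m; omega
  have hk : ∀ x j, p.keyF tab i x j < 2 ^ p.m := fun x j =>
    p.lev_lt htab i (fun c => (dig_lt _ _ _).trans_le (Nat.pow_le_pow_right two_pos hmn)) j
  suffices h : ∃ ω ∈ (⊤ : AddSubmonoid (Table (2 ^ p.Z) p.m)), ∀ x ∈ S, ∀ y < 2 ^ (i + 4),
      xorSum (fun j => p.stageF ω.get (2 ^ (i + 1 + p.σ) + j)
      (p.pairF tab (p.keyF tab i (x % 2 ^ (2 ^ i * p.n)) j) (p.keyF tab i (x / 2 ^ (2 ^ i * p.n)) j)) 0 y) (2 ^ (i + 3)) = τ x y by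
    obtain ⟨ω, _, h⟩ := h
    exact ⟨ω, h⟩
  refine xor_surj_of_isolate ⊤ (fun (ω : Table (2 ^ p.Z) p.m) x y => xorSum (fun j => p.stageF ω.get (2 ^ (i + 1 + p.σ) + j)
      (p.pairF tab (p.keyF tab i (x % 2 ^ (2 ^ i * p.n)) j) (p.keyF tab i (x / 2 ^ (2 ^ i * p.n)) j)) 0 y) (2 ^ (i + 3)))
      ?_ ?_ S ?_ τ hτ
  · intro ω ω' x y
    rw [← xorSum_xor]
    exact xorSum_congr fun j _ => p.stageF_xor (Table.get_add ω ω') _ _ _ _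
  · intro ω x y
    exact xorSum_lt fun j _ => p.stageF_lt ω.get_lt _ _ _ _
  · intro S' hS' hne
    have hpow : 2 ^ (2 ^ (i + 1) * p.n) = 2 ^ (2 ^ i * p.n) * 2 ^ (2 ^ i * p.n) := by rw [← pow_add]; congr 1; rw [pow_succ]; ring
    obtain ⟨x₀, hx₀, j₀, hj₀, h1⟩ := hl.pair hne ((Finset.card_le_card hS').trans hS) (a := fun x => x % 2 ^ (2 ^ i * p.n))
      (b := fun x => x / 2 ^ (2 ^ i * p.n)) (fun x _ => Nat.mod_lt _ (by positivity))
      (fun x hx => by rw [Nat.div_lt_iff_lt_mul (by positivity), ← hpow]; exact hU x (hS' hx))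
      (fun x _ y _ e1 e2 => by rw [← Nat.div_add_mod x (2 ^ (2 ^ i * p.n)), ← Nat.div_add_mod y (2 ^ (2 ^ i * p.n)), e1, e2])
    refine ⟨x₀, hx₀, fun t ht => ?_⟩
    set c : ℕ → ℕ := fun x => p.keyF tab i (x % 2 ^ (2 ^ i * p.n)) j₀ * 2 ^ p.m + p.keyF tab i (x / 2 ^ (2 ^ i * p.n)) j₀ with hc
    have c1 : ∀ x, c x / 2 ^ p.m = p.keyF tab i (x % 2 ^ (2 ^ i * p.n)) j₀ := fun x => by
      rw [hc]; simp only
      rw [add_comm, Nat.add_mul_div_right _ _ (by positivity), Nat.div_eq_of_lt (hk _ _), zero_add]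
    have c2 : ∀ x, c x % 2 ^ p.m = p.keyF tab i (x / 2 ^ (2 ^ i * p.n)) j₀ := fun x => by
      rw [hc]; simp only
      rw [Nat.mul_add_mod_self_right, Nat.mod_eq_of_lt (hk _ _)]
    have hrow : 2 ^ (i + 1 + p.σ) + j₀ < 2 ^ (p.l + p.σ + 1) := by
      have e1 : 2 ^ (i + 1 + p.σ + 1) = 2 ^ (i + 1 + p.σ) * 2 := pow_succ _ _
      have e2 : 2 ^ (i + 3) ≤ 2 ^ (i + 1 + p.σ) := Nat.pow_le_pow_right two_pos (by have := hg.hσ; omega)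
      have e3 : 2 ^ (i + 1 + p.σ + 1) ≤ 2 ^ (p.l + p.σ + 1) := Nat.pow_le_pow_right two_pos (by omega)
      omega
    obtain ⟨ω, hω1, hω2⟩ := p.stage_surj (J := 2 ^ (i + 1 + p.σ) + j₀) (ρ := p.m) (d := 2 ^ (i + 4)) hrow le_rfl
      (Nat.pow_le_pow_right two_pos (by have := hg.hδ; unfold Par.E; omega))
      (c := fun x g => p.pairF tab (x / 2 ^ p.m) (x % 2 ^ p.m) g) (k := fun _ => 0) (S := S'.image c)
      (fun x _ g _ => p.idx_zero_lt (p.pairF_lt _ _ _ _))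
      (pair_sep hg hm (Finset.card_image_le.trans ((Finset.card_le_card hS').trans hS)) (by
        intro x hx
        obtain ⟨y, hy, rfl⟩ := Finset.mem_image.1 hx
        rw [two_mul, pow_add]
        calc c y < p.keyF tab i (y % 2 ^ (2 ^ i * p.n)) j₀ * 2 ^ p.m + 2 ^ p.m := Nat.add_lt_add_left (hk _ _) _
          _ = (p.keyF tab i (y % 2 ^ (2 ^ i * p.n)) j₀ + 1) * 2 ^ p.m := by ring
          _ ≤ _ := Nat.mul_le_mul_right _ (hk _ _)))
      (fun x y => if x = c x₀ then t y else 0) (fun x y => by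
        split_ifs
        · exact ht y
        · positivity)
    have hz : ∀ x, ∀ y < 2 ^ (i + 4), xorSum (fun j => p.stageF ω.get (2 ^ (i + 1 + p.σ) + j)
        (p.pairF tab (p.keyF tab i (x % 2 ^ (2 ^ i * p.n)) j) (p.keyF tab i (x / 2 ^ (2 ^ i * p.n)) j)) 0 y) (2 ^ (i + 3)) =
        p.stageF ω.get (2 ^ (i + 1 + p.σ) + j₀)
          (p.pairF tab (p.keyF tab i (x % 2 ^ (2 ^ i * p.n)) j₀) (p.keyF tab i (x / 2 ^ (2 ^ i * p.n)) j₀)) 0 y := by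
      intro x y hy
      refine xorSum_single hj₀ fun j _ hne => xorSum_zero fun g hgd => hω1 _ ?_
      rw [p.entry_rowOf hgd (p.idx_zero_lt (p.pairF_lt _ _ _ _))
        (hy.trans_le (Nat.pow_le_pow_right two_pos (by have := hg.hδ; unfold Par.E; omega)))]
      omega
    have hv : ∀ x ∈ S', ∀ y < 2 ^ (i + 4), p.stageF ω.get (2 ^ (i + 1 + p.σ) + j₀)
          (p.pairF tab (p.keyF tab i (x % 2 ^ (2 ^ i * p.n)) j₀) (p.keyF tab i (x / 2 ^ (2 ^ i * p.n)) j₀)) 0 y =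
          if c x = c x₀ then t y else 0 := by
      intro x hx y hy
      have := hω2 (c x) (Finset.mem_image_of_mem _ hx) y hy
      simp only [c1, c2] at this
      rw [← this, Nat.mod_eq_of_lt (p.stageF_lt ω.get_lt _ _ _ _)]
    refine ⟨ω, trivial, fun y hy => ?_, fun x hx hne y hy => ?_⟩
    · rw [hz x₀ y hy, hv x₀ hx₀ y hy, if_pos rfl]
    · rw [hz x y hy, hv x hx y hy, if_neg]
      intro he
      rcases h1 x hx hne with h2 | h2
      · exact h2 (by rw [← c1, ← c1, he])
      · exact h2 (by rw [← c2, ← c2, he])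

end Par
end WordRAM

namespace WordRAM
namespace Par
variable {p : Par}

/-- A table whose characters in the rows of a set are replaced. -/
theorem get_rows (W : Set ℕ) [DecidablePred (· ∈ {i : Fin (2 ^ p.Z) | p.rowOf i ∈ W})] [DecidablePred (· ∈ W)]
    (r ω : Table (2 ^ p.Z) p.m) (z : ℕ) :
    Table.get (Set.piecewise {i : Fin (2 ^ p.Z) | p.rowOf i ∈ W} r ω) z = if p.rowOf z ∈ W then r.get z else ω.get z := by
  unfold Table.get
  by_cases hz : z < 2 ^ p.Z <;> by_cases hW : p.rowOf z ∈ W <;> simp [hz, hW, Set.piecewise]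

theorem prob_chunk_step (hg : p.Good) {s : ℕ} (hs : s < p.Q) :
    uniformProb {ω : Table (2 ^ p.Z) p.m | Maj (2 ^ (s * p.h)) (2 ^ p.κ) (2 ^ p.δ) (p.chunkF ω.get s) ∧
      ¬ Maj (2 ^ ((s + 1) * p.h)) (2 ^ p.κ) (2 ^ p.δ) (p.chunkF ω.get (s + 1))} ≤ 2 * (1 / 2 ^ (p.n + p.Q + 1) : ℝ) ^ 2 := by
  classical
  have hδE : 2 ^ p.δ ≤ 2 ^ p.E := Nat.pow_le_pow_right two_pos (by unfold Par.E; omega)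
  refine uniformProb_le_of_piecewise {i : Fin (2 ^ p.Z) | p.rowOf i ∈ ({s} : Set ℕ)} _ _ ?_
  intro (ω : Table (2 ^ p.Z) p.m)
  have hget := fun r => p.get_rows {s} r ω
  have hst : ∀ r : Table (2 ^ p.Z) p.m, ∀ C, ∀ g < 2 ^ p.δ, p.chunkF (Table.get (Set.piecewise {i : Fin (2 ^ p.Z) | p.rowOf i ∈ ({s} : Set ℕ)} r ω)) s C g =
      p.chunkF ω.get s C g := fun r C g hgd => by
    unfold chunkF
    rw [p.stQ_tab_congr (fun z hz => ?_) (fun i _ => dig_lt _ _ _) (hgd.trans_le hδE)]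
    rw [hget, if_neg]
    simp only [Set.mem_singleton_iff]; omega
  by_cases hm : Maj (2 ^ (s * p.h)) (2 ^ p.κ) (2 ^ p.δ) (p.chunkF ω.get s)
  swap
  · refine le_trans (le_of_eq ?_) (show (0 : ℝ) ≤ _ by positivity)
    rw [← uniformProb_empty (Ω := Table (2 ^ p.Z) p.m)]
    congr 1
    ext r
    simp only [Set.mem_ofPred_eq, Set.mem_empty_iff_false, iff_false, not_and]
    intro h
    exact absurd (h.congr fun x _ i hi => (hst r x i hi).symm) hm
  have hΦ : ∀ r : Table (2 ^ p.Z) p.m, ∀ C, ∀ g < 2 ^ p.δ,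
      p.chunkF (Table.get (Set.piecewise {i : Fin (2 ^ p.Z) | p.rowOf i ∈ ({s} : Set ℕ)} r ω)) (s + 1) C g =
      p.stageF r.get s (p.chunkF ω.get s C) (dig p.h C s) g % 2 ^ p.pm := fun r C g hgd => by
    have e : p.chunkF (Table.get (Set.piecewise {i : Fin (2 ^ p.Z) | p.rowOf i ∈ ({s} : Set ℕ)} r ω)) (s + 1) C g =
      p.stageF (Table.get (Set.piecewise {i : Fin (2 ^ p.Z) | p.rowOf i ∈ ({s} : Set ℕ)} r ω)) s
        (p.chunkF (Table.get (Set.piecewise {i : Fin (2 ^ p.Z) | p.rowOf i ∈ ({s} : Set ℕ)} r ω)) s C) (dig p.h C s) g % 2 ^ p.pm := rfl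
    rw [e, stageF_congr (hst r C), p.stageF_tab_congr (c := p.chunkF ω.get s C) (tab := r.get) (fun z hz => by rw [hget, if_pos (by simpa using hz)])
      (fun g' _ => p.idx_lt (c := p.chunkF ω.get s C g') (Nat.mod_lt _ (by positivity)) (dig_lt _ _ _)) (hgd.trans_le hδE)]
  refine le_trans (uniformProb_mono (B := {r : Table (2 ^ p.Z) p.m | ¬ Maj (2 ^ ((s + 1) * p.h)) (2 ^ p.κ) (4 * 2 ^ (p.δ - 2))
    fun C g => p.stageF r.get s (p.chunkF ω.get s C) (dig p.h C s) g % 2 ^ p.pm}) ?_) ?_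
  · rintro r ⟨_, h2⟩ h3
    rw [← hg.four] at h3
    exact h2 (h3.congr fun x _ i hi => hΦ r x i hi)
  · refine uniformProb_not_maj_le (g := p.h) _ (by omega) ?_ (fun r x y => Nat.mod_lt _ (by positivity)) ?_
    · have h1 := hg.hD
      have h2 : 1 ≤ p.h := by have := hg.hn; unfold Par.h; omega
      have h3 : p.n ≤ 2 * p.h := by unfold Par.h; omega
      have h4 : p.h * (2 * p.Q + 3) ≤ p.h * 2 ^ (p.δ - 2) := Nat.mul_le_mul_left _ h1
      have h5 : (s + 1) * p.h ≤ p.Q * p.h := Nat.mul_le_mul_right _ hs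
      nlinarith
    · intro S hS hU
      refine uniformProb_xor_le (ρ := p.pm) _ (fun a b x y => ?_) (fun r x y => Nat.mod_lt _ (by positivity)) S fun τ hτ => ?_
      · rw [← Nat.xor_mod_two_pow, p.stageF_xor (Table.get_add a b)]
      · have hJ : s < 2 ^ (p.l + p.σ + 1) := hs.trans_le (hg.hQ.trans (Nat.pow_le_pow_right two_pos (by omega)))
        obtain ⟨r, _, hr⟩ := p.stage_surj hJ hg.pm_le (show 4 * 2 ^ (p.δ - 2) ≤ 2 ^ p.E by rw [← hg.four]; exact hδE)
          (c := p.chunkF ω.get s) (k := fun C => dig p.h C s) (S := S)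
          (fun x _ g _ => p.idx_lt (Nat.mod_lt _ (by positivity)) (dig_lt _ _ _)) (chunk_sep hm hS hU) τ hτ
        exact ⟨r, hr⟩

theorem keyF_succ (tab : ℕ → ℕ) (i X y : ℕ) : p.keyF tab (i + 1) X y = xorSum (fun j => p.stageF tab (2 ^ (i + 1 + p.σ) + j)
      (p.pairF tab (p.keyF tab i (X % 2 ^ (2 ^ i * p.n)) j) (p.keyF tab i (X / 2 ^ (2 ^ i * p.n)) j)) 0 y) (2 ^ (i + 3)) := by
  have e1 : ∀ j, p.lev tab i (fun c => dig p.n X (2 ^ i + c)) j = p.keyF tab i (X / 2 ^ (2 ^ i * p.n)) j := fun j =>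
    p.lev_key_congr (fun c _ => (dig_div _ _ _ _).symm) j
  have e2 : ∀ j, p.lev tab i (dig p.n X) j = p.keyF tab i (X % 2 ^ (2 ^ i * p.n)) j := fun j =>
    p.lev_key_congr (fun c hc => (dig_mod hc).symm) j
  simp only [← e1, ← e2]
  rfl

theorem prob_level_step (hg : p.Good) {i : ℕ} (hi : i < p.l) :
    uniformProb {ω : Table (2 ^ p.Z) p.m | Maj (2 ^ (p.Q * p.h)) (2 ^ p.κ) (2 ^ p.δ) (p.chunkF ω.get p.Q) ∧
      Maj (2 ^ (2 ^ i * p.n)) (2 ^ p.κ) (2 ^ (i + 3)) (p.keyF ω.get i) ∧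
      ¬ Maj (2 ^ (2 ^ (i + 1) * p.n)) (2 ^ p.κ) (2 ^ (i + 1 + 3)) (p.keyF ω.get (i + 1))} ≤ 2 * (1 / 2 ^ (2 ^ (i + 1) * p.n) : ℝ) ^ 2 := by
  classical
  have hσ := hg.hσ
  have hδE : 2 ^ p.δ ≤ 2 ^ p.E := Nat.pow_le_pow_right two_pos (by unfold Par.E; omega)
  have hiE : 2 ^ (i + 4) ≤ 2 ^ p.E := Nat.pow_le_pow_right two_pos (by have := hg.hδ; unfold Par.E; omega)
  have hjE : 2 ^ (i + 3) ≤ 2 ^ p.E := Nat.pow_le_pow_right two_pos (by unfold Par.E; omega)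
  set W : Set ℕ := {J | 2 ^ (i + 1 + p.σ) ≤ J} with hW
  refine uniformProb_le_of_piecewise {z : Fin (2 ^ p.Z) | p.rowOf z ∈ W} _ _ ?_
  intro (ω : Table (2 ^ p.Z) p.m)
  have hget := fun r => p.get_rows W r ω
  set pw := fun r : Table (2 ^ p.Z) p.m => Table.get (Set.piecewise {z : Fin (2 ^ p.Z) | p.rowOf z ∈ W} r ω) with hpw
  have hlow : ∀ r z, p.rowOf z < 2 ^ (i + 1 + p.σ) → pw r z = ω.get z := fun r z hz => by
    rw [hpw]; simp only
    rw [hget, if_neg (by simp only [hW, Set.mem_ofPred_eq]; omega)]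
  have hQW : p.Q ≤ 2 ^ (i + 1 + p.σ) := hg.hQ.trans (Nat.pow_le_pow_right two_pos (by omega))
  have hst : ∀ r : Table (2 ^ p.Z) p.m, ∀ C, ∀ g < 2 ^ p.δ, p.chunkF (pw r) p.Q C g = p.chunkF ω.get p.Q C g := fun r C g hgd => by
    unfold chunkF
    rw [p.stQ_tab_congr (fun z hz => hlow r z (by omega)) (fun i _ => dig_lt _ _ _) (hgd.trans_le hδE)]
  have hlv : ∀ r, ∀ X, ∀ j < 2 ^ (i + 3), p.keyF (pw r) i X j = p.keyF ω.get i X j := fun r X j hj =>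
    p.lev_tab_congr hσ hi.le (fun z hz => hlow r z (by omega))
      (fun z hz => hlow r z (by rwa [show i + p.σ + 1 = i + 1 + p.σ by omega] at hz)) (hj.trans_le hjE)
  by_cases hm : Maj (2 ^ (p.Q * p.h)) (2 ^ p.κ) (2 ^ p.δ) (p.chunkF ω.get p.Q) ∧
      Maj (2 ^ (2 ^ i * p.n)) (2 ^ p.κ) (2 ^ (i + 3)) (p.keyF ω.get i)
  swap
  · refine le_trans (le_of_eq ?_) (show (0 : ℝ) ≤ _ by positivity)
    rw [← uniformProb_empty (Ω := Table (2 ^ p.Z) p.m)]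
    congr 1
    ext r
    simp only [Set.mem_ofPred_eq, Set.mem_empty_iff_false, iff_false, not_and]
    intro h h'
    exact absurd ⟨h.congr fun x _ i hi => (hst r x i hi).symm, h'.congr fun x _ i hi => (hlv r x i hi).symm⟩ hm
  obtain ⟨hm1, hm2⟩ := hm
  have hΦ : ∀ r : Table (2 ^ p.Z) p.m, ∀ X, ∀ y < 2 ^ (i + 4), p.keyF (pw r) (i + 1) X y =
      xorSum (fun j => p.stageF r.get (2 ^ (i + 1 + p.σ) + j) (p.pairF ω.get (p.keyF ω.get i (X % 2 ^ (2 ^ i * p.n)) j)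
        (p.keyF ω.get i (X / 2 ^ (2 ^ i * p.n)) j)) 0 y) (2 ^ (i + 3)) := fun r X y hy => by
    rw [p.keyF_succ]
    refine xorSum_congr fun j hj => ?_
    rw [p.stageF_tab_congr (tab := r.get) (fun z hz => ?_) (fun g hg => p.idx_zero_lt (p.pairF_lt _ _ _ _)) (hy.trans_le hiE)]
    · refine stageF_congr (fun g hg => ?_) _ _ _
      rw [hlv r _ j hj, hlv r _ j hj, p.pairF_tab_congr (fun z hz => hlow r z (by omega)) (hg.trans_le hδE)]
    · rw [hpw]; simp only
      rw [hget, if_pos (by simp only [hW, Set.mem_ofPred_eq]; omega)]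
  have e4 : 2 ^ (i + 4) = 4 * 2 ^ (i + 2) := by rw [pow_add, pow_add]; ring
  refine le_trans (uniformProb_mono (B := {r : Table (2 ^ p.Z) p.m | ¬ Maj (2 ^ (2 ^ (i + 1) * p.n)) (2 ^ p.κ) (4 * 2 ^ (i + 2))
    fun X y => xorSum (fun j => p.stageF r.get (2 ^ (i + 1 + p.σ) + j) (p.pairF ω.get (p.keyF ω.get i (X % 2 ^ (2 ^ i * p.n)) j)
        (p.keyF ω.get i (X / 2 ^ (2 ^ i * p.n)) j)) 0 y) (2 ^ (i + 3))}) ?_) ?_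
  · rintro r ⟨_, _, h2⟩ h3
    rw [← e4] at h3
    exact h2 (h3.congr fun x _ y hy => hΦ r x y hy)
  · have hlt : ∀ (r : Table (2 ^ p.Z) p.m) X y, xorSum (fun j => p.stageF r.get (2 ^ (i + 1 + p.σ) + j)
        (p.pairF ω.get (p.keyF ω.get i (X % 2 ^ (2 ^ i * p.n)) j) (p.keyF ω.get i (X / 2 ^ (2 ^ i * p.n)) j)) 0 y) (2 ^ (i + 3)) <
        2 ^ p.m := fun r X y => xorSum_lt fun j _ => p.stageF_lt r.get_lt _ _ _ _
    have em : p.κ + p.n + 4 = p.m := by unfold Par.m; ring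
    refine uniformProb_not_maj_le (g := p.n) _ (Nat.mul_pos (by positivity) hg.hn) ?_ ?_ ?_
    · apply le_of_eq
      rw [pow_succ 2 (i + 1)]; ring
    · rw [em]; exact hlt
    · rw [em]
      intro S hS hU
      rw [← e4]
      refine uniformProb_xor_le (ρ := p.m) _ (fun a b x y => ?_) hlt S fun τ hτ => ?_
      · rw [← xorSum_xor]
        exact xorSum_congr fun j _ => p.stageF_xor (Table.get_add a b) _ _ _ _
      · exact level_surj hg ω.get_lt hm1 hi hm2 hS hU τ hτ

theorem chunkF_maj_zero (p : Par) (tab : ℕ → ℕ) : Maj (2 ^ (0 * p.h)) (2 ^ p.κ) (2 ^ p.δ) (p.chunkF tab 0) :=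
  Maj.of_injOn (by positivity) fun i _ x hx y hy _ => by simp at hx hy; omega

theorem keyF_maj_zero (p : Par) (tab : ℕ → ℕ) : Maj (2 ^ (2 ^ 0 * p.n)) (2 ^ p.κ) (2 ^ (0 + 3)) (p.keyF tab 0) :=
  Maj.of_injOn (by positivity) fun i _ x hx y hy h => by
    simp only [keyF, lev, dig, zero_mul, pow_zero, Nat.div_one, one_mul] at h hx hy
    rwa [Nat.mod_eq_of_lt hx, Nat.mod_eq_of_lt hy] at h

theorem sum_level_le {n : ℕ} (hn : 0 < n) (l : ℕ) :
    ∑ i ∈ Finset.range l, 2 * (1 / 2 ^ (2 ^ (i + 1) * n) : ℝ) ^ 2 ≤ 1 / 2 ^ (n + 1) := by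
  have h1 : ∀ i : ℕ, 2 * (1 / 2 ^ (2 ^ (i + 1) * n) : ℝ) ^ 2 ≤ 1 / 2 ^ (n + 1) * (1 / 2) ^ (i + 1) := by
    intro i
    rw [div_pow, one_pow, ← pow_mul, div_pow, one_pow, div_mul_div_comm, one_mul, ← pow_add, mul_one_div,
      div_le_div_iff₀ (by positivity) (by positivity), one_mul, ← pow_succ']
    refine pow_le_pow_right₀ (by norm_num) ?_
    have h2 : i + 2 ≤ 2 ^ (i + 1) := (Nat.lt_two_pow_self (n := i + 1))
    have h3 : (i + 2) * n ≤ 2 ^ (i + 1) * n := Nat.mul_le_mul_right _ h2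
    nlinarith
  refine (Finset.sum_le_sum fun i _ => h1 i).trans ?_
  rw [← Finset.mul_sum]
  have h2 : ∀ l : ℕ, ∑ i ∈ Finset.range l, (1 / 2 : ℝ) ^ (i + 1) = 1 - (1 / 2) ^ l := by
    intro l
    induction l with
    | zero => simp
    | succ l ih => rw [Finset.sum_range_succ, ih, pow_succ]; ring
  rw [h2]
  have : (0 : ℝ) ≤ (1 / 2) ^ l := by positivity
  have h3 : (0 : ℝ) ≤ 1 / 2 ^ (n + 1) := by positivity
  nlinarith

/-- The function is majority-unique with high probability. -/
theorem prob_not_maj (hg : p.Good) : uniformProb {ω : Table (2 ^ p.Z) p.m |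
    ¬ Maj (2 ^ (2 ^ p.l * p.n)) (2 ^ p.κ) (2 ^ (p.l + 3)) (p.keyF ω.get p.l)} ≤ 1 / 2 ^ p.n := by
  classical
  have hsub : {ω : Table (2 ^ p.Z) p.m | ¬ Maj (2 ^ (2 ^ p.l * p.n)) (2 ^ p.κ) (2 ^ (p.l + 3)) (p.keyF ω.get p.l)} ⊆
      (⋃ s ∈ Finset.range p.Q, {ω : Table (2 ^ p.Z) p.m | Maj (2 ^ (s * p.h)) (2 ^ p.κ) (2 ^ p.δ) (p.chunkF ω.get s) ∧
        ¬ Maj (2 ^ ((s + 1) * p.h)) (2 ^ p.κ) (2 ^ p.δ) (p.chunkF ω.get (s + 1))}) ∪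
      ⋃ i ∈ Finset.range p.l, {ω : Table (2 ^ p.Z) p.m | Maj (2 ^ (p.Q * p.h)) (2 ^ p.κ) (2 ^ p.δ) (p.chunkF ω.get p.Q) ∧
        Maj (2 ^ (2 ^ i * p.n)) (2 ^ p.κ) (2 ^ (i + 3)) (p.keyF ω.get i) ∧
        ¬ Maj (2 ^ (2 ^ (i + 1) * p.n)) (2 ^ p.κ) (2 ^ (i + 1 + 3)) (p.keyF ω.get (i + 1))} := by
    intro ω hω
    by_contra hcon
    simp only [Set.mem_union, Set.mem_iUnion, Finset.mem_range, Set.mem_ofPred_eq, exists_prop, not_or, not_exists, not_and,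
      not_not] at hcon
    obtain ⟨h1, h2⟩ := hcon
    have h3 : ∀ s ≤ p.Q, Maj (2 ^ (s * p.h)) (2 ^ p.κ) (2 ^ p.δ) (p.chunkF ω.get s) := by
      intro s
      induction s with
      | zero => intro _; exact p.chunkF_maj_zero _
      | succ s ih => exact fun hs => h1 s (by omega) (ih (by omega))
    have h4 : ∀ i ≤ p.l, Maj (2 ^ (2 ^ i * p.n)) (2 ^ p.κ) (2 ^ (i + 3)) (p.keyF ω.get i) := by
      intro i
      induction i with
      | zero => intro _; exact p.keyF_maj_zero _
      | succ i ih => exact fun hi => h2 i (by omega) (h3 _ le_rfl) (ih (by omega))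
    exact hω (h4 _ le_rfl)
  refine (uniformProb_mono hsub).trans ((uniformProb_union_le _ _).trans ?_)
  have h1 := (uniformProb_biUnion_le (Finset.range p.Q) fun s => {ω : Table (2 ^ p.Z) p.m |
      Maj (2 ^ (s * p.h)) (2 ^ p.κ) (2 ^ p.δ) (p.chunkF ω.get s) ∧
      ¬ Maj (2 ^ ((s + 1) * p.h)) (2 ^ p.κ) (2 ^ p.δ) (p.chunkF ω.get (s + 1))}).trans
    (Finset.sum_le_sum fun s hs => prob_chunk_step hg (Finset.mem_range.1 hs))
  have h2 := ((uniformProb_biUnion_le (Finset.range p.l) fun i => {ω : Table (2 ^ p.Z) p.m |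
      Maj (2 ^ (p.Q * p.h)) (2 ^ p.κ) (2 ^ p.δ) (p.chunkF ω.get p.Q) ∧
      Maj (2 ^ (2 ^ i * p.n)) (2 ^ p.κ) (2 ^ (i + 3)) (p.keyF ω.get i) ∧
      ¬ Maj (2 ^ (2 ^ (i + 1) * p.n)) (2 ^ p.κ) (2 ^ (i + 1 + 3)) (p.keyF ω.get (i + 1))}).trans
    (Finset.sum_le_sum fun i hi => prob_level_step hg (Finset.mem_range.1 hi))).trans (sum_level_le hg.hn p.l)
  have h3 : ∑ s ∈ Finset.range p.Q, 2 * (1 / 2 ^ (p.n + p.Q + 1) : ℝ) ^ 2 ≤ 1 / 2 ^ (p.n + 1) := by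
    rw [Finset.sum_const, Finset.card_range, nsmul_eq_mul]
    have hQ : (p.Q : ℝ) ≤ 2 ^ p.Q := by exact_mod_cast Nat.lt_two_pow_self.le
    calc (p.Q : ℝ) * (2 * (1 / 2 ^ (p.n + p.Q + 1)) ^ 2) ≤ 2 ^ p.Q * (2 * (1 / 2 ^ (p.n + p.Q + 1)) ^ 2) := by gcongr
      _ = 2 ^ (p.Q + 1) / 2 ^ ((p.n + p.Q + 1) * 2) := by rw [div_pow, one_pow, ← pow_mul, pow_succ]; ring
      _ ≤ 1 / 2 ^ (p.n + 1) := by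
        rw [div_le_div_iff₀ (by positivity) (by positivity), one_mul, ← pow_add]
        exact pow_le_pow_right₀ (by norm_num) (by omega)
  have h4 : (1 : ℝ) / 2 ^ p.n = 1 / 2 ^ (p.n + 1) + 1 / 2 ^ (p.n + 1) := by rw [pow_succ]; field_simp; norm_num
  rw [h4]
  exact add_le_add (h1.trans h3) h2

end Par
end WordRAM

namespace Hashing

theorem MajorityUnique.of_maj {α β : Type} {d k U : ℕ} {f : ℕ → ℕ → ℕ} {Γ : α → Fin d → β} (e : α → ℕ) (he : Function.Injective e)
    (hU : ∀ x, e x < U) (g : β → ℕ) (hg : ∀ x j, g (Γ x j) = f (e x) j) (h : Maj U k d f) : MajorityUnique k Γ := by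
  classical
  intro S hne hS
  obtain ⟨X, hX, h1⟩ := h (S.image e) (hne.image e) (Finset.card_image_le.trans hS) (by
    intro X hX
    obtain ⟨x, _, rfl⟩ := Finset.mem_image.1 hX
    exact hU x)
  obtain ⟨x, hx, rfl⟩ := Finset.mem_image.1 hX
  refine ⟨x, hx, ?_⟩
  have h2 : (uniq d f (S.image e) (e x)).card ≤ (nbrs Γ {x} \ nbrs Γ (S.erase x)).card := by
    refine Finset.card_le_card_of_surjOn (fun q => (q.1 : ℕ)) ?_
    intro j hj
    simp only [uniq, Finset.coe_filter, Finset.mem_range, Set.mem_ofPred_eq] at hj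
    obtain ⟨hjd, hj⟩ := hj
    refine ⟨(⟨j, hjd⟩, Γ x ⟨j, hjd⟩), ?_, rfl⟩
    simp only [nbrs, Finset.coe_sdiff, Set.mem_sdiff, Finset.mem_coe, Finset.mem_biUnion, Finset.mem_image, Finset.mem_univ, true_and,
      Finset.mem_singleton, Finset.mem_erase, not_exists, not_and, Prod.mk.injEq]
    refine ⟨⟨x, rfl, ⟨j, hjd⟩, rfl, rfl⟩, ?_⟩
    rintro y ⟨hyx, hy⟩ i rfl h3
    refine hj (e y) (Finset.mem_image_of_mem _ hy) (fun h => hyx (he h)) ?_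
    have := congrArg g h3
    rwa [hg, hg] at this
  rw [div_lt_iff₀ (by norm_num)]
  exact_mod_cast (by omega : d < (nbrs Γ {x} \ nbrs Γ (S.erase x)).card * 2)

end Hashing

namespace WordRAM

theorem accF_cast {r : ℕ} {e : ℕ → ℕ} {z : ℕ} (he : ∀ i < z, e i < r) :
    ((accF r e z : ℕ) : ZMod r) = -∑ i ∈ Finset.range z, (e i : ZMod r) := by
  induction z with
  | zero => simp [accF]
  | succ z ih =>
    have h := he z (by omega)
    rw [Finset.sum_range_succ, neg_add, ← ih fun i hi => he i (by omega), accF]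
    split_ifs with hle
    · rw [Nat.cast_sub hle]; ring
    · rw [Nat.cast_sub (by omega), Nat.cast_add, ZMod.natCast_self]; ring

theorem accF_congr {r : ℕ} {e e' : ℕ → ℕ} {z : ℕ} (h : ∀ i < z, e i = e' i) : accF r e z = accF r e' z := by
  induction z with
  | zero => rfl
  | succ z ih => simp only [accF, ih fun i hi => h i (by omega), h z (by omega)]

/-- Sums of table entries over the neighbours are `k`-independent if every small set has a unique neighbour. -/
theorem kIndependent_of_maj {u r k U d m : ℕ} (hr : 0 < r) (hu : u ≤ U) {Γ : ℕ → ℕ → ℕ} (hm : Maj U k d Γ) (hΓ : ∀ x j, Γ x j < 2 ^ m)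
    (f : (Fin (d * 2 ^ m) → Fin r) → Fin u → Fin r)
    (hf : ∀ s x, (f s x : ℕ) = accF r (fun z => if h : z * 2 ^ m + Γ x z < d * 2 ^ m then (s ⟨z * 2 ^ m + Γ x z, h⟩ : ℕ) else 0) d) :
    KIndependent k f := by
  classical
  have : NeZero r := ⟨hr.ne'⟩
  intro X hX y
  have hidx : ∀ z < d, ∀ x : ℕ, z * 2 ^ m + Γ x z < d * 2 ^ m := fun z hz x => by
    calc z * 2 ^ m + Γ x z < z * 2 ^ m + 2 ^ m := Nat.add_lt_add_left (hΓ x z) _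
      _ = (z + 1) * 2 ^ m := by ring
      _ ≤ _ := Nat.mul_le_mul_right _ hz
  set g : (Fin (d * 2 ^ m) → Fin r) → ℕ → ℕ → ZMod r := fun s x z =>
    if h : z * 2 ^ m + Γ x z < d * 2 ^ m then ((s ⟨z * 2 ^ m + Γ x z, h⟩ : ℕ) : ZMod r) else 0 with hg
  have hfc : ∀ s x, ((f s x : ℕ) : ZMod r) = -∑ z ∈ Finset.range d, g s x z := fun s x => by
    rw [hf, accF_cast]
    · congr 1
      refine Finset.sum_congr rfl fun z hz => ?_
      simp only [hg]
      split_ifs <;> simp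
    · intro z hz
      split_ifs
      · exact Fin.isLt _
      · exact hr
  have hadd : ∀ s s' x z, g (s + s') x z = g s x z + g s' x z := fun s s' x z => by
    simp only [hg]
    split_ifs
    · simp [Fin.val_add]
    · simp
  let φ : (Fin (d * 2 ^ m) → Fin r) →+ (X → ZMod r) := AddMonoidHom.mk' (fun s x => -∑ z ∈ Finset.range d, g s (x : Fin u) z) (by
    intro s s'
    funext x
    simp only [hadd, Finset.sum_add_distrib, neg_add, Pi.add_apply])
  have hφ : Function.Surjective φ := by
    intro t
    suffices h : ∀ Y : Finset (Fin u), Y ⊆ X → ∀ t : Fin u → ZMod r, ∃ s, ∀ x ∈ Y, -∑ z ∈ Finset.range d, g s (x : Fin u) z = t x by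
      obtain ⟨s, hs⟩ := h X subset_rfl fun x => if h : x ∈ X then t ⟨x, h⟩ else 0
      refine ⟨s, funext fun x => ?_⟩
      have := hs x x.2
      rw [dif_pos x.2] at this
      exact this
    intro Y
    induction Y using Finset.strongInduction with
    | H Y ih =>
      intro hYX t
      rcases Y.eq_empty_or_nonempty with rfl | hne
      · exact ⟨0, by simp⟩
      obtain ⟨a, ha, j, hj, h1⟩ := hm.exists_unique (hne.image Fin.val)
        (Finset.card_image_le.trans ((Finset.card_le_card hYX).trans hX)) (a := id) (by
        intro x hx
        obtain ⟨x', _, rfl⟩ := Finset.mem_image.1 hx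
        exact x'.2.trans_le hu)
      obtain ⟨x₀, hx₀, rfl⟩ := Finset.mem_image.1 ha
      obtain ⟨s₁, h2⟩ := ih (Y.erase x₀) (Finset.erase_ssubset hx₀) ((Finset.erase_subset _ _).trans hYX) t
      set c : ZMod r := -(t x₀ + ∑ z ∈ Finset.range d, g s₁ x₀ z) with hc
      have hcr : c.val < r := ZMod.val_lt c
      set s₂ : Fin (d * 2 ^ m) → Fin r := Pi.single ⟨j * 2 ^ m + Γ x₀ j, hidx j hj _⟩ ⟨c.val, hcr⟩ with hs₂
      have h3 : ∀ x ∈ Y, ∑ z ∈ Finset.range d, g s₂ x z = if x = x₀ then c else 0 := by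
        intro x hx
        have hz : ∀ z < d, g s₂ x z = if z = j ∧ Γ x j = Γ x₀ j then c else 0 := by
          intro z hz
          simp only [hg]
          rw [dif_pos (hidx z hz x), hs₂, Pi.single_apply]
          have : ((⟨z * 2 ^ m + Γ x z, hidx z hz x⟩ : Fin (d * 2 ^ m)) = ⟨j * 2 ^ m + Γ x₀ j, hidx j hj _⟩) ↔ z = j ∧ Γ x j = Γ x₀ j := by
            rw [Fin.mk.injEq]
            constructor
            · intro h
              have h4 := congrArg (· / 2 ^ m) h
              have h5 := congrArg (· % 2 ^ m) h
              simp only [Nat.mul_add_mod_self_right, Nat.mod_eq_of_lt (hΓ _ _)] at h5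
              simp only [add_comm (_ * 2 ^ m), Nat.add_mul_div_right _ _ (show 0 < 2 ^ m by positivity), Nat.div_eq_of_lt (hΓ _ _),
                zero_add] at h4
              subst h4
              exact ⟨rfl, h5⟩
            · rintro ⟨rfl, h⟩; rw [h]
          simp only [this]
          split_ifs
          · simp
          · simp
        rw [Finset.sum_congr rfl fun z hz' => hz z (Finset.mem_range.1 hz')]
        split_ifs with hxx
        · subst hxx
          rw [Finset.sum_eq_single j]
          · simp
          · intro z _ hne; simp [hne]
          · intro h; exact absurd (Finset.mem_range.2 hj) h
        · refine Finset.sum_eq_zero fun z _ => if_neg ?_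
          rintro ⟨_, h⟩
          exact h1 x (Finset.mem_image_of_mem _ hx) (fun h => hxx (Fin.ext h)) h
      refine ⟨s₁ + s₂, fun x hx => ?_⟩
      simp only [hadd, Finset.sum_add_distrib]
      rw [h3 x hx]
      split_ifs with hxx
      · subst hxx; rw [hc]; ring
      · rw [add_zero, h2 x (Finset.mem_erase.2 ⟨hxx, hx⟩)]
  have hset : {s | ∀ x ∈ X, f s x = y x} = φ ⁻¹' {fun x : X => ((y x : ℕ) : ZMod r)} := by
    ext s
    simp only [Set.mem_ofPred_eq, Set.mem_preimage, Set.mem_singleton_iff]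
    constructor
    · intro h
      funext x
      rw [← h x x.2]
      exact (hfc s x).symm
    · intro h x hx
      have h1 := congrFun h ⟨x, hx⟩
      have h2 : ((f s x : ℕ) : ZMod r) = ((y x : ℕ) : ZMod r) := (hfc s x).trans h1
      have h3 := congrArg ZMod.val h2
      rw [ZMod.val_natCast, ZMod.val_natCast, Nat.mod_eq_of_lt (f s x).2, Nat.mod_eq_of_lt (y x).2] at h3
      exact Fin.ext h3
  rw [hset, uniformProb_preimage φ hφ]
  unfold uniformProb
  simp [ZMod.card]

namespace Par
variable (p : Par)

/-- Words as memory contents. -/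
def wmem {N w : ℕ} (ρ : Fin N → Fin (2 ^ w)) (a : ℕ) : ℕ := if h : a < N then (ρ ⟨a, h⟩ : ℕ) else 0

/-- The table given by random words. -/
def wtab {w : ℕ} (ρ : Fin p.tw → Fin (2 ^ w)) : Table (2 ^ p.Z) p.m := fun z =>
  XW.mk (p.pack.chr (wmem ρ) 0 z) (Pack.chr_lt _ _ _ _)

theorem wtab_num {w : ℕ} (ρ : Fin p.tw → Fin (2 ^ w)) (z : Fin (2 ^ p.Z)) : (p.wtab ρ z).num = p.pack.chr (wmem ρ) 0 z := rfl

theorem wtab_surj {w : ℕ} (hw : p.pack.Fits w) (f : Table (2 ^ p.Z) p.m) : ∃ ρ : Fin p.tw → Fin (2 ^ w), p.wtab ρ = f := by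
  have key : ∀ K : ℕ, ∃ mem : ℕ → ℕ, (∀ a, mem a < 2 ^ w) ∧ ∀ z < K, p.pack.chr mem 0 z = f.get z := by
    intro K
    induction K with
    | zero => exact ⟨fun _ => 0, fun _ => by positivity, by simp⟩
    | succ K ih =>
      obtain ⟨mem, h1, h2⟩ := ih
      have hc : p.pack.chr mem 0 K ^^^ f.get K < 2 ^ p.pack.m := Nat.xor_lt_two_pow (Pack.chr_lt _ _ _ _) (f.get_lt K)
      have h3 := Pack.chr_update hw (mem := mem) (D := 0) (z := K) hc
      refine ⟨_, fun a => ?_, fun z hz => (h3 z).trans ?_⟩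
      · rw [Function.update_apply]
        split_ifs
        · exact Nat.xor_lt_two_pow (h1 _) (Nat.mod_lt _ (by positivity))
        · exact h1 a
      · split_ifs with h
        · subst h; rw [← Nat.xor_assoc, Nat.xor_self, Nat.zero_xor]
        · exact h2 z (by omega)
  obtain ⟨mem, h1, h2⟩ := key (2 ^ p.Z)
  refine ⟨fun a => ⟨mem a, h1 a⟩, funext fun z => XW.ext ?_⟩
  have h3 : (z : ℕ) / 2 ^ p.γ < p.tw := by
    unfold tw
    rw [Nat.div_lt_iff_lt_mul (by positivity), ← pow_add]
    exact z.2.trans_le (Nat.pow_le_pow_right two_pos (by omega))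
  have h4 := h2 z z.2
  unfold Table.get at h4
  rw [dif_pos z.2] at h4
  rw [← h4]
  rw [wtab_num]
  exact Pack.chr_congr _ (dif_pos (by rw [zero_add]; exact h3))

theorem uniformProb_wtab {w : ℕ} (hw : p.pack.Fits w) (A : Set (Table (2 ^ p.Z) p.m)) :
    uniformProb {ρ : Fin p.tw → Fin (2 ^ w) | p.wtab ρ ∈ A} = uniformProb A := by
  have key : ∀ a b c : Fin p.tw → Fin (2 ^ w), (∀ i, (c i : ℕ) = a i ^^^ b i) → p.wtab c = p.wtab a + p.wtab b := by
    intro a b c hc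
    funext z
    refine XW.ext (Nat.eq_of_testBit_eq fun i => ?_)
    rw [Pi.add_apply, XW.num_add, wtab_num, wtab_num, wtab_num, Nat.testBit_xor, Pack.testBit_chr, Pack.testBit_chr, Pack.testBit_chr]
    have e : ∀ j, wmem c j = wmem a j ^^^ wmem b j := fun j => by
      unfold wmem
      split_ifs
      · exact hc _
      · rfl
    rw [e, Nat.testBit_xor]
    cases decide (i < p.pack.m) <;> rfl
  let φ : (Fin p.tw → XW w) →+ Table (2 ^ p.Z) p.m := AddMonoidHom.mk' (fun ρ => p.wtab (w := w) ρ)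
    fun a b => key a b _ fun _ => rfl
  exact uniformProb_preimage φ (fun f => p.wtab_surj hw f) A

theorem wtab_get {w : ℕ} (ρ : Fin p.tw → Fin (2 ^ w)) {mem : ℕ → ℕ} (h : ∀ a (h : a < p.tw), mem (p.tb + a) = ρ ⟨a, h⟩) :
    p.TabOk (p.wtab ρ).get mem := by
  intro z hz
  have h3 : z / 2 ^ p.γ < p.tw := by
    unfold tw
    rw [Nat.div_lt_iff_lt_mul (by positivity), ← pow_add]
    exact hz.trans_le (Nat.pow_le_pow_right two_pos (by omega))
  unfold Table.get
  rw [dif_pos hz, wtab_num]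
  have hpg : p.pack.γ = p.γ := rfl
  unfold Pack.chr
  rw [hpg, h _ h3, zero_add, wmem, dif_pos h3]

end Par
end WordRAM

namespace WordRAM

/-! ### Choice of the parameters -/

/-- number of chunk stages -/
def cQ (a : ℕ) : ℕ := 4 * (a + 5)
/-- logarithm of the number of hash characters of a pair -/
def cδ (a : ℕ) : ℕ := 2 * cQ a + 5
/-- total size of the constants -/
def cw (a : ℕ) : ℕ := cQ a + 2 * cδ a + 30
/-- factor that makes the words long enough -/
def cA (a : ℕ) : ℕ := (a + 3 + cw a) * 2 ^ cw a

/-- The parameters for `2 ^ l` characters of `n` bits and sets of `2 ^ κ` keys, where `κ ≤ a * n`. -/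
def stdPar (a l n κ w : ℕ) : Par :=
  ⟨l, n, κ, (Pack.std w (n + κ + 4)).γ, (Pack.std w (n + κ + 4)).μ, cδ a, cQ a, cQ a⟩

theorem stdPar_good {a l n κ w : ℕ} (hn : 0 < n) (hκ : κ ≤ a * n) : (stdPar a l n κ w).Good where
  hn := hn
  hσ := by simp only [stdPar, cQ]; omega
  hQ := by
    have : cQ a < 2 ^ cQ a := Nat.lt_two_pow_self
    simp only [stdPar, pow_succ]; omega
  hδ := by simp only [stdPar, cδ]; omega
  hD := by
    have : 2 * cQ a + 3 < 2 ^ (2 * cQ a + 3) := Nat.lt_two_pow_self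
    simp only [stdPar, cδ]; exact this.le
  even := by simp only [stdPar, cQ]; omega
  cover := by
    simp only [Par.m, Par.h, stdPar, cQ]
    have h1 : n ≤ 2 * ((n + 1) / 2) := by omega
    have h2 : (a + 5) * n ≤ (a + 5) * (2 * ((n + 1) / 2)) := Nat.mul_le_mul_left _ h1
    have h3 : 4 * (a + 5) / 2 * ((n + 1) / 2) = (a + 5) * (2 * ((n + 1) / 2)) := by
      rw [show 4 * (a + 5) / 2 = (a + 5) * 2 by omega, mul_assoc]
    rw [h3]
    nlinarith

theorem stdPar_wide {a l n κ w : ℕ} (hn : 0 < n) (hκ : κ ≤ a * n) (hw : 0 < w)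
    (H : cA a * (2 ^ (n + κ + 2 * l) * n) ≤ w * 2 ^ w) : n + κ + l + cw a < w := by
  unfold cA at H
  generalize cw a = c at *
  by_contra hcon
  obtain ⟨M, hM⟩ : ∃ M, M = n + κ + l + c := ⟨_, rfl⟩
  have hwM : w ≤ M := by omega
  have h1 : w * 2 ^ w ≤ M * 2 ^ M := Nat.mul_le_mul hwM (Nat.pow_le_pow_right two_pos hwM)
  have e1 : 2 ^ M = 2 ^ (n + κ + l) * 2 ^ c := by rw [hM, ← pow_add]
  have e2 : 2 ^ (n + κ + 2 * l) = 2 ^ (n + κ + l) * 2 ^ l := by rw [← pow_add]; congr 1; ring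
  have h2 : (2 ^ (n + κ + l) * 2 ^ c) * ((a + 3 + c) * (2 ^ l * n)) ≤ (2 ^ (n + κ + l) * 2 ^ c) * M := by
    calc _ = (a + 3 + c) * 2 ^ c * (2 ^ (n + κ + 2 * l) * n) := by rw [e2]; ring
      _ ≤ M * 2 ^ M := H.trans h1
      _ = _ := by rw [e1]; ring
  have h3 := Nat.le_of_mul_le_mul_left h2 (by positivity)
  have h4 : l < 2 ^ l := Nat.lt_two_pow_self
  clear H h1 e1 e2 h2 hcon hwM
  have h5 : n ≤ 2 ^ l * n := Nat.le_mul_of_pos_left _ (by positivity)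
  have h6 : 2 ^ l ≤ 2 ^ l * n := Nat.le_mul_of_pos_right _ hn
  generalize 2 ^ l * n = P at *
  have h8 : a * n ≤ a * P := Nat.mul_le_mul_left _ h5
  have h9 : c ≤ c * P := Nat.le_mul_of_pos_right _ (by omega)
  have h7 : (a + 3 + c) * P = a * P + 3 * P + c * P := by ring
  omega

theorem two_mul_le_two_pow {w : ℕ} (hw : 0 < w) : 2 * w ≤ 2 ^ w := by
  obtain ⟨c, hc⟩ := Nat.exists_eq_add_of_lt hw
  rw [hc, zero_add, pow_succ]
  have : c < 2 ^ c := Nat.lt_two_pow_self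
  omega

theorem Pack.std_shift {w m : ℕ} (hm : 0 < m) (hmw : m ≤ w) : 2 ^ ((Pack.std w m).γ + (Pack.std w m).μ) < 2 ^ w := by
  rcases (Pack.std_fits hmw (hm.trans_le hmw)).fits with h | h
  · rw [h, zero_add]
    have h1 := two_pow_clog_lt hm
    have h2 := two_mul_le_two_pow (hm.trans_le hmw)
    change 2 ^ Nat.clog 2 m < _
    omega
  · exact h.trans_lt Nat.lt_two_pow_self

theorem stdPar_ok {a l n κ w S : ℕ} {inp : List ℕ} (hn : 0 < n) (hw : n + κ + l + cw a < w)
    (hS : S ≤ 2 ^ w) (hS' : (stdPar a l n κ w).tb + (stdPar a l n κ w).tw ≤ S) : (stdPar a l n κ w).Ok ⟨w, S, inp⟩ ∧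
      (stdPar a l n κ w).Z < 2 ^ w := by
  have hcw : cw a = cQ a + 2 * cδ a + 30 := rfl
  have hfit : (Pack.std w (n + κ + 4)).Fits w := Pack.std_fits (by omega) (by omega)
  have hsh : 2 ^ ((Pack.std w (n + κ + 4)).γ + (Pack.std w (n + κ + 4)).μ) < 2 ^ w := Pack.std_shift (by omega) (by omega)
  constructor
  · constructor
    · exact hfit
    · change l + cQ a + 1 + cδ a + (κ + (n + 1) / 2 + 4 + (n + 1) / 2) < w
      omega
    · exact hsh
    · exact ((Nat.pow_lt_pow_iff_right (by norm_num)).1 hsh).trans Nat.lt_two_pow_self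
    · change l + 3 + cδ a + cQ a + 8 < w
      omega
    · exact hS'
    · exact hS
    · exact hn
    · change 2 ≤ cQ a
      unfold cQ; omega
    · have : cQ a < 2 ^ cQ a := Nat.lt_two_pow_self
      change cQ a ≤ 2 ^ (cQ a + 1)
      rw [pow_succ]; omega
  · change l + cQ a + 1 + cδ a + (κ + (n + 1) / 2 + 4 + (n + 1) / 2) + (l + 3 + cδ a) < 2 ^ w
    have := two_mul_le_two_pow (show 0 < w by omega)
    omega

theorem two_pow_sub_le {w m : ℕ} (hm : 0 < m) (hw : 0 < w) (e : ℕ) :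
    (2 : ℝ) ^ (e - (Pack.std w m).γ) ≤ 1 + 4 * 2 ^ e * (m / w) := by
  rcases le_total e (Pack.std w m).γ with h | h
  · rw [Nat.sub_eq_zero_of_le h, pow_zero]
    have : (0 : ℝ) ≤ 4 * 2 ^ e * (m / w) := by positivity
    linarith
  · have hw' : (0 : ℝ) < w := by exact_mod_cast hw
    have h1 : w * 2 ^ (e - (Pack.std w m).γ) ≤ 4 * 2 ^ e * m := by
      have h2 := Pack.std_lt w m
      have h3 : 2 ^ (Pack.std w m).μ < 2 * m := two_pow_clog_lt hm
      calc w * 2 ^ (e - (Pack.std w m).γ) ≤ 2 ^ ((Pack.std w m).γ + (Pack.std w m).μ + 1) * 2 ^ (e - (Pack.std w m).γ) :=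
            Nat.mul_le_mul_right _ h2.le
        _ = 2 ^ e * (2 * 2 ^ (Pack.std w m).μ) := by
            rw [← pow_add, ← pow_succ', ← pow_add]; congr 1; omega
        _ ≤ 2 ^ e * (2 * (2 * m)) := by gcongr
        _ = _ := by ring
    have h2 : (w : ℝ) * 2 ^ (e - (Pack.std w m).γ) ≤ 4 * 2 ^ e * m := by exact_mod_cast h1
    rw [← mul_div_assoc]
    have h3 : (2 : ℝ) ^ (e - (Pack.std w m).γ) ≤ 4 * 2 ^ e * m / w := by
      rw [le_div_iff₀ hw', mul_comm]; exact h2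
    linarith

theorem stdPar_pow_sub_le {a l n κ w : ℕ} (hn : 0 < n) (hκ : κ ≤ a * n) (hw : 0 < w) (e : ℕ) :
    (2 : ℝ) ^ (e - (stdPar a l n κ w).γ) ≤ 1 + (4 * (a + 5)) * 2 ^ e * (n / w) := by
  refine (two_pow_sub_le (m := n + κ + 4) (by omega) hw e).trans ?_
  have hw' : (0 : ℝ) < w := by exact_mod_cast hw
  have h1 : ((n + κ + 4 : ℕ) : ℝ) ≤ (a + 5) * n := by
    have : n + κ + 4 ≤ (a + 5) * n := by nlinarith
    exact_mod_cast this
  have h2 : ((n + κ + 4 : ℕ) : ℝ) / w ≤ (a + 5) * (n / w) := by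
    rw [← mul_div_assoc]; exact div_le_div_of_nonneg_right h1 hw'.le
  have h3 : 4 * (2 : ℝ) ^ e * (((n + κ + 4 : ℕ) : ℝ) / w) ≤ 4 * 2 ^ e * ((a + 5) * (n / w)) := by gcongr
  linarith

/-- Constant for the size of the table. -/
def ct (a : ℕ) : ℝ := 4 * (a + 5) * 2 ^ cw a

theorem stdPar_tw_le {a l n κ w : ℕ} (hn : 0 < n) (hκ : κ ≤ a * n) (hw : 0 < w) :
    ((stdPar a l n κ w).tw : ℝ) ≤ 1 + ct a * (2 ^ (n + κ + 2 * l) * (n / w)) := by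
  unfold Par.tw
  push_cast
  refine (stdPar_pow_sub_le hn hκ hw _).trans ?_
  have h1 : (stdPar a l n κ w).Z ≤ cw a + (n + κ + 2 * l) := by
    change l + cQ a + 1 + cδ a + (κ + (n + 1) / 2 + 4 + (n + 1) / 2) + (l + 3 + cδ a) ≤ cQ a + 2 * cδ a + 30 + (n + κ + 2 * l)
    omega
  have h2 : (2 : ℝ) ^ (stdPar a l n κ w).Z ≤ 2 ^ cw a * 2 ^ (n + κ + 2 * l) := by
    rw [← pow_add]; exact pow_le_pow_right₀ (by norm_num) h1
  have h3 : (0 : ℝ) ≤ n / w := by positivity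
  unfold ct
  have h4 : (4 * ((a : ℝ) + 5)) * 2 ^ (stdPar a l n κ w).Z * (n / w) ≤ (4 * (a + 5)) * (2 ^ cw a * 2 ^ (n + κ + 2 * l)) * (n / w) := by
    gcongr
  linarith

theorem stdPar_tb_add_tw_le (a l n κ w : ℕ) : (stdPar a l n κ w).tb + (stdPar a l n κ w).tw ≤ 32 + 5 * (stdPar a l n κ w).tw := by
  have : (stdPar a l n κ w).bw ≤ (stdPar a l n κ w).tw :=
    Nat.pow_le_pow_right two_pos (Nat.sub_le_sub_right (by unfold Par.Z; omega) _)
  unfold Par.tb Par.buf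
  omega

theorem sum_two_pow_le (l : ℕ) : ∑ i ∈ Finset.range l, (2 : ℝ) ^ i ≤ 2 ^ l := by
  induction l with
  | zero => simp
  | succ l ih => rw [Finset.sum_range_succ, pow_succ]; linarith

/-- The time for the levels and the initial copying. -/
theorem exists_coreT_le (a : ℕ) : ∃ c : ℝ, 0 < c ∧ ∀ l n κ w : ℕ, 0 < n → 0 < w → κ ≤ a * n → ∀ T : ℕ,
    ((stdPar a l n κ w).coreT T : ℝ) ≤ (c + T) * (2 ^ l * (1 + l + 2 ^ l * (n / w))) := by
  set d : ℝ := 2 ^ cδ a with hd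
  set P1 : ℝ := (cQ a + 1) * (12 * d + d * (26 * d + 60) + 100 + 7) + d * 60 + 67 with hP1
  set P2 : ℝ := d * 26 with hP2
  set c4 : ℝ := 4 * (a + 5) with hc4
  have hd0 : 0 < d := by positivity
  have hP10 : 0 ≤ P1 := by positivity
  have hP20 : 0 ≤ P2 := by positivity
  have hc40 : 0 ≤ c4 := by positivity
  refine ⟨12 + 96 * (d * c4) + 316 + 300 + 154 + 4 * (P1 + P2) + 96 * (d * c4) + 64 * (P2 * c4), by positivity, ?_⟩
  intro l n κ w hn hw hκ T
  set p := stdPar a l n κ w with hp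
  set y : ℝ := n / w with hy
  set L : ℝ := 2 ^ l with hL
  have hy0 : 0 ≤ y := by positivity
  have hL1 : 1 ≤ L := one_le_pow₀ (by norm_num)
  have hlL : (l : ℝ) ≤ L := by
    have : ((l : ℕ) : ℝ) ≤ ((2 ^ l : ℕ) : ℝ) := Nat.cast_le.2 (Nat.lt_two_pow_self (n := l)).le
    rwa [Nat.cast_pow, Nat.cast_ofNat] at this
  have hbw : (p.bw : ℝ) ≤ 1 + 8 * (d * c4) * (L * y) := by
    unfold Par.bw
    push_cast
    refine (stdPar_pow_sub_le hn hκ hw _).trans (le_of_eq ?_)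
    change 1 + c4 * 2 ^ (l + 3 + cδ a) * y = _
    rw [pow_add, pow_add, ← hL, ← hd]; ring
  have hst : (p.stepT : ℝ) = 12 * d + d * (26 * d + 60) + 100 := by
    simp only [Par.stepT]; push_cast; rfl
  have hpair : ∀ i : ℕ, (p.pairT (i + 4) : ℝ) + 67 ≤ P1 + P2 * (1 + 16 * c4 * (2 ^ i * y)) := by
    intro i
    have h1 := stdPar_pow_sub_le (a := a) (l := l) hn hκ hw (i + 4)
    have e : (p.pairT (i + 4) : ℝ) + 67 = P1 + P2 * 2 ^ (i + 4 - p.γ) := by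
      simp only [Par.pairT]; push_cast; rw [hst, hP1, hP2]
      change ((cQ a : ℝ) + 1) * _ + d * _ + 67 = _
      ring
    rw [e]
    have h2 : 1 + 4 * ((a : ℝ) + 5) * 2 ^ (i + 4) * y = 1 + 16 * c4 * (2 ^ i * y) := by rw [pow_add, hc4]; ring
    rw [h2] at h1
    have := mul_le_mul_of_nonneg_left h1 hP20
    linarith
  have hlev : ∀ i ∈ Finset.range l, ((p.levelT i + 7 : ℕ) : ℝ) ≤
      (12 * (1 + 8 * (d * c4) * (L * y)) + 4 * L * (P1 + P2) + 35 * L + 107) + 64 * (P2 * c4) * (L * y) * 2 ^ i := by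
    intro i hi
    have hi' := Finset.mem_range.1 hi
    have e1 : p.levelT i = p.bw * 12 + 2 ^ l * 4 * (p.pairT (i + 4) + 67) + 2 ^ (l - 1 - i) * 35 + 100 := by
      have e2 : 2 ^ (l - 1 - i) * 2 ^ (i + 3) = 2 ^ l * 4 := by
        rw [← pow_add, show (4 : ℕ) = 2 ^ 2 by norm_num, ← pow_add]; congr 1; omega
      change p.bw * 12 + 2 ^ (l - 1 - i) * (2 ^ (i + 3) * (p.pairT (i + 4) + 67) + 35) + 100 = _
      rw [mul_add, ← mul_assoc, e2]; ring
    have h3 : (2 : ℝ) ^ (l - 1 - i) ≤ L := pow_le_pow_right₀ (by norm_num) (by omega)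
    rw [e1]
    push_cast
    rw [← hL]
    have h4 := mul_le_mul_of_nonneg_left (hpair i) (show (0 : ℝ) ≤ L * 4 by positivity)
    have h5 : (p.bw : ℝ) * 12 ≤ 12 * (1 + 8 * (d * c4) * (L * y)) := by linarith
    clear_value P1 P2 c4 L y d
    linarith
  have hsum : (∑ i ∈ Finset.range l, ((p.levelT i + 7 : ℕ) : ℝ)) ≤
      l * (12 * (1 + 8 * (d * c4) * (L * y)) + 4 * L * (P1 + P2) + 35 * L + 107) + 64 * (P2 * c4) * (L * y) * L := by
    refine (Finset.sum_le_sum hlev).trans ?_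
    rw [Finset.sum_add_distrib, Finset.sum_const, Finset.card_range, nsmul_eq_mul, ← Finset.mul_sum]
    have := mul_le_mul_of_nonneg_left (sum_two_pow_le l) (show 0 ≤ 64 * (P2 * c4) * (L * y) by positivity)
    linarith
  set G := L * (1 + l + L * y) with hG
  have hl0 : (0 : ℝ) ≤ l := by positivity
  have hLy : 0 ≤ L * y := by positivity
  have g1 : L ≤ G := by rw [hG]; nlinarith [mul_nonneg (zero_le_one.trans hL1) (add_nonneg hl0 hLy)]
  have g0 : 1 ≤ G := hL1.trans g1
  have g2 : L * l ≤ G := by rw [hG]; nlinarith [mul_nonneg (zero_le_one.trans hL1) (add_nonneg (zero_le_one (α := ℝ)) hLy)]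
  have g3 : L * (L * y) ≤ G := by rw [hG]; nlinarith [mul_nonneg (zero_le_one.trans hL1) (add_nonneg (zero_le_one (α := ℝ)) hl0)]
  have g4 : L * y ≤ G := le_trans (by nlinarith) g3
  have g5 : (l : ℝ) ≤ G := le_trans (by nlinarith) g2
  have g6 : (l : ℝ) * (L * y) ≤ G := le_trans (mul_le_mul_of_nonneg_right hlL hLy) g3
  have hdc : 0 ≤ d * c4 := by positivity
  have hpc : 0 ≤ P2 * c4 := by positivity
  have k1 := mul_le_mul_of_nonneg_left g4 hdc
  have k2 := mul_le_mul_of_nonneg_left g6 hdc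
  have k3 := mul_le_mul_of_nonneg_left g3 hpc
  have k4 := mul_le_mul_of_nonneg_left g2 (show 0 ≤ P1 + P2 by positivity)
  have k5 := mul_le_mul_of_nonneg_left g1 (show (0 : ℝ) ≤ T by positivity)
  have e : (p.coreT T : ℝ) = p.bw * 12 + L * (T + 316) + (∑ i ∈ Finset.range l, ((p.levelT i + 7 : ℕ) : ℝ)) + 300 := by
    unfold Par.coreT; push_cast; rfl
  rw [e]
  clear hst hpair hlev e
  clear_value G P1 P2 c4 L y d
  linarith

attribute [irreducible] cA cw cδ cQ ct

end WordRAM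

namespace WordRAM

/-- Memory contents as numbers. -/
def memN {w : ℕ} (M : Mem w) (a : ℕ) : ℕ := (M (BitVec.ofNat w a)).toNat

theorem getD_ofFn {n : ℕ} (f : Fin n → ℕ) (i : ℕ) : (List.ofFn f).getD i 0 = if h : i < n then f ⟨i, h⟩ else 0 := by
  split_ifs with h
  · simp [List.getD_eq_getElem?_getD, h]
  · simp [List.getD_eq_getElem?_getD, h]

theorem map_range_eq_ofFn {n : ℕ} (f : ℕ → ℕ) : (List.range n).map f = List.ofFn fun i : Fin n => f i := by
  apply List.ext_getElem <;> simp

/-- With high probability the tables of random words give majority-unique functions. -/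
theorem Par.prob_maj {p : Par} (hg : p.Good) {w : ℕ} (hw : p.pack.Fits w) {A : Set (Fin p.tw → Fin (2 ^ w))}
    (hA : ∀ ρ, Maj (2 ^ (2 ^ p.l * p.n)) (2 ^ p.κ) (2 ^ (p.l + 3)) (p.keyF (p.wtab ρ).get p.l) → ρ ∈ A) :
    1 - 1 / 2 ^ p.n ≤ uniformProb A := by
  have h1 := p.prob_not_maj hg
  have h2 := uniformProb_compl {ω : Table (2 ^ p.Z) p.m | ¬ Maj (2 ^ (2 ^ p.l * p.n)) (2 ^ p.κ) (2 ^ (p.l + 3)) (p.keyF ω.get p.l)}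
  rw [← p.uniformProb_wtab hw] at h2
  have h3 := h2.symm.trans_le (uniformProb_mono fun ρ hρ => hA ρ (not_not.1 hρ))
  linarith

theorem exists_majorityUnique (a : ℝ) : ∃ C : ℝ, 0 < C ∧ ∃ build eval : Prog,
      ∀ l n κ w : ℕ, 0 < l → 0 < n → 0 < κ → 0 < w → (κ : ℝ) ≤ a * n →
      ∀ S : ℕ, S = ⌊C * (1 + 2 ^ (n + κ + 2 * l) * n / w)⌋₊ →
      C * (1 + 2 ^ (n + κ + 2 * l) * n / w) ≤ (2 : ℝ) ^ w →
      ∃ (N : ℕ) (Γ : (Fin N → Fin (2 ^ w)) →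
          (Fin (2 ^ l) → BitVec n) → Fin (2 ^ (l + 3)) → BitVec (n + κ + 4)),
        (∀ ρ : Fin N → Fin (2 ^ w), ∃ (M : Mem w) (out : List (BitVec w)),
          Runs S (C * (w + 2 ^ (n + κ + l) * (1 + 2 ^ l * n / w))) build
            ([l, n, κ] ++ List.ofFn fun i => (ρ i : ℕ)) (fun _ => 0) M out ∧
          Represents S (C * (2 ^ l * (l + 2 ^ l * n / w))) eval
            (fun x : Fin (2 ^ l) → BitVec n => List.ofFn fun i => (x i).toNat)
            (fun x out => out.map BitVec.toNat = List.ofFn fun j => (Γ ρ x j).toNat) M) ∧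
        1 - (2 : ℝ) ^ (-(n : ℤ) + 1) ≤
          uniformProb {ρ : Fin N → Fin (2 ^ w) | MajorityUnique (2 ^ κ) (Γ ρ)} := by
  obtain ⟨c, hc, hcore⟩ := exists_coreT_le ⌈a⌉₊
  set a' := ⌈a⌉₊ with ha'
  obtain ⟨A, hA⟩ : ∃ A : ℕ, A = cA a' := ⟨_, rfl⟩
  obtain ⟨B, hB⟩ : ∃ B : ℝ, B = ct a' := ⟨_, rfl⟩
  have hB0 : 0 ≤ B := by rw [hB]; unfold ct; positivity
  refine ⟨A + 1000 + 16 * B + 2 * c, by positivity, (buildC (cδ a') (cQ a') (cQ a')).comp, (evalC (cδ a') (cQ a') (cQ a')).comp, ?_⟩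
  intro l n κ w hl hn hκ0 hw hκ S hS hSw
  have hκa : κ ≤ a' * n := by
    have : (κ : ℝ) ≤ a' * n := hκ.trans (mul_le_mul_of_nonneg_right (Nat.le_ceil a) (by positivity))
    exact_mod_cast this
  have hw' : (0 : ℝ) < w := by exact_mod_cast hw
  have hw1 : (1 : ℝ) ≤ w := by exact_mod_cast hw
  set C : ℝ := A + 1000 + 16 * B + 2 * c with hC
  have hA0 : (0 : ℝ) ≤ A := by positivity
  have hC0 : 0 ≤ C := by positivity
  set Y : ℝ := 2 ^ (n + κ + 2 * l) * (n / w) with hY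
  have hY0 : 0 ≤ Y := by positivity
  rw [mul_div_assoc, ← hY] at hS hSw
  have hS2 : S ≤ 2 ^ w := by
    rw [hS]; exact Nat.floor_le_of_le (by push_cast; exact hSw)
  have hwide : n + κ + l + cw a' < w := by
    refine stdPar_wide hn hκa hw ?_
    rw [← hA]
    have h1 : (A : ℝ) * Y ≤ 2 ^ w := by nlinarith
    have h2 : (A : ℝ) * Y * w ≤ 2 ^ w * w := mul_le_mul_of_nonneg_right h1 hw'.le
    have h3 : (A : ℝ) * Y * w = A * (2 ^ (n + κ + 2 * l) * n) := by rw [hY]; field_simp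
    rw [h3, mul_comm ((2 : ℝ) ^ w)] at h2
    exact_mod_cast h2
  obtain ⟨p, hp⟩ : ∃ p, p = stdPar a' l n κ w := ⟨_, rfl⟩
  have htw : (p.tw : ℝ) ≤ 1 + B * Y := by rw [hp, hB]; exact stdPar_tw_le hn hκa hw
  have htop : p.tb + p.tw ≤ S := by
    have h1 : p.tb + p.tw ≤ 32 + 5 * p.tw := by rw [hp]; exact stdPar_tb_add_tw_le _ _ _ _ _
    rw [hS]
    refine Nat.le_floor (le_trans (Nat.cast_le.2 h1) ?_)
    push_cast
    have h2 : (37 + 5 * B) * (1 + Y) ≤ C * (1 + Y) := mul_le_mul_of_nonneg_right (by rw [hC]; linarith) (by linarith)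
    nlinarith
  have hok : ∀ inp, p.Ok ⟨w, S, inp⟩ ∧ p.Z < 2 ^ w := fun inp => by
    rw [hp] at htop ⊢; exact stdPar_ok hn hwide hS2 htop
  have hpl : p.l = l := by rw [hp]; rfl
  have hpn : p.n = n := by rw [hp]; rfl
  have hpκ : p.κ = κ := by rw [hp]; rfl
  have hpm : p.m = n + κ + 4 := by rw [Par.m, hpn, hpκ]
  have hpd : p.δ = cδ a' := by rw [hp]; rfl
  have hpQ : p.Q = cQ a' := by rw [hp]; rfl
  have hpσ : p.σ = cQ a' := by rw [hp]; rfl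
  have hpk : p.pack = Pack.std w p.m := by rw [hp]; rfl
  have hgood : p.Good := by rw [hp]; exact stdPar_good hn hκa
  have hcoreT : (p.coreT 10 : ℝ) ≤ (c + 10) * (2 ^ l * (1 + l + 2 ^ l * (n / w))) := by
    rw [hp]; exact_mod_cast hcore l n κ w hn hw hκa 10
  clear_value C Y
  have hfit : p.pack.Fits w := (hok []).1.fits
  have hww : w < 2 ^ w := Nat.lt_two_pow_self
  have htb : 32 ≤ p.tb := by unfold Par.tb Par.buf; omega
  have h32 : p.tb + p.tw ≤ 2 ^ w := htop.trans hS2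
  let xs : (Fin (2 ^ l) → BitVec n) → ℕ → ℕ := fun x ν => (List.ofFn fun i => (x i).toNat).getD ν 0
  have hxs : ∀ x ν, xs x ν < 2 ^ n := fun x ν => by
    simp only [xs, getD_ofFn]
    split_ifs
    · exact BitVec.isLt _
    · positivity
  have hnm : (2 : ℕ) ^ n ≤ 2 ^ p.m := Nat.pow_le_pow_right two_pos (by omega)
  refine ⟨p.tw, fun ρ x j => BitVec.ofNat (n + κ + 4) (p.lev (p.wtab ρ).get p.l (xs x) j), ?_, ?_⟩
  · intro ρ
    set inp : List ℕ := [l, n, κ] ++ List.ofFn fun i => (ρ i : ℕ) with hinp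
    have hword : ∀ i (h : i < p.tw), Env.word ⟨w, S, inp⟩ (3 + i) 0 = ρ ⟨i, h⟩ := fun i h => by
      have e : inp.getD (3 + i) 0 = ρ ⟨i, h⟩ := by
        rw [hinp, List.getD_append_right _ _ _ _ (by simp)]
        simp only [List.length_cons, List.length_nil, Nat.zero_add, Nat.reduceAdd, Nat.add_sub_cancel_left, getD_ofFn, h, dite_true]
      simp only [Env.word, e, mul_zero, pow_zero, Nat.div_one]
      exact Nat.mod_eq_of_lt (ρ ⟨i, h⟩).2
    have hw0 : Env.word ⟨w, S, inp⟩ 0 0 = p.l := by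
      simp [Env.word, hinp, hpl]; exact Nat.mod_eq_of_lt (by omega)
    have hw1' : Env.word ⟨w, S, inp⟩ 1 0 = p.n := by
      simp [Env.word, hinp, hpn]; exact Nat.mod_eq_of_lt (by omega)
    have hw2 : Env.word ⟨w, S, inp⟩ 2 0 = p.κ := by
      simp [Env.word, hinp, hpκ]; exact Nat.mod_eq_of_lt (by omega)
    have hBu := buildC_wp (hok inp).1 hpk (h := ⟨fun _ => 0, fun _ => 0, []⟩) hw0 hw1' hw2 (hok inp).2
    rw [hpd, hpQ, hpσ] at hBu
    obtain ⟨M, out, h, hrun, ⟨hcell, htab⟩, hM, -⟩ := WP.runs (T' := C * (w + 2 ^ (n + κ + l) * (1 + 2 ^ l * n / w))) hS2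
      (fun _ => 0) (T := w * 41 + p.tw * 16 + 450) (by
        have e1 : (2 : ℝ) ^ (n + κ + l) * (1 + 2 ^ l * n / w) = 2 ^ (n + κ + l) + Y := by
          rw [hY, show n + κ + 2 * l = (n + κ + l) + l by ring, pow_add _ (n + κ + l)]; ring
        rw [e1]
        push_cast
        have h1 : (1 : ℝ) ≤ 2 ^ (n + κ + l) := one_le_pow₀ (by norm_num)
        have h2 : (507 + 16 * B) * (w + (2 ^ (n + κ + l) + Y)) ≤ C * (w + (2 ^ (n + κ + l) + Y)) :=
          mul_le_mul_of_nonneg_right (by rw [hC]; linarith) (by positivity)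
        have h3 : 0 ≤ B * (w + 2 ^ (n + κ + l)) := by positivity
        linarith) (by simpa using hBu)
    refine ⟨M, out, hrun, {M | p.Cells w (memN M) ∧ ∀ a (h : a < p.tw), memN M (p.tb + a) = ρ ⟨a, h⟩}, ⟨?_, ?_⟩, ?_⟩
    · exact hcell.congr fun a ha => hM a (by omega)
    · intro a ha
      rw [memN, hM _ (by omega), htab _ (by omega) (by omega), Nat.add_sub_cancel_left, hword a ha]
    intro M ⟨hcM, htM⟩ x
    have hE := evalC_wp (hok (List.ofFn fun i => (x i).toNat)).1 (h := ⟨fun _ => 0, memN M, []⟩) hcM (p.wtab_get ρ htM) (x := xs x)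
      (fun ν hν => ⟨by
        simp only [Env.word, mul_zero, pow_zero, Nat.div_one]
        exact Nat.mod_eq_of_lt ((hxs x ν).trans_le (Nat.pow_le_pow_right two_pos (by omega))), (hxs x ν).trans_le hnm⟩)
    rw [hpd, hpQ, hpσ] at hE
    obtain ⟨M', out', h', hrun', ⟨hkeep, ho⟩, hM', ho'⟩ := WP.runs (T' := C * (2 ^ l * (l + 2 ^ l * n / w))) hS2 M (by
        have hl1 : (1 : ℝ) ≤ l := by exact_mod_cast hl
        rw [hpl, mul_div_assoc]
        push_cast
        have hy : 0 ≤ (2 : ℝ) ^ l * (n / w) := by positivity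
        have h1 : (1 : ℝ) ≤ 2 ^ l := one_le_pow₀ (by norm_num)
        have h2 : (2 : ℝ) ^ l * (1 + l + 2 ^ l * (n / w)) ≤ 2 * (2 ^ l * (l + 2 ^ l * (n / w))) := by nlinarith
        have h3 : (2 : ℝ) ^ l ≤ 2 ^ l * (l + 2 ^ l * (n / w)) := le_mul_of_one_le_right (by positivity) (by linarith)
        have h4 := mul_le_mul_of_nonneg_left h2 (show 0 ≤ c + 10 by linarith)
        have h5 : (2 * (c + 10) + 199) * ((2 : ℝ) ^ l * (l + 2 ^ l * (n / w))) ≤ C * (2 ^ l * (l + 2 ^ l * (n / w))) :=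
          mul_le_mul_of_nonneg_right (by rw [hC]; linarith) (by positivity)
        rw [pow_add]
        linarith) hE
    refine ⟨M', ⟨?_, ?_⟩, out', hrun', ?_⟩
    · exact hcM.congr fun a ha => by rw [memN, hM' _ (by omega), hkeep _ (by omega)]
    · intro a ha
      rw [memN, hM' _ (by omega), hkeep _ (by omega)]; exact htM a ha
    · beta_reduce
      rw [ho', ho, List.nil_append, hpl, map_range_eq_ofFn]
      congr 1
      funext j
      rw [BitVec.toNat_ofNat, ← hpm, Nat.mod_eq_of_lt]
      exact p.lev_lt (fun z => Table.get_lt _ _) _ (fun ν => (hxs x ν).trans_le hnm) _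
  · have h1 : (2 : ℝ) ^ (-(n : ℤ) + 1) = 2 * (1 / 2 ^ p.n) := by
      rw [zpow_add₀ (by norm_num), zpow_neg, zpow_natCast, hpn]; ring
    have h2 : (0 : ℝ) ≤ 1 / 2 ^ p.n := by positivity
    refine le_trans (by linarith) (p.prob_maj hgood hfit (fun ρ hρ => ?_))
    choose X hX1 hX2 using fun x => exists_dig n (2 ^ l) (xs x) fun i _ => hxs x i
    have h3 := MajorityUnique.of_maj (Γ := fun (x : Fin (2 ^ l) → BitVec n) (j : Fin (2 ^ (l + 3))) =>
      BitVec.ofNat (n + κ + 4) (p.lev (p.wtab ρ).get p.l (xs x) j)) X (fun x y hxy => ?_) (U := 2 ^ (2 ^ p.l * p.n))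
      (fun x => by rw [hpl, hpn]; exact hX1 x) BitVec.toNat (f := p.keyF (p.wtab ρ).get p.l) (fun x j => ?_) (k := 2 ^ p.κ) (by rw [← hpl]; exact hρ)
    · rw [hpκ] at h3; exact h3
    · funext i
      apply BitVec.eq_of_toNat_eq
      have h4 : xs x i = xs y i := by rw [← hX2 x i i.2, ← hX2 y i i.2, hxy]
      simpa [xs, getD_ofFn] using h4
    · rw [BitVec.toNat_ofNat, ← hpm, Nat.mod_eq_of_lt]
      · refine p.lev_key_congr (fun ν hν => ?_) _
        rw [hpl] at hν
        rw [hpn, hX2 x ν hν]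
      · exact p.lev_lt (fun z => Table.get_lt _ _) _ (fun ν => (hxs x ν).trans_le hnm) _

end WordRAM

namespace WordRAM

theorem le_logb_two {e u : ℕ} (h : 2 ^ e ≤ u) : (e : ℝ) ≤ Real.logb 2 u := by
  have hu : 0 < u := lt_of_lt_of_le (by positivity) h
  rw [Real.le_logb_iff_rpow_le (by norm_num) (by exact_mod_cast hu), Real.rpow_natCast]
  exact_mod_cast h

theorem logb_two_le {e u : ℕ} (hu : 0 < u) (h : u ≤ 2 ^ e) : Real.logb 2 u ≤ e := by
  rw [Real.logb_le_iff_le_rpow (by norm_num) (by exact_mod_cast hu), Real.rpow_natCast]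
  exact_mod_cast h

theorem two_pow_size_le {u : ℕ} (hu : 0 < u) : 2 ^ Nat.size u ≤ 2 * u := by
  obtain ⟨e, he⟩ := Nat.exists_eq_succ_of_ne_zero (Nat.size_pos.2 hu).ne'
  have h1 : 2 ^ e ≤ u := Nat.lt_size.1 (by omega)
  rw [he, Nat.pow_succ]; omega

theorem size_le_logb {u : ℕ} (hu : 0 < u) : (Nat.size u : ℝ) ≤ Real.logb 2 u + 1 := by
  obtain ⟨e, he⟩ := Nat.exists_eq_succ_of_ne_zero (Nat.size_pos.2 hu).ne'
  have := le_logb_two (Nat.lt_size.1 (show e < Nat.size u by omega))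
  rw [he]; push_cast; linarith

theorem logb_two_nonneg {u : ℕ} (hu : 0 < u) : 0 ≤ Real.logb 2 u :=
  Real.logb_nonneg (by norm_num) (by exact_mod_cast hu)

theorem logb_two_rpow_le {u : ℕ} (hu : 0 < u) {k : ℕ} (hk : 0 < k) {a : ℝ} (h : (k : ℝ) ≤ (u : ℝ) ^ a) :
    Real.logb 2 k ≤ a * Real.logb 2 u := by
  rw [← Real.logb_rpow_eq_mul_logb_of_pos (by exact_mod_cast hu)]
  exact Real.logb_le_logb_of_le (by norm_num) (by exact_mod_cast hk) h

/-- Relations between the numbers `u`, `t`, `k` and the parameters for the keys. -/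
structure KeyBounds (u t k l n κ s : ℕ) (a x Λ : ℝ) : Prop where
  n_pos : 0 < n
  κ_le : κ ≤ (⌈a⌉₊ + 1) * n
  s_le : s ≤ t
  s_pos : 0 < s
  two_pow_l : 2 ^ l ≤ 2 * s
  u_le : u ≤ 2 ^ (2 ^ l * n)
  size_le : Nat.size u ≤ n * 2 ^ l
  x_ge : 1 ≤ x
  Λ_nonneg : 0 ≤ Λ
  Λ_le : u = 1 ∧ s = 1 ∧ k = 1 ∧ x = 1 ∧ Λ = 0 ∨ 1 ≤ Λ
  fail : 1 / 2 ^ n ≤ (u : ℝ) ^ (-(1 / (t : ℝ)))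
  pow_le : (2 : ℝ) ^ (n + κ + l) ≤ 16 * (k * x * s)
  mul_le : (n : ℝ) * 2 ^ l ≤ 4 * (Λ + 1)

theorem keyBounds {u t k : ℕ} {a : ℝ} (hu : 0 < u) (ht : 0 < t) (hk : 0 < k) (hka : (k : ℝ) ≤ (u : ℝ) ^ (a / t)) :
    KeyBounds u t k (Nat.clog 2 (min t (Nat.size u))) (Nat.size u / min t (Nat.size u) + 1) (Nat.size k) (min t (Nat.size u)) a
      ((u : ℝ) ^ (1 / (t : ℝ))) (Real.logb 2 u) := by
  have hℓ0 : 0 < Nat.size u := Nat.size_pos.2 hu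
  have hℓΛ := size_le_logb hu
  have hΛℓ : Real.logb 2 u ≤ Nat.size u := logb_two_le hu (Nat.lt_size_self u).le
  have hΛ0 := logb_two_nonneg hu
  have hu' : (0 : ℝ) < u := by exact_mod_cast hu
  have ht' : (0 : ℝ) < t := by exact_mod_cast ht
  have ht1 : (1 : ℝ) ≤ t := by exact_mod_cast ht
  have hx : (u : ℝ) ^ (1 / (t : ℝ)) = 2 ^ (Real.logb 2 u / t) := by
    conv_lhs => rw [← Real.rpow_logb (b := 2) (by norm_num) (by norm_num) hu']
    rw [← Real.rpow_mul (by norm_num)]; congr 1; ring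
  have hneg : (u : ℝ) ^ (-(1 / (t : ℝ))) = 1 / 2 ^ (Real.logb 2 u / t) := by
    rw [Real.rpow_neg hu'.le, hx, one_div]
  have hs0 : 0 < min t (Nat.size u) := lt_min ht hℓ0
  have hcase : u = 1 ∨ 2 ≤ u := by omega
  rw [hx]
  set Λ := Real.logb 2 u with hΛ
  set ℓ := Nat.size u with hℓ
  obtain ⟨s, hs⟩ : ∃ s, s = min t ℓ := ⟨_, rfl⟩
  rw [← hs] at hs0 ⊢
  have hst : s ≤ t := hs ▸ min_le_left _ _
  have hsℓ : s ≤ ℓ := hs ▸ min_le_right _ _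
  obtain ⟨n, hn⟩ : ∃ n, n = ℓ / s + 1 := ⟨_, rfl⟩
  rw [← hn]
  have hn0 : 0 < n := by rw [hn]; exact Nat.succ_pos _
  have hns : ℓ ≤ n * s := by rw [hn, mul_comm]; exact (Nat.lt_mul_div_succ _ hs0).le
  have hns' : (ℓ : ℝ) ≤ n * s := by exact_mod_cast hns
  have hsl : s ≤ 2 ^ Nat.clog 2 s := Nat.le_pow_clog (by norm_num) s
  have hls : 2 ^ Nat.clog 2 s ≤ 2 * s := (two_pow_clog_lt hs0).le
  have hnl : ℓ ≤ n * 2 ^ Nat.clog 2 s := hns.trans (Nat.mul_le_mul_left _ hsl)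
  have hst' : (s : ℝ) ≤ t := by exact_mod_cast hst
  have hΛn : Λ / t ≤ n := by
    rw [div_le_iff₀ ht']
    exact (hΛℓ.trans hns').trans (mul_le_mul_of_nonneg_left hst' (by positivity))
  have hpow : (2 : ℝ) ^ (Λ / t) ≤ 2 ^ n := by
    rw [← Real.rpow_natCast]; exact Real.rpow_le_rpow_of_exponent_le (by norm_num) hΛn
  have hn4 : (2 : ℝ) ^ n ≤ 4 * 2 ^ (Λ / t) := by
    have h1 : (n : ℝ) ≤ Λ / t + 2 := by
      rw [hn, hs]
      push_cast
      rcases le_total t ℓ with h | h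
      · rw [min_eq_left h]
        have h2 : ((ℓ / t : ℕ) : ℝ) ≤ ℓ / t := Nat.cast_div_le
        have h3 : (ℓ : ℝ) / t ≤ (Λ + 1) / t := div_le_div_of_nonneg_right hℓΛ ht'.le
        have h4 : 1 / (t : ℝ) ≤ 1 := by rw [div_le_one ht']; exact ht1
        rw [add_div] at h3
        linarith
      · rw [min_eq_right h, Nat.div_self hℓ0]
        have : 0 ≤ Λ / t := by positivity
        push_cast
        linarith
    calc (2 : ℝ) ^ n = 2 ^ (n : ℝ) := (Real.rpow_natCast _ _).symm
      _ ≤ 2 ^ (Λ / t + 2) := Real.rpow_le_rpow_of_exponent_le (by norm_num) h1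
      _ = 4 * 2 ^ (Λ / t) := by rw [Real.rpow_add (by norm_num)]; norm_num; ring
  have h2l : (2 : ℝ) ^ Nat.clog 2 s ≤ 2 * s := by exact_mod_cast hls
  have hkk : (2 : ℝ) ^ Nat.size k ≤ 2 * k := by exact_mod_cast two_pow_size_le hk
  refine ⟨hn0, ?_, hst, hs0, hls, ?_, hnl, Real.one_le_rpow (by norm_num) (by positivity), hΛ0, ?_,
    hneg ▸ one_div_le_one_div_of_le (by positivity) hpow, ?_, ?_⟩
  · obtain ⟨e, he⟩ := Nat.exists_eq_succ_of_ne_zero (Nat.size_pos.2 hk).ne'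
    have h1 := le_logb_two (Nat.lt_size.1 (show e < Nat.size k by omega))
    have h2 := logb_two_rpow_le hu hk hka
    have h3 : a / t * Λ ≤ ⌈a⌉₊ * n := by
      rw [div_mul_eq_mul_div, mul_div_assoc]
      calc a * (Λ / t) ≤ ⌈a⌉₊ * (Λ / t) := mul_le_mul_of_nonneg_right (Nat.le_ceil a) (by positivity)
        _ ≤ _ := mul_le_mul_of_nonneg_left hΛn (by positivity)
    have h4 : e ≤ ⌈a⌉₊ * n := by exact_mod_cast h1.trans (h2.trans h3)
    rw [add_mul]; omega
  · refine (Nat.lt_size_self u).le.trans (Nat.pow_le_pow_right two_pos ?_)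
    rw [mul_comm]; exact hnl
  · rcases hcase with rfl | h
    · left
      have h0 : Λ = 0 := by simp [hΛ]
      have h1 : ℓ = 1 := by simp [hℓ]
      refine ⟨rfl, by omega, ?_, by simp [h0], h0⟩
      have : (k : ℝ) ≤ 1 := by simpa using hka
      have : k ≤ 1 := by exact_mod_cast this
      omega
    · right
      have := le_logb_two (e := 1) (u := u) (by simpa using h)
      simpa using this
  · rw [pow_add, pow_add]
    calc (2 : ℝ) ^ n * 2 ^ Nat.size k * 2 ^ Nat.clog 2 s ≤ (4 * 2 ^ (Λ / t)) * (2 * k) * (2 * s) := by gcongr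
      _ = _ := by ring
  · have h1 : n * 2 ^ Nat.clog 2 s ≤ 4 * ℓ := by
      calc n * 2 ^ Nat.clog 2 s ≤ n * (2 * s) := Nat.mul_le_mul_left _ hls
        _ = 2 * (ℓ / s * s + s) := by rw [hn]; ring
        _ ≤ 4 * ℓ := by have := Nat.div_mul_le_self ℓ s; omega
    have h2 : (n : ℝ) * 2 ^ Nat.clog 2 s ≤ 4 * ℓ := by exact_mod_cast h1
    linarith

namespace KeyBounds
variable {u t k l n κ s : ℕ} {a x Λ : ℝ}

theorem key_le (h : KeyBounds u t k l n κ s a x Λ) : k * x * s * (Λ + 1) ≤ 1 + 2 * (k * x * t * Λ) := by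
  have hst : (s : ℝ) ≤ t := by exact_mod_cast h.s_le
  have hx : (0 : ℝ) ≤ k * x := mul_nonneg (by positivity) (by linarith [h.x_ge])
  rcases h.Λ_le with ⟨-, h2, h3, h4, h5⟩ | h1
  · simp [h2, h3, h4, h5]
  · calc k * x * s * (Λ + 1) ≤ k * x * t * (2 * Λ) :=
        mul_le_mul (mul_le_mul_of_nonneg_left hst hx) (by linarith) (by linarith) (by positivity)
      _ ≤ _ := by linarith

theorem size_mul_le (h : KeyBounds u t k l n κ s a x Λ) : (2 : ℝ) ^ (n + κ + 2 * l) * n ≤ 64 + 128 * (k * x * t * Λ) := by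
  have h1 := h.key_le
  have h2 : (2 : ℝ) ^ (n + κ + 2 * l) * n = 2 ^ (n + κ + l) * (n * 2 ^ l) := by
    rw [show n + κ + 2 * l = (n + κ + l) + l by ring, pow_add _ (n + κ + l)]; ring
  have hx : (0 : ℝ) ≤ k * x := mul_nonneg (by positivity) (by linarith [h.x_ge])
  have h3 : (2 : ℝ) ^ (n + κ + l) * (n * 2 ^ l) ≤ 16 * (k * x * s) * (4 * (Λ + 1)) :=
    mul_le_mul h.pow_le h.mul_le (by positivity) (by positivity)
  rw [h2]; linarith

/-- The evaluation time in terms of `t`. -/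
theorem time_le (h : KeyBounds u t k l n κ s a x Λ) {w : ℝ} (hw : 1 ≤ w) :
    (2 : ℝ) ^ l * (1 + l + 2 ^ l * (n / w)) ≤ 22 * (1 + t * Real.logb 2 t + t * Λ / w) ∧
      (2 : ℝ) ^ l ≤ 2 * t ∧ (t : ℝ) ≤ 1 + t * Real.logb 2 t := by
  have hst : (s : ℝ) ≤ t := by exact_mod_cast h.s_le
  have ht : 0 < t := h.s_pos.trans_le h.s_le
  have hls : (2 : ℝ) ^ l ≤ 2 * s := by exact_mod_cast h.two_pow_l
  have hlt : (2 : ℝ) ^ l ≤ 2 * t := by linarith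
  have hlog0 := logb_two_nonneg ht
  have h1 : (t : ℝ) ≤ 1 + t * Real.logb 2 t := by
    rcases Nat.lt_or_ge 1 t with h1 | h1
    · have h2 := le_logb_two (e := 1) (u := t) (by rw [pow_one]; exact h1)
      have : (t : ℝ) * (1 : ℕ) ≤ t * Real.logb 2 t := mul_le_mul_of_nonneg_left h2 (by positivity)
      push_cast at this; linarith
    · obtain rfl : t = 1 := by omega
      simp
  refine ⟨?_, hlt, h1⟩
  have h2 : (l : ℝ) ≤ Real.logb 2 t + 1 := by
    have h3 := le_logb_two (h.two_pow_l.trans (Nat.mul_le_mul_left 2 h.s_le))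
    push_cast at h3
    rw [Real.logb_mul (by norm_num) (by positivity), Real.logb_self_eq_one (by norm_num)] at h3
    linarith
  have h3 : (2 : ℝ) ^ l * (1 + l) ≤ (2 * t) * (2 + Real.logb 2 t) := by
    apply mul_le_mul hlt (by linarith) (by positivity) (by positivity)
  have hw0 : 0 < w := by linarith
  have hΛ := h.Λ_nonneg
  have h4 : (2 : ℝ) ^ l * (2 ^ l * (n / w)) ≤ 8 + 16 * (t * Λ / w) := by
    have h5 : (2 : ℝ) ^ l * (n * 2 ^ l) ≤ 2 * s * (4 * (Λ + 1)) := mul_le_mul hls h.mul_le (by positivity) (by positivity)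
    have h6 : 2 * (s : ℝ) * (4 * (Λ + 1)) ≤ 8 + 16 * (t * Λ) := by
      rcases h.Λ_le with ⟨-, h2, h3, h4, h5⟩ | h1
      · simp [h2, h5]; norm_num
      · nlinarith [mul_le_mul hst (show Λ + 1 ≤ 2 * Λ by linarith) (by linarith) (by positivity)]
    have h7 : (2 : ℝ) ^ l * (2 ^ l * (n / w)) = 2 ^ l * (n * 2 ^ l) / w := by ring
    rw [h7, div_le_iff₀ hw0]
    have h8 : (8 + 16 * (t * Λ / w)) * w = 8 * w + 16 * (t * Λ) := by field_simp
    linarith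
  have h5 : 0 ≤ (t : ℝ) * Λ / w := by positivity
  have h6 : 0 ≤ (t : ℝ) * Real.logb 2 t := by positivity
  rw [mul_add]
  linarith

end KeyBounds

/-- Digits of a number. -/
theorem sum_words (w x N : ℕ) : ∑ j ∈ Finset.range N, x / 2 ^ (w * j) % 2 ^ w * 2 ^ (w * j) = x % 2 ^ (w * N) := by
  induction N with
  | zero => simp [Nat.mod_one]
  | succ N ih => rw [Finset.sum_range_succ, ih, mul_add_one, pow_add, Nat.mod_mul, mul_comm (_ % _)]

theorem ofDigits_map_range (b N : ℕ) (D : ℕ → ℕ) :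
    Nat.ofDigits b ((List.range N).map D) = ∑ j ∈ Finset.range N, D j * b ^ j := by
  induction N with
  | zero => simp
  | succ N ih =>
    rw [List.range_succ, List.map_append, Nat.ofDigits_append, ih, Finset.sum_range_succ]
    simp [mul_comm]

end WordRAM

namespace WordRAM

/-- Number of words of a number. -/
def numWords (w r : ℕ) : ℕ := (Nat.digits (2 ^ w) r).length

/-- Length of the characters for words of numbers less than `r`. -/
def valLen (w r : ℕ) : ℕ := if numWords w r = 1 then Nat.size (r / 2 ^ (w * 0) % 2 ^ w) else w

/-- The parameters for a table of numbers less than `r`. -/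
def stdVPar (p : Par) (w r : ℕ) : VPar :=
  { toPar := p, nr := numWords w r, σr := Nat.clog 2 (numWords w r), γr := (Pack.std w (valLen w r)).γ, μr := (Pack.std w (valLen w r)).μ
    mr := valLen w r }

variable {w r : ℕ}

theorem lt_numWords (hw : 0 < w) (j : ℕ) : j < numWords w r ↔ 2 ^ (w * j) ≤ r := Env.lt_words (E := ⟨w, 0, [r]⟩) hw 0 j

theorem numWords_pos (hw : 0 < w) (hr : 0 < r) : 0 < numWords w r := by rw [lt_numWords hw]; simpa using Nat.succ_le_of_lt hr

theorem lt_two_pow_numWords (hw : 0 < w) : r < 2 ^ (w * numWords w r) := by rw [← not_le, ← lt_numWords hw]; exact lt_irrefl _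

theorem numWords_le (hw : 0 < w) (hr : 0 < r) : (numWords w r : ℝ) ≤ 1 + Real.logb 2 r / w := by
  have hw' : (0 : ℝ) < w := by exact_mod_cast hw
  obtain ⟨e, he⟩ := Nat.exists_eq_succ_of_ne_zero (numWords_pos hw hr).ne'
  have h1 := le_logb_two ((lt_numWords (r := r) hw e).1 (by omega))
  rw [he]
  push_cast at h1 ⊢
  have : (e : ℝ) ≤ Real.logb 2 r / w := by rw [le_div_iff₀ hw']; linarith
  linarith

theorem valLen_eq (hw : 0 < w) (h : numWords w r = 1) : valLen w r = Nat.size r ∧ r < 2 ^ w := by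
  have h1 := lt_two_pow_numWords (r := r) hw
  rw [h, mul_one] at h1
  rw [valLen, if_pos h]
  simp [Nat.mod_eq_of_lt h1, h1]

theorem valLen_pos (hw : 0 < w) (hr : 0 < r) : 0 < valLen w r ∧ valLen w r ≤ w := by
  by_cases h : numWords w r = 1
  · obtain ⟨h1, h2⟩ := valLen_eq hw h
    rw [h1]
    exact ⟨Nat.size_pos.2 hr, Nat.size_le.2 h2⟩
  · rw [valLen, if_neg h]; exact ⟨hw, le_rfl⟩

theorem digit_lt (hw : 0 < w) {s j : ℕ} (hs : s < r) (hj : j < numWords w r) : s / 2 ^ (w * j) % 2 ^ w < 2 ^ valLen w r := by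
  by_cases h : numWords w r = 1
  · rw [(valLen_eq hw h).1]
    exact (Nat.mod_le _ _).trans_lt ((Nat.div_le_self _ _).trans_lt (hs.trans (Nat.lt_size_self r)))
  · rw [valLen, if_neg h]; exact Nat.mod_lt _ (by positivity)

theorem stdVPar_case (p : Par) (hw : 0 < w) (hr : 0 < r) :
    numWords w r = 1 ∧ (stdVPar p w r).σr = 0 ∨ 2 ≤ numWords w r ∧ (stdVPar p w r).γr = 0 := by
  have h0 := numWords_pos hw hr
  by_cases h : numWords w r = 1
  · left
    simp [stdVPar, h]
  · right
    have h1 : Nat.log 2 w ≤ Nat.clog 2 w := (Nat.pow_le_pow_iff_right (a := 2) (by norm_num)).1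
      ((Nat.pow_log_le_self 2 hw.ne').trans (Nat.le_pow_clog (by norm_num) w))
    simp only [stdVPar, valLen, if_neg h, Pack.std]
    omega

theorem two_pow_σr_le (p : Par) (hw : 0 < w) (hr : 0 < r) : 2 ^ (stdVPar p w r).σr ≤ (stdVPar p w r).vw := by
  rcases stdVPar_case p hw hr with ⟨-, h⟩ | ⟨-, h⟩
  · rw [h, pow_zero]; exact Nat.one_le_two_pow
  · unfold VPar.vw VPar.vz
    rw [h]
    exact Nat.pow_le_pow_right two_pos (by omega)

theorem vw_le (p : Par) (hw : 0 < w) (hr : 0 < r) :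
    ((stdVPar p w r).vw : ℝ) ≤ 1 + 4 * 2 ^ (p.l + 3 + p.m) * ((Real.logb 2 r + 1) / w) := by
  have hw' : (0 : ℝ) < w := by exact_mod_cast hw
  have hn := numWords_le hw hr
  rcases stdVPar_case p hw hr with ⟨h1, h2⟩ | ⟨h1, h2⟩
  · have h3 := two_pow_sub_le (valLen_pos hw hr).1 hw (p.l + 3 + p.m)
    have h4 := size_le_logb hr
    rw [← (valLen_eq hw h1).1] at h4
    have h5 : ((stdVPar p w r).vw : ℝ) = 2 ^ (p.l + 3 + p.m - (Pack.std w (valLen w r)).γ) := by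
      unfold VPar.vw VPar.vz; rw [h2]; push_cast; rfl
    rw [h5]
    refine h3.trans ?_
    gcongr
  · have h3 : (stdVPar p w r).vw = 2 ^ (p.l + 3 + p.m) * 2 ^ Nat.clog 2 (numWords w r) := by
      unfold VPar.vw VPar.vz; rw [h2, Nat.sub_zero, ← pow_add]; rfl
    have h4 : ((2 ^ Nat.clog 2 (numWords w r) : ℕ) : ℝ) ≤ 2 * numWords w r := by exact_mod_cast (two_pow_clog_lt (by omega)).le
    have h5 : (2 : ℝ) ≤ numWords w r := by exact_mod_cast h1
    have h6 : Real.logb 2 r / w ≤ (Real.logb 2 r + 1) / w := by gcongr; linarith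
    rw [h3, Nat.cast_mul]
    have h7 := mul_le_mul_of_nonneg_left (show ((2 ^ Nat.clog 2 (numWords w r) : ℕ) : ℝ) ≤ 4 * ((Real.logb 2 r + 1) / w) by linarith)
      (show (0 : ℝ) ≤ ((2 ^ (p.l + 3 + p.m) : ℕ) : ℝ) by positivity)
    push_cast at h7 ⊢
    linarith

theorem stdVPar_ok {p : Par} {S : ℕ} {inp : List ℕ} (hp : p.Ok ⟨w, S, inp⟩) (hw : p.l + 3 + p.m < w) (hr : 0 < r)
    (htop : p.tb + p.tw + 3 * (stdVPar p w r).vw ≤ S) : (stdVPar p w r).Ok ⟨w, S, inp⟩ := by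
  have hw0 : 0 < w := by omega
  have hv := two_pow_σr_le p hw0 hr
  obtain ⟨hm0, hmw⟩ := valLen_pos hw0 hr
  have hS : S ≤ 2 ^ w := hp.S
  have htop' : (stdVPar p w r).vb + (stdVPar p w r).vw ≤ S := by
    have : (stdVPar p w r).vb = p.tb + p.tw + 2 ^ (stdVPar p w r).σr + 2 ^ (stdVPar p w r).σr := rfl
    omega
  refine ⟨hp, Pack.std_fits hmw hw0, numWords_pos hw0 hr, Nat.le_pow_clog (by norm_num) _, htop', ?_, ?_⟩
  · rcases stdVPar_case p hw0 hr with ⟨-, h⟩ | ⟨-, h⟩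
    · unfold VPar.vz; rw [h]; exact hw
    · rw [← Nat.pow_lt_pow_iff_right (a := 2) (by norm_num)]
      have h1 : (stdVPar p w r).vw = 2 ^ (stdVPar p w r).vz := by unfold VPar.vw; rw [h, Nat.sub_zero]
      have h2 : 0 < (stdVPar p w r).vb := Nat.add_pos_right _ (by positivity)
      change 2 ^ (stdVPar p w r).vz < 2 ^ w
      omega
  · exact (Nat.pow_lt_pow_iff_right (by norm_num)).1 (Pack.std_shift hm0 hmw)

/-- A word representation of numbers less than `r`. -/
theorem sum_numWords (hw : 0 < w) {s : ℕ} (hs : s ≤ r) :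
    ∑ j ∈ Finset.range (numWords w r), s / 2 ^ (w * j) % 2 ^ w * 2 ^ (w * j) = s := by
  rw [sum_words, Nat.mod_eq_of_lt (hs.trans_lt (lt_two_pow_numWords hw))]

end WordRAM

namespace WordRAM

/-- The sizes of the tables in terms of `u`, `t`, `k`. -/
theorem KeyBounds.space_le {u t k l n κ s : ℕ} {a x Λ : ℝ} (h : KeyBounds u t k l n κ s a x Λ) {w R B : ℝ} (hw : 1 ≤ w)
    (hB : 0 ≤ B) (hR : R ≤ B * Λ) : (2 : ℝ) ^ (n + κ + 2 * l) * (n / w) ≤ 64 + 128 * (k * x * t * Λ / w) ∧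
      (2 : ℝ) ^ (l + 3 + (n + κ + 4)) ≤ 2048 * (k * x * t) ∧
      (2 : ℝ) ^ (l + 3 + (n + κ + 4)) * ((R + 1) / w) ≤ 2048 * (B + 1) * (1 + 2 * (k * x * t * Λ / w)) := by
  have hw0 : 0 < w := by linarith
  have hst : (s : ℝ) ≤ t := by exact_mod_cast h.s_le
  have hx : (0 : ℝ) ≤ k * x := mul_nonneg (by positivity) (by linarith [h.x_ge])
  have hM : (2 : ℝ) ^ (l + 3 + (n + κ + 4)) ≤ 2048 * (k * x * s) := by
    rw [show l + 3 + (n + κ + 4) = (n + κ + l) + 7 by ring, pow_add _ (n + κ + l)]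
    have := h.pow_le
    norm_num
    linarith
  have hΛ := h.Λ_nonneg
  have hdiv : ∀ A D : ℝ, 0 ≤ A → A ≤ D * w → A / w ≤ D := fun A D _ hD => (div_le_iff₀ hw0).2 hD
  have e : k * x * t * Λ / w * w = k * x * t * Λ := div_mul_cancel₀ _ hw0.ne'
  refine ⟨?_, hM.trans (mul_le_mul_of_nonneg_left (mul_le_mul_of_nonneg_left hst hx) (by norm_num)), ?_⟩
  · rw [← mul_div_assoc]
    refine hdiv _ _ (by positivity) ?_
    have := h.size_mul_le
    rw [add_mul, mul_assoc 128, e]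
    linarith
  · have h1 : (2 : ℝ) ^ (l + 3 + (n + κ + 4)) * (R + 1) ≤ 2048 * (k * x * s) * ((B + 1) * (Λ + 1)) :=
      (mul_le_mul_of_nonneg_left (by nlinarith) (by positivity)).trans (mul_le_mul_of_nonneg_right hM (by positivity))
    have h2 := mul_le_mul_of_nonneg_left h.key_le (show 0 ≤ 2048 * (B + 1) by positivity)
    have h3 : 2048 * (B + 1) * 1 ≤ 2048 * (B + 1) * w := mul_le_mul_of_nonneg_left hw (by positivity)
    rw [← mul_div_assoc, div_le_iff₀ hw0]
    have h4 : 2048 * (B + 1) * (1 + 2 * (k * x * t * Λ / w)) * w = 2048 * (B + 1) * w + 2048 * (B + 1) * (2 * (k * x * t * Λ)) := by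
      linear_combination (2048 * (B + 1) * 2) * e
    rw [h4]
    linarith

theorem exists_family_of_par {p : Par} {w S u r t k : ℕ} (hgood : p.Good) (hpk : p.pack = Pack.std w p.m)
    (hok : ∀ inp, p.Ok ⟨w, S, inp⟩) (hZ : p.Z < 2 ^ w) (hvok : ∀ inp, (stdVPar p w r).Ok ⟨w, S, inp⟩)
    (hu : 0 < u) (hr : 0 < r) (ht : 0 < t) (hl : p.l = Nat.clog 2 (min t (Nat.size u)))
    (hn : p.n = Nat.size u / min t (Nat.size u) + 1) (hκ : p.κ = Nat.size k) (hup : u ≤ 2 ^ (2 ^ p.l * p.n))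
    (hsz : 2 * Nat.size u < 2 ^ w) (htw : Nat.size u = 1 ∨ numWords w t < 2 ^ w) {T₀ T₁ : ℝ}
    (h₁ : ((w * 190 + numWords w u * 12 + p.tw * 16 + numWords w r * 16 + 750 : ℕ) : ℝ) ≤ T₀)
    (h₂ : ((2 ^ (p.l + 3 + p.m) * (numWords w r * 60 + 15) + 340 : ℕ) : ℝ) ≤ T₀)
    (h₃ : ((p.coreT 60 + (60 + ((2 ^ (p.l + 3) * (numWords w r * 160 + 80) + numWords w r * 12 + 25) + (numWords w r * 12 + 5))) : ℕ) : ℝ)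
      ≤ T₁) :
    ∃ (N L : ℕ) (f : (Fin N → Fin (2 ^ w)) → (Fin L → Fin r) → Fin u → Fin r),
        (∀ ρ : Fin N → Fin (2 ^ w), ∃ (F : Mem w) (out : List (BitVec w)),
          Runs S T₀ (selectC p.δ p.Q p.σ).comp
            ([u, r, t, k] ++ List.ofFn fun i => (ρ i : ℕ)) (fun _ => 0) F out ∧
          ∀ s : Fin L → Fin r, ∃ (M : Mem w) (out' : List (BitVec w)),
            Runs S T₀ (sampleC p.δ p.Q p.σ).comp (List.ofFn fun i => (s i : ℕ)) F M out' ∧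
            Represents S T₁ (evalSumC p.δ p.Q p.σ).comp
              (fun x : Fin u => [(x : ℕ)])
              (fun x out => wordsToNat out = (f ρ s x : ℕ)) M) ∧
        1 - 1 / 2 ^ p.n ≤ uniformProb {ρ : Fin N → Fin (2 ^ w) | KIndependent k (f ρ)} := by
  obtain ⟨q, hq⟩ : ∃ q, q = stdVPar p w r := ⟨_, rfl⟩
  have hqp : q.toPar = p := by rw [hq]; rfl
  subst hqp
  rw [← hq] at hvok
  have hnr : q.nr = numWords w r := by rw [hq]; rfl
  have hmr : q.mr = valLen w r := by rw [hq]; rfl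
  have hσ : q.σr = Nat.clog 2 q.nr := by rw [hq]; rfl
  have hrp : q.rp = Pack.std w q.mr := by rw [hq]; rfl
  obtain ⟨a1, a2, a3, a4, a5⟩ := VPar.addrs (hvok [])
  have e3 : q.rb = q.tb + q.tw := rfl
  have hS2 : S ≤ 2 ^ w := (hok []).S
  have htop : q.vb + q.vw ≤ S := (hvok []).top
  have hfit : q.pack.Fits w := (hok []).fits
  have hw : 0 < w := by have : q.E + q.σ + 8 < w := (hok []).lw; omega
  have hmw : q.mr ≤ w := (hvok []).fits.word
  have hκw : q.κ ≤ w := by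
    have : q.n + q.κ + 4 ≤ w := hfit.word
    omega
  have hkw : k < 2 ^ w := (Nat.lt_size_self k).trans_le (Nat.pow_le_pow_right two_pos (by omega))
  rw [← hnr] at h₁ h₂ h₃
  have hlev : ∀ (ρ : Fin q.tw → Fin (2 ^ w)) X z, q.keyF (q.wtab ρ).get q.l X z < 2 ^ q.m := fun ρ X z =>
    q.lev_lt (fun z => Table.get_lt _ _) _ (fun ν => (dig_lt _ _ _).trans_le (Nat.pow_le_pow_right two_pos (by unfold Par.m; omega))) _
  let sN : (Fin (2 ^ (q.l + 3) * 2 ^ q.m) → Fin r) → ℕ → ℕ := fun s i => (List.ofFn fun i => (s i : ℕ)).getD i 0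
  have hsN : ∀ s i, sN s i < r := fun s i => by
    simp only [sN, getD_ofFn]
    split_ifs
    · exact Fin.isLt _
    · exact hr
  refine ⟨q.tw, 2 ^ (q.l + 3) * 2 ^ q.m, fun ρ s x => ⟨accF r (fun z => sN s (z * 2 ^ q.m + q.keyF (q.wtab ρ).get q.l x z)) (2 ^ (q.l + 3)),
    accF_lt hr fun i _ => hsN s _⟩, ?_, ?_⟩
  · intro ρ
    set inp : List ℕ := [u, r, t, k] ++ List.ofFn fun i => (ρ i : ℕ) with hinp
    have hword : ∀ i (h : i < q.tw), Env.word ⟨w, S, inp⟩ (4 + i) 0 = ρ ⟨i, h⟩ := fun i h => by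
      have e : inp.getD (4 + i) 0 = ρ ⟨i, h⟩ := by
        rw [hinp, List.getD_append_right _ _ _ _ (by simp)]
        simp only [List.length_cons, List.length_nil, Nat.zero_add, Nat.reduceAdd, Nat.add_sub_cancel_left, getD_ofFn, h, dite_true]
      simp only [Env.word, e, mul_zero, pow_zero, Nat.div_one]
      exact Nat.mod_eq_of_lt (ρ ⟨i, h⟩).2
    have hB := selectC_wp (h := ⟨fun _ => 0, fun _ => (0 : BitVec w).toNat, []⟩) (hvok inp) hpk hZ (u := u) (t := t) (k := k) rfl rfl rfl hu ht hkw hsz htw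
      hl hn hκ hnr hσ (by rw [hnr, hmr]; rfl) (by rw [hmr]; exact (valLen_pos hw hr).1) hrp (fun _ => by simp)
    obtain ⟨F, out, h, hrun, ⟨hcell, hvcell, htab, hR, hzero⟩, hF, -⟩ := WP.runs (T' := T₀) hS2 (fun _ => 0) h₁ hB
    refine ⟨F, out, hrun, fun s => ?_⟩
    have hF' : ∀ a < 2 ^ w, memN F a = h.m a := hF
    have hw3 : ∀ i < 2 ^ (q.l + 3 + q.m), ∀ j < q.nr, Env.word ⟨w, S, List.ofFn fun i => (s i : ℕ)⟩ i j < 2 ^ q.mr := fun i _ j hj => by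
      rw [hmr]; exact digit_lt hw (hsN s i) (by omega)
    have hSm := sampleC_wp (h := ⟨fun _ => 0, memN F, []⟩) (hvok (List.ofFn fun i => (s i : ℕ)))
      (hcell.congr fun a ha => hF' a (by omega)) (hvcell.congr fun a _ ha => hF' a (by omega))
      (fun a ha ha' => (hF' a (lt_of_lt_of_le ha' hS2)).trans (hzero a ha)) hw3
    obtain ⟨M, out', h', hrun', ⟨hkeep, hval⟩, hM, -⟩ := WP.runs (T' := T₀) hS2 F h₂ hSm
    have hM' : ∀ a < 2 ^ w, memN M a = h'.m a := hM
    have hFM : ∀ a < q.vb, memN M a = h.m a := fun a ha => by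
      rw [hM' a (by omega), hkeep a ha]; exact hF' a (by omega)
    have haddr : ∀ i < 2 ^ (q.l + 3 + q.m), ∀ j < q.nr, q.vb + (i * 2 ^ q.σr + j) / 2 ^ q.rp.γ < S := fun i hi j hj => by
      have h5 : q.nr ≤ 2 ^ q.σr := (hvok []).le
      have h6 := (VPar.vaddr (q := q) hi (j := j) (by omega)).2
      have hrg : q.rp.γ = q.γr := rfl
      rw [hrg]; omega
    set V : ℕ → ℕ → ℕ := fun i j => sN s i / 2 ^ (w * j) % 2 ^ w with hV
    set R : ℕ → ℕ := fun j => r / 2 ^ (w * j) % 2 ^ w with hRd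
    refine ⟨M, out', hrun', {M | q.toPar.Cells w (memN M) ∧ q.Cells (memN M) ∧ (∀ a (h : a < q.tw), memN M (q.tb + a) = ρ ⟨a, h⟩) ∧
      q.Tab w V R (memN M)}, ⟨?_, ?_, ?_, ?_, ?_⟩, ?_⟩
    · exact hcell.congr fun a ha => hFM a (by omega)
    · exact hvcell.congr fun a _ ha => hFM a (by omega)
    · intro a ha
      rw [hFM _ (by omega), htab _ (by omega) (by omega), Nat.add_sub_cancel_left, hword a ha]
    · intro i hi j hj
      refine Eq.trans (Pack.chr_congr _ (hM' _ ((haddr i hi j hj).trans_le hS2))) (hval i hi j hj)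
    · intro j hj
      rw [hFM _ (by omega), hR j hj]; rfl
    intro M ⟨hcM, hvM, htM, hTM⟩ x
    have hE := evalSumC_wp (hvok [(x : ℕ)]) (h := ⟨fun _ => 0, memN M, []⟩) hcM hvM (q.wtab_get ρ htM) (X := x) rfl hTM hr
      (s := sN s) (by rw [hnr]; exact sum_numWords hw le_rfl) (fun j _ => Nat.mod_lt _ (by positivity))
      (fun i _ => ⟨fun j _ => Nat.mod_lt _ (by positivity), by rw [hnr]; exact sum_numWords hw (hsN s i).le, hsN s i⟩)
    obtain ⟨N, o, h2, hrun2, ⟨hk2, D, hD, ho, hsum⟩, hN, ho'⟩ := WP.runs (T' := T₁) hS2 M h₃ hE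
    have hk3 : ∀ a < 2 ^ w, (a < 32 ∨ q.tb ≤ a) → (a < q.ab ∨ q.ab + q.nr ≤ a) → memN N a = memN M a := fun a h4 h5 h6 =>
      (hN a h4).trans (hk2 a h5 h6)
    refine ⟨N, ⟨?_, ?_, ?_, ?_, ?_⟩, o, hrun2, ?_⟩
    · exact hcM.congr fun a ha => hk3 a (by omega) (by omega) (by omega)
    · exact hvM.congr fun a _ ha => hk3 a (by omega) (by omega) (by omega)
    · intro a ha
      rw [hk3 _ (by omega) (by omega) (by omega)]; exact htM a ha
    · intro i hi j hj
      have h4 := haddr i hi j hj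
      have h5 := Nat.zero_le ((i * 2 ^ q.σr + j) / 2 ^ q.rp.γ)
      rw [← hTM.chr i hi j hj]
      exact Pack.chr_congr _ (hk3 _ (by omega) (by omega) (by omega))
    · intro j hj
      rw [hk3 _ (by omega) (by omega) (by omega)]; exact hTM.R j hj
    · change Nat.ofDigits (2 ^ w) (o.map BitVec.toNat) = accF r _ _
      rw [ho', ho, List.nil_append, ofDigits_map_range]
      simp only [← pow_mul]
      exact hsum
  · refine q.toPar.prob_maj hgood hfit fun ρ hρ => ?_
    refine kIndependent_of_maj (d := 2 ^ (q.l + 3)) (m := q.m) hr hup (fun Y h4 h5 h6 => hρ Y h4 (h5.trans ?_) h6) (hlev ρ) _ fun s x => ?_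
    · rw [hκ]; exact (Nat.lt_size_self k).le
    · exact accF_congr fun z _ => by simp only [sN, getD_ofFn]

theorem exists_independent_family (a b : ℝ) : ∃ C : ℝ, 0 < C ∧ ∃ selectFamily sampleFunction eval : Prog,
      ∀ u r t k w : ℕ, 0 < u → 0 < r → 0 < t → 0 < k → 0 < w →
      (k : ℝ) ≤ (u : ℝ) ^ (a / t) → (r : ℝ) ≤ (u : ℝ) ^ b →
      ∀ S : ℕ, S = ⌊C * (1 + k * (u : ℝ) ^ (1 / (t : ℝ)) * t * Real.logb 2 u / w)⌋₊ →
      C * (1 + k * (u : ℝ) ^ (1 / (t : ℝ)) * t * Real.logb 2 u / w) ≤ (2 : ℝ) ^ w →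
      ∀ T₀ : ℝ, T₀ = C * (w + k * (u : ℝ) ^ (1 / (t : ℝ)) * t * (1 + Real.logb 2 u / w)) →
      ∃ (N L : ℕ) (f : (Fin N → Fin (2 ^ w)) → (Fin L → Fin r) → Fin u → Fin r),
        (∀ ρ : Fin N → Fin (2 ^ w), ∃ (F : Mem w) (out : List (BitVec w)),
          Runs S T₀ selectFamily
            ([u, r, t, k] ++ List.ofFn fun i => (ρ i : ℕ)) (fun _ => 0) F out ∧
          ∀ s : Fin L → Fin r, ∃ (M : Mem w) (out' : List (BitVec w)),
            Runs S T₀ sampleFunction (List.ofFn fun i => (s i : ℕ)) F M out' ∧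
            Represents S (C * (1 + t * Real.logb 2 t + t * Real.logb 2 u / w)) eval
              (fun x : Fin u => [(x : ℕ)])
              (fun x out => wordsToNat out = (f ρ s x : ℕ)) M) ∧
        1 - (u : ℝ) ^ (-(1 / (t : ℝ))) ≤
          uniformProb {ρ : Fin N → Fin (2 ^ w) | KIndependent k (f ρ)} := by
  obtain ⟨c, hc, hcore⟩ := exists_coreT_le (⌈a⌉₊ + 1)
  obtain ⟨a', ha'⟩ : ∃ a', a' = ⌈a⌉₊ + 1 := ⟨_, rfl⟩
  rw [← ha'] at hcore
  obtain ⟨A, hA⟩ : ∃ A : ℕ, A = cA a' := ⟨_, rfl⟩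
  obtain ⟨D, hD⟩ : ∃ D : ℝ, D = ct a' := ⟨_, rfl⟩
  obtain ⟨B, hBb⟩ : ∃ B : ℝ, B = ⌈b⌉₊ := ⟨_, rfl⟩
  have hD0 : 0 ≤ D := by rw [hD]; unfold ct; positivity
  have hB0 : 0 ≤ B := by rw [hBb]; positivity
  refine ⟨128 * A + 3000 * D + 200000 * (B + 1) + 22 * c, by positivity, (selectC (cδ a') (cQ a') (cQ a')).comp,
    (sampleC (cδ a') (cQ a') (cQ a')).comp, (evalSumC (cδ a') (cQ a') (cQ a')).comp, ?_⟩
  intro u r t k w hu hr ht hk hw hka hrb S hS hSw T₀ hT₀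
  have hb := keyBounds hu ht hk hka
  have hR : Real.logb 2 r ≤ B * Real.logb 2 u := by
    refine (logb_two_rpow_le hu hr hrb).trans (mul_le_mul_of_nonneg_right ?_ (logb_two_nonneg hu))
    rw [hBb]; exact Nat.le_ceil b
  obtain ⟨l, hl⟩ : ∃ l, l = Nat.clog 2 (min t (Nat.size u)) := ⟨_, rfl⟩
  obtain ⟨n, hn⟩ : ∃ n, n = Nat.size u / min t (Nat.size u) + 1 := ⟨_, rfl⟩
  obtain ⟨κ, hκ⟩ : ∃ κ, κ = Nat.size k := ⟨_, rfl⟩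
  rw [← hl, ← hn, ← hκ] at hb
  generalize hx : (u : ℝ) ^ (1 / (t : ℝ)) = x at hb hS hSw hT₀
  have hw1 : (1 : ℝ) ≤ w := by exact_mod_cast hw
  have hw' : (0 : ℝ) < w := by linarith
  obtain ⟨hY, hM, hV⟩ := hb.space_le hw1 hB0 hR
  obtain ⟨ht1, ht2, ht3⟩ := hb.time_le hw1
  have hnu := numWords_le hw hu
  have hnr := numWords_le hw hr
  have hRw : Real.logb 2 r / w ≤ B * (Real.logb 2 u / w) := by
    rw [← mul_div_assoc]; exact div_le_div_of_nonneg_right hR hw'.le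
  have hΛ0 := hb.Λ_nonneg
  have ht1' : (1 : ℝ) ≤ t := by exact_mod_cast ht
  have hk1 : (1 : ℝ) ≤ k := by exact_mod_cast hk
  have hkx : 1 ≤ k * x := one_le_mul_of_one_le_of_one_le hk1 hb.x_ge
  have hG : 1 ≤ k * x * t := one_le_mul_of_one_le_of_one_le hkx ht1'
  have htu := hb.Λ_le
  generalize hΛ : Real.logb 2 (u : ℝ) = Λ at *
  generalize hRR : Real.logb 2 (r : ℝ) = R at *
  set C : ℝ := 128 * A + 3000 * D + 200000 * (B + 1) + 22 * c with hC
  have hA0 : (0 : ℝ) ≤ A := by positivity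
  have hC0 : 0 ≤ C := by positivity
  set X : ℝ := k * x * t * Λ / w with hX
  have hX0 : 0 ≤ X := by positivity
  have hΛX : Λ / w ≤ X := by
    rw [hX]; exact div_le_div_of_nonneg_right (le_mul_of_one_le_left hΛ0 hG) hw'.le
  have hT : T₀ = C * (w + k * x * t + X) := by rw [hT₀, hX]; ring
  have hXw : X * w = k * x * t * Λ := by rw [hX, div_mul_cancel₀ _ hw'.ne']
  clear_value C X
  have hS2 : S ≤ 2 ^ w := by
    rw [hS]; exact Nat.floor_le_of_le (by push_cast; exact hSw)
  have hwide : n + κ + l + cw a' < w := by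
    refine stdPar_wide hb.n_pos (ha' ▸ hb.κ_le) hw ?_
    rw [← hA]
    have h1 : (A : ℝ) * (2 ^ (n + κ + 2 * l) * n) ≤ A * (64 + 128 * (X * w)) := by
      rw [hXw]; exact mul_le_mul_of_nonneg_left hb.size_mul_le hA0
    have h2 : A * (64 + 128 * (X * w)) ≤ w * (128 * A * (1 + X)) := by
      have := mul_le_mul_of_nonneg_left hw1 hA0
      linarith
    have h3 : 128 * A * (1 + X) ≤ C * (1 + X) := mul_le_mul_of_nonneg_right (by rw [hC]; linarith) (by linarith)
    have h4 := h1.trans (h2.trans (mul_le_mul_of_nonneg_left (h3.trans hSw) hw'.le))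
    exact_mod_cast h4
  have hκa : κ ≤ a' * n := ha' ▸ hb.κ_le
  obtain ⟨p, hp⟩ : ∃ p, p = stdPar a' l n κ w := ⟨_, rfl⟩
  have htw : (p.tw : ℝ) ≤ 1 + D * (64 + 128 * X) := by
    have h1 : (p.tw : ℝ) ≤ 1 + D * (2 ^ (n + κ + 2 * l) * (n / w)) := by rw [hp, hD]; exact stdPar_tw_le hb.n_pos hκa hw
    exact h1.trans (by gcongr)
  have h32 : p.tb + p.tw ≤ 32 + 5 * p.tw := by rw [hp]; exact stdPar_tb_add_tw_le _ _ _ _ _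
  have hpl : p.l = l := by rw [hp]; rfl
  have hpn : p.n = n := by rw [hp]; rfl
  have hpκ : p.κ = κ := by rw [hp]; rfl
  have hpm : p.m = n + κ + 4 := by rw [Par.m, hpn, hpκ]
  have hpd : p.δ = cδ a' := by rw [hp]; rfl
  have hpQ : p.Q = cQ a' := by rw [hp]; rfl
  have hpσ : p.σ = cQ a' := by rw [hp]; rfl
  have hpk : p.pack = Pack.std w p.m := by rw [hp]; rfl
  have hgood : p.Good := by rw [hp]; exact stdPar_good hb.n_pos hκa
  have hcoreT : (p.coreT 60 : ℝ) ≤ (c + 60) * (2 ^ l * (1 + l + 2 ^ l * (n / w))) := by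
    rw [hp]; exact_mod_cast hcore l n κ w hb.n_pos hw hκa 60
  have hvw := vw_le p hw hr
  rw [hRR, hpl, hpm] at hvw
  have hBX : 0 ≤ B * X := mul_nonneg hB0 hX0
  have hDX : 0 ≤ D * X := mul_nonneg hD0 hX0
  have htopv : p.tb + p.tw + 3 * (stdVPar p w r).vw ≤ S := by
    rw [hS]
    refine Nat.le_floor (le_trans (Nat.cast_le.2 (Nat.add_le_add_right h32 _)) ?_)
    push_cast
    have h2 : (640 * D + 50000 * (B + 1)) * (1 + X) ≤ C * (1 + X) := mul_le_mul_of_nonneg_right (by rw [hC]; linarith) (by linarith)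
    linarith
  have hok : ∀ inp, p.Ok ⟨w, S, inp⟩ ∧ p.Z < 2 ^ w := fun inp => by
    have htop : p.tb + p.tw ≤ S := by omega
    rw [hp] at htop ⊢; exact stdPar_ok hb.n_pos hwide hS2 htop
  have hvok : ∀ inp, (stdVPar p w r).Ok ⟨w, S, inp⟩ := fun inp =>
    stdVPar_ok (hok inp).1 (by rw [hpl, hpm]; unfold cw at hwide; omega) hr htopv
  have hw2 : w < 2 ^ w := Nat.lt_two_pow_self
  have hsz : 2 * Nat.size u < 2 ^ w := by
    have h1 : (n + 1) * 2 ^ l ≤ 2 ^ n * 2 ^ l := Nat.mul_le_mul_right _ Nat.lt_two_pow_self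
    have h2 : 2 ^ (n + l + 1) ≤ 2 ^ w := Nat.pow_le_pow_right two_pos (by omega)
    have h3 := hb.size_le
    have h4 : 0 < 2 ^ l := by positivity
    rw [pow_succ, pow_add] at h2
    rw [add_mul, one_mul] at h1
    omega
  have htw2 : Nat.size u = 1 ∨ numWords w t < 2 ^ w := by
    rcases htu with ⟨h1, -⟩ | h1
    · left; simp [h1]
    · right
      have h2 : (t : ℝ) ≤ X * w := by
        rw [hXw]
        calc (t : ℝ) ≤ k * x * t := le_mul_of_one_le_left (by positivity) hkx
          _ ≤ k * x * t * Λ := le_mul_of_one_le_right (by positivity) h1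
      have h3 : 1 * (1 + X) ≤ C * (1 + X) := mul_le_mul_of_nonneg_right (by rw [hC]; linarith) (by linarith)
      have h4 : (w : ℝ) < 2 ^ w := by exact_mod_cast hw2
      have h5 : (t : ℝ) < 2 ^ (w * 2) := by
        rw [pow_mul, sq]
        exact h2.trans_lt (mul_lt_mul'' (by linarith) h4 hX0 hw'.le)
      have h6 : t < 2 ^ (w * 2) := by exact_mod_cast h5
      have h7 := (lt_numWords (r := t) hw 2).not.2 (not_le.2 h6)
      have h8 : 30 ≤ cw a' := by unfold cw; omega
      omega
  have hnrX : (numWords w r : ℝ) ≤ 1 + B * (Λ / w) := by linarith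
  have hΛw0 : 0 ≤ Λ / w := by positivity
  have key := exists_family_of_par (T₀ := T₀) (T₁ := C * (1 + t * Real.logb 2 t + t * Λ / w)) hgood hpk (fun inp => (hok inp).1)
    (hok []).2 hvok hu hr ht (hpl.trans hl) (hpn.trans hn) (hpκ.trans hκ) (by rw [hpl, hpn]; exact hb.u_le) hsz htw2 ?_ ?_ ?_
  · obtain ⟨N, L, f, h1, h2⟩ := key
    rw [hpd, hpQ, hpσ] at h1
    refine ⟨N, L, f, h1, le_trans ?_ h2⟩
    rw [hpn]
    linarith [hb.fail]
  · rw [hT]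
    push_cast
    have h1 : (2100 * D + 1000 + 16 * B) * (w + k * x * t + X) ≤ C * (w + k * x * t + X) :=
      mul_le_mul_of_nonneg_right (by rw [hC]; linarith) (by linarith)
    have h2 := mul_le_mul_of_nonneg_left hΛX hB0
    have h3 := mul_le_mul_of_nonneg_left hG hD0
    have h4 : 0 ≤ D * w := mul_nonneg hD0 hw'.le
    have h5 : 0 ≤ B * w := mul_nonneg hB0 hw'.le
    have h6 : 0 ≤ B * (k * x * t) := mul_nonneg hB0 (by linarith)
    generalize k * x * t = G at *
    linarith
  · rw [hT, hpl, hpm]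
    push_cast
    have h1 : (153600 + 122880 * B + 340) * (w + k * x * t + X) ≤ C * (w + k * x * t + X) :=
      mul_le_mul_of_nonneg_right (by rw [hC]; linarith) (by linarith)
    have h2 : (2 : ℝ) ^ (l + 3 + (n + κ + 4)) * (numWords w r * 60 + 15) ≤ 2048 * (k * x * t) * (75 + 60 * (B * (Λ / w))) :=
      mul_le_mul hM (by linarith) (by positivity) (by linarith)
    have h3 : 2048 * (k * x * t) * (75 + 60 * (B * (Λ / w))) = 153600 * (k * x * t) + 122880 * (B * X) := by rw [hX]; ring
    have h5 : 0 ≤ B * w := mul_nonneg hB0 hw'.le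
    have h6 : 0 ≤ B * (k * x * t) := mul_nonneg hB0 (by linarith)
    generalize k * x * t = G at *
    linarith
  · rw [hpl]
    push_cast
    obtain ⟨v, hv⟩ : ∃ v, v = t * Λ / w := ⟨_, rfl⟩
    have hv0 : 0 ≤ v := by rw [hv]; positivity
    have hΛv : Λ / w ≤ v := by rw [hv]; exact div_le_div_of_nonneg_right (le_mul_of_one_le_left hΛ0 ht1') hw'.le
    have htv : t * (Λ / w) = v := by rw [hv]; ring
    rw [← hv] at ht1 ⊢
    have hlog0 : 0 ≤ (t : ℝ) * Real.logb 2 t := mul_nonneg (by linarith) (logb_two_nonneg ht)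
    generalize (t : ℝ) * Real.logb 2 t = y at *
    have h1 : (22 * c + 10000 + 3000 * B) * (1 + y + v) ≤ C * (1 + y + v) :=
      mul_le_mul_of_nonneg_right (by rw [hC]; linarith) (by linarith)
    have h2 := mul_le_mul_of_nonneg_left ht1 (show 0 ≤ c + 60 by linarith)
    have h3 := mul_le_mul_of_nonneg_left hΛv hB0
    have h4 : (2 : ℝ) ^ l * numWords w r ≤ 2 * t * (1 + B * (Λ / w)) := mul_le_mul ht2 hnrX (by positivity) (by linarith)
    have h5 : 2 * t * (1 + B * (Λ / w)) = 2 * t + 2 * (B * v) := by rw [← htv]; ring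
    have h6 : 0 ≤ B * y := mul_nonneg hB0 hlog0
    have h7 : 0 ≤ B * v := mul_nonneg hB0 hv0
    have h8 := mul_nonneg hc.le hlog0
    have h9 := mul_nonneg hc.le hv0
    rw [pow_add]
    linarith

end WordRAM

theorem mainTheorem12 :
    -- Part 1: the majority-unique function.
    (∀ a : ℝ, ∃ C : ℝ, 0 < C ∧ ∃ build eval : Prog,
      ∀ l n κ w : ℕ, 0 < l → 0 < n → 0 < κ → 0 < w → (κ : ℝ) ≤ a * n →
      ∀ S : ℕ, S = ⌊C * (1 + 2 ^ (n + κ + 2 * l) * n / w)⌋₊ →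
      C * (1 + 2 ^ (n + κ + 2 * l) * n / w) ≤ (2 : ℝ) ^ w →
      ∃ (N : ℕ) (Γ : (Fin N → Fin (2 ^ w)) →
          (Fin (2 ^ l) → BitVec n) → Fin (2 ^ (l + 3)) → BitVec (n + κ + 4)),
        (∀ ρ : Fin N → Fin (2 ^ w), ∃ (M : Mem w) (out : List (BitVec w)),
          Runs S (C * (w + 2 ^ (n + κ + l) * (1 + 2 ^ l * n / w))) build
            ([l, n, κ] ++ List.ofFn fun i => (ρ i : ℕ)) (fun _ => 0) M out ∧
          Represents S (C * (2 ^ l * (l + 2 ^ l * n / w))) eval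
            (fun x : Fin (2 ^ l) → BitVec n => List.ofFn fun i => (x i).toNat)
            (fun x out => out.map BitVec.toNat = List.ofFn fun j => (Γ ρ x j).toNat) M) ∧
        1 - (2 : ℝ) ^ (-(n : ℤ) + 1) ≤
          uniformProb {ρ : Fin N → Fin (2 ^ w) | MajorityUnique (2 ^ κ) (Γ ρ)}) ∧
    -- Part 2: the independent family.
    (∀ a b : ℝ, ∃ C : ℝ, 0 < C ∧ ∃ selectFamily sampleFunction eval : Prog,
      ∀ u r t k w : ℕ, 0 < u → 0 < r → 0 < t → 0 < k → 0 < w →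
      (k : ℝ) ≤ (u : ℝ) ^ (a / t) → (r : ℝ) ≤ (u : ℝ) ^ b →
      ∀ S : ℕ, S = ⌊C * (1 + k * (u : ℝ) ^ (1 / (t : ℝ)) * t * Real.logb 2 u / w)⌋₊ →
      C * (1 + k * (u : ℝ) ^ (1 / (t : ℝ)) * t * Real.logb 2 u / w) ≤ (2 : ℝ) ^ w →
      ∀ T₀ : ℝ, T₀ = C * (w + k * (u : ℝ) ^ (1 / (t : ℝ)) * t * (1 + Real.logb 2 u / w)) →
      ∃ (N L : ℕ) (f : (Fin N → Fin (2 ^ w)) → (Fin L → Fin r) → Fin u → Fin r),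
        (∀ ρ : Fin N → Fin (2 ^ w), ∃ (F : Mem w) (out : List (BitVec w)),
          Runs S T₀ selectFamily
            ([u, r, t, k] ++ List.ofFn fun i => (ρ i : ℕ)) (fun _ => 0) F out ∧
          ∀ s : Fin L → Fin r, ∃ (M : Mem w) (out' : List (BitVec w)),
            Runs S T₀ sampleFunction (List.ofFn fun i => (s i : ℕ)) F M out' ∧
            Represents S (C * (1 + t * Real.logb 2 t + t * Real.logb 2 u / w)) eval
              (fun x : Fin u => [(x : ℕ)])
              (fun x out => wordsToNat out = (f ρ s x : ℕ)) M) ∧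
        1 - (u : ℝ) ^ (-(1 / (t : ℝ))) ≤
          uniformProb {ρ : Fin N → Fin (2 ^ w) | KIndependent k (f ρ)}) :=
  ⟨exists_majorityUnique, exists_independent_family⟩
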